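/- Let $S$ be a string link with $k$ strands $L_1,\dots,L_k$ in $D^2\times I$ (not necessarily pure), with its strands oriented from $D^2\times\{1\}$ to $D^2\times\{0\}$, given by a generic projection to the square $I^2$ with $n$ crossings. The projection divides the square into $n+k+1$ regions. Place a meridian of each strand at its bottom end. A *state* $x$ is a choice, for each crossing, of one of its four quadrants and, for each strand, of one of the two sides of its meridian, such that each region other than the leftmost one is chosen exactly once. States are the points of $\mathbb T_\alpha\cap\mathbb T_\beta$ for the Heegaard diagram of $S^3$ that has one $\alpha$-curve for each crossing and each meridian and one $\beta$-curve for each region other than the leftmost. At a crossing write $N$ for the quadrant between the two outgoing edges, $B$ for the one between the two incoming edges, and $W$, $E$ for those on the left and on the right (looking from $B$ to $N$). The weight for $L_i$ of a chosen quadrant, all weights not listed being $0$, is: at a self-crossing of $L_i$ of sign $\epsilon=\pm1$, $-\epsilon/2$ for $N$ and $+\epsilon/2$ for $B$; at a crossing of $L_i$ with another strand, $-\tfrac12$ (positive crossing) for $N$ and $W$ if $L_i$ passes over, for $N$ and $E$ if it passes under, and $+\tfrac12$ (negative crossing) for $N$ and $E$ if $L_i$ passes over, for $N$ and $W$ if it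 passes under. Let $\mathcal F_i(x)$ be the sum of the weights for $L_i$ over all crossings, and let $G(x)$ be the number of negative crossings minus the number of positive crossings at which $x$ chooses $N$. Put $$\nabla_S(h_1,\dots,h_k)=\sum_x(-1)^{G(x)}h_1^{\mathcal F_1(x)}\cdots h_k^{\mathcal F_k(x)} .$$ Then all $\mathcal F_i(x)$ are integers, so $\nabla_S\in\mathbb Z[h_1^{\pm1},\dots,h_k^{\pm1}]$, and for every $i$ the following hold. 1. Setting $h_j=1$ for all $j\ne i$ in $\nabla_S$ gives $\Delta_{\widehat L_i}(h_i)$, the Alexander–Conway polynomial of the knot $\widehat L_i\subset S^3$ obtained by forgetting the other strands and joining the ends of $L_i$ by an unknotted arc outside $D^2\times I$. (That is the unique Alexander polynomial $\Delta$ of $\widehat L_i$ with $\Delta(t^{-1})=\Delta(t)$ and $\Delta(1)=1$.) 2. Let the Heegaard surface $\Sigma$ be the boundary of the $\alpha$-handlebody, a neighbourhood of the projected string link and of the ball outside $D^2\times I$, oriented by its outward normal. Replacing the meridian of $L_i$ by a $0$-framed longitude $\lambda_i$ gives a Heegaard diagram for the $0$-surgery on $\widehat L_i$, with basepoint $w$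 on the part of $\Sigma$ outside $D^2\times I$. Let $x'$ be the intersection point next to $x$ that uses, instead of the point of $x$ on the meridian of $L_i$, a point of $\lambda_i$ on the same $\beta$-curve next to that meridian. There is a periodic domain $\mathcal P_i$ of the new diagram, representing a Seifert surface of $\widehat L_i$ capped off in the surgery, whose boundary contains $\lambda_i$, oriented opposite to $L_i$, with coefficient $1$. For each such $\mathcal P_i$ and each state $x$, $$\langle c_1(\mathfrak s_w(x')),[\mathcal P_i]\rangle=2\,\mathcal F_i(x),$$ where the left side is given in the Heegaard diagram by $e(\mathcal P_i)+2n_{x'}(\mathcal P_i)-2n_w(\mathcal P_i)$, with $e$ the Euler measure, $n_{x'}$ the sum of the average local multiplicities at the points of $x'$, and $n_w$ the multiplicity at $w$. -/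

import Mathlib

open scoped LaurentPolynomial

namespace StringLink

/-- The two sides of an oriented arc, seen when looking along its orientation. -/
inductive Side
  | left
  | right
  deriving DecidableEq

instance : Fintype Side := ⟨{.left, .right}, by intro s; cases s <;> decide⟩

/-- The four quadrants at a crossing: between the two outgoing edges (`ahead`), between the two
incoming edges (`behind`), and the two quadrants in between, to the left and to the right when one
looks from `behind` to `ahead`. -/
inductive Quadrant
  | ahead
  | behind
  | left
  | right
  deriving DecidableEq

instance : Fintype Quadrant :=
  ⟨{.ahead, .behind, .left, .right}, by intro q; cases q <;> decide⟩

/-- The combinatorial data of a generic projection into the square of a string link with `k`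
strands, oriented from the top edge of the square to the bottom edge: a signed Gauss code.
`passage ⟨j, m⟩ = (c, b)` says that the `m`-th crossing met along strand `j` is `c`, and that the
strand passes over there if `b = true` and under if `b = false`.
`top p` and `bot p` are the strands whose end is the `p`-th, from left to right, on the top and on
the bottom edge of the square; the two orders are unrelated, so the string link need not be pure. -/
structure GaussData (k : ℕ) where
  numCrossings : ℕ
  len : Fin k → ℕ
  passage : (Σ j : Fin k, Fin (len j)) ≃ Fin numCrossings × Bool
  positive : Fin numCrossings → Bool
  top : Equiv.Perm (Fin k)
  bot : Equiv.Perm (Fin k)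

namespace GaussData

variable {k : ℕ} (D : GaussData k)

/-- Edge `⟨j, m⟩` is the part of strand `j` after its first `m` passages and before the next. -/
abbrev Edge : Type := Σ j : Fin k, Fin (D.len j + 1)

def firstEdge (j : Fin k) : D.Edge := ⟨j, 0⟩

def lastEdge (j : Fin k) : D.Edge := ⟨j, Fin.last (D.len j)⟩

/-- The strand that makes the passage `p`. -/
def strand (p : Fin D.numCrossings × Bool) : Fin k := (D.passage.symm p).1

def inEdge (p : Fin D.numCrossings × Bool) : D.Edge :=
  ⟨(D.passage.symm p).1, (D.passage.symm p).2.castSucc⟩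

def outEdge (p : Fin D.numCrossings × Bool) : D.Edge :=
  ⟨(D.passage.symm p).1, (D.passage.symm p).2.succ⟩

/-- Rotate a crossing so that both of its strands point upwards. This is the passage that runs from
bottom left to top right: the over passage at a positive crossing, the under passage at a negative
crossing. -/
def rising (c : Fin D.numCrossings) : Fin D.numCrossings × Bool := (c, D.positive c)

/-- The passage that runs from bottom right to top left. -/
def falling (c : Fin D.numCrossings) : Fin D.numCrossings × Bool := (c, !D.positive c)

/-- A side of an edge. -/
abbrev EdgeSide : Type := D.Edge × Side

/-- Walk around a region of the square with the region on the left. The walk runs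
forwards along an edge that has the region on its left side, and backwards along an edge that has it
on its right side. At a crossing it turns left; at the boundary of the square it follows the
boundary to the next end of a strand. (A strand that runs downwards has its left side to the east.)
-/
def next : D.EdgeSide → D.EdgeSide
  | (⟨j, m⟩, Side.left) =>
      if h : (m : ℕ) < D.len j then
        let p := D.passage ⟨j, ⟨m, h⟩⟩
        if p = D.rising p.1 then (D.outEdge (D.falling p.1), Side.left)
        else (D.inEdge (D.rising p.1), Side.right)
      else if h' : (D.bot.symm j : ℕ) + 1 < k then
        (D.lastEdge (D.bot ⟨(D.bot.symm j : ℕ) + 1, h'⟩), Side.right)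
      else (D.firstEdge (D.top (D.bot.symm j)), Side.left)
  | (⟨j, m⟩, Side.right) =>
      if h : 0 < (m : ℕ) then
        let p := D.passage ⟨j, ⟨(m : ℕ) - 1, by have := m.isLt; omega⟩⟩
        if p = D.rising p.1 then (D.inEdge (D.falling p.1), Side.right)
        else (D.outEdge (D.rising p.1), Side.left)
      else if 0 < (D.top.symm j : ℕ) then
        (D.firstEdge (D.top ⟨(D.top.symm j : ℕ) - 1, by have := (D.top.symm j).isLt; omega⟩),
          Side.left)
      else (D.lastEdge (D.bot (D.top.symm j)), Side.right)

/-- The regions into which the projection divides the square: orbits of `next`. -/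
def Region : Type := Quot fun a b : D.EdgeSide => b = D.next a

def region (a : D.EdgeSide) : D.Region := Quot.mk _ a

/-- The edge side along which the walk around the region arrives at the quadrant `q` of `c`. -/
def arrival (c : Fin D.numCrossings) : Quadrant → D.EdgeSide
  | Quadrant.left => (D.inEdge (D.rising c), Side.left)
  | Quadrant.behind => (D.inEdge (D.falling c), Side.left)
  | Quadrant.right => (D.outEdge (D.rising c), Side.right)
  | Quadrant.ahead => (D.outEdge (D.falling c), Side.right)

end GaussData

/-- A projection of a string link with `k` strands in `D² × I`. The data describe a cellular
decomposition of a closed oriented surface by the projection and the boundary of the square.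
This graph is connected, has `numCrossings + 2 k` vertices and `2 numCrossings + 3 k` edges, and its
faces are the exterior of the square and the regions; hence the surface is a sphere, so that the
data come from a projection into the square, if and only if there are `numCrossings + k + 1`
regions. -/
structure Diagram (k : ℕ) extends GaussData k where
  planar : Nat.card toGaussData.Region = numCrossings + k + 1

namespace Diagram

variable {k : ℕ} (D : Diagram k)

/-- The region that touches the left edge of the square. -/
def IsLeftmost (R : D.Region) : Prop :=
  ∃ j : Fin k, (D.bot.symm j : ℕ) = 0 ∧ R = D.region (D.lastEdge j, Side.right)

/-- A choice of a quadrant at each crossing and of a side of the meridian of each strand (the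
meridians are placed at the bottom ends), that is, of an intersection point on each `α`-curve of
the Heegaard diagram defined by the projection: the `α`-curve of a crossing meets the `β`-curves of
its four quadrants, and the meridian of a strand those of the two regions on its sides. -/
structure Marking where
  quad : Fin D.numCrossings → Quadrant
  side : Fin k → Side
  deriving Fintype

/-- The regions chosen by a marking. -/
def marked (x : D.Marking) : Fin D.numCrossings ⊕ Fin k → D.Region
  | Sum.inl c => D.region (D.arrival c (x.quad c))
  | Sum.inr j => D.region (D.lastEdge j, x.side j)

/-- An intersection point of `𝕋_α` and `𝕋_β`: a marking that uses each region other than the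
leftmost one exactly once. -/
def IsState (x : D.Marking) : Prop :=
  Function.Injective (D.marked x) ∧ Set.range (D.marked x) = {R | ¬ D.IsLeftmost R}

abbrev State : Type := {x : D.Marking // D.IsState x}

noncomputable instance : Fintype D.State := by
  classical exact Subtype.fintype _

/-- Weights for the strand that passes over at a crossing with another strand. -/
def overWeight (positive : Bool) (q : Quadrant) : ℚ :=
  match positive, q with
  | true, Quadrant.left => -1 / 2
  | true, Quadrant.ahead => -1 / 2
  | false, Quadrant.right => 1 / 2
  | false, Quadrant.ahead => 1 / 2
  | _, _ => 0

/-- Weights for the strand that passes under at a crossing with another strand. -/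
def underWeight (positive : Bool) (q : Quadrant) : ℚ :=
  match positive, q with
  | true, Quadrant.right => -1 / 2
  | true, Quadrant.ahead => -1 / 2
  | false, Quadrant.left => 1 / 2
  | false, Quadrant.ahead => 1 / 2
  | _, _ => 0

/-- Weights for a strand at a crossing with itself. -/
def selfWeight (positive : Bool) (q : Quadrant) : ℚ :=
  match positive, q with
  | true, Quadrant.ahead => -1 / 2
  | true, Quadrant.behind => 1 / 2
  | false, Quadrant.ahead => 1 / 2
  | false, Quadrant.behind => -1 / 2
  | _, _ => 0

/-- The weight for strand `i` of the quadrant `q` of the crossing `c`. -/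
def weight (i : Fin k) (c : Fin D.numCrossings) (q : Quadrant) : ℚ :=
  if D.strand (c, true) = i then
    if D.strand (c, false) = i then selfWeight (D.positive c) q else overWeight (D.positive c) q
  else if D.strand (c, false) = i then underWeight (D.positive c) q else 0

/-- The filtration index `F_i(x)`. -/
def filtration (i : Fin k) (x : D.State) : ℚ :=
  ∑ c, D.weight i c (x.1.quad c)

/-- The grading `G(x)`. -/
def grading (x : D.State) : ℤ :=
  ∑ c, if x.1.quad c = Quadrant.ahead then (if D.positive c then -1 else 1) else 0

/-- `∇_S = ∑ₓ (-1)^G(x) h₁^F₁(x) ⋯ h_k^F_k(x)`. As the weights are half-integers, it is written in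
the ring of Laurent polynomials with rational exponents, the group ring of `ℚᵏ`. -/
noncomputable def nabla : AddMonoidAlgebra ℤ (Fin k → ℚ) :=
  ∑ x : D.State,
    AddMonoidAlgebra.single (fun j => D.filtration j x) ((D.grading x).negOnePow : ℤ)

/-- Substitution of `1` for all variables `h_j` with `j ≠ i`. -/
noncomputable def specialize (i : Fin k) :
    AddMonoidAlgebra ℤ (Fin k → ℚ) →+* AddMonoidAlgebra ℤ ℚ :=
  AddMonoidAlgebra.mapDomainRingHom ℤ (Pi.evalAddMonoidHom (fun _ : Fin k => ℚ) i)

/-- Laurent polynomials as Laurent polynomials with rational exponents. -/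
noncomputable def ofLaurent : ℤ[T;T⁻¹] →+* AddMonoidAlgebra ℤ ℚ :=
  AddMonoidAlgebra.mapDomainRingHom ℤ (Int.castAddHom ℚ)

/-! ### The closure of a strand and its Alexander–Conway polynomial -/

/-- The Gauss code of the knot obtained from strand `i` by forgetting the other strands and joining
its two ends by an unknotted arc outside of the square (the code is read cyclically). -/
def closureCode (i : Fin k) : List (Fin D.numCrossings × Bool) :=
  (List.ofFn fun m : Fin (D.len i) => D.passage ⟨i, m⟩).filter
    fun p => D.strand (p.1, !p.2) = i

end Diagram

section Alexander

variable {C : Type} [DecidableEq C]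

/-- The under passages of a Gauss code. The `r`-th of them ends the `r`-th arc of the knot diagram
and begins the next one. -/
def unders (code : List (C × Bool)) : List (C × Bool) := code.filter fun p => !p.2

/-- The number of the arc that passes over the crossing `c`. -/
def overArc (code : List (C × Bool)) (c : C) : ℕ :=
  (unders (code.takeWhile fun p => p ≠ (c, true))).length % (unders code).length

/-- The Alexander matrix of a knot diagram: to each crossing belongs the relation
`(1 - t) o + t l - r = 0`, where `o` is the over arc and `l`, `r` are the arcs to the left and to
the right of it (`l` is the outgoing under arc at a positive crossing, the incoming one at a
negative crossing). -/
noncomputable def alexanderMatrix (positive : C → Bool) (code : List (C × Bool)) :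
    Matrix (Fin (unders code).length) (Fin (unders code).length) ℤ[T;T⁻¹] :=
  Matrix.of fun r s =>
    let c := ((unders code).get r).1
    (if (s : ℕ) = overArc code c then 1 - LaurentPolynomial.T 1 else 0) +
    (if s = r then (if positive c then -1 else LaurentPolynomial.T 1) else 0) +
    (if (s : ℕ) = ((r : ℕ) + 1) % (unders code).length then
      (if positive c then LaurentPolynomial.T 1 else -1) else 0)

/-- The minor of the Alexander matrix without the first row and column (`1` if there is no
crossing). -/
noncomputable def alexanderMinor (positive : C → Bool) (code : List (C × Bool)) : ℤ[T;T⁻¹] :=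
  ((alexanderMatrix positive code).submatrix
    (fun r : Fin ((unders code).length - 1) =>
      (⟨(r : ℕ) + 1, by have := r.isLt; omega⟩ : Fin (unders code).length))
    (fun r : Fin ((unders code).length - 1) =>
      (⟨(r : ℕ) + 1, by have := r.isLt; omega⟩ : Fin (unders code).length))).det

/-- `Δ` is the Alexander–Conway polynomial of the knot: the Alexander polynomial, which is the minor
of the Alexander matrix up to units, normalized by `Δ(t⁻¹) = Δ(t)` and `Δ(1) = 1`. -/
def IsAlexanderConway (positive : C → Bool) (code : List (C × Bool)) (Δ : ℤ[T;T⁻¹]) : Prop :=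
  Associated (alexanderMinor positive code) Δ ∧ LaurentPolynomial.invert Δ = Δ ∧
    LaurentPolynomial.eval₂ (RingHom.id ℤ) 1 Δ = 1

end Alexander

namespace Diagram

variable {k : ℕ} (D : Diagram k) (i : Fin k)

/-! ### The Heegaard diagram of the zero surgery on the closure of strand `i`

The Heegaard surface `Σ` of the string link is the boundary of a neighbourhood of the projection
(with a ball for each crossing) and of a ball outside of `D² × I`. The plane of projection cuts it
into an upper and a lower sheet, which meet along the curves `β_R`, one for each region `R`; the
curve of the leftmost region is not an attaching curve. The sheets are copies of a neighbourhood of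
the projection; `Σ` is oriented by its outward normal, so that the upper sheet is oriented as the
plane. The other curves consist of arcs on the sheets with ends on the `β_R`:

* for each crossing the attaching curve `α_c`, which separates the ends of the over strand from the
  ends of the under strand on the four-holed sphere at `c`;
* for each edge `e` a curve `κ_e` around the tube at `e`. If `e` is the last edge of the strand `j`,
  it is the meridian of that strand. It is an attaching curve if `j ≠ i`; all the other `κ_e`, as
  well as `β_R` for the leftmost region, only serve to cut `Σ` into discs;
* the attaching curve `λ`, a longitude of the closure of strand `i`, which replaces the meridian of
  the strand `i`. It runs along the top of the tubes of strand `i` and closes up on the upper sheet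
  of the outer ball. At an under passage it goes to the lower sheet before the crossing
  and back after it. At a crossing with another strand it does so twice on the right side of the
  tube. At a self-crossing it uses different sides, so that it winds once around the tube, against
  the sign of the crossing; thus its framing is `0`. Around the meridian of strand `i`, it makes a
  finger move across the `β`-curve of the region on the left side of the strand, through which it
  gets the intersection points with this `β`-curve next to the meridian.
-/

/-- The under passages of strand `i`. -/
abbrev UnderPos : Type := {m : Fin (D.len i) // (D.passage ⟨i, m⟩).2 = false}

/-- The under passage belongs to a crossing of strand `i` with itself. -/
def IsSelf (u : D.UnderPos i) : Prop := D.strand ((D.passage ⟨i, u.1⟩).1, true) = i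

open Classical in
/-- The side of the tube on which `λ` goes to the lower sheet. -/
noncomputable def dipInSide (u : D.UnderPos i) : Side :=
  if D.IsSelf i u ∧ D.positive (D.passage ⟨i, u.1⟩).1 = true then Side.left else Side.right

open Classical in
/-- The side of the tube on which `λ` returns to the upper sheet. -/
noncomputable def dipOutSide (u : D.UnderPos i) : Side :=
  if D.IsSelf i u ∧ D.positive (D.passage ⟨i, u.1⟩).1 = false then Side.left else Side.right

/-- The intersection points of the `β`-curves with the other curves. -/
inductive BetaPoint
  /-- with `α_c`, in the given quadrant -/
  | corner (c : Fin D.numCrossings) (q : Quadrant)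
  /-- with `κ_e`, on the given side of `e` -/
  | tube (e : D.Edge) (s : Side)
  /-- with `λ`, before an under passage -/
  | dipIn (u : D.UnderPos i)
  /-- with `λ`, after an under passage -/
  | dipOut (u : D.UnderPos i)
  /-- with `λ`, before the meridian of strand `i` -/
  | before
  /-- with `λ`, after the meridian of strand `i` -/
  | after

/-- The position of an intersection point on its `β`-curve: the edge side on which it lies, and its
rank on this edge side in the order of the walk around the region. Corners come at the end of the
edge side that leads to them. -/
noncomputable def place : D.BetaPoint i → D.EdgeSide × ℕ
  | .corner c q => (D.arrival c q, 5)
  | .tube e s => ((e, s), 2)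
  | .dipIn u => ((⟨i, u.1.castSucc⟩, D.dipInSide i u),
      if D.dipInSide i u = Side.left then 4 else 0)
  | .dipOut u => ((⟨i, u.1.succ⟩, D.dipOutSide i u),
      if D.dipOutSide i u = Side.left then 0 else 4)
  | .before => ((D.lastEdge i, Side.left), 1)
  | .after => ((D.lastEdge i, Side.left), 3)

/-- `q` is the successor of `p` on a `β`-curve (each edge side carries at least one point). -/
def BetaNext (p q : D.BetaPoint i) : Prop :=
  ((D.place i q).1 = (D.place i p).1 ∧ (D.place i p).2 < (D.place i q).2 ∧
    ∀ r, (D.place i r).1 = (D.place i p).1 →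
      ¬ ((D.place i p).2 < (D.place i r).2 ∧ (D.place i r).2 < (D.place i q).2)) ∨
  ((D.place i q).1 = D.next (D.place i p).1 ∧
    (∀ r, (D.place i r).1 = (D.place i p).1 → (D.place i r).2 ≤ (D.place i p).2) ∧
    (∀ r, (D.place i r).1 = (D.place i q).1 → (D.place i q).2 ≤ (D.place i r).2))

/-- The intersection points of all curves: those on the `β`-curves and, for each edge
`e = ⟨i, m⟩` of strand `i`, the intersection point of `λ` and `κ_e`, which lies on the lower sheet
for the last edge and on the upper sheet for the others. -/
inductive Vertex
  | pt (p : D.BetaPoint i)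
  | mid (m : Fin (D.len i + 1))

/-- Four darts leave each vertex; they are numbered counterclockwise on `Σ`.
At a point of a `β`-curve: `0` forwards on the `β`-curve, `1` into the lower sheet, `2` backwards on
the `β`-curve, `3` into the upper sheet.
At the intersection point of `λ` and `κ_e`: `0` forwards on `λ`, `2` backwards on `λ`, and of `1`
and `3` the first (on the upper sheet) or the second (on the lower sheet) leads to the left side of
the edge. -/
abbrev Dart : Type := D.Vertex i × Fin 4

/-- The dart where `λ` enters the `m`-th edge of strand `i`. -/
def entry (m : Fin (D.len i + 1)) : D.Dart i :=
  if m = Fin.last _ then (.pt .before, 3) else (.mid m, 2)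

/-- The dart where `λ` leaves the `m`-th edge of strand `i`. -/
def exit (m : Fin (D.len i + 1)) : D.Dart i :=
  if m = Fin.last _ then (.pt .after, 3) else (.mid m, 0)

/-- The dart number for the upper or lower sheet. -/
def sheet (upper : Bool) : Fin 4 := if upper then 3 else 1

/-- The two darts are the two ends of an arc between adjacent intersection points. -/
inductive Glued : D.Dart i → D.Dart i → Prop
  | beta (p q : D.BetaPoint i) : D.BetaNext i p q → Glued (.pt p, 0) (.pt q, 2)
  | alpha_ahead_left (c : Fin D.numCrossings) :
      Glued (.pt (.corner c .ahead), sheet (D.positive c))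
        (.pt (.corner c .left), sheet (D.positive c))
  | alpha_left_behind (c : Fin D.numCrossings) :
      Glued (.pt (.corner c .left), sheet (!D.positive c))
        (.pt (.corner c .behind), sheet (!D.positive c))
  | alpha_behind_right (c : Fin D.numCrossings) :
      Glued (.pt (.corner c .behind), sheet (D.positive c))
        (.pt (.corner c .right), sheet (D.positive c))
  | alpha_right_ahead (c : Fin D.numCrossings) :
      Glued (.pt (.corner c .right), sheet (!D.positive c))
        (.pt (.corner c .ahead), sheet (!D.positive c))
  | tube_other (e : D.Edge) (upper : Bool) : e.1 ≠ i →
      Glued (.pt (.tube e .left), sheet upper) (.pt (.tube e .right), sheet upper)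
  | tube_upper_left (m : Fin (D.len i + 1)) : m ≠ Fin.last _ →
      Glued (.pt (.tube ⟨i, m⟩ .left), 3) (.mid m, 1)
  | tube_upper_right (m : Fin (D.len i + 1)) : m ≠ Fin.last _ →
      Glued (.mid m, 3) (.pt (.tube ⟨i, m⟩ .right), 3)
  | tube_lower (m : Fin (D.len i + 1)) : m ≠ Fin.last _ →
      Glued (.pt (.tube ⟨i, m⟩ .left), 1) (.pt (.tube ⟨i, m⟩ .right), 1)
  | last_upper :
      Glued (.pt (.tube (D.lastEdge i) .left), 3) (.pt (.tube (D.lastEdge i) .right), 3)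
  | last_lower_left :
      Glued (.pt (.tube (D.lastEdge i) .left), 1) (.mid (Fin.last _), 3)
  | last_lower_right :
      Glued (.mid (Fin.last _), 1) (.pt (.tube (D.lastEdge i) .right), 1)
  | lambda_before : Glued (.pt .before, 1) (.mid (Fin.last _), 2)
  | lambda_after : Glued (.mid (Fin.last _), 0) (.pt .after, 1)
  | lambda_over (m : Fin (D.len i)) : (D.passage ⟨i, m⟩).2 = true →
      Glued (D.exit i m.castSucc) (D.entry i m.succ)
  | lambda_in (u : D.UnderPos i) : Glued (D.exit i u.1.castSucc) (.pt (.dipIn u), 3)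
  | lambda_under (u : D.UnderPos i) : Glued (.pt (.dipIn u), 1) (.pt (.dipOut u), 1)
  | lambda_out (u : D.UnderPos i) : Glued (.pt (.dipOut u), 3) (D.entry i u.1.succ)
  | lambda_close : Glued (D.exit i (Fin.last _)) (D.entry i 0)

/-- The corner `(v, a)` at the vertex `v` lies between the darts `a` and `a + 1`. Corners of the same
component of the complement of the curves are related along the two sides of an arc. -/
inductive SameFace : D.Dart i → D.Dart i → Prop
  | leftSide (v w : D.Vertex i) (a b : Fin 4) :
      D.Glued i (v, a) (w, b) → SameFace (v, a) (w, b - 1)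
  | rightSide (v w : D.Vertex i) (a b : Fin 4) :
      D.Glued i (v, a) (w, b) → SameFace (v, a - 1) (w, b)

/-- The components of the complement of all curves in `Σ`; they are discs. -/
def Face : Type := Quot (D.SameFace i)

/-- The multiplicity of a `2`-chain at a corner. -/
def mult (P : D.Face i → ℤ) (v : D.Vertex i) (a : Fin 4) : ℤ := P (Quot.mk _ (v, a))

/-- `P` is a periodic domain of the Heegaard diagram of the zero surgery: a `2`-chain whose boundary
is a combination of full attaching curves. The first condition says that the boundary is a
combination of full curves, the other two that the auxiliary curves do not occur in it. -/
structure IsPeriodicDomain (P : D.Face i → ℤ) : Prop where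
  curves : ∀ v, D.mult i P v 0 + D.mult i P v 2 = D.mult i P v 1 + D.mult i P v 3
  tubes : ∀ (e : D.Edge) (s : Side), (e.1 = i ∨ e ≠ D.lastEdge e.1) →
    D.mult i P (.pt (.tube e s)) 2 = D.mult i P (.pt (.tube e s)) 3
  leftmost : ∀ p : D.BetaPoint i, D.IsLeftmost (D.region (D.place i p).1) →
    D.mult i P (.pt p) 0 = D.mult i P (.pt p) 3

/-- `P` is a periodic domain `𝒫_i` for the closed surface obtained by capping off a Seifert surface
of the closure of strand `i`: the attaching curve `λ`, oriented opposite to the strand, occurs in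
its boundary with coefficient one. -/
def IsSeifertDomain (P : D.Face i → ℤ) : Prop :=
  D.IsPeriodicDomain i P ∧
    D.mult i P (.mid (Fin.last _)) 3 - D.mult i P (.mid (Fin.last _)) 0 = 1

/-- The Euler measure of `P`: a disc with `r` corners, all of them right angles, has Euler measure
`1 - r / 4`. -/
noncomputable def eulerMeasure (P : D.Face i → ℤ) : ℚ :=
  ∑ᶠ f : D.Face i, (P f : ℚ) * (1 - (Nat.card {d : D.Dart i // Quot.mk _ d = f} : ℚ) / 4)

/-- The average of the multiplicities of `P` around a vertex. -/
def pointMeasure (P : D.Face i → ℤ) (v : D.Vertex i) : ℚ :=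
  (∑ a : Fin 4, (D.mult i P v a : ℚ)) / 4

/-- `n_{x'}(P)` for the intersection point `x'` of the surgery diagram next to `x`: on `λ`, it uses
the intersection point with the same `β`-curve next to the meridian of strand `i` (the region on the
left side of the strand, which is the one that each `x` uses there). -/
def stateMeasure (P : D.Face i → ℤ) (x : D.State) : ℚ :=
  (∑ c, D.pointMeasure i P (.pt (.corner c (x.1.quad c)))) +
    (∑ j ∈ Finset.univ.erase i, D.pointMeasure i P (.pt (.tube (D.lastEdge j) (x.1.side j)))) +
    D.pointMeasure i P (.pt .before)

/-- The multiplicity of `P` at the basepoint `w`, on the lower sheet of the outer ball. -/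
def baseMult (P : D.Face i → ℤ) : ℤ := D.mult i P (.pt (.tube (D.lastEdge i) .right)) 1

/-- The evaluation `⟨c₁(𝔰_w(x')), [P]⟩` of the first Chern class of the `Spinᶜ` structure of `x'` on
the homology class of a periodic domain, read off from the Heegaard diagram:
`e(P) + 2 n_{x'}(P) - 2 n_w(P)`. -/
noncomputable def chern (P : D.Face i → ℤ) (x : D.State) : ℚ :=
  D.eulerMeasure i P + 2 * D.stateMeasure i P x - 2 * D.baseMult i P

end Diagram

end StringLink

/-! ### Regions, quadrants and the walk around a region -/

namespace StringLink

/-! State sums are determinants. A state is a term in the expansion of the determinant of the matrix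
of intersections of the `α`-curves with the `β`-curves; the planarity count of regions makes this
matrix square. The signs of the terms are found by comparing two states. Their difference is a flow
along the edges, vanishing at the ends of the strands, and its odd part is a subgraph that meets as
many regions as crossings. The first return maps of the walks around regions and around crossings
therefore have equal signs on this subgraph, and the sign of the comparing permutation is the parity
of the number of its edges (`Separates.sign_comparePerm`), which is a product of signs of the
quadrants `behind` (`sign_comparePerm`). So a state sum with arbitrary weights is a determinant up
to one sign that depends neither on the weights nor on the ring (`exists_det_eq_stateSum`).

For a function `g` on the regions let `diff g` be its difference across the edges. With unit
weights, the row of a crossing computes the jump of `diff g` there. These jumps and the values at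
the bottom are free coordinates on the functions that vanish on the leftmost region
(`flat_det_isUnit`, `exists_of_jumps`). By the matrix determinant lemma, weighted determinants over
regions become determinants of linear systems over the edges (`det_squareMatrix_eq`). This gives at
once that the signed number of states is one (`stateSum_one`), and that the signed sum of each `F_i`
is zero (`sum_filtration_eq_zero`). Hence the specialization of the state sum to strand `i` has
value one and derivative zero at one. Moreover the half-integers `F_i(x)` agree modulo one, and a
vanishing signed mean over states of total number one makes them integers.

Multiplying weights by factors of crossings and of regions changes a state sum by a unit only. One
such change (`weight_lower`) turns the weights of strand `i` into those of the relations of the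
Alexander matrix: the other strands split off as a triangular block with unit determinant, the edges
inside an arc are eliminated, and a linear relation between the relations permits the removal of a
row and a column. What remains is the minor of the Alexander matrix of the closure
(`associated_alexanderMinor`). A second change (`weight_upper`), with the variable inverted, leads
to the same relations rescaled by powers of the variable, so the state sum is symmetric up to a
unit. Units of the group ring of `ℚ` over `ℤ` are signed monomials, and value one and derivative
zero at one exclude all of them but one (`eq_of_associated`). This one principle yields the
symmetry, the uniqueness of the Alexander-Conway polynomial and its equality with the specialization
(`isAlexanderConway_iff`).

For the Chern class, a 2-chain is recorded by its values on the gaps between consecutive points of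
the `β`-curves on the two sheets. The components of the complement are matched with an explicit list
of names (`exists_faceEquiv`). A chain is a periodic domain with coefficient one at `λ` exactly if
its multiplicities on the lower and the upper sheet differ by a numbering of the regions that jumps
by one across strand `i`, and it does not jump at the auxiliary curves (`isSeifertDomain_iff`).
Since all corners are right angles, the Euler measure is the sum over the faces minus the sum of the
point measures of the vertices. So the evaluation is a sum of local terms: a crossing contributes
twice the weight of its chosen quadrant (`crossing_measure`), and the contribution of the outer ball
cancels against the base point. Such domains exist because multiplicities can be propagated along
the strands (`exists_seifertNumbers`). -/

/-- The other side of an edge. -/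
def Side.flip : Side → Side
  | .left => .right
  | .right => .left

@[simp] theorem Side.flip_flip (s : Side) : s.flip.flip = s := by cases s <;> rfl

theorem Side.sum_univ {M : Type*} [AddCommMonoid M] (f : Side → M) :
    ∑ s, f s = f .left + f .right := by
  have h : (Finset.univ : Finset Side) = {.left, .right} := rfl
  rw [h, Finset.sum_pair (by decide)]

theorem Quadrant.sum_univ {M : Type*} [AddCommMonoid M] (f : Quadrant → M) :
    ∑ q, f q = f .ahead + f .behind + f .left + f .right := by
  have h : (Finset.univ : Finset Quadrant) = {.ahead, .behind, .left, .right} := rfl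
  rw [h, Finset.sum_insert (by decide), Finset.sum_insert (by decide), Finset.sum_pair (by decide)]
  simp only [add_assoc]

namespace GaussData

variable {k : ℕ} (D : GaussData k)

theorem rising_ne_falling (c : Fin D.numCrossings) : D.rising c ≠ D.falling c := by
  simp [rising, falling]

theorem eq_rising_or_falling (p : Fin D.numCrossings × Bool) :
    p = D.rising p.1 ∨ p = D.falling p.1 := by
  rcases p with ⟨c, b⟩
  simp only [rising, falling, Prod.mk.injEq, true_and]
  cases b <;> cases D.positive c <;> simp

@[simp] theorem rising_fst (c) : (D.rising c).1 = c := rfl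
@[simp] theorem falling_fst (c) : (D.falling c).1 = c := rfl

theorem inEdge_passage (j : Fin k) (m : Fin (D.len j)) :
    D.inEdge (D.passage ⟨j, m⟩) = ⟨j, m.castSucc⟩ := by
  unfold inEdge; rw [Equiv.symm_apply_apply]

theorem outEdge_passage (j : Fin k) (m : Fin (D.len j)) :
    D.outEdge (D.passage ⟨j, m⟩) = ⟨j, m.succ⟩ := by
  unfold outEdge; rw [Equiv.symm_apply_apply]

theorem next_inEdge_left_rising (c : Fin D.numCrossings) :
    D.next (D.inEdge (D.rising c), .left) = (D.outEdge (D.falling c), .left) := by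
  obtain ⟨⟨j, m⟩, h⟩ := D.passage.surjective (D.rising c)
  simp only [← h, inEdge_passage]
  simp [next, h]

theorem next_inEdge_left_falling (c : Fin D.numCrossings) :
    D.next (D.inEdge (D.falling c), .left) = (D.inEdge (D.rising c), .right) := by
  obtain ⟨⟨j, m⟩, h⟩ := D.passage.surjective (D.falling c)
  simp only [← h, inEdge_passage]
  simp [next, h, (D.rising_ne_falling c).symm]

theorem next_outEdge_right_rising (c : Fin D.numCrossings) :
    D.next (D.outEdge (D.rising c), .right) = (D.inEdge (D.falling c), .right) := by
  obtain ⟨⟨j, m⟩, h⟩ := D.passage.surjective (D.rising c)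
  simp only [← h, outEdge_passage]
  simp [next, h]

theorem next_outEdge_right_falling (c : Fin D.numCrossings) :
    D.next (D.outEdge (D.falling c), .right) = (D.outEdge (D.rising c), .left) := by
  obtain ⟨⟨j, m⟩, h⟩ := D.passage.surjective (D.falling c)
  simp only [← h, outEdge_passage]
  simp [next, h, (D.rising_ne_falling c).symm]

theorem next_lastEdge_left (j : Fin k) :
    D.next (D.lastEdge j, .left) = if h' : (D.bot.symm j : ℕ) + 1 < k then
        (D.lastEdge (D.bot ⟨(D.bot.symm j : ℕ) + 1, h'⟩), Side.right)
      else (D.firstEdge (D.top (D.bot.symm j)), Side.left) := by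
  simp [next, lastEdge]; rfl

theorem next_firstEdge_right (j : Fin k) :
    D.next (D.firstEdge j, .right) = if 0 < (D.top.symm j : ℕ) then
        (D.firstEdge (D.top ⟨(D.top.symm j : ℕ) - 1, by have := (D.top.symm j).isLt; omega⟩),
          Side.left)
      else (D.lastEdge (D.bot (D.top.symm j)), Side.right) := by
  simp [next, firstEdge]; rfl

/-- The edge side along which the walk leaves the quadrant `q` of `c`. -/
def departure (c : Fin D.numCrossings) : Quadrant → D.EdgeSide
  | .left => (D.outEdge (D.falling c), .left)
  | .behind => (D.inEdge (D.rising c), .right)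
  | .right => (D.inEdge (D.falling c), .right)
  | .ahead => (D.outEdge (D.rising c), .left)

theorem next_arrival (c : Fin D.numCrossings) (q : Quadrant) :
    D.next (D.arrival c q) = D.departure c q := by
  cases q
  · exact D.next_outEdge_right_falling c
  · exact D.next_inEdge_left_falling c
  · exact D.next_inEdge_left_rising c
  · exact D.next_outEdge_right_rising c

theorem region_next (a : D.EdgeSide) : D.region (D.next a) = D.region a :=
  (Quot.sound (r := fun a b : D.EdgeSide => b = D.next a) rfl).symm

/-- The region at a quadrant of a crossing. -/
def corner (c : Fin D.numCrossings) (q : Quadrant) : D.Region := D.region (D.arrival c q)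

theorem region_arrival (c q) : D.region (D.arrival c q) = D.corner c q := rfl

theorem region_departure (c q) : D.region (D.departure c q) = D.corner c q := by
  rw [← next_arrival, region_next, corner]

theorem region_ri_left (c) : D.region (D.inEdge (D.rising c), .left) = D.corner c .left := rfl
theorem region_fi_left (c) : D.region (D.inEdge (D.falling c), .left) = D.corner c .behind := rfl
theorem region_ro_right (c) : D.region (D.outEdge (D.rising c), .right) = D.corner c .right := rfl
theorem region_fo_right (c) : D.region (D.outEdge (D.falling c), .right) = D.corner c .ahead := rfl
theorem region_fo_left (c) : D.region (D.outEdge (D.falling c), .left) = D.corner c .left :=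
  D.region_departure c .left
theorem region_ri_right (c) : D.region (D.inEdge (D.rising c), .right) = D.corner c .behind :=
  D.region_departure c .behind
theorem region_fi_right (c) : D.region (D.inEdge (D.falling c), .right) = D.corner c .right :=
  D.region_departure c .right
theorem region_ro_left (c) : D.region (D.outEdge (D.rising c), .left) = D.corner c .ahead :=
  D.region_departure c .ahead

/-- Induction along a strand, from the bottom to the top. -/
theorem edge_induction_up {motive : D.Edge → Prop} (last : ∀ j, motive (D.lastEdge j))
    (step : ∀ p, motive (D.outEdge p) → motive (D.inEdge p)) (e : D.Edge) : motive e := by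
  obtain ⟨j, m⟩ := e
  induction m using Fin.reverseInduction with
  | last => exact last j
  | cast m ih =>
    have := step (D.passage ⟨j, m⟩)
    rw [inEdge_passage, outEdge_passage] at this
    exact this ih

/-- Induction along a strand, from the top to the bottom. -/
theorem edge_induction_down {motive : D.Edge → Prop} (first : ∀ j, motive (D.firstEdge j))
    (step : ∀ p, motive (D.inEdge p) → motive (D.outEdge p)) (e : D.Edge) : motive e := by
  obtain ⟨j, m⟩ := e
  induction m using Fin.induction with
  | zero => exact first j
  | succ m ih =>
    have := step (D.passage ⟨j, m⟩)
    rw [inEdge_passage, outEdge_passage] at this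
    exact this ih

/-- An edge side is an arrival at a crossing, or leads to the boundary of the square. -/
theorem target_cases (a : D.EdgeSide) :
    (∃ c q, a = D.arrival c q) ∨ (∃ j, a = (D.lastEdge j, .left)) ∨
      ∃ j, a = (D.firstEdge j, .right) := by
  obtain ⟨⟨j, m⟩, s⟩ := a
  cases s
  · induction m using Fin.lastCases with
    | last => exact Or.inr (Or.inl ⟨j, rfl⟩)
    | cast m =>
      left
      rw [← inEdge_passage]
      rcases D.eq_rising_or_falling (D.passage ⟨j, m⟩) with h | h <;> rw [h]
      · exact ⟨_, .left, rfl⟩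
      · exact ⟨_, .behind, rfl⟩
  · induction m using Fin.cases with
    | zero => exact Or.inr (Or.inr ⟨j, rfl⟩)
    | succ m =>
      left
      rw [← outEdge_passage]
      rcases D.eq_rising_or_falling (D.passage ⟨j, m⟩) with h | h <;> rw [h]
      · exact ⟨_, .right, rfl⟩
      · exact ⟨_, .ahead, rfl⟩

theorem inEdge_injective : Function.Injective D.inEdge := by
  intro p p' h
  apply D.passage.symm.injective
  simp only [inEdge] at h
  generalize D.passage.symm p = x at h ⊢
  generalize D.passage.symm p' = y at h ⊢
  obtain ⟨j, m⟩ := x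
  obtain ⟨j', m'⟩ := y
  obtain ⟨rfl, h2⟩ := Sigma.mk.inj h
  simp only [heq_eq_eq, Fin.castSucc_inj] at h2
  subst h2; rfl

theorem outEdge_injective : Function.Injective D.outEdge := by
  intro p p' h
  apply D.passage.symm.injective
  simp only [outEdge] at h
  generalize D.passage.symm p = x at h ⊢
  generalize D.passage.symm p' = y at h ⊢
  obtain ⟨j, m⟩ := x
  obtain ⟨j', m'⟩ := y
  obtain ⟨rfl, h2⟩ := Sigma.mk.inj h
  simp only [heq_eq_eq, Fin.succ_inj] at h2
  subst h2; rfl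

theorem rising_injective : Function.Injective D.rising := fun _ _ h => congrArg Prod.fst h
theorem falling_injective : Function.Injective D.falling := fun _ _ h => congrArg Prod.fst h

theorem rising_ne_falling' (c c') : D.rising c ≠ D.falling c' := by
  intro h
  have : c = c' := congrArg Prod.fst h
  subst this
  exact D.rising_ne_falling c h

theorem arrival_injective {c c' : Fin D.numCrossings} {q q' : Quadrant}
    (h : D.arrival c q = D.arrival c' q') : c = c' ∧ q = q' := by
  have hs := congrArg Prod.snd h
  have he := congrArg Prod.fst h
  cases q <;> cases q' <;> simp only [arrival, reduceCtorEq] at hs he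
  all_goals first
    | exact ⟨D.falling_injective (D.outEdge_injective he), rfl⟩
    | exact ⟨D.rising_injective (D.outEdge_injective he), rfl⟩
    | exact ⟨D.falling_injective (D.inEdge_injective he), rfl⟩
    | exact ⟨D.rising_injective (D.inEdge_injective he), rfl⟩
    | exact absurd (D.outEdge_injective he) (D.rising_ne_falling' _ _)
    | exact absurd (D.outEdge_injective he).symm (D.rising_ne_falling' _ _)
    | exact absurd (D.inEdge_injective he) (D.rising_ne_falling' _ _)
    | exact absurd (D.inEdge_injective he).symm (D.rising_ne_falling' _ _)

theorem inEdge_ne_lastEdge (p j) : D.inEdge p ≠ D.lastEdge j := by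
  intro h
  simp only [inEdge, lastEdge] at h
  generalize D.passage.symm p = x at h
  obtain ⟨j', m⟩ := x
  obtain ⟨rfl, h2⟩ := Sigma.mk.inj h
  exact absurd (eq_of_heq h2) (Fin.castSucc_lt_last m).ne

theorem outEdge_ne_firstEdge (p j) : D.outEdge p ≠ D.firstEdge j := by
  intro h
  simp only [outEdge, firstEdge] at h
  generalize D.passage.symm p = x at h
  obtain ⟨j', m⟩ := x
  obtain ⟨rfl, h2⟩ := Sigma.mk.inj h
  exact absurd (eq_of_heq h2) (Fin.succ_ne_zero m)

/-- As there are finitely many edge sides, this suffices for `next` to be a permutation. Every edge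
side is either the departure from a quadrant or comes after an end of a strand on the boundary of
the square. -/
theorem next_surjective : Function.Surjective D.next := by
  rintro ⟨⟨j, m⟩, s⟩
  cases s
  · induction m using Fin.cases with
    | zero =>
      by_cases h : (D.top.symm j : ℕ) + 1 < k
      · refine ⟨(D.firstEdge (D.top ⟨_, h⟩), .right), ?_⟩
        rw [next_firstEdge_right, if_pos (by simp)]
        change (D.firstEdge _, _) = (D.firstEdge j, _)
        congr 2
        apply D.top.symm.injective
        ext; simp
      · refine ⟨(D.lastEdge (D.bot (D.top.symm j)), .left), ?_⟩
        rw [next_lastEdge_left, dif_neg (by simpa using h)]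
        change (D.firstEdge _, _) = (D.firstEdge j, _)
        simp
    | succ m =>
      rw [← outEdge_passage]
      rcases D.eq_rising_or_falling (D.passage ⟨j, m⟩) with h | h <;> rw [h]
      · exact ⟨_, D.next_arrival _ .ahead⟩
      · exact ⟨_, D.next_arrival _ .left⟩
  · induction m using Fin.lastCases with
    | last =>
      by_cases h : 0 < (D.bot.symm j : ℕ)
      · refine ⟨(D.lastEdge (D.bot ⟨(D.bot.symm j : ℕ) - 1, by
          have := (D.bot.symm j).isLt; omega⟩), .left), ?_⟩
        have h1 : (D.bot.symm j : ℕ) - 1 + 1 = D.bot.symm j := by omega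
        rw [next_lastEdge_left, dif_pos (by simp [h1])]
        change (D.lastEdge _, _) = (D.lastEdge j, _)
        congr 2
        apply D.bot.symm.injective
        ext; simp [h1]
      · refine ⟨(D.firstEdge (D.top (D.bot.symm j)), .right), ?_⟩
        rw [next_firstEdge_right, if_neg (by simpa using h)]
        change (D.lastEdge _, _) = (D.lastEdge j, _)
        simp
    | cast m =>
      rw [← inEdge_passage]
      rcases D.eq_rising_or_falling (D.passage ⟨j, m⟩) with h | h <;> rw [h]
      · exact ⟨_, D.next_arrival _ .behind⟩
      · exact ⟨_, D.next_arrival _ .right⟩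

/-- The walk around the regions as a permutation. -/
noncomputable def nextPerm : Equiv.Perm D.EdgeSide :=
  Equiv.ofBijective D.next (Finite.injective_iff_bijective.mp
    (Finite.injective_iff_surjective.mpr D.next_surjective))

@[simp] theorem nextPerm_apply (a) : D.nextPerm a = D.next a := rfl

theorem next_injective : Function.Injective D.next := D.nextPerm.injective

/-- The region at the left end of the bottom edge, to the left of the strand at position `p`. -/
theorem region_bot_left (j j' : Fin k) (h : (D.bot.symm j' : ℕ) = D.bot.symm j + 1) :
    D.region (D.lastEdge j', .right) = D.region (D.lastEdge j, .left) := by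
  have hk : (D.bot.symm j : ℕ) + 1 < k := by have := (D.bot.symm j').isLt; omega
  rw [← D.region_next (D.lastEdge j, .left), next_lastEdge_left, dif_pos hk]
  congr 3
  apply D.bot.symm.injective
  ext; simp [h]

theorem region_top_left (j j' : Fin k) (h : (D.top.symm j' : ℕ) = D.top.symm j + 1) :
    D.region (D.firstEdge j', .right) = D.region (D.firstEdge j, .left) := by
  rw [← D.region_next (D.firstEdge j', .right), next_firstEdge_right, if_pos (by omega)]
  congr 3
  apply D.top.symm.injective
  ext; simp [h]

/-- A function on the regions that takes the same value on both sides of each edge is constant. -/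
theorem region_const {X : Type*} (g : D.Region → X) (x : X)
    (hg : ∀ e, g (D.region (e, .left)) = g (D.region (e, .right)))
    (h0 : ∀ j, (D.bot.symm j : ℕ) = 0 → g (D.region (D.lastEdge j, .right)) = x) (R) : g R = x := by
  -- Neighbours on the bottom edge share the region between them, so the value spreads from left to
  -- right along the bottom.
  have hb : ∀ n, ∀ j, (D.bot.symm j : ℕ) = n → g (D.region (D.lastEdge j, .right)) = x := by
    intro n
    induction n with
    | zero => exact h0
    | succ n ih =>
      intro j hj
      have hn : n < k := by have := (D.bot.symm j).isLt; omega
      rw [D.region_bot_left (D.bot ⟨n, hn⟩) j (by simp [hj]), hg]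
      exact ih _ (by simp)
  -- The value then spreads up each strand: two regions at consecutive edges of a strand are
  -- separated by an edge of the crossing strand.
  have he : ∀ e, g (D.region (e, .left)) = x := by
    intro e
    apply D.edge_induction_up (motive := fun e => g (D.region (e, .left)) = x)
    · intro j; rw [hg]; exact hb _ j rfl
    · intro p hp
      rcases D.eq_rising_or_falling p with h | h <;> rw [h] at hp ⊢ <;> generalize p.1 = c at hp ⊢
      · rw [region_ri_left, ← region_fo_left, hg, region_fo_right, ← region_ro_left, hp]
      · rw [hg, region_fi_right, ← region_ro_right, ← hg, region_ro_left, ← region_fo_right, ← hg, hp]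
  obtain ⟨⟨e, s⟩, rfl⟩ := Quot.exists_rep R
  cases s
  · exact he e
  · exact (hg e).symm.trans (he e)

end GaussData
end StringLink

/-! ### The matrix of intersections and its expansion over states -/

namespace StringLink
namespace Diagram

variable {k : ℕ} (D : Diagram k)

open Matrix

theorem isLeftmost_iff (i : Fin k) (R : D.Region) :
    D.IsLeftmost R ↔ R = D.region (D.lastEdge (D.bot ⟨0, i.pos⟩), .right) := by
  constructor
  · rintro ⟨j, hj, rfl⟩
    have : j = D.bot ⟨0, i.pos⟩ := by
      apply D.bot.symm.injective
      ext; simp [hj]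
    rw [this]
  · intro h
    exact ⟨_, by simp, h⟩

instance : Finite D.Region := by
  apply Nat.finite_of_card_ne_zero
  rw [D.planar]; omega

/-- The regions that are not leftmost. -/
abbrev InnerRegion : Type := {R : D.Region // ¬ D.IsLeftmost R}

noncomputable instance : Fintype D.Region := Fintype.ofFinite _
noncomputable instance : DecidableEq D.Region := Classical.decEq _
noncomputable instance : DecidablePred D.IsLeftmost := Classical.decPred _

/-- The index type of the `α`-curves: crossings and meridians. -/
abbrev Row : Type := Fin D.numCrossings ⊕ Fin k

/-- The planarity count, less the leftmost region. It makes the matrix of intersections square; the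
strand `i` only serves to exclude `k = 0`, where there is no leftmost region. -/
theorem card_innerRegion (i : Fin k) : Fintype.card D.InnerRegion = Fintype.card D.Row := by
  have h1 : Fintype.card {R : D.Region // D.IsLeftmost R} = 1 := by
    rw [Fintype.card_eq_one_iff]
    refine ⟨⟨_, (D.isLeftmost_iff i _).mpr rfl⟩, ?_⟩
    rintro ⟨R, hR⟩
    exact Subtype.ext ((D.isLeftmost_iff i _).mp hR)
  have h2 := D.planar
  rw [Nat.card_eq_fintype_card] at h2
  rw [Fintype.card_subtype_compl, h1, h2]
  simp

/-- An enumeration of the inner regions by the `α`-curves. -/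
noncomputable def regionEquiv (i : Fin k) : D.InnerRegion ≃ D.Row :=
  Fintype.equivOfCardEq (D.card_innerRegion i)

section Ring

variable {R : Type*} [CommRing R]

/-- The difference of the values of `g` on the right and on the left side of an edge. -/
def diff (g : D.Region → R) (e : D.Edge) : R :=
  g (D.region (e, .right)) - g (D.region (e, .left))

/-- A function vanishes on the leftmost region. -/
def VanishesLeft (g : D.Region → R) : Prop := ∀ S, D.IsLeftmost S → g S = 0

/-- Extension by zero to the leftmost region. -/
noncomputable def extendZero (g : D.InnerRegion → R) (S : D.Region) : R :=
  if h : D.IsLeftmost S then 0 else g ⟨S, h⟩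

theorem vanishesLeft_extendZero (g : D.InnerRegion → R) : D.VanishesLeft (D.extendZero g) :=
  fun _ h => dif_pos h

theorem sum_ite_mul_eq (g : D.InnerRegion → R) (S : D.Region) (r : R) :
    ∑ T : D.InnerRegion, (if S = T then r else 0) * g T = r * D.extendZero g S := by
  unfold extendZero
  split_ifs with h
  · rw [mul_zero]
    refine Finset.sum_eq_zero fun T _ => ?_
    rw [if_neg, zero_mul]
    rintro rfl
    exact T.2 h
  · rw [Finset.sum_eq_single ⟨S, h⟩]
    · simp
    · intro T _ hT
      rw [if_neg, zero_mul]
      rintro rfl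
      exact hT rfl
    · simp

/-- The sign of the intersection of the meridian with a `β`-curve. -/
def sideSign : Side → R
  | .left => -1
  | .right => 1

/-- The signs of the intersections of the curve of a crossing with the `β`-curves. -/
def quadSign : Quadrant → R
  | .ahead => 1
  | .behind => 1
  | .left => -1
  | .right => -1

/-- The matrix of the intersections of the `α`-curves with the `β`-curves, with weights at the
crossings. -/
noncomputable def stateMatrix (w : Fin D.numCrossings → Quadrant → R) :
    Matrix D.Row D.InnerRegion R :=
  Matrix.of fun a S => match a with
    | .inl c => ∑ q, if D.corner c q = S then w c q else 0
    | .inr j => ∑ s, if D.region (D.lastEdge j, s) = S then sideSign s else 0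

theorem stateMatrix_mulVec_inl (w : Fin D.numCrossings → Quadrant → R) (g c) :
    (D.stateMatrix w *ᵥ g) (.inl c) = ∑ q, w c q * D.extendZero g (D.corner c q) := by
  simp only [mulVec, dotProduct, stateMatrix, of_apply, Finset.sum_mul]
  rw [Finset.sum_comm]
  exact Finset.sum_congr rfl fun q _ => D.sum_ite_mul_eq g _ _

theorem stateMatrix_mulVec_inr (w : Fin D.numCrossings → Quadrant → R) (g j) :
    (D.stateMatrix w *ᵥ g) (.inr j) = D.diff (D.extendZero g) (D.lastEdge j) := by
  simp only [mulVec, dotProduct, stateMatrix, of_apply, Finset.sum_mul]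
  rw [Finset.sum_comm, Finset.sum_congr rfl fun s _ => D.sum_ite_mul_eq g _ _, Side.sum_univ]
  simp [sideSign, diff]
  ring

/-- The square matrix of a state sum. -/
noncomputable def squareMatrix (i : Fin k) (w : Fin D.numCrossings → Quadrant → R) :
    Matrix D.Row D.Row R := (D.stateMatrix w).submatrix id (D.regionEquiv i).symm

theorem diff_ri (g : D.Region → R) (c) :
    D.diff g (D.inEdge (D.rising c)) = g (D.corner c .behind) - g (D.corner c .left) := by
  rw [diff, GaussData.region_ri_left, GaussData.region_ri_right]
theorem diff_ro (g : D.Region → R) (c) :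
    D.diff g (D.outEdge (D.rising c)) = g (D.corner c .right) - g (D.corner c .ahead) := by
  rw [diff, GaussData.region_ro_left, GaussData.region_ro_right]
theorem diff_fi (g : D.Region → R) (c) :
    D.diff g (D.inEdge (D.falling c)) = g (D.corner c .right) - g (D.corner c .behind) := by
  rw [diff, GaussData.region_fi_left, GaussData.region_fi_right]
theorem diff_fo (g : D.Region → R) (c) :
    D.diff g (D.outEdge (D.falling c)) = g (D.corner c .ahead) - g (D.corner c .left) := by
  rw [diff, GaussData.region_fo_left, GaussData.region_fo_right]

theorem diff_kirchhoff (g : D.Region → R) (c) :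
    D.diff g (D.inEdge (D.rising c)) + D.diff g (D.inEdge (D.falling c)) =
      D.diff g (D.outEdge (D.rising c)) + D.diff g (D.outEdge (D.falling c)) := by
  rw [diff_ri, diff_ro, diff_fi, diff_fo]; ring

/-- The jumps of the differences at the crossings, and their values at the bottom. -/
def jumps (g : D.Region → R) : D.Row → R :=
  Sum.elim (fun c => D.diff g (D.inEdge (D.rising c)) - D.diff g (D.outEdge (D.rising c)))
    fun j => D.diff g (D.lastEdge j)

/-- The alternating sum of `g` over the four quadrants is the change of `diff g` along the rising
passage, and by `diff_kirchhoff` its negative along the falling one. -/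
theorem flat_mulVec (g : D.InnerRegion → R) :
    D.stateMatrix (fun _ => quadSign) *ᵥ g = D.jumps (D.extendZero g) := by
  ext a
  cases a with
  | inl c =>
    rw [stateMatrix_mulVec_inl, Quadrant.sum_univ]
    simp only [quadSign, jumps, Sum.elim_inl, diff_ri, diff_ro]
    ring
  | inr j => rw [stateMatrix_mulVec_inr]; rfl

theorem diff_eq_zero_of_jumps {g : D.Region → R} (h : D.jumps g = 0) (e) : D.diff g e = 0 := by
  apply D.edge_induction_up (motive := fun e => D.diff g e = 0)
  · intro j; exact congrFun h (.inr j)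
  · intro p hp
    have h1 : D.diff g (D.inEdge (D.rising p.1)) - D.diff g (D.outEdge (D.rising p.1)) = 0 :=
      congrFun h (.inl p.1)
    have h2 := D.diff_kirchhoff g p.1
    rcases D.eq_rising_or_falling p with h' | h' <;> rw [h'] at hp ⊢ <;> rw [hp] at *
    · simpa using h1
    · rw [sub_eq_zero] at h1; rw [h1] at h2; simpa using h2

/-- Without jumps, the differences stay zero from the bottom up, so `g` is constant with the value
of the leftmost region. -/
theorem eq_zero_of_jumps {g : D.Region → R} (h0 : D.VanishesLeft g) (h : D.jumps g = 0) :
    g = 0 := by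
  funext S
  refine D.region_const g 0 (fun e => ?_) (fun j hj => h0 _ ⟨j, hj, rfl⟩) S
  exact (sub_eq_zero.mp (D.diff_eq_zero_of_jumps h e)).symm

theorem flat_mulVec_eq_zero {g : D.InnerRegion → R}
    (h : D.stateMatrix (fun _ => quadSign) *ᵥ g = 0) : g = 0 := by
  rw [flat_mulVec] at h
  have := D.eq_zero_of_jumps (D.vanishesLeft_extendZero g) h
  funext S
  have h2 := congrFun this S.1
  rwa [extendZero, dif_neg S.2] at h2

theorem squareMatrix_mulVec (i : Fin k) (w : Fin D.numCrossings → Quadrant → R) (v) :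
    D.squareMatrix i w *ᵥ v = D.stateMatrix w *ᵥ (v ∘ D.regionEquiv i) := by
  ext a
  simp only [mulVec, dotProduct, squareMatrix, submatrix_apply, id]
  exact Fintype.sum_equiv (D.regionEquiv i).symm _ _ fun x => by simp

theorem squareMatrix_map {R' : Type*} [CommRing R'] (f : R →+* R') (i : Fin k)
    (w : Fin D.numCrossings → Quadrant → R) :
    (D.squareMatrix i w).map f = D.squareMatrix i fun c q => f (w c q) := by
  ext a S
  rcases a with c | j
  · simp [squareMatrix, stateMatrix, apply_ite f]
  · simp only [squareMatrix, stateMatrix, map_apply, submatrix_apply, of_apply, Side.sum_univ,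
      map_add, apply_ite f, sideSign, map_zero, map_one, map_neg, id]

theorem map_quadSign {R' : Type*} [CommRing R'] (f : R →+* R') (q) :
    f (quadSign q) = quadSign q := by cases q <;> simp [quadSign]

theorem flat_det_ne_zero [IsDomain R] (i : Fin k) :
    (D.squareMatrix i (fun _ => quadSign (R := R))).det ≠ 0 := by
  intro h
  obtain ⟨v, hv, h0⟩ := exists_mulVec_eq_zero_iff.mpr h
  rw [squareMatrix_mulVec] at h0
  apply hv
  have := D.flat_mulVec_eq_zero h0
  funext a
  have h2 := congrFun this ((D.regionEquiv i).symm a)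
  simpa using h2

/-- Injectivity holds over every domain, in particular over every prime field. So the integral
determinant is divisible by no prime, and a unit of `ℤ` stays a unit in every ring. -/
theorem flat_det_isUnit (i : Fin k) :
    IsUnit (D.squareMatrix i (fun _ => quadSign (R := R))).det := by
  have key : IsUnit (D.squareMatrix i (fun _ => quadSign (R := ℤ))).det := by
    rw [Int.isUnit_iff_natAbs_eq]
    by_contra hne
    obtain ⟨p, hp, hdvd⟩ := Nat.exists_prime_and_dvd hne
    have := Fact.mk hp
    apply D.flat_det_ne_zero (R := ZMod p) i
    have h1 : (Int.castRingHom (ZMod p)) (D.squareMatrix i (fun _ => quadSign (R := ℤ))).det = 0 := by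
      rw [eq_intCast, ZMod.intCast_zmod_eq_zero_iff_dvd]
      exact Int.natCast_dvd.mpr hdvd
    rw [RingHom.map_det, RingHom.mapMatrix_apply, squareMatrix_map] at h1
    simpa only [map_quadSign] using h1
  have h2 := key.map (Int.castRingHom R)
  rw [RingHom.map_det, RingHom.mapMatrix_apply, squareMatrix_map] at h2
  simpa only [map_quadSign] using h2

/-- Functions on the regions are determined by their jumps, which are arbitrary. -/
theorem exists_of_jumps (i : Fin k) (y : D.Row → R) :
    ∃ g : D.Region → R, D.VanishesLeft g ∧ D.jumps g = y := by
  have hu := D.flat_det_isUnit (R := R) i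
  refine ⟨D.extendZero (((D.squareMatrix i (fun _ => quadSign (R := R)))⁻¹ *ᵥ y) ∘ D.regionEquiv i),
    D.vanishesLeft_extendZero _, ?_⟩
  rw [← flat_mulVec, ← squareMatrix_mulVec, mulVec_mulVec, mul_nonsing_inv _ hu, one_mulVec]

/-- Rows that can be expressed by jumps. -/
theorem squareMatrix_eq_mul (i : Fin k) (w : Fin D.numCrossings → Quadrant → R)
    (K : Matrix D.Row D.Row R)
    (h1 : ∀ g : D.Region → R, ∀ c,
      ∑ q, w c q * g (D.corner c q) = (K *ᵥ D.jumps g) (.inl c))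
    (h2 : ∀ g : D.Region → R, ∀ j, D.diff g (D.lastEdge j) = (K *ᵥ D.jumps g) (.inr j)) :
    D.squareMatrix i w = K * D.squareMatrix i (fun _ => quadSign) := by
  apply ext_of_mulVec_single
  intro b
  rw [← mulVec_mulVec, squareMatrix_mulVec, squareMatrix_mulVec, flat_mulVec]
  ext a
  cases a with
  | inl c => rw [stateMatrix_mulVec_inl, h1]
  | inr j => rw [stateMatrix_mulVec_inr, h2]

end Ring

open Matrix

/-- A marking as a pair of functions. -/
def markingEquiv : ((Fin D.numCrossings → Quadrant) × (Fin k → Side)) ≃ D.Marking where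
  toFun p := ⟨p.1, p.2⟩
  invFun x := (x.quad, x.side)
  left_inv _ := rfl
  right_inv _ := rfl

/-- The bijection between the `α`-curves and the inner regions given by a state. -/
noncomputable def stateEquiv (x : D.State) : D.Row ≃ D.InnerRegion :=
  Equiv.ofBijective (fun a => ⟨D.marked x.1 a, by
      have h : D.marked x.1 a ∈ Set.range (D.marked x.1) := ⟨a, rfl⟩
      rw [x.2.2] at h; exact h⟩) <| by
    constructor
    · intro a b h
      exact x.2.1 (congrArg Subtype.val h)
    · rintro ⟨S, hS⟩
      have h : S ∈ Set.range (D.marked x.1) := by rw [x.2.2]; exact hS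
      obtain ⟨a, ha⟩ := h
      exact ⟨a, Subtype.ext ha⟩

theorem stateEquiv_coe (x : D.State) (a) : (D.stateEquiv x a : D.Region) = D.marked x.1 a := rfl

/-- The permutation given by a state. -/
noncomputable def statePerm (i : Fin k) (x : D.State) : Equiv.Perm D.Row :=
  (D.stateEquiv x).trans (D.regionEquiv i)

theorem isState_iff (i : Fin k) (x : D.Marking) (σ : Equiv.Perm D.Row)
    (h : ∀ a, D.marked x a = ((D.regionEquiv i).symm (σ a)).1) : D.IsState x := by
  constructor
  · intro a b hab
    rw [h, h] at hab
    exact σ.injective ((D.regionEquiv i).symm.injective (Subtype.ext hab))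
  · ext S
    constructor
    · rintro ⟨a, rfl⟩
      rw [h]; exact ((D.regionEquiv i).symm (σ a)).2
    · intro hS
      refine ⟨σ.symm (D.regionEquiv i ⟨S, hS⟩), ?_⟩
      rw [h]; simp

theorem sum_perm_eq {R : Type*} [CommRing R] (i : Fin k) (x : D.Marking)
    [Decidable (D.IsState x)] (r : R) :
    ∑ σ : Equiv.Perm D.Row, (Equiv.Perm.sign σ : R) *
      (if ∀ a, D.marked x a = ((D.regionEquiv i).symm (σ a)).1 then r else 0) =
    if h : D.IsState x then (Equiv.Perm.sign (D.statePerm i ⟨x, h⟩) : R) * r else 0 := by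
  split_ifs with hx
  · rw [Finset.sum_eq_single (D.statePerm i ⟨x, hx⟩)]
    · rw [if_pos]
      intro a
      simp [statePerm, stateEquiv_coe]
    · intro σ _ hσ
      rw [if_neg, mul_zero]
      intro h
      apply hσ
      ext1 a
      apply (D.regionEquiv i).symm.injective
      apply Subtype.ext
      rw [← h]
      simp [statePerm, stateEquiv_coe]
    · simp
  · refine Finset.sum_eq_zero fun σ _ => ?_
    rw [if_neg, mul_zero]
    intro h
    exact hx (D.isState_iff i x σ h)

/-- An entry is a sum over quadrants or sides, since a region may meet an `α`-curve several times.
Expanding determinant and entries gives a sum over pairs of a permutation and a marking. A pair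
survives only if the marking induces the permutation, which happens for exactly one permutation if
the marking is a state and for none otherwise. -/
theorem det_squareMatrix {R : Type*} [CommRing R] (i : Fin k)
    (w : Fin D.numCrossings → Quadrant → R) :
    (D.squareMatrix i w).det = ∑ x : D.State, (Equiv.Perm.sign (D.statePerm i x) : R) *
      ((∏ c, w c (x.1.quad c)) * ∏ j, sideSign (x.1.side j)) := by
  classical
  rw [← det_transpose, det_apply']
  have h1 : ∀ σ : Equiv.Perm D.Row, ∏ a, (D.squareMatrix i w)ᵀ (σ a) a =
      ∑ x : D.Marking, if ∀ a, D.marked x a = ((D.regionEquiv i).symm (σ a)).1 then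
        (∏ c, w c (x.quad c)) * ∏ j, sideSign (x.side j) else 0 := by
    intro σ
    rw [Fintype.prod_sum_type]
    simp only [transpose_apply, squareMatrix, submatrix_apply, id, stateMatrix, of_apply]
    rw [Fintype.prod_sum, Fintype.prod_sum, Finset.sum_mul_sum, ← Fintype.sum_prod_type',
      ← D.markingEquiv.sum_comp]
    refine Finset.sum_congr rfl fun p _ => ?_
    rw [Fintype.prod_ite_zero, Fintype.prod_ite_zero]
    by_cases h : ∀ a, D.marked (D.markingEquiv p) a = ((D.regionEquiv i).symm (σ a)).1
    · rw [if_pos h]; exact congrArg₂ (· * ·) (if_pos fun c => h (.inl c)) (if_pos fun j => h (.inr j))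
    · rw [if_neg h]
      rw [Sum.forall, not_and_or] at h
      rcases h with h | h
      · exact (congrArg₂ (· * ·) (if_neg h) rfl).trans (zero_mul _)
      · exact (congrArg₂ (· * ·) rfl (if_neg h)).trans (mul_zero _)
  simp only [h1, Finset.mul_sum]
  rw [Finset.sum_comm]
  simp only [D.sum_perm_eq i]
  refine Eq.trans (Finset.sum_filter_of_ne (p := D.IsState) ?_).symm ?_
  · intro x _ hx
    by_contra h
    exact hx (dif_neg h)
  · rw [Finset.sum_subtype _ (p := D.IsState) (by simp)]
    exact Finset.sum_congr rfl fun x _ => dif_pos x.2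

/-- All states use the region on the left side of each meridian. -/
theorem state_side (x : D.State) (j : Fin k) : x.1.side j = .left := by
  -- From left to right along the bottom: the right side of the first strand is the leftmost region,
  -- and the right side of each later strand is the region that its left neighbour already uses.
  have key : ∀ n, ∀ j, (D.bot.symm j : ℕ) = n → x.1.side j = .left := by
    intro n
    induction n with
    | zero =>
      intro j hj
      by_contra h
      have h' : x.1.side j = .right := by
        revert h; cases x.1.side j <;> simp
      have := (D.stateEquiv x (.inr j)).2
      rw [stateEquiv_coe] at this
      exact this ⟨j, hj, by rw [marked, h']⟩
    | succ n ih =>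
      intro j hj
      have hn : n < k := by have := (D.bot.symm j).isLt; omega
      by_contra h
      have h' : x.1.side j = .right := by
        revert h; cases x.1.side j <;> simp
      have h1 := ih (D.bot ⟨n, hn⟩) (by simp)
      have h2 : D.marked x.1 (.inr j) = D.marked x.1 (.inr (D.bot ⟨n, hn⟩)) := by
        simp only [marked, h', h1]
        exact D.region_bot_left _ _ (by simp [hj])
      have h3 := Sum.inr.inj (x.2.1 h2)
      rw [h3] at hj
      simp at hj
  exact key _ j rfl

end Diagram
end StringLink

/-! ### Signs of permutations and first return maps -/

namespace StringLink

open Equiv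

section Perm

theorem card_image_eq_of_iff {α β γ : Type*} [DecidableEq β] [DecidableEq γ] (s : Finset α)
    (f : α → β) (g : α → γ) (h : ∀ a ∈ s, ∀ b ∈ s, f a = f b ↔ g a = g b) :
    (s.image f).card = (s.image g).card := by
  classical
  refine Finset.card_bij' (fun b hb => g (Finset.mem_image.mp hb).choose)
    (fun c hc => f (Finset.mem_image.mp hc).choose) ?_ ?_ ?_ ?_
  · intro b hb
    exact Finset.mem_image_of_mem _ (Finset.mem_image.mp hb).choose_spec.1
  · intro c hc
    exact Finset.mem_image_of_mem _ (Finset.mem_image.mp hc).choose_spec.1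
  · intro b hb
    generalize_proofs h1 h2
    rw [(h _ h2.choose_spec.1 _ h1.choose_spec.1).mpr h2.choose_spec.2]
    exact h1.choose_spec.2
  · intro b hb
    generalize_proofs h1 h2
    rw [(h _ h2.choose_spec.1 _ h1.choose_spec.1).mp h2.choose_spec.2]
    exact h1.choose_spec.2

/-- The sign of a permutation whose orbits are the fibres of a function. -/
theorem sign_of_fibers {S F : Type*} [Fintype S] [DecidableEq S] [DecidableEq F] (p : Perm S)
    (g : S → F) (h : ∀ s t, g s = g t ↔ p.SameCycle s t) :
    Perm.sign p = (-1) ^ (Fintype.card S + (Finset.univ.image g).card) := by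
  -- Fixed points are orbits as well; they are split off because the cycle type only lists the
  -- nontrivial cycles. In the exponent they appear twice and cancel.
  have h1 : (Finset.univ.image g).card =
      (p.support.image g).card + (p.supportᶜ.image g).card := by
    rw [← Finset.union_compl p.support, Finset.image_union, Finset.card_union_of_disjoint]
    · rw [Finset.disjoint_left]
      intro f hf hf'
      obtain ⟨s, hs, rfl⟩ := Finset.mem_image.mp hf
      obtain ⟨t, ht, hst⟩ := Finset.mem_image.mp hf'
      rw [Finset.mem_compl, Perm.notMem_support] at ht
      have := (h t s).mp hst
      have h2 := this.eq_of_left ht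
      rw [Perm.mem_support, ← h2] at hs
      exact hs ht
  have h2 : (p.supportᶜ.image g).card = p.supportᶜ.card := by
    apply Finset.card_image_of_injOn
    intro s hs t _ hst
    have hs' : s ∈ p.supportᶜ := hs
    rw [Finset.mem_compl, Perm.notMem_support] at hs'
    exact ((h s t).mp hst).eq_of_left hs'
  have h3 : (p.support.image g).card = p.cycleFactorsFinset.card := by
    have h4 : p.support.image (fun s => p.cycleOf s) = p.cycleFactorsFinset := by
      ext c
      rw [Finset.mem_image]
      constructor
      · rintro ⟨s, hs, rfl⟩
        exact Perm.cycleOf_mem_cycleFactorsFinset_iff.mpr hs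
      · intro hc
        obtain ⟨s, hs⟩ := (Perm.mem_cycleFactorsFinset_iff.mp hc).1.nonempty_support
        exact ⟨s, Perm.mem_cycleFactorsFinset_support_le hc hs,
          ((Perm.cycle_is_cycleOf hs hc).symm)⟩
    rw [← h4]
    apply card_image_eq_of_iff
    intro s hs t _
    rw [h]
    constructor
    · intro hst; exact hst.cycleOf_eq
    · intro hst
      have hm := Perm.mem_support_cycleOf_iff.mpr ⟨Perm.SameCycle.refl p s, hs⟩
      rw [hst] at hm
      exact (Perm.mem_support_cycleOf_iff.mp hm).1.symm
  have h5 := Finset.card_add_card_compl p.support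
  rw [Perm.sign_of_cycleType, Perm.sum_cycleType, h1, h2, h3, ← h5]
  have h6 : p.cycleType.card = p.cycleFactorsFinset.card := by
    rw [Perm.cycleType_def]; simp
  rw [h6, show p.support.card + p.supportᶜ.card + (p.cycleFactorsFinset.card + p.supportᶜ.card) =
    p.support.card + p.cycleFactorsFinset.card + 2 * p.supportᶜ.card by ring, pow_add _ _ (2 * _),
    pow_mul]
  simp

variable {X F : Type*} [Fintype X]

/-- The first return of `p` to `S` is defined: the orbits, which are the fibres of `π`, leave and
enter `S` at most once. -/
structure ReturnsOnce (p : Perm X) (S : X → Prop) (π : X → F) : Prop where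
  inv : ∀ a, π (p a) = π a
  exit_unique : ∀ a b, S a → ¬ S (p a) → S b → ¬ S (p b) → π a = π b → a = b
  entry_unique : ∀ a b, ¬ S a → S (p a) → ¬ S b → S (p b) → π a = π b → a = b
  exists_entry : ∀ a, S a → ¬ S (p a) → ∃ b, ¬ S b ∧ S (p b) ∧ π b = π a
  exists_exit : ∀ a, ¬ S a → S (p a) → ∃ b, S b ∧ ¬ S (p b) ∧ π b = π a

/-- A permutation that preserves a finite fibre leaves `S` in it as often as it enters `S`. If there
are at most two changes in each fibre, there is at most one of each kind. -/
theorem returnsOnce_of_two {p : Perm X} {S : X → Prop} [DecidablePred S] {π : X → F}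
    (inv : ∀ a, π (p a) = π a) (P Q : X → Prop)
    (hP : ∀ a b, P a → P b → π a = π b → a = b) (hQ : ∀ a b, Q a → Q b → π a = π b → a = b)
    (hS : ∀ a, ¬ (S a ↔ S (p a)) → P a ∨ Q a) : ReturnsOnce p S π := by
  classical
  let ex (f : F) : Finset X := {a | π a = f ∧ S a ∧ ¬ S (p a)}
  let en (f : F) : Finset X := {a | π a = f ∧ ¬ S a ∧ S (p a)}
  have hcard : ∀ f, (ex f).card = (en f).card := by
    intro f
    let both : Finset X := {a | π a = f ∧ S a ∧ S (p a)}
    have h1 : (ex f).card + both.card = ({a | π a = f ∧ S a} : Finset X).card := by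
      rw [← Finset.card_union_of_disjoint]
      · congr 1; ext a
        simp only [ex, both, Finset.mem_union, Finset.mem_filter, Finset.mem_univ, true_and]
        tauto
      · rw [Finset.disjoint_left]
        intro a
        simp only [ex, both, Finset.mem_filter, Finset.mem_univ, true_and]
        tauto
    have h2 : (en f).card + both.card = ({a | π a = f ∧ S (p a)} : Finset X).card := by
      rw [← Finset.card_union_of_disjoint]
      · congr 1; ext a
        simp only [en, both, Finset.mem_union, Finset.mem_filter, Finset.mem_univ, true_and]
        tauto
      · rw [Finset.disjoint_left]
        intro a
        simp only [en, both, Finset.mem_filter, Finset.mem_univ, true_and]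
        tauto
    have h3 : ({a | π a = f ∧ S (p a)} : Finset X).card =
        ({a | π a = f ∧ S a} : Finset X).card := by
      apply Finset.card_bij (fun a _ => p a)
      · intro a; simp [inv]
      · intro a _ b _ h; exact p.injective h
      · intro b hb
        refine ⟨p.symm b, ?_, by simp⟩
        have := inv (p.symm b)
        rw [Equiv.apply_symm_apply] at this
        simpa [← this] using hb
    omega
  have hle : ∀ f, (ex f).card + (en f).card ≤ 2 := by
    intro f
    have h1 : Disjoint (ex f) (en f) := by
      rw [Finset.disjoint_left]
      intro a
      simp only [ex, en, Finset.mem_filter, Finset.mem_univ, true_and]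
      tauto
    rw [← Finset.card_union_of_disjoint h1]
    have h2 : ex f ∪ en f ⊆ ({a | π a = f ∧ P a} : Finset X) ∪ ({a | π a = f ∧ Q a} : Finset X) := by
      intro a ha
      have := hS a
      simp only [ex, en, Finset.mem_union, Finset.mem_filter, Finset.mem_univ, true_and] at ha ⊢
      tauto
    refine (Finset.card_le_card h2).trans ((Finset.card_union_le _ _).trans ?_)
    have h3 : ({a | π a = f ∧ P a} : Finset X).card ≤ 1 := by
      rw [Finset.card_le_one]
      intro a ha b hb
      simp only [Finset.mem_filter, Finset.mem_univ, true_and] at ha hb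
      exact hP a b ha.2 hb.2 (ha.1.trans hb.1.symm)
    have h4 : ({a | π a = f ∧ Q a} : Finset X).card ≤ 1 := by
      rw [Finset.card_le_one]
      intro a ha b hb
      simp only [Finset.mem_filter, Finset.mem_univ, true_and] at ha hb
      exact hQ a b ha.2 hb.2 (ha.1.trans hb.1.symm)
    omega
  refine ⟨inv, ?_, ?_, ?_, ?_⟩
  · intro a b h1 h2 h3 h4 h
    have h5 : (ex (π b)).card ≤ 1 := by have := hcard (π b); have := hle (π b); omega
    exact Finset.card_le_one.mp h5 a (by simp [ex, *]) b (by simp [ex, *])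
  · intro a b h1 h2 h3 h4 h
    have h5 : (en (π b)).card ≤ 1 := by have := hcard (π b); have := hle (π b); omega
    exact Finset.card_le_one.mp h5 a (by simp [en, *]) b (by simp [en, *])
  · intro a h1 h2
    have h5 : 0 < (ex (π a)).card := Finset.card_pos.mpr ⟨a, by simp [ex, *]⟩
    rw [hcard] at h5
    obtain ⟨b, hb⟩ := Finset.card_pos.mp h5
    simp only [en, Finset.mem_filter, Finset.mem_univ, true_and] at hb
    exact ⟨b, hb.2.1, hb.2.2, hb.1⟩
  · intro a h1 h2
    have h5 : 0 < (en (π a)).card := Finset.card_pos.mpr ⟨a, by simp [en, *]⟩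
    rw [← hcard] at h5
    obtain ⟨b, hb⟩ := Finset.card_pos.mp h5
    simp only [ex, Finset.mem_filter, Finset.mem_univ, true_and] at hb
    exact ⟨b, hb.2.1, hb.2.2, hb.1⟩

namespace ReturnsOnce

variable {p : Perm X} {S : X → Prop} {π : X → F} (H : ReturnsOnce p S π)
include H

/-- The first return map needs no iteration: a point from which `p` leaves `S` is sent to the image
of the unique entry point of its fibre. -/
theorem exists_perm [DecidablePred S] : ∃ r : Perm {a // S a},
    (∀ a : {a // S a}, S (p a) → (r a : X) = p a) ∧
    (∀ a : {a // S a}, ¬ S (p a) → ∃ b, ¬ S b ∧ p b = r a ∧ π b = π a) := by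
  classical
  choose ent h1 h2 h3 using H.exists_entry
  let f : {a // S a} → {a // S a} := fun a =>
    if h : S (p a) then ⟨p a, h⟩ else ⟨p (ent a a.2 h), h2 a a.2 h⟩
  have hf1 : ∀ a : {a // S a}, S (p a) → (f a : X) = p a := by
    intro a h; simp [f, h]
  have hf2 : ∀ a : {a // S a}, (h : ¬ S (p a)) → (f a : X) = p (ent a a.2 h) := by
    intro a h; simp [f, h]
  have hinj : Function.Injective f := by
    intro a b hab
    have hab' : (f a : X) = f b := congrArg _ hab
    apply Subtype.ext
    by_cases ha : S (p a) <;> by_cases hb : S (p b)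
    · rw [hf1 a ha, hf1 b hb] at hab'
      exact p.injective hab'
    · rw [hf1 a ha, hf2 b hb] at hab'
      exact absurd (p.injective hab' ▸ a.2) (h1 b b.2 hb)
    · rw [hf2 a ha, hf1 b hb] at hab'
      exact absurd (p.injective hab' ▸ b.2) (h1 a a.2 ha)
    · rw [hf2 a ha, hf2 b hb] at hab'
      have h := p.injective hab'
      refine H.exit_unique a b a.2 ha b.2 hb ?_
      rw [← h3 a a.2 ha, ← h3 b b.2 hb, h]
  refine ⟨Equiv.ofBijective f (Finite.injective_iff_bijective.mp hinj), hf1, ?_⟩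
  intro a h
  exact ⟨ent a a.2 h, h1 a a.2 h, (hf2 a h).symm, h3 a a.2 h⟩

/-- For points in the same fibre, label a point of `S` by its cycle under `r`, and a point outside
`S` by the cycle at the entry of its fibre, if there is one. The label is invariant under `p`, hence
constant on the orbits of `p`. So the return map has one cycle for each fibre that meets `S`. -/
theorem sameCycle_iff {r : Perm {a // S a}}
    (h1 : ∀ a : {a // S a}, S (p a) → (r a : X) = p a)
    (h2 : ∀ a : {a // S a}, ¬ S (p a) → ∃ b, ¬ S b ∧ p b = r a ∧ π b = π a)
    (horb : ∀ a b, S a → S b → π a = π b → Relation.EqvGen (fun a b => b = p a) a b)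
    (a b : {a // S a}) : π a = π b ↔ r.SameCycle a b := by
  classical
  constructor
  · intro hab
    let lab : X → Option (Quotient (Perm.SameCycle.setoid r)) := fun x =>
      if h : S x then some (Quotient.mk _ ⟨x, h⟩)
      else if h : ∃ y, ¬ S y ∧ S (p y) ∧ π y = π x then
        some (Quotient.mk _ ⟨p h.choose, h.choose_spec.2.1⟩) else none
    have hlab : ∀ x, lab (p x) = lab x := by
      intro x
      by_cases hx : S x <;> by_cases hpx : S (p x)
      · simp only [lab, hx, hpx, dif_pos]
        congr 1
        apply Quotient.sound
        have h3 : r ⟨x, hx⟩ = ⟨p x, hpx⟩ := Subtype.ext (h1 ⟨x, hx⟩ hpx)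
        exact Perm.SameCycle.symm ⟨1, by rw [zpow_one]; exact h3⟩
      · simp only [lab, hx, hpx, dif_pos, dif_neg, not_false_eq_true]
        obtain ⟨y, hy, hyr, hyx⟩ := h2 ⟨x, hx⟩ hpx
        have hyS : S (p y) := by rw [hyr]; exact (r ⟨x, hx⟩).2
        have he : ∃ y, ¬ S y ∧ S (p y) ∧ π y = π (p x) := ⟨y, hy, hyS, by rw [hyx, H.inv]⟩
        rw [dif_pos he]
        congr 1
        apply Quotient.sound
        have h3 : he.choose = y := H.entry_unique _ _ he.choose_spec.1 he.choose_spec.2.1 hy hyS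
          (by rw [he.choose_spec.2.2, hyx, H.inv])
        have h4 : r ⟨x, hx⟩ = ⟨p he.choose, he.choose_spec.2.1⟩ := by
          apply Subtype.ext
          rw [← hyr]
          exact congrArg p h3.symm
        rw [← h4]
        exact Perm.SameCycle.symm ⟨1, by rw [zpow_one]⟩
      · simp only [lab, hx, hpx, dif_pos, dif_neg, not_false_eq_true]
        have he : ∃ y, ¬ S y ∧ S (p y) ∧ π y = π x := ⟨x, hx, hpx, rfl⟩
        rw [dif_pos he]
        have h3 : he.choose = x := H.entry_unique _ _ he.choose_spec.1 he.choose_spec.2.1 hx hpx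
          he.choose_spec.2.2
        congr 2
        exact Subtype.ext (congrArg p h3.symm)
      · simp only [lab, hx, hpx, dif_neg, not_false_eq_true, H.inv]
    have hgen : ∀ x y, Relation.EqvGen (fun a b => b = p a) x y → lab x = lab y := by
      intro x y hxy
      induction hxy with
      | rel x y h => rw [h, hlab]
      | refl => rfl
      | symm _ _ _ ih => exact ih.symm
      | trans _ _ _ _ _ ih1 ih2 => exact ih1.trans ih2
    have h3 := hgen _ _ (horb a b a.2 b.2 hab)
    simp only [lab, a.2, b.2, dif_pos] at h3
    exact Quotient.exact (Option.some.inj h3)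
  · have hinv : ∀ a : {a // S a}, π (r a) = π a := by
      intro a
      by_cases h : S (p a)
      · rw [h1 a h, H.inv]
      · obtain ⟨y, _, hy, hyx⟩ := h2 a h
        rw [← hy, H.inv, hyx]
    rintro ⟨n, rfl⟩
    have hz : ∀ n : ℤ, ∀ a : {a // S a}, π ((r ^ n) a) = π a := by
      intro n
      induction n using Int.induction_on with
      | zero => simp
      | succ n ih => intro a; rw [zpow_add_one, Perm.mul_apply, ih, hinv]
      | pred n ih =>
        intro a
        rw [zpow_sub_one, Perm.mul_apply, ih]
        have := hinv (r⁻¹ a)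
        rw [show r (r⁻¹ a) = a by simp] at this
        exact this.symm
    exact (hz n a).symm

end ReturnsOnce

/-- Inverting a permutation on an invariant set does not change the sign. -/
theorem exists_perm_eq_or_inv [DecidableEq X] (p : Perm X) (Y : X → Prop) [DecidablePred Y]
    (hY : ∀ a, Y a → Y (p a)) : ∃ q : Perm X, (∀ a, ¬ Y a → q a = p a) ∧
      (∀ a, Y a → q a = p.symm a) ∧ Perm.sign q = Perm.sign p := by
  have hY' : ∀ a, Y a → Y (p.symm a) := fun a ha =>
    Perm.perm_symm_mapsTo_of_mapsTo p (s := {a | Y a}) hY ha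
  have hY2 : ∀ a, Y (p a) ↔ Y a := fun a =>
    ⟨fun h => by simpa using hY' _ h, hY a⟩
  let f : X → X := fun a => if Y a then a else p a
  have hf : Function.Injective f := by
    intro a b hab
    simp only [f] at hab
    split_ifs at hab with ha hb hb
    · exact hab
    · rw [hab, hY2] at ha; exact absurd ha hb
    · rw [← hab, hY2] at hb; exact absurd hb ha
    · exact p.injective hab
  let r : Perm X := Equiv.ofBijective f (Finite.injective_iff_bijective.mp hf)
  have hr : ∀ a, r a = if Y a then a else p a := fun _ => rfl
  -- Here `r` is `p` off `Y` and the identity on `Y`. The square `r * r` is even, so the sign is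
  -- that of `p⁻¹`.
  refine ⟨r * r * p⁻¹, ?_, ?_, ?_⟩
  · intro a ha
    have h1 : ¬ Y (p.symm a) := fun h => ha (by simpa using hY _ h)
    change r (r (p.symm a)) = p a
    rw [hr (p.symm a), if_neg h1, Equiv.apply_symm_apply, hr, if_neg ha]
  · intro a ha
    change r (r (p.symm a)) = p.symm a
    rw [hr (p.symm a), if_pos (hY' a ha), hr, if_pos (hY' a ha)]
  · rw [Perm.sign_mul, Perm.sign_mul, Int.units_mul_self, one_mul, Perm.sign_inv]

end Perm
end StringLink

/-! ### Sums over edges and the walk around a crossing -/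

namespace StringLink
namespace GaussData
variable {k : ℕ} (D : GaussData k)

/-- The edges are the edges that lead to a crossing and the last edges. -/
theorem edge_cases (e : D.Edge) : (∃ p, e = D.inEdge p) ∨ ∃ j, e = D.lastEdge j := by
  obtain ⟨j, m⟩ := e
  induction m using Fin.lastCases with
  | last => exact Or.inr ⟨j, rfl⟩
  | cast m => exact Or.inl ⟨_, (D.inEdge_passage j m).symm⟩

theorem sum_passage {M : Type*} [AddCommMonoid M] (f : Fin D.numCrossings × Bool → M) :
    ∑ p, f p = ∑ c, (f (D.rising c) + f (D.falling c)) := by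
  rw [Fintype.sum_prod_type]
  refine Finset.sum_congr rfl fun c _ => ?_
  rw [Fintype.sum_bool, rising, falling]
  cases D.positive c
  · exact add_comm _ _
  · rfl

theorem sum_edge {M : Type*} [AddCommMonoid M] (f : D.Edge → M) :
    ∑ e, f e = ∑ p, f (D.inEdge p) + ∑ j, f (D.lastEdge j) := by
  rw [← D.passage.sum_comp, Fintype.sum_sigma, Fintype.sum_sigma, ← Finset.sum_add_distrib]
  refine Finset.sum_congr rfl fun j _ => ?_
  rw [Fin.sum_univ_castSucc]
  simp only [inEdge_passage]
  rfl

theorem sum_edge' {M : Type*} [AddCommMonoid M] (f : D.Edge → M) :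
    ∑ e, f e = ∑ p, f (D.outEdge p) + ∑ j, f (D.firstEdge j) := by
  rw [← D.passage.sum_comp, Fintype.sum_sigma, Fintype.sum_sigma, ← Finset.sum_add_distrib]
  refine Finset.sum_congr rfl fun j _ => ?_
  rw [Fin.sum_univ_succ, add_comm]
  simp only [outEdge_passage]
  rfl

theorem sum_telescope {M : Type*} [AddCommGroup M] (f : D.Edge → M) :
    ∑ p, (f (D.inEdge p) - f (D.outEdge p)) = ∑ j, (f (D.firstEdge j) - f (D.lastEdge j)) := by
  rw [Finset.sum_sub_distrib, Finset.sum_sub_distrib, sub_eq_sub_iff_add_eq_add, ← sum_edge,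
    add_comm, ← sum_edge']

/-- Functions on the edges with given jumps at the passages and given values at the bottom. -/
theorem exists_of_passage_jumps {M : Type*} [AddCommGroup M] (last : Fin k → M)
    (jump : Fin D.numCrossings × Bool → M) : ∃ h : D.Edge → M, (∀ j, h (D.lastEdge j) = last j) ∧
      ∀ p, h (D.inEdge p) - h (D.outEdge p) = jump p := by
  refine ⟨fun e => last e.1 + ∑ m : Fin (D.len e.1), if (e.2 : ℕ) ≤ m then
    jump (D.passage ⟨e.1, m⟩) else 0, ?_, ?_⟩
  · intro j
    change last j + ∑ m : Fin (D.len j), (if D.len j ≤ (m : ℕ) then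
      jump (D.passage ⟨j, m⟩) else 0) = last j
    rw [Finset.sum_eq_zero, add_zero]
    intro m _
    exact if_neg (by have := m.isLt; omega)
  · intro p
    obtain ⟨⟨j, m⟩, rfl⟩ := D.passage.surjective p
    rw [inEdge_passage, outEdge_passage, add_sub_add_left_eq_sub, ← Finset.sum_sub_distrib]
    rw [Finset.sum_eq_single m]
    · simp
    · intro m' _ hm
      have : (m' : ℕ) ≠ m := fun h => hm (Fin.ext h)
      simp only [Fin.val_castSucc, Fin.val_succ]
      by_cases h : (m : ℕ) ≤ m'
      · rw [if_pos h, if_pos (by omega), sub_self]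
      · rw [if_neg h, if_neg (by omega), sub_self]
    · simp

/-- The crossing to which an edge side leads. -/
def target : D.EdgeSide → Option (Fin D.numCrossings)
  | (⟨j, m⟩, .left) => if h : (m : ℕ) < D.len j then some (D.passage ⟨j, ⟨m, h⟩⟩).1 else none
  | (⟨j, m⟩, .right) => if h : 0 < (m : ℕ) then
      some (D.passage ⟨j, ⟨(m : ℕ) - 1, by have := m.isLt; omega⟩⟩).1 else none

theorem target_inEdge_left (p) : D.target (D.inEdge p, .left) = some p.1 := by
  obtain ⟨⟨j, m⟩, rfl⟩ := D.passage.surjective p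
  rw [inEdge_passage]
  simp [target]

theorem target_outEdge_right (p) : D.target (D.outEdge p, .right) = some p.1 := by
  obtain ⟨⟨j, m⟩, rfl⟩ := D.passage.surjective p
  rw [outEdge_passage]
  simp [target]

theorem target_arrival (c q) : D.target (D.arrival c q) = some c := by
  cases q
  · exact D.target_outEdge_right _
  · exact D.target_inEdge_left _
  · exact D.target_inEdge_left _
  · exact D.target_outEdge_right _

theorem target_lastEdge_left (j) : D.target (D.lastEdge j, .left) = none := by
  simp [target, lastEdge]

theorem target_firstEdge_right (j) : D.target (D.firstEdge j, .right) = none := by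
  simp [target, firstEdge]

/-- The same edge with the other side. -/
def flip : Equiv.Perm D.EdgeSide where
  toFun a := (a.1, a.2.flip)
  invFun a := (a.1, a.2.flip)
  left_inv a := by simp
  right_inv a := by simp

@[simp] theorem flip_flip (a) : D.flip (D.flip a) = a := D.flip.left_inv a

/-- Rotation of the edges around a crossing. -/
def rotate : Quadrant → Quadrant
  | .left => .ahead
  | .ahead => .right
  | .right => .behind
  | .behind => .left

theorem departure_eq (c q) : D.departure c q = D.flip (D.arrival c (rotate q)) := by
  cases q <;> rfl

theorem next_boundary (a : D.EdgeSide)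
    (h : (∃ j, a = (D.lastEdge j, .left)) ∨ ∃ j, a = (D.firstEdge j, .right)) :
    (∃ j, D.next a = (D.lastEdge j, .right)) ∨ ∃ j, D.next a = (D.firstEdge j, .left) := by
  rcases h with ⟨j, rfl⟩ | ⟨j, rfl⟩
  · rw [next_lastEdge_left]
    split_ifs
    · exact Or.inl ⟨_, rfl⟩
    · exact Or.inr ⟨_, rfl⟩
  · rw [next_firstEdge_right]
    split_ifs
    · exact Or.inr ⟨_, rfl⟩
    · exact Or.inl ⟨_, rfl⟩

/-- The walk departs from the vertex at which it has arrived. Hence `turn` preserves the vertex from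
which an edge side starts, where all ends on the boundary of the square count as one vertex `none`.
-/
theorem target_flip_next (a) : D.target (D.flip (D.next a)) = D.target a := by
  rcases D.target_cases a with ⟨c, q, rfl⟩ | h
  · rw [next_arrival, departure_eq, flip_flip, target_arrival, target_arrival]
  · have h1 : D.target a = none := by
      rcases h with ⟨j, rfl⟩ | ⟨j, rfl⟩
      · exact D.target_lastEdge_left j
      · exact D.target_firstEdge_right j
    rw [h1]
    rcases D.next_boundary a h with ⟨j, hj⟩ | ⟨j, hj⟩ <;> rw [hj]
    · exact D.target_lastEdge_left j
    · exact D.target_firstEdge_right j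

/-- Rotation around the origin of an edge side. -/
noncomputable def turn : Equiv.Perm D.EdgeSide := D.flip.trans D.nextPerm

theorem turn_apply (a) : D.turn a = D.next (D.flip a) := rfl

theorem turn_flip_arrival (c q) : D.turn (D.flip (D.arrival c q)) =
    D.flip (D.arrival c (rotate q)) := by
  rw [turn_apply, flip_flip, next_arrival, departure_eq]

theorem eqvGen_turn (c q q') : Relation.EqvGen (fun a b => b = D.turn a)
    (D.flip (D.arrival c q)) (D.flip (D.arrival c q')) := by
  have key : ∀ q, Relation.EqvGen (fun a b => b = D.turn a)
      (D.flip (D.arrival c q)) (D.flip (D.arrival c .left)) := by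
    have step : ∀ q, Relation.EqvGen (fun a b => b = D.turn a)
      (D.flip (D.arrival c q)) (D.flip (D.arrival c (rotate q))) :=
      fun q => .rel _ _ (D.turn_flip_arrival c q).symm
    intro q
    cases q
    · exact .trans _ _ _ (step .ahead) (.trans _ _ _ (step .right) (step .behind))
    · exact step .behind
    · exact .refl _
    · exact .trans _ _ _ (step .right) (step .behind)
  exact .trans _ _ _ (key q) (.symm _ _ (key q'))

end GaussData
end StringLink

/-! ### The difference of two states as a flow -/

namespace StringLink
namespace Diagram

variable {k : ℕ} (D : Diagram k)

open Equiv

/-- All states use the same regions at the meridians, so their crossings together use the same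
regions too: the right side does not depend on `x`. -/
theorem sum_marked {M : Type*} [AddCommGroup M] (x : D.State) (g : D.Region → M) :
    ∑ c, g (D.corner c (x.1.quad c)) =
      ∑ S : D.InnerRegion, g S - ∑ j, g (D.region (D.lastEdge j, .left)) := by
  rw [eq_sub_iff_add_eq, ← (D.stateEquiv x).sum_comp, Fintype.sum_sum_type]
  congr 1
  refine Finset.sum_congr rfl fun j _ => ?_
  rw [stateEquiv_coe, marked, state_side]

/-- The difference of two states as a chain of corners. -/
def markDiff (x y : D.State) (c : Fin D.numCrossings) (q : Quadrant) : ℤ :=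
  (if x.1.quad c = q then 1 else 0) - (if y.1.quad c = q then 1 else 0)

theorem sum_markDiff (x y : D.State) (c) : ∑ q, D.markDiff x y c q = 0 := by
  simp [markDiff]

theorem sum_markDiff_mul (x y : D.State) (g : D.Region → ℤ) :
    ∑ c, ∑ q, D.markDiff x y c q * g (D.corner c q) = 0 := by
  simp only [markDiff, sub_mul, Finset.sum_sub_distrib, ite_mul, one_mul, zero_mul,
    Finset.sum_ite_eq, Finset.mem_univ, if_true]
  rw [sum_marked, sum_marked, sub_self]

theorem diff_const {R : Type*} [CommRing R] {g : D.Region → R}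
    (h : ∀ c, D.jumps g (.inl c) = 0) (e : D.Edge) : D.diff g e = D.diff g (D.lastEdge e.1) := by
  have hp : ∀ p, D.diff g (D.inEdge p) = D.diff g (D.outEdge p) := by
    intro p
    have h1 := h p.1
    have h2 := D.diff_kirchhoff g p.1
    simp only [jumps, Sum.elim_inl] at h1
    rcases D.eq_rising_or_falling p with h' | h' <;> rw [h']
    · exact sub_eq_zero.mp h1
    · rw [sub_eq_zero.mp h1] at h2; exact add_left_cancel h2
  apply D.edge_induction_up (motive := fun e => D.diff g e = D.diff g (D.lastEdge e.1))
  · intro j; rfl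
  · intro p ih; rw [hp, ih]; rfl

/-- The difference of two states is a flow along the edges. -/
theorem exists_flow (x y : D.State) : ∃ h : D.Edge → ℤ, (∀ j, h (D.lastEdge j) = 0) ∧
    (∀ j, h (D.firstEdge j) = 0) ∧
    ∀ c q, h (D.arrival c q).1 - h (D.departure c q).1 = D.markDiff x y c q := by
  classical
  let f := D.markDiff x y
  -- Adding the required conditions for `left` and `ahead`, and for `behind` and `left`, prescribes
  -- the jump of `h` along each passage. This determines `h` from the bottom; left to show are one
  -- condition at each crossing and the vanishing at the top.
  obtain ⟨h, h0, hj⟩ := D.exists_of_passage_jumps (fun _ => (0 : ℤ)) fun p =>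
    if p = D.rising p.1 then f p.1 .left + f p.1 .ahead else f p.1 .behind + f p.1 .left
  have hr : ∀ c, h (D.inEdge (D.rising c)) - h (D.outEdge (D.rising c)) = f c .left + f c .ahead :=
    fun c => (hj _).trans (if_pos rfl)
  have hf : ∀ c, h (D.inEdge (D.falling c)) - h (D.outEdge (D.falling c)) =
      f c .behind + f c .left :=
    fun c => (hj _).trans (if_neg (D.rising_ne_falling c).symm)
  have hsum : ∀ c, f c .ahead + f c .behind + f c .left + f c .right = 0 := by
    intro c
    have := D.sum_markDiff x y c
    rwa [Quadrant.sum_univ] at this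
  -- Summation by parts of `diff g * h` along all strands, combined with the fact that the
  -- difference of two states is orthogonal to every function on the regions. The remaining
  -- conditions follow by testing against suitable `g`.
  have key : ∀ g : D.Region → ℤ, ∑ c, D.jumps g (.inl c) *
      (h (D.inEdge (D.rising c)) - h (D.inEdge (D.falling c)) + f c .behind) =
      ∑ j, D.diff g (D.firstEdge j) * h (D.firstEdge j) := by
    intro g
    have h1 := D.sum_telescope fun e => D.diff g e * h e
    simp only [h0, mul_zero, sub_zero] at h1
    rw [← h1, D.sum_passage, ← sub_eq_zero, ← Finset.sum_sub_distrib, ← D.sum_markDiff_mul x y g]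
    refine Finset.sum_congr rfl fun c _ => ?_
    have h2 := hr c
    have h3 := hf c
    have h4 := hsum c
    rw [Quadrant.sum_univ]
    simp only [jumps, Sum.elim_inl, diff_ri, diff_ro, diff_fi, diff_fo]
    change _ = f c _ * _ + f c _ * _ + f c _ * _ + f c _ * _
    rw [sub_eq_iff_eq_add] at h2 h3
    rw [h2, h3, show f c .right = -(f c .ahead + f c .behind + f c .left) by linarith]
    ring
  have hfirst : ∀ j, h (D.firstEdge j) = 0 := by
    intro j
    -- This `g` has difference one across strand `j` and zero across all other strands, so it
    -- isolates the value of `h` at the top of strand `j`.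
    obtain ⟨g, _, hg⟩ := D.exists_of_jumps (R := ℤ) j (Pi.single (.inr j) 1)
    have h1 : ∀ c, D.jumps g (.inl c) = 0 := by intro c; rw [hg]; simp
    have h2 := key g
    simp only [h1, zero_mul, Finset.sum_const_zero] at h2
    have h3 : ∀ j', D.diff g (D.firstEdge j') = if j = j' then 1 else 0 := by
      intro j'
      rw [D.diff_const h1]
      have := congrFun hg (.inr j')
      simp only [jumps, Sum.elim_inr] at this
      change D.diff g (D.lastEdge j') = _
      rw [this, Pi.single_apply]
      simp [eq_comm]
    simp only [h3, ite_mul, one_mul, zero_mul, Finset.sum_ite_eq, Finset.mem_univ, if_true] at h2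
    exact h2.symm
  have hB : ∀ c, h (D.inEdge (D.falling c)) - h (D.inEdge (D.rising c)) = f c .behind := by
    intro c
    obtain ⟨j, -⟩ : ∃ j : Fin k, True := ⟨D.strand (c, true), trivial⟩
    -- This `g` jumps only at `c`, so it isolates the missing condition at `c`.
    obtain ⟨g, _, hg⟩ := D.exists_of_jumps (R := ℤ) j (Pi.single (.inl c) 1)
    have h2 := key g
    rw [hg, Finset.sum_eq_zero (f := fun j => D.diff g (D.firstEdge j) * h (D.firstEdge j))
      (fun j _ => by rw [hfirst, mul_zero]), Finset.sum_eq_single c] at h2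
    · rw [Pi.single_eq_same] at h2; linarith
    · intro c' _ hc; rw [Pi.single_eq_of_ne (by simpa using hc), zero_mul]
    · simp
  refine ⟨h, h0, hfirst, fun c q => ?_⟩
  have h1 := hr c
  have h2 := hf c
  have h3 := hB c
  have h4 := hsum c
  cases q <;> simp only [GaussData.arrival, GaussData.departure] <;> change _ = f c _ <;> linarith

/-- The edge side leads to the corner that the state chooses at some crossing. -/
def IsCorner (x : D.State) (a : D.EdgeSide) : Prop := ∃ c, a = D.arrival c (x.1.quad c)

/-- A set of edges whose indicator function changes along the regions and around the crossings
exactly at the corners of two states. -/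
structure Separates (x y : D.State) (S : D.EdgeSide → Prop) : Prop where
  flip : ∀ a, S (D.flip a) ↔ S a
  change : ∀ a, ¬ (S a ↔ S (D.next a)) → D.IsCorner x a ∨ D.IsCorner y a
  ne : ∀ c, x.1.quad c ≠ y.1.quad c →
    ¬ (S (D.arrival c (x.1.quad c)) ↔ S (D.next (D.arrival c (x.1.quad c))))
  boundary : ∀ a, D.target a = none → ¬ S a

theorem corner_unique (x : D.State) {a b} (ha : D.IsCorner x a) (hb : D.IsCorner x b)
    (h : D.region a = D.region b) : a = b := by
  obtain ⟨c, rfl⟩ := ha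
  obtain ⟨c', rfl⟩ := hb
  have : (Sum.inl c : D.Row) = .inl c' := x.2.1 h
  rw [Sum.inl.inj this]

theorem corner_unique' (x : D.State) {a b} (ha : D.IsCorner x a) (hb : D.IsCorner x b)
    (h : D.target a = D.target b) : a = b := by
  obtain ⟨c, rfl⟩ := ha
  obtain ⟨c', rfl⟩ := hb
  rw [GaussData.target_arrival, GaussData.target_arrival] at h
  rw [Option.some.inj h]

variable {D} {x y : D.State} {S : D.EdgeSide → Prop}

/-- The corner of `x` at `c` is where the walk around the region leaves `S`. -/
def Leaves (S : D.EdgeSide → Prop) (x : D.State) (c : Fin D.numCrossings) : Prop :=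
  S (D.arrival c (x.1.quad c)) ∧ ¬ S (D.next (D.arrival c (x.1.quad c)))

/-- The corner of `x` at `c` is where the walk around the region enters `S`. -/
def Enters (S : D.EdgeSide → Prop) (x : D.State) (c : Fin D.numCrossings) : Prop :=
  ¬ S (D.arrival c (x.1.quad c)) ∧ S (D.next (D.arrival c (x.1.quad c)))

namespace Separates

theorem symm (H : D.Separates x y S) : D.Separates y x S where
  flip := H.flip
  change a h := (H.change a h).symm
  -- The set `S` cannot change exactly once in a full turn around the crossing. So a change at the
  -- corner of `x` forces one at the corner of `y`, the only other place where it may occur.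
  ne c h := by
    have h1 := H.ne c h.symm
    by_contra h2
    have h3 : ∀ q, q ≠ x.1.quad c → q ≠ y.1.quad c →
        (S (D.arrival c q) ↔ S (D.next (D.arrival c q))) := by
      intro q hx hy
      by_contra hq
      rcases H.change _ hq with ⟨c', hc⟩ | ⟨c', hc⟩
      · obtain ⟨rfl, rfl⟩ := D.arrival_injective hc; exact hx rfl
      · obtain ⟨rfl, rfl⟩ := D.arrival_injective hc; exact hy rfl
    have h4 : ∀ q, q ≠ x.1.quad c → (S (D.arrival c q) ↔ S (D.next (D.arrival c q))) := by
      intro q hq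
      by_cases hy : q = y.1.quad c
      · rw [hy]; exact h2
      · exact h3 q hq hy
    have h5 : ∀ q, S (D.next (D.arrival c q)) ↔ S (D.arrival c (GaussData.rotate q)) := by
      intro q
      rw [GaussData.next_arrival, GaussData.departure_eq, H.flip]
    simp only [h5] at h1 h4
    revert h1 h4
    generalize x.1.quad c = q
    intro h1 h4
    have hA := h4 .ahead
    have hB := h4 .behind
    have hL := h4 .left
    have hR := h4 .right
    cases q <;> simp only [GaussData.rotate, ne_eq, reduceCtorEq, not_false_eq_true, not_true,
      forall_const] at * <;> tauto
  boundary := H.boundary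

variable (H : D.Separates x y S)
include H

/-- Each of the two states has at most one crossing corner in a region, so the walk around it
changes between `S` and its complement at most twice. -/
theorem returnsOnce : ReturnsOnce D.nextPerm S D.region := by
  classical
  exact returnsOnce_of_two (fun a => D.region_next a) (D.IsCorner x) (D.IsCorner y)
    (fun _ _ => D.corner_unique x) (fun _ _ => D.corner_unique y) H.change

theorem returnsOnce_turn : ReturnsOnce D.turn S fun a => D.target (D.flip a) := by
  classical
  refine returnsOnce_of_two (fun a => D.target_flip_next _) (fun a => D.IsCorner x (D.flip a))
    (fun a => D.IsCorner y (D.flip a)) ?_ ?_ ?_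
  · intro a b ha hb h; exact D.flip.injective (D.corner_unique' x ha hb h)
  · intro a b ha hb h; exact D.flip.injective (D.corner_unique' y ha hb h)
  · intro a h
    rw [← H.flip a] at h
    exact H.change _ h

/-- The turn around the crossing must enter `S` again, and the corner of `x` is already taken by the
place where it leaves. -/
theorem enters_of_leaves (c) (h : Leaves S x c) : Enters S y c := by
  obtain ⟨b, hb1, hb2, hb3⟩ := H.returnsOnce_turn.exists_entry (D.flip (D.arrival c (x.1.quad c)))
    ((H.flip _).mpr h.1) (by rw [GaussData.turn_apply, GaussData.flip_flip]; exact h.2)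
  obtain ⟨b, rfl⟩ := D.flip.surjective b
  simp only [GaussData.flip_flip, GaussData.target_arrival, GaussData.turn_apply] at hb2 hb3
  rw [H.flip] at hb1
  rcases H.change b (by tauto) with ⟨c', rfl⟩ | ⟨c', rfl⟩ <;>
    rw [GaussData.target_arrival] at hb3 <;> obtain rfl := Option.some.inj hb3
  · exact absurd h.1 hb1
  · exact ⟨hb1, hb2⟩

theorem leaves_of_enters (c) (h : Enters S x c) : Leaves S y c := by
  obtain ⟨b, hb1, hb2, hb3⟩ := H.returnsOnce_turn.exists_exit (D.flip (D.arrival c (x.1.quad c)))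
    (by rw [H.flip]; exact h.1) (by rw [GaussData.turn_apply, GaussData.flip_flip]; exact h.2)
  obtain ⟨b, rfl⟩ := D.flip.surjective b
  simp only [GaussData.flip_flip, GaussData.target_arrival, GaussData.turn_apply] at hb2 hb3
  rw [H.flip] at hb1
  rcases H.change b (by tauto) with ⟨c', rfl⟩ | ⟨c', rfl⟩ <;>
    rw [GaussData.target_arrival] at hb3 <;> obtain rfl := Option.some.inj hb3
  · exact absurd hb1 h.1
  · exact ⟨hb1, hb2⟩

/-- The same argument for the walk around the region. Its entry into `S` is a corner of `y`, and it
lies at the crossing where `y` uses the region that `x` uses at `c`. -/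
theorem exists_enters (c) (h : Leaves S x c) :
    ∃ c', Enters S y c' ∧ D.corner c (x.1.quad c) = D.corner c' (y.1.quad c') := by
  obtain ⟨b, hb1, hb2, hb3⟩ := H.returnsOnce.exists_entry _ h.1 h.2
  rcases H.change b (by rw [GaussData.nextPerm_apply] at hb2; tauto) with hb | ⟨c', rfl⟩
  · rw [D.corner_unique x hb ⟨c, rfl⟩ hb3] at hb1
    exact absurd h.1 hb1
  · exact ⟨c', ⟨hb1, hb2⟩, hb3.symm⟩

theorem exists_leaves (c) (h : Enters S x c) :
    ∃ c', Leaves S y c' ∧ D.corner c (x.1.quad c) = D.corner c' (y.1.quad c') := by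
  obtain ⟨b, hb1, hb2, hb3⟩ := H.returnsOnce.exists_exit _ h.1 h.2
  rcases H.change b (by rw [GaussData.nextPerm_apply] at hb2; tauto) with hb | ⟨c', rfl⟩
  · rw [D.corner_unique x hb ⟨c, rfl⟩ hb3] at hb1
    exact absurd hb1 h.1
  · exact ⟨c', ⟨hb1, hb2⟩, hb3.symm⟩

omit H in
theorem iff_of_region {R : D.Region} (h : ∀ a, D.region a = R → (S a ↔ S (D.next a))) {a b}
    (ha : D.region a = R) (hb : D.region b = R) : S a ↔ S b := by
  have key : ∀ a b, Relation.EqvGen (fun a b => b = D.next a) a b →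
      D.region a = D.region b ∧ (D.region a = R → (S a ↔ S b)) := by
    intro a b hab
    induction hab with
    | rel a b hab => subst hab; exact ⟨(D.region_next a).symm, h a⟩
    | refl => exact ⟨rfl, fun _ => Iff.rfl⟩
    | symm a b _ ih => exact ⟨ih.1.symm, fun hb => (ih.2 (ih.1.trans hb)).symm⟩
    | trans a b c _ _ h1 h2 => exact ⟨h1.1.trans h2.1, fun ha =>
        (h1.2 ha).trans (h2.2 (h1.1.symm.trans ha))⟩
  exact (key a b (Quot.eqvGen_exact (ha.trans hb.symm))).2 ha

/-- If `S` does not change at the corner of `x`, then `x` and `y` agree at `c`, and `S` is constant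
both in the turn around `c` and in the walk around the region of that corner. If it does change
there, `S` meets both. -/
theorem meets_iff (c) : (∃ q, S (D.arrival c q)) ↔
    ∃ a, S a ∧ D.region a = D.corner c (x.1.quad c) := by
  constructor
  · rintro ⟨q, hq⟩
    by_cases h : S (D.arrival c (x.1.quad c))
    · exact ⟨_, h, rfl⟩
    · refine ⟨_, ?_, D.region_next _⟩
      by_contra h1
      have hne : x.1.quad c = y.1.quad c := by
        by_contra hne
        exact H.ne c hne (by tauto)
      have h2 : ∀ q, S (D.arrival c q) ↔ S (D.next (D.arrival c q)) := by
        intro q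
        by_contra hq
        rcases H.change _ hq with ⟨c', hc⟩ | ⟨c', hc⟩ <;>
          obtain ⟨rfl, rfl⟩ := D.arrival_injective hc
        · tauto
        · rw [← hne] at hq; tauto
      have h5 : ∀ q, S (D.next (D.arrival c q)) ↔ S (D.arrival c (GaussData.rotate q)) := by
        intro q
        rw [GaussData.next_arrival, GaussData.departure_eq, H.flip]
      simp only [h5] at h2
      have hA := h2 .ahead
      have hB := h2 .behind
      have hL := h2 .left
      have hR := h2 .right
      simp only [GaussData.rotate] at hA hB hL hR
      revert h hq
      generalize x.1.quad c = q'
      cases q <;> cases q' <;> tauto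
  · rintro ⟨a, ha, hR⟩
    by_contra hc
    push Not at hc
    have hnext : ∀ q, ¬ S (D.next (D.arrival c q)) := by
      intro q
      rw [GaussData.next_arrival, GaussData.departure_eq, H.flip]
      exact hc _
    have hne : x.1.quad c = y.1.quad c := by
      by_contra hne
      exact H.ne c hne (iff_of_false (hc _) (hnext _))
    refine hc (x.1.quad c) ((iff_of_region (R := D.corner c (x.1.quad c)) ?_ hR rfl).mp ha)
    intro b hb
    by_contra hb'
    rcases H.change _ hb' with h | h
    · rw [D.corner_unique x h ⟨c, rfl⟩ hb] at hb'
      exact hb' (iff_of_false (hc _) (hnext _))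
    · rw [D.corner_unique y h ⟨c, rfl⟩ (by rw [hb, hne]; rfl)] at hb'
      exact hb' (iff_of_false (hc _) (hnext _))

/-- The regions that no crossing uses are the leftmost one and those left of the last edges. On them
`S` is constant, as no corner of `x` or `y` lies there, and it misses the last edge on their border.
-/
theorem exists_corner {a} (ha : S a) : ∃ c, D.region a = D.corner c (x.1.quad c) := by
  have hlast : ∀ j, ¬ S (D.lastEdge j, .left) := fun j =>
    H.boundary _ (D.target_lastEdge_left j)
  by_contra hc
  push Not at hc
  have h0 : ∀ b, D.region b = D.region a → ¬ D.IsCorner x b := by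
    rintro b hb ⟨c, rfl⟩
    exact hc c hb.symm
  have hside : ∀ z : D.State, ∀ j, D.region (D.lastEdge j, .left) = D.marked z.1 (.inr j) := by
    intro z j; rw [marked, state_side]
  by_cases hl : D.IsLeftmost (D.region a)
  · have hy : ∀ b, D.region b = D.region a → ¬ D.IsCorner y b := by
      rintro b hb ⟨c, rfl⟩
      have := (D.stateEquiv y (.inl c)).2
      rw [stateEquiv_coe] at this
      exact this (by rw [← hb] at hl; exact hl)
    obtain ⟨j, -, hj⟩ := hl
    have h1 := (iff_of_region (R := D.region a) (S := S) (fun b hb => by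
      by_contra h
      exact (H.change b h).elim (h0 b hb) (hy b hb)) rfl hj.symm).mp ha
    exact hlast j ((H.flip _).mp h1)
  · obtain ⟨b, hb⟩ := (D.stateEquiv x).surjective ⟨_, hl⟩
    have hb' := congrArg Subtype.val hb
    rw [stateEquiv_coe] at hb'
    cases b with
    | inl c => exact hc c hb'.symm
    | inr j =>
      change D.marked x.1 (.inr j) = D.region a at hb'
      rw [← hside] at hb'
      have hy : ∀ b, D.region b = D.region a → ¬ D.IsCorner y b := by
        rintro b hb ⟨c, rfl⟩
        have h1 : D.marked y.1 (.inl c) = D.marked y.1 (.inr j) := by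
          rw [← hside, hb']; exact hb
        exact absurd (y.2.1 h1) (by simp)
      exact hlast j ((iff_of_region (R := D.region a) (S := S) (fun b hb => by
        by_contra h
        exact (H.change b h).elim (h0 b hb) (hy b hb)) rfl hb').mp ha)

theorem exists_target {a} (ha : S a) : ∃ c q, D.flip a = D.arrival c q := by
  rcases D.target_cases (D.flip a) with h | h
  · exact h
  · refine absurd ((H.flip a).mpr ha) (H.boundary _ ?_)
    rcases h with ⟨j, h⟩ | ⟨j, h⟩ <;> rw [h]
    · exact D.target_lastEdge_left j
    · exact D.target_firstEdge_right j

/-- The state `x` itself matches the crossings that meet `S` with the regions that meet `S`. -/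
theorem card_image [Fintype {a // S a}] [DecidableEq (Option (Fin D.numCrossings))] :
    (Finset.univ.image fun a : {a // S a} => D.region a).card =
      (Finset.univ.image fun a : {a // S a} => D.target (D.flip a)).card := by
  classical
  let A : Finset (Fin D.numCrossings) := {c | ∃ q, S (D.arrival c q)}
  have h1 : (Finset.univ.image fun a : {a // S a} => D.region a) =
      A.image fun c => D.corner c (x.1.quad c) := by
    ext R
    simp only [Finset.mem_image, Finset.mem_univ, true_and, Subtype.exists, A, Finset.mem_filter]
    constructor
    · rintro ⟨a, ha, rfl⟩
      obtain ⟨c, hc⟩ := H.exists_corner ha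
      exact ⟨c, (H.meets_iff c).mpr ⟨a, ha, hc⟩, hc.symm⟩
    · rintro ⟨c, hc, rfl⟩
      obtain ⟨a, ha, h⟩ := (H.meets_iff c).mp hc
      exact ⟨a, ha, h⟩
  have h2 : (Finset.univ.image fun a : {a // S a} => D.target (D.flip a)) = A.image some := by
    ext R
    simp only [Finset.mem_image, Finset.mem_univ, true_and, Subtype.exists, A, Finset.mem_filter]
    constructor
    · rintro ⟨a, ha, rfl⟩
      obtain ⟨c, q, hc⟩ := H.exists_target ha
      refine ⟨c, ⟨q, ?_⟩, by rw [hc, GaussData.target_arrival]⟩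
      rw [← hc, H.flip]; exact ha
    · rintro ⟨c, ⟨q, hq⟩, rfl⟩
      exact ⟨D.flip (D.arrival c q), (H.flip _).mpr hq, by
        rw [GaussData.flip_flip, GaussData.target_arrival]⟩
  rw [h1, h2, Finset.card_image_of_injective _ (Option.some_injective _),
    Finset.card_image_of_injective]
  intro c c' h
  exact Sum.inl.inj (x.2.1 h : (Sum.inl c : D.Row) = .inl c')

end Separates

end Diagram
end StringLink

/-! ### Kasteleyn's theorem: the signs of the states -/

namespace StringLink
namespace Diagram

variable {k : ℕ} {D : Diagram k}

open Equiv

variable {x y : D.State} {S : D.EdgeSide → Prop}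

/-- The permutation of the `α`-curves that compares two states. -/
noncomputable def comparePerm (x y : D.State) : Perm D.Row :=
  (D.stateEquiv x).trans (D.stateEquiv y).symm

theorem comparePerm_eq_iff (x y : D.State) (a b : D.Row) :
    comparePerm x y a = b ↔ D.marked x.1 a = D.marked y.1 b := by
  rw [comparePerm, Equiv.trans_apply, Equiv.symm_apply_eq, ← stateEquiv_coe, ← stateEquiv_coe,
    Subtype.ext_iff]

theorem comparePerm_inr (x y : D.State) (j) : comparePerm x y (.inr j) = .inr j := by
  rw [comparePerm_eq_iff, marked, marked, state_side, state_side]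

namespace Separates

variable (H : D.Separates x y S)
include H

/-- The permutation `flip` of the edge sides in `S`. -/
def flipPerm : Perm {a // S a} := D.flip.subtypePerm (p := S) (fun a => (H.flip a))

/-- Going back around `c` from the entry at the corner of `y` leads to the exit at the corner of
`x`; going on around the region there leads to the entry at the corner of `y` at `c'`. So the
composition moves entries just as the comparison of the states moves crossings. -/
theorem compose_apply {r1 r2 : Perm {a // S a}}
    (h1 : ∀ a : {a // S a}, ¬ S (D.nextPerm a) →
      ∃ b, ¬ S b ∧ D.nextPerm b = r1 a ∧ D.region b = D.region a)
    (h2 : ∀ a : {a // S a}, ¬ S (D.turn a) →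
      ∃ b, ¬ S b ∧ D.turn b = r2 a ∧ D.target (D.flip b) = D.target (D.flip a))
    {c c'} (hc : Leaves S x c) (hc' : Enters S y c')
    (h : D.corner c (x.1.quad c) = D.corner c' (y.1.quad c')) {s : {a // S a}}
    (hs : (s : D.EdgeSide) = D.next (D.arrival c (y.1.quad c))) :
    ((r1 * H.flipPerm * r2⁻¹) s : D.EdgeSide) = D.next (D.arrival c' (y.1.quad c')) := by
  let t : {a // S a} := ⟨D.flip (D.arrival c (x.1.quad c)), (H.flip _).mpr hc.1⟩
  have ht : r2 t = s := by
    obtain ⟨b, hb1, hb2, hb3⟩ := h2 t (by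
      rw [GaussData.turn_apply, GaussData.flip_flip]; exact hc.2)
    have hy := H.enters_of_leaves c hc
    have : b = D.flip (D.arrival c (y.1.quad c)) := by
      refine H.returnsOnce_turn.entry_unique _ _ hb1 (by rw [hb2]; exact (r2 t).2)
        ((H.flip _).not.mpr hy.1) (by rw [GaussData.turn_apply, GaussData.flip_flip]; exact hy.2) ?_
      rw [hb3]
      change D.target (D.flip (D.flip _)) = D.target (D.flip (D.flip _))
      rw [GaussData.flip_flip, GaussData.flip_flip, GaussData.target_arrival,
        GaussData.target_arrival]
    apply Subtype.ext
    rw [← hb2, this, GaussData.turn_apply, GaussData.flip_flip, hs]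
  have hi : r2⁻¹ s = t := by rw [Perm.inv_eq_iff_eq, ht]
  rw [Perm.mul_apply, hi, Perm.mul_apply]
  have hf : H.flipPerm t = ⟨D.arrival c (x.1.quad c), hc.1⟩ := Subtype.ext (D.flip_flip _)
  rw [hf]
  obtain ⟨b, hb1, hb2, hb3⟩ := h1 ⟨D.arrival c (x.1.quad c), hc.1⟩ hc.2
  have : b = D.arrival c' (y.1.quad c') := by
    refine H.returnsOnce.entry_unique _ _ hb1 (by rw [hb2]; exact (r1 _).2) hc'.1 hc'.2 ?_
    rw [hb3]; exact h
  rw [← hb2, this, GaussData.nextPerm_apply]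

theorem sign_flipPerm [DecidableEq {a // S a}] [Fintype {a // S a}] :
    Perm.sign H.flipPerm = (-1) ^ Nat.card {e : D.Edge // S (e, .left)} := by
  classical
  have hS : ∀ a : D.EdgeSide, S a ↔ S (a.1, .left) := by
    rintro ⟨e, s⟩
    cases s
    · rfl
    · exact H.flip (e, .left)
  let f : {e : D.Edge // S (e, .left)} × Side ≃ {a // S a} :=
    { toFun := fun p => ⟨(p.1.1, p.2), (hS _).mpr p.1.2⟩
      invFun := fun a => (⟨a.1.1, (hS _).mp a.2⟩, a.1.2)
      left_inv := fun _ => rfl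
      right_inv := fun _ => rfl }
  let sw : Perm Side := ⟨Side.flip, Side.flip, Side.flip_flip, Side.flip_flip⟩
  have hsw : Perm.sign sw = -1 := by
    have : sw = swap .left .right := by ext s; cases s <;> rfl
    rw [this, Perm.sign_swap (by simp)]
  have h1 : Perm.sign H.flipPerm =
      Perm.sign (Equiv.prodCongrRight fun _ : {e : D.Edge // S (e, .left)} => sw) := by
    symm
    apply Perm.sign_bij (fun p _ => f p)
    · intro p _ _; rfl
    · intro p p' _ _ h; exact f.injective h
    · intro a _
      refine ⟨f.symm a, ?_, f.apply_symm_apply a⟩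
      intro h
      have := congrArg Prod.snd h
      change Side.flip _ = _ at this
      revert this
      generalize (f.symm a).2 = s
      cases s <;> simp [Side.flip]
  rw [h1, Perm.sign_prodCongrRight]
  simp [hsw, Nat.card_eq_fintype_card]

/-- The sign of the comparison of two states is determined by the set `S`. -/
theorem sign_comparePerm : Perm.sign (comparePerm x y) =
    (-1) ^ Nat.card {e : D.Edge // S (e, .left)} := by
  classical
  obtain ⟨r1, h1, h1'⟩ := H.returnsOnce.exists_perm
  obtain ⟨r2, h2, h2'⟩ := H.returnsOnce_turn.exists_perm
  have hs1 := sign_of_fibers r1 (fun a => D.region a)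
    (fun a b => H.returnsOnce.sameCycle_iff h1 h1' (fun a b _ _ h => Quot.eqvGen_exact h) a b)
  have hs2 := sign_of_fibers r2 (fun a => D.target (D.flip a))
    (fun a b => H.returnsOnce_turn.sameCycle_iff h2 h2' (fun a b ha hb h => by
      obtain ⟨c, q, hc⟩ := H.exists_target ha
      obtain ⟨c', q', hc'⟩ := H.exists_target hb
      rw [hc, hc', GaussData.target_arrival, GaussData.target_arrival] at h
      obtain rfl := Option.some.inj h
      have := D.eqvGen_turn c q q'
      rwa [← hc, ← hc', GaussData.flip_flip, GaussData.flip_flip] at this) a b)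
  -- Both return maps act on the same set with equally many cycles, one for each region or crossing
  -- that `S` meets, so their signs agree.
  rw [H.card_image, ← hs2] at hs1
  have hβ : Perm.sign (r1 * H.flipPerm * r2⁻¹) = Perm.sign H.flipPerm := by
    rw [Perm.sign_mul, Perm.sign_mul, Perm.sign_inv, hs1, mul_right_comm, Int.units_mul_self,
      one_mul]
  rw [← H.sign_flipPerm, ← hβ]
  let Y : D.Row → Prop := Sum.elim (fun c => ¬ Leaves S x c) fun _ => True
  -- Where `x` leaves `S`, the composition of return maps acts as the comparing permutation, but
  -- where `y` leaves, the roles of the states are exchanged and it acts as the inverse. Inverting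
  -- on the complementary invariant set keeps the sign.
  obtain ⟨q, hq1, hq2, hq3⟩ := exists_perm_eq_or_inv (comparePerm x y) Y (by
    rintro (c | j) ha
    · generalize hb : comparePerm x y (.inl c) = b
      cases b with
      | inr j => trivial
      | inl c' =>
        intro hl
        apply ha
        obtain ⟨c'', h3, h4⟩ := H.symm.exists_leaves c' (H.enters_of_leaves c' hl)
        rw [comparePerm_eq_iff] at hb
        have h5 : (Sum.inl c : D.Row) = .inl c'' := x.2.1 (hb.trans h4)
        rw [Sum.inl.inj h5]; exact h3
    · rw [comparePerm_inr]; trivial)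
  rw [← hq3]
  have hqx : ∀ {c c'}, Leaves S x c → D.corner c (x.1.quad c) = D.corner c' (y.1.quad c') →
      q (.inl c) = .inl c' := by
    intro c c' hc h
    rw [hq1 (.inl c) (fun hY : ¬ Leaves S x c => hY hc), comparePerm_eq_iff]; exact h
  have hqy : ∀ {c c'}, Leaves S y c → D.corner c (y.1.quad c) = D.corner c' (x.1.quad c') →
      q (.inl c) = .inl c' := by
    intro c c' hc h
    rw [hq2 (.inl c) (fun hx : Leaves S x c => (H.enters_of_leaves c hx).1 hc.1), Equiv.symm_apply_eq, eq_comm,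
      comparePerm_eq_iff]; exact h.symm
  have hpos : ∀ a, q a ≠ a → ∃ s : {a // S a}, ∃ c, a = .inl c ∧
      ((Leaves S x c ∧ (s : D.EdgeSide) = D.next (D.arrival c (y.1.quad c))) ∨
      (Leaves S y c ∧ (s : D.EdgeSide) = D.next (D.arrival c (x.1.quad c)))) := by
    rintro (c | j) ha
    · have hne : x.1.quad c ≠ y.1.quad c := by
        intro he
        apply ha
        have h5 : comparePerm x y (.inl c) = .inl c := by
          rw [comparePerm_eq_iff, marked, marked, he]
        by_cases hY : Y (.inl c)
        · rw [hq2 _ hY, Equiv.symm_apply_eq, h5]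
        · rw [hq1 _ hY, h5]
      have h6 : Leaves S x c ∨ Enters S x c := by
        have := H.ne c hne
        unfold Leaves Enters; tauto
      rcases h6 with h6 | h6
      · exact ⟨⟨_, (H.enters_of_leaves c h6).2⟩, c, rfl, Or.inl ⟨h6, rfl⟩⟩
      · exact ⟨⟨_, h6.2⟩, c, rfl, Or.inr ⟨H.leaves_of_enters c h6, rfl⟩⟩
    · refine absurd ?_ ha
      rw [hq2 (.inr j) trivial, Equiv.symm_apply_eq, comparePerm_inr]
  have happx : ∀ {c} (s : {a // S a}), Leaves S x c →
      (s : D.EdgeSide) = D.next (D.arrival c (y.1.quad c)) → ∃ c', q (.inl c) = .inl c' ∧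
        Leaves S x c' ∧
        ((r1 * H.flipPerm * r2⁻¹) s : D.EdgeSide) = D.next (D.arrival c' (y.1.quad c')) := by
    intro c s hc hs
    obtain ⟨c', h3, h4⟩ := H.exists_enters c hc
    exact ⟨c', hqx hc h4, H.symm.leaves_of_enters c' h3, H.compose_apply h1' h2' hc h3 h4 hs⟩
  have happy : ∀ {c} (s : {a // S a}), Leaves S y c →
      (s : D.EdgeSide) = D.next (D.arrival c (x.1.quad c)) → ∃ c', q (.inl c) = .inl c' ∧
        Leaves S y c' ∧
        ((r1 * H.flipPerm * r2⁻¹) s : D.EdgeSide) = D.next (D.arrival c' (x.1.quad c')) := by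
    intro c s hc hs
    obtain ⟨c', h3, h4⟩ := H.symm.exists_enters c hc
    exact ⟨c', hqy hc h4, H.leaves_of_enters c' h3, H.symm.compose_apply h1' h2' hc h3 h4 hs⟩
  choose i ci hi hi' using hpos
  have hnot : ∀ c, Leaves S x c → Leaves S y c → False := fun c hx hy =>
    (H.enters_of_leaves c hx).1 hy.1
  have harr : ∀ {c c' : Fin D.numCrossings} {u v}, D.next (D.arrival c u) = D.next (D.arrival c' v) →
      c = c' := fun h => (D.arrival_injective (D.next_injective h)).1
  apply Perm.sign_bij i
  · intro a ha ha'
    apply Subtype.ext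
    have e1 := hi _ ha
    rcases hi' _ ha with ⟨h3, h4⟩ | ⟨h3, h4⟩
    · obtain ⟨c', h5, h6, h7⟩ := happx _ h3 h4
      rw [← e1] at h5
      have e2 := (hi _ ha').symm.trans h5
      rw [h7]
      rcases hi' _ ha' with ⟨h8, h9⟩ | ⟨h8, h9⟩ <;> rw [Sum.inl.inj e2] at h8 h9
      · exact h9
      · exact (hnot _ h6 h8).elim
    · obtain ⟨c', h5, h6, h7⟩ := happy _ h3 h4
      rw [← e1] at h5
      have e2 := (hi _ ha').symm.trans h5
      rw [h7]
      rcases hi' _ ha' with ⟨h8, h9⟩ | ⟨h8, h9⟩ <;> rw [Sum.inl.inj e2] at h8 h9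
      · exact (hnot _ h8 h6).elim
      · exact h9
  · intro a b ha hb hab
    rw [hi _ ha, hi _ hb]
    congr 1
    rcases hi' _ ha with ⟨-, h4⟩ | ⟨-, h4⟩ <;> rcases hi' _ hb with ⟨-, h6⟩ | ⟨-, h6⟩ <;>
      rw [hab, h6] at h4 <;> exact (harr h4).symm
  · intro s hs
    obtain ⟨t, rfl⟩ := r2.surjective s
    -- If `turn t` stays in `S`, both return maps are plain steps and the composition fixes `r2 t`.
    -- So the moved points all come directly after an entry into `S`, at a corner of `x` or of `y`.
    have h3 : (r1 * H.flipPerm * r2⁻¹) (r2 t) = r1 (H.flipPerm t) := by simp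
    have h4 : ¬ S (D.turn t) := by
      intro h4
      apply hs
      apply Subtype.ext
      rw [h3, h2 t h4, h1 (H.flipPerm t) h4]
      rfl
    have hS : S (D.flip t) := (H.flip _).mpr t.2
    obtain ⟨b, hb1, hb2, hb3⟩ := h2' t h4
    have hbc : D.IsCorner x (D.flip b) ∨ D.IsCorner y (D.flip b) := by
      apply H.change
      rw [H.flip]
      have : S (D.next (D.flip b)) := by rw [← GaussData.turn_apply, hb2]; exact (r2 t).2
      tauto
    have hs' : ((r2 t : {a // S a}) : D.EdgeSide) = D.next (D.flip b) := by
      rw [← hb2, GaussData.turn_apply]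
    have hSb : S (D.next (D.flip b)) := hs' ▸ (r2 t).2
    rcases hbc with ⟨c, hc⟩ | ⟨c, hc⟩
    · rw [hc] at hs' hSb
      have hE : Enters S x c := ⟨by rw [← hc, H.flip]; exact hb1, hSb⟩
      have hL := H.leaves_of_enters c hE
      have hne : q (.inl c) ≠ .inl c := by
        intro he
        obtain ⟨c', h5, h6, h7⟩ := happy _ hL hs'
        obtain rfl : c = c' := Sum.inl.inj (he.symm.trans h5)
        exact hs (Subtype.ext (h7.trans hs'.symm))
      refine ⟨.inl c, hne, Subtype.ext ?_⟩
      obtain e := Sum.inl.inj (hi _ hne)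
      rcases hi' _ hne with ⟨h8, h9⟩ | ⟨h8, h9⟩ <;> rw [← e] at h8 h9
      · exact (hnot _ h8 hL).elim
      · rw [h9, hs']
    · rw [hc] at hs' hSb
      have hE : Enters S y c := ⟨by rw [← hc, H.flip]; exact hb1, hSb⟩
      have hL := H.symm.leaves_of_enters c hE
      have hne : q (.inl c) ≠ .inl c := by
        intro he
        obtain ⟨c', h5, h6, h7⟩ := happx _ hL hs'
        obtain rfl : c = c' := Sum.inl.inj (he.symm.trans h5)
        exact hs (Subtype.ext (h7.trans hs'.symm))
      refine ⟨.inl c, hne, Subtype.ext ?_⟩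
      obtain e := Sum.inl.inj (hi _ hne)
      rcases hi' _ hne with ⟨h8, h9⟩ | ⟨h8, h9⟩ <;> rw [← e] at h8 h9
      · rw [h9, hs']
      · exact (hnot _ hL h8).elim

end Separates

/-- The sign of a quadrant in Kasteleyn's theorem. -/
def kasteleynSign (q : Quadrant) : ℤˣ := if q = .behind then -1 else 1

/-- The set `S` consists of the edges with odd flow. Each edge either leads to a crossing or is a
last edge with flow zero, so the parity of their number is a product over crossings of the parities
of the two incoming flows. The two flows differ by the contribution of the quadrant `behind`. -/
theorem sign_comparePerm (x y : D.State) : Perm.sign (comparePerm x y) =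
    ∏ c, kasteleynSign (x.1.quad c) * kasteleynSign (y.1.quad c) := by
  classical
  obtain ⟨h, h0, h1, h2⟩ := D.exists_flow x y
  have hflow : ∀ c q, h (D.arrival c q).1 = h (D.next (D.arrival c q)).1 + D.markDiff x y c q := by
    intro c q; rw [← h2, GaussData.next_arrival]; ring
  have hb : ∀ a, ((∃ j, a = (D.lastEdge j, Side.left)) ∨ ∃ j, a = (D.firstEdge j, Side.right)) →
      h a.1 = 0 := by
    rintro a (⟨j, rfl⟩ | ⟨j, rfl⟩)
    · exact h0 j
    · exact h1 j
  have H : D.Separates x y fun a => Odd (h a.1) := by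
    refine ⟨fun a => Iff.rfl, ?_, ?_, ?_⟩
    · intro a ha
      rcases D.target_cases a with ⟨c, q, rfl⟩ | h3
      · by_contra hc
        push Not at hc
        have h3 : x.1.quad c ≠ q := fun h3 => hc.1 ⟨c, by rw [h3]⟩
        have h4 : y.1.quad c ≠ q := fun h3 => hc.2 ⟨c, by rw [h3]⟩
        apply ha
        rw [hflow, markDiff, if_neg h3, if_neg h4, sub_zero, add_zero]
      · refine absurd ?_ ha
        rw [hb a h3]
        rcases D.next_boundary a h3 with ⟨j, hj⟩ | ⟨j, hj⟩ <;> rw [hj]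
        · change _ ↔ Odd (h (D.lastEdge j)); rw [h0]
        · change _ ↔ Odd (h (D.firstEdge j)); rw [h1]
    · intro c hne
      rw [hflow, markDiff, if_pos rfl, if_neg (Ne.symm hne), sub_zero, Int.odd_add]
      have : ¬ Even (1 : ℤ) := by decide
      rw [← Int.not_even_iff_odd (n := h _)]
      tauto
    · intro a ha
      rcases D.target_cases a with ⟨c, q, rfl⟩ | h3
      · rw [GaussData.target_arrival] at ha; simp at ha
      · rw [hb a h3]; decide
  rw [H.sign_comparePerm]
  have h3 : ∀ c, kasteleynSign (x.1.quad c) * kasteleynSign (y.1.quad c) =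
      (h (D.inEdge (D.rising c))).negOnePow * (h (D.inEdge (D.falling c))).negOnePow := by
    intro c
    have := h2 c .behind
    simp only [GaussData.arrival, GaussData.departure] at this
    rw [sub_eq_iff_eq_add] at this
    rw [this, Int.negOnePow_add, mul_left_comm, Int.units_mul_self, mul_one, markDiff]
    unfold kasteleynSign
    split_ifs <;> simp
  simp only [h3]
  have h4 := GaussData.sum_passage D.toGaussData (M := Additive ℤˣ)
    fun p => Additive.ofMul (h (D.inEdge p)).negOnePow
  have h5 := GaussData.sum_edge D.toGaussData (M := Additive ℤˣ)
    fun e => Additive.ofMul (h e).negOnePow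
  simp only [h0, Int.negOnePow_zero, ofMul_one, Finset.sum_const_zero, add_zero] at h5
  rw [← h5] at h4
  refine Eq.trans ?_ (congrArg Additive.toMul h4)
  rw [toMul_sum, Nat.card_eq_fintype_card, Fintype.card_subtype]
  simp only [toMul_ofMul]
  rw [← Finset.prod_const, Finset.prod_filter]
  refine Finset.prod_congr rfl fun e _ => ?_
  split_ifs with ho
  · exact (Int.negOnePow_odd _ ho).symm
  · exact (Int.negOnePow_even _ (Int.not_odd_iff_even.mp ho)).symm

/-- Kasteleyn's theorem: up to a common sign, the signs of the states are given by the corners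
`behind`. -/
theorem exists_sign (D : Diagram k) (i : Fin k) : ∃ ε : ℤˣ, ∀ x : D.State,
    Perm.sign (D.statePerm i x) = ε * ∏ c, kasteleynSign (x.1.quad c) := by
  by_cases hne : Nonempty D.State
  · obtain ⟨y⟩ := hne
    refine ⟨Perm.sign (D.statePerm i y) * ∏ c, kasteleynSign (y.1.quad c), fun x => ?_⟩
    have h1 : D.statePerm i x = D.statePerm i y * comparePerm x y := by
      ext1 a; simp [statePerm, comparePerm]
    rw [h1, Perm.sign_mul, sign_comparePerm, Finset.prod_mul_distrib, mul_comm (∏ c, _), mul_assoc]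
  · exact ⟨1, fun x => (hne ⟨x⟩).elim⟩

end Diagram
end StringLink

/-! ### State sums with arbitrary weights as determinants -/

namespace StringLink
namespace Diagram

variable {k : ℕ} (D : Diagram k)

open Matrix

section Ring

variable {R : Type*} [CommRing R]

/-- The sum over all states of the products of given weights of the chosen quadrants. -/
noncomputable def stateSum (w : Fin D.numCrossings → Quadrant → R) : R :=
  ∑ x : D.State, ((D.grading x).negOnePow : ℤ) * ∏ c, w c (x.1.quad c)

theorem negOnePow_grading (x : D.State) : ((D.grading x).negOnePow : ℤˣ) =
    ∏ c, if x.1.quad c = .ahead then -1 else 1 := by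
  have key : ∀ (s : Finset (Fin D.numCrossings)) (f : Fin D.numCrossings → ℤ),
      (∑ c ∈ s, f c).negOnePow = ∏ c ∈ s, (f c).negOnePow := by
    intro s f
    classical
    induction s using Finset.induction_on with
    | empty => simp
    | insert a s ha ih => rw [Finset.sum_insert ha, Finset.prod_insert ha, Int.negOnePow_add, ih]
  rw [grading, key]
  refine Finset.prod_congr rfl fun c _ => ?_
  split_ifs <;> simp

/-- State sums are determinants. -/
theorem exists_det_eq_stateSum (i : Fin k) : ∃ ε : ℤˣ, ∀ {R : Type} [CommRing R]
    (w : Fin D.numCrossings → Quadrant → R),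
    (D.squareMatrix i fun c q => quadSign q * w c q).det = ((ε : ℤ) : R) * D.stateSum w := by
  obtain ⟨ε, hε⟩ := D.exists_sign i
  refine ⟨ε * (-1) ^ D.numCrossings * (-1) ^ k, fun {R} _ w => ?_⟩
  rw [det_squareMatrix, stateSum, Finset.mul_sum]
  refine Finset.sum_congr rfl fun x _ => ?_
  -- The sign of `behind` from Kasteleyn's theorem and the intersection signs combine to the sign of
  -- `ahead` in the grading, up to a factor `-1` for each crossing. The meridians add `(-1) ^ k`.
  have h1 : ∀ c, ((kasteleynSign (x.1.quad c) : ℤ) : R) * quadSign (x.1.quad c) =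
      -((((if x.1.quad c = .ahead then -1 else 1 : ℤˣ) : ℤ)) : R) := by
    intro c
    cases x.1.quad c <;> simp [kasteleynSign, quadSign]
  have h2 : ∏ c, (((kasteleynSign (x.1.quad c) : ℤ) : R) * quadSign (x.1.quad c)) =
      (-1) ^ D.numCrossings * (((D.grading x).negOnePow : ℤ) : R) := by
    simp only [h1, Finset.prod_neg, negOnePow_grading]
    simp
  have h3 : ∏ j, sideSign (R := R) (x.1.side j) = (-1) ^ k := by
    simp [state_side, sideSign]
  rw [hε, h3, Finset.prod_mul_distrib]
  rw [Finset.prod_mul_distrib] at h2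
  simp only [Units.val_mul, Int.cast_mul, Units.coe_prod, Int.cast_prod, Units.val_pow_eq_pow_val,
    Units.val_neg, Units.val_one, Int.cast_pow, Int.cast_neg, Int.cast_one]
  linear_combination (((ε : ℤ) : R) * (∏ c, w c (x.1.quad c)) * (-1) ^ k) * h2

theorem map_stateSum {R' : Type*} [CommRing R'] (f : R →+* R')
    (w : Fin D.numCrossings → Quadrant → R) :
    f (D.stateSum w) = D.stateSum fun c q => f (w c q) := by
  simp [stateSum, map_sum, map_mul, map_prod]

theorem prod_marked (x : D.State) (f : D.Region → Rˣ) :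
    ∏ c, f (D.corner c (x.1.quad c)) =
      (∏ S : D.InnerRegion, f S) * (∏ j, f (D.region (D.lastEdge j, .left)))⁻¹ := by
  have := D.sum_marked (M := Additive Rˣ) x fun S => Additive.ofMul (f S)
  have := congrArg Additive.toMul this
  rwa [toMul_sum, toMul_sub, toMul_sum, toMul_sum, div_eq_mul_inv] at this

/-- A change of the weights by factors of the crossings and of the regions. -/
theorem stateSum_gauge (w w' : Fin D.numCrossings → Quadrant → R) (u : Fin D.numCrossings → Rˣ)
    (f : D.Region → Rˣ) (h : ∀ c q, w' c q = u c * f (D.corner c q) * w c q) :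
    Associated (D.stateSum w) (D.stateSum w') := by
  refine ⟨(∏ c, u c) *
    ((∏ S : D.InnerRegion, f S) * (∏ j, f (D.region (D.lastEdge j, .left)))⁻¹), ?_⟩
  rw [stateSum, Finset.sum_mul, stateSum]
  refine Finset.sum_congr rfl fun x _ => ?_
  simp only [h, Finset.prod_mul_distrib, ← D.prod_marked x, Units.val_mul, Units.coe_prod]
  ring

end Ring

end Diagram

/-! ### From determinants over regions to determinants over edges -/

section Triangular

open Matrix

theorem det_of_triangular {n α R : Type*} [Fintype n] [DecidableEq n] [LinearOrder α] [CommRing R]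
    (b : n → α) (hb : Function.Injective b) (M : Matrix n n R)
    (h : ∀ i j, b j < b i → M i j = 0) : M.det = ∏ i, M i i := by
  let _ : LinearOrder n := LinearOrder.lift' b hb
  convert det_of_isUpperTriangular (M := M) (fun i j hij => h i j hij)

end Triangular

namespace Diagram

variable {k : ℕ} (D : Diagram k)

open Matrix

section Edge

variable {R : Type*} [CommRing R]

/-- The edges lead to a passage or to the bottom. -/
noncomputable def edgeEquiv : (Fin D.numCrossings × Bool) ⊕ Fin k ≃ D.Edge :=
  Equiv.ofBijective (Sum.elim D.inEdge D.lastEdge) <| by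
    constructor
    · rintro (p | j) (p' | j') h
      · rw [D.inEdge_injective h]
      · exact absurd h (D.inEdge_ne_lastEdge p j')
      · exact absurd h.symm (D.inEdge_ne_lastEdge p' j)
      · exact congrArg Sum.inr (congrArg Sigma.fst h)
    · intro e
      rcases D.edge_cases e with ⟨p, rfl⟩ | ⟨j, rfl⟩
      · exact ⟨.inl p, rfl⟩
      · exact ⟨.inr j, rfl⟩

@[simp] theorem edgeEquiv_symm_inEdge (p) : D.edgeEquiv.symm (D.inEdge p) = .inl p := by
  rw [Equiv.symm_apply_eq]; rfl

@[simp] theorem edgeEquiv_symm_lastEdge (j) : D.edgeEquiv.symm (D.lastEdge j) = .inr j := by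
  rw [Equiv.symm_apply_eq]; rfl

/-- The sign of the jump at a passage. -/
noncomputable def jumpSign (p : Fin D.numCrossings × Bool) : R :=
  if p = D.rising p.1 then 1 else -1

@[simp] theorem jumpSign_rising (c) : D.jumpSign (R := R) (D.rising c) = 1 := if_pos rfl

@[simp] theorem jumpSign_falling (c) : D.jumpSign (R := R) (D.falling c) = -1 :=
  if_neg (D.rising_ne_falling c).symm

theorem diff_in_sub_out (g : D.Region → R) (p) :
    D.diff g (D.inEdge p) - D.diff g (D.outEdge p) = D.jumpSign p * D.jumps g (.inl p.1) := by
  have h := D.diff_kirchhoff g p.1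
  rcases D.eq_rising_or_falling p with h' | h' <;> rw [h'] <;> simp [jumps]
  linear_combination h

/-- The equations for the differences at the edges which say that the difference on the edge `z c`,
multiplied by `ρ c`, is added to the jump at the crossing `c`. -/
noncomputable def edgeMatrix (ρ : Fin D.numCrossings → R) (z : Fin D.numCrossings → D.Edge) :
    Matrix D.Edge D.Edge R :=
  Matrix.of fun e => Sum.elim
    (fun p => Pi.single (D.inEdge p) 1 - Pi.single (D.outEdge p) 1 +
      (D.jumpSign p * ρ p.1) • Pi.single (z p.1) 1)
    (fun j => Pi.single (D.lastEdge j) 1) (D.edgeEquiv.symm e)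

theorem edgeMatrix_inEdge (ρ : Fin D.numCrossings → R) (z p) :
    D.edgeMatrix ρ z (D.inEdge p) = Pi.single (D.inEdge p) 1 - Pi.single (D.outEdge p) 1 +
      (D.jumpSign p * ρ p.1) • Pi.single (z p.1) 1 := by
  change Sum.elim _ _ (D.edgeEquiv.symm (D.inEdge p)) = _
  rw [edgeEquiv_symm_inEdge, Sum.elim_inl]

theorem edgeMatrix_lastEdge (ρ : Fin D.numCrossings → R) (z j) :
    D.edgeMatrix ρ z (D.lastEdge j) = Pi.single (D.lastEdge j) 1 := by
  change Sum.elim _ _ (D.edgeEquiv.symm (D.lastEdge j)) = _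
  rw [edgeEquiv_symm_lastEdge, Sum.elim_inr]

/-- The order of the edges along the strands. -/
def edgeOrder (e : D.Edge) : Fin k ×ₗ ℕ := toLex (e.1, (e.2 : ℕ))

theorem edgeOrder_injective : Function.Injective D.edgeOrder := by
  rintro ⟨j, m⟩ ⟨j', m'⟩ h
  have h1 : (j, (m : ℕ)) = (j', (m' : ℕ)) := toLex.injective h
  simp only [Prod.mk.injEq] at h1
  obtain ⟨rfl, h2⟩ := h1
  rw [Fin.ext h2]

theorem edgeOrder_lt_iff {e e' : D.Edge} :
    D.edgeOrder e < D.edgeOrder e' ↔ e.1 < e'.1 ∨ e.1 = e'.1 ∧ (e.2 : ℕ) < e'.2 := by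
  rw [edgeOrder, edgeOrder, Prod.Lex.toLex_lt_toLex]

theorem edgeOrder_in_lt_out (p) : D.edgeOrder (D.inEdge p) < D.edgeOrder (D.outEdge p) := by
  rw [edgeOrder_lt_iff]
  right
  simp [GaussData.inEdge, GaussData.outEdge]

/-- In the order along the strands, every equation expresses the difference on an edge by
differences on later edges. -/
theorem det_edgeMatrix_of_lt (ρ : Fin D.numCrossings → R) (z : Fin D.numCrossings → D.Edge)
    (h : ∀ p : Fin D.numCrossings × Bool, ρ p.1 = 0 ∨
      D.edgeOrder (D.inEdge p) < D.edgeOrder (z p.1)) : (D.edgeMatrix ρ z).det = 1 := by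
  rw [det_of_triangular D.edgeOrder D.edgeOrder_injective]
  · refine Finset.prod_eq_one fun e _ => ?_
    rcases D.edge_cases e with ⟨p, rfl⟩ | ⟨j, rfl⟩
    · have h1 := (D.edgeOrder_in_lt_out p).ne
      have h2 : D.inEdge p ≠ D.outEdge p := fun h' => h1 (congrArg _ h')
      rw [edgeMatrix_inEdge]
      simp only [Pi.add_apply, Pi.sub_apply, Pi.single_eq_same, Pi.single_eq_of_ne h2, Pi.smul_apply]
      rcases h p with h | h
      · simp [h]
      · have h3 : D.inEdge p ≠ z p.1 := fun h' => h.ne (congrArg _ h')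
        simp [Pi.single_eq_of_ne h3]
    · simp [edgeMatrix_lastEdge]
  · intro e e' he
    have h0 : e' ≠ e := fun h' => he.ne (congrArg _ h')
    rcases D.edge_cases e with ⟨p, rfl⟩ | ⟨j, rfl⟩
    · have h1 := he.trans (D.edgeOrder_in_lt_out p)
      have h2 : e' ≠ D.outEdge p := fun h' => h1.ne (congrArg _ h')
      rw [edgeMatrix_inEdge]
      simp only [Pi.add_apply, Pi.sub_apply, Pi.single_eq_of_ne h0, Pi.single_eq_of_ne h2,
        Pi.smul_apply]
      rcases h p with h | h
      · simp [h]
      · have h3 : e' ≠ z p.1 := fun h' => (he.trans h).ne (congrArg _ h')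
        simp [Pi.single_eq_of_ne h3]
    · rw [edgeMatrix_lastEdge, Pi.single_eq_of_ne h0]

/-- The matrix `A` without the terms `ρ` recovers the differences from the jumps: `A⁻¹ * B` maps
`jumps g` to `diff g`. So the weighted matrix is `1 + P * A⁻¹ * B` times the unweighted one, and the
determinant of this factor is that of `A + B * P`, as `A` has determinant one. -/
theorem det_squareMatrix_eq (i : Fin k) (w : Fin D.numCrossings → Quadrant → R)
    (ρ : Fin D.numCrossings → R) (z : Fin D.numCrossings → D.Edge)
    (h : ∀ (g : D.Region → R) (c), ∑ q, w c q * g (D.corner c q) =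
      D.jumps g (.inl c) + ρ c * D.diff g (z c)) :
    (D.squareMatrix i w).det = (D.edgeMatrix ρ z).det * (D.squareMatrix i fun _ => quadSign).det := by
  classical
  let A : Matrix D.Edge D.Edge R := D.edgeMatrix 0 z
  let B : Matrix D.Edge D.Row R := Matrix.of fun e => Sum.elim
    (fun p => D.jumpSign (R := R) p • (Pi.single (Sum.inl p.1) 1 : D.Row → R))
    (fun j => (Pi.single (Sum.inr j) 1 : D.Row → R)) (D.edgeEquiv.symm e)
  let P : Matrix D.Row D.Edge R := Matrix.of (Sum.elim (fun c => ρ c • Pi.single (z c) 1) 0)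
  have hA : A.det = 1 := D.det_edgeMatrix_of_lt 0 z fun p => Or.inl rfl
  have hE : D.edgeMatrix ρ z = A + B * P := by
    ext e e'
    rw [Matrix.add_apply, mul_apply]
    rcases D.edge_cases e with ⟨p, rfl⟩ | ⟨j, rfl⟩
    · rw [edgeMatrix_inEdge]
      simp only [A, edgeMatrix_inEdge]
      have : ∀ a, B (D.inEdge p) a = D.jumpSign p * (if a = .inl p.1 then 1 else 0) := by
        intro a; simp [B, Pi.single_apply]
      simp only [this, mul_ite, mul_one, mul_zero, ite_mul, zero_mul, Finset.sum_ite_eq',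
        Finset.mem_univ, if_true]
      simp [P, mul_assoc]
    · rw [edgeMatrix_lastEdge]
      simp only [A, edgeMatrix_lastEdge]
      have : ∀ a, B (D.lastEdge j) a = (if a = .inr j then 1 else 0) := by
        intro a; simp [B, Pi.single_apply]
      simp only [this, ite_mul, one_mul, zero_mul, Finset.sum_ite_eq', Finset.mem_univ, if_true]
      simp [P]
  have hd : ∀ g : D.Region → R, A⁻¹ *ᵥ (B *ᵥ D.jumps g) = D.diff g := by
    intro g
    have h1 : B *ᵥ D.jumps g = A *ᵥ D.diff g := by
      ext e
      rcases D.edge_cases e with ⟨p, rfl⟩ | ⟨j, rfl⟩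
      · have h1 : B (D.inEdge p) = D.jumpSign (R := R) p • (Pi.single (Sum.inl p.1) 1 : D.Row → R) := by
          ext a; simp [B]
        rw [mulVec, mulVec, h1, smul_dotProduct, single_dotProduct, one_mul]
        simp only [A, edgeMatrix_inEdge]
        simp only [Pi.zero_apply, mul_zero, zero_smul, add_zero, sub_dotProduct, single_dotProduct,
          one_mul]
        exact (D.diff_in_sub_out g p).symm
      · have h1 : B (D.lastEdge j) = (Pi.single (Sum.inr j) 1 : D.Row → R) := by
          ext a; simp [B]
        rw [mulVec, mulVec, h1, single_dotProduct, one_mul]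
        simp only [A, edgeMatrix_lastEdge]
        rw [single_dotProduct, one_mul]
        rfl
    rw [h1, mulVec_mulVec, nonsing_inv_mul _ (by rw [hA]; exact isUnit_one), one_mulVec]
  rw [hE, det_add_mul _ _ (by rw [hA]; exact isUnit_one), hA, one_mul, ← det_mul]
  congr 1
  apply D.squareMatrix_eq_mul i w
  · intro g c
    rw [add_mulVec, one_mulVec, Matrix.mul_assoc, ← mulVec_mulVec, ← mulVec_mulVec, hd, h]
    simp only [Pi.add_apply, mulVec, P, of_apply, Sum.elim_inl, smul_dotProduct, single_dotProduct,
      one_mul, smul_eq_mul]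
  · intro g j
    rw [add_mulVec, one_mulVec, Matrix.mul_assoc, ← mulVec_mulVec, ← mulVec_mulVec, hd]
    have : (P *ᵥ D.diff g) (.inr j) = 0 := zero_dotProduct _
    rw [Pi.add_apply, this, add_zero]
    rfl

end Edge

/-! ### Value and derivative of the state sum at one -/

open Matrix

/-- The passage of a crossing that comes later in the order of the edges. -/
noncomputable def later (c : Fin D.numCrossings) : Fin D.numCrossings × Bool :=
  if D.edgeOrder (D.inEdge (c, true)) < D.edgeOrder (D.inEdge (c, false)) then (c, false)
  else (c, true)

/-- The passage of a crossing that comes earlier in the order of the edges. -/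
noncomputable def earlier (c : Fin D.numCrossings) : Fin D.numCrossings × Bool :=
  (c, !(D.later c).2)

@[simp] theorem earlier_fst (c) : (D.earlier c).1 = c := rfl

theorem eq_later_or_earlier (p : Fin D.numCrossings × Bool) :
    p = D.later p.1 ∨ p = D.earlier p.1 := by
  obtain ⟨c, b⟩ := p
  unfold earlier later
  split_ifs <;> cases b <;> simp

theorem earlier_lt_later (c) :
    D.edgeOrder (D.inEdge (D.earlier c)) < D.edgeOrder (D.inEdge (D.later c)) := by
  unfold earlier later
  split_ifs with h
  · exact h
  · refine lt_of_le_of_ne (not_lt.mp h) fun h' => ?_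
    have := D.inEdge_injective (D.edgeOrder_injective h')
    simp at this

theorem later_cases (c) : (D.later c = D.rising c ∧ D.earlier c = D.falling c) ∨
    (D.later c = D.falling c ∧ D.earlier c = D.rising c) := by
  unfold earlier later GaussData.rising GaussData.falling
  split_ifs <;> cases D.positive c <;> simp

/-- The signed number of the states is one. -/
theorem stateSum_one (i : Fin k) : D.stateSum (fun _ _ => (1 : ℤ)) = 1 := by
  obtain ⟨ε, hε⟩ := D.exists_det_eq_stateSum i
  -- Each crossing keeps two quadrants, those on the two sides of the incoming edge of the later
  -- passage up to the sign of their difference. The row is the jump corrected by the difference on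
  -- the outgoing edge of this passage, so the system over the edges is triangular and the state sum
  -- is unchanged.
  let w : Fin D.numCrossings → Quadrant → ℤ := fun c q =>
    if q = .behind then 1 else if q = .ahead then 0 else
    if D.later c = D.rising c then (if q = .left then 1 else 0)
    else (if q = .right then 1 else 0)
  have h1 := hε (fun _ _ => (1 : ℤ))
  have h2 := hε w
  have h3 := D.det_squareMatrix_eq i (fun c q => quadSign q * w c q)
    (fun c => D.jumpSign (D.later c)) (fun c => D.outEdge (D.later c)) (by
      intro g c
      rw [Quadrant.sum_univ]
      rcases D.later_cases c with ⟨h, -⟩ | ⟨h, -⟩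
      · simp only [w, h, jumpSign_rising, jumps, Sum.elim_inl, diff_ri, diff_ro, quadSign]
        simp; ring
      · simp only [w, h, jumpSign_falling, jumps, Sum.elim_inl, diff_ri, diff_ro, diff_fo, quadSign,
          (D.rising_ne_falling c).symm]
        simp; ring)
  rw [D.det_edgeMatrix_of_lt _ _ (fun p => Or.inr ?_), one_mul] at h3
  · simp only [mul_one] at h1
    rw [h2, h1] at h3
    have hε0 : (ε : ℤ) ≠ 0 := ε.ne_zero
    have h4 : D.stateSum w = D.stateSum fun _ _ => 1 := by
      simpa [hε0] using h3
    -- States using a quadrant `ahead` have weight zero, and all others count with sign `+`. Being a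
    -- unit of `ℤ`, the sum must be one.
    have h5 : 0 ≤ D.stateSum w := by
      refine Finset.sum_nonneg fun x _ => ?_
      by_cases hx : ∃ c, x.1.quad c = .ahead
      · obtain ⟨c, hc⟩ := hx
        rw [Finset.prod_eq_zero (Finset.mem_univ c), mul_zero]
        simp [w, hc]
      · push Not at hx
        have : (D.grading x).negOnePow = 1 := by
          rw [negOnePow_grading]
          exact Finset.prod_eq_one fun c _ => if_neg (hx c)
        rw [this]
        refine mul_nonneg (by simp) (Finset.prod_nonneg fun c _ => ?_)
        simp only [w]
        split_ifs <;> simp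
    have h6 := D.flat_det_isUnit (R := ℤ) i
    rw [h1, ← h4] at h6
    have h7 := isUnit_of_mul_isUnit_right h6
    rw [← h4]
    rcases Int.isUnit_iff.mp h7 with h | h
    · exact h
    · omega
  · refine lt_of_le_of_lt ?_ (D.edgeOrder_in_lt_out _)
    rcases D.eq_later_or_earlier p with h | h
    · rw [← h]
    · rw [h]; exact (D.earlier_lt_later _).le

theorem extendZero_eq {R : Type*} [CommRing R] {g : D.Region → R} (h : D.VanishesLeft g) :
    D.extendZero (fun S => g S.1) = g := by
  funext S
  unfold extendZero
  split_ifs with hS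
  · exact (h S hS).symm
  · rfl

section Unit

variable {R : Type*} [CommRing R] {g : D.Region → R} {c : Fin D.numCrossings}
  (hg : D.jumps g = Pi.single (.inl c) 1)
include hg

theorem diff_in_eq_out {p} (hp : p.1 ≠ c) : D.diff g (D.inEdge p) = D.diff g (D.outEdge p) := by
  have := D.diff_in_sub_out g p
  rw [hg, Pi.single_eq_of_ne (by simpa using hp), mul_zero] at this
  exact sub_eq_zero.mp this

theorem diff_lastEdge (j) : D.diff g (D.lastEdge j) = 0 := by
  have : D.jumps g (.inr j) = 0 := by rw [hg]; simp
  exact this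

/-- Going up from the bottom, where `diff g` is zero, it first changes at a passage of `c`. -/
theorem diff_eq_zero_of_after (e : D.Edge) (he : ∀ p : Fin D.numCrossings × Bool, p.1 = c →
    (D.inEdge p).1 = e.1 → ((D.inEdge p).2 : ℕ) < e.2) : D.diff g e = 0 := by
  revert he
  apply D.edge_induction_up (motive := fun e => (∀ p : Fin D.numCrossings × Bool, p.1 = c →
    (D.inEdge p).1 = e.1 → ((D.inEdge p).2 : ℕ) < e.2) → D.diff g e = 0)
  · intro j _; exact D.diff_lastEdge hg j
  · intro p ih he
    have hp : p.1 ≠ c := fun hp => (he p hp rfl).false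
    rw [D.diff_in_eq_out hg hp]
    refine ih fun p' h1 h2 => (he p' h1 h2).trans ?_
    simp [GaussData.inEdge, GaussData.outEdge]

theorem diff_out_later : D.diff g (D.outEdge (D.later c)) = 0 := by
  apply D.diff_eq_zero_of_after hg
  rintro p rfl h
  have h0 : ((D.inEdge (D.later p.1)).2 : ℕ) < (D.outEdge (D.later p.1)).2 := by
    simp [GaussData.inEdge, GaussData.outEdge]
  rcases D.eq_later_or_earlier p with h1 | h1
  · rw [← h1] at h0 ⊢; exact h0
  · rw [h1]
    simp only [earlier_fst]
    refine lt_trans ?_ h0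
    rcases (D.edgeOrder_lt_iff).mp (D.earlier_lt_later p.1) with h2 | h2
    · rw [← h1] at h2; exact absurd h h2.ne
    · exact h2.2

theorem diff_out_earlier (hs : D.strand (D.earlier c) ≠ D.strand (D.later c)) :
    D.diff g (D.outEdge (D.earlier c)) = 0 := by
  apply D.diff_eq_zero_of_after hg
  rintro p rfl h
  rcases D.eq_later_or_earlier p with h1 | h1
  · have h' : D.strand (D.earlier p.1) = D.strand p := h.symm
    rw [h', ← h1] at hs
    exact absurd rfl hs
  · rw [← h1]
    simp [GaussData.inEdge, GaussData.outEdge]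

theorem diff_out_earlier' (hs : D.strand (D.earlier c) = D.strand (D.later c)) :
    D.diff g (D.outEdge (D.earlier c)) = D.diff g (D.inEdge (D.later c)) := by
  have hlt : ((D.inEdge (D.earlier c)).2 : ℕ) < (D.inEdge (D.later c)).2 := by
    rcases (D.edgeOrder_lt_iff).mp (D.earlier_lt_later c) with h | h
    · exact absurd hs h.ne
    · exact h.2
  have hout : ∀ p, ((D.outEdge p).2 : ℕ) = (D.inEdge p).2 + 1 := fun p => by
    simp [GaussData.inEdge, GaussData.outEdge]
  have key : ∀ e : D.Edge, e.1 = (D.inEdge (D.later c)).1 →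
      ((D.inEdge (D.earlier c)).2 : ℕ) < e.2 → (e.2 : ℕ) ≤ (D.inEdge (D.later c)).2 →
      D.diff g e = D.diff g (D.inEdge (D.later c)) := by
    intro e
    apply D.edge_induction_up (motive := fun e => e.1 = (D.inEdge (D.later c)).1 →
      ((D.inEdge (D.earlier c)).2 : ℕ) < e.2 → (e.2 : ℕ) ≤ (D.inEdge (D.later c)).2 →
      D.diff g e = D.diff g (D.inEdge (D.later c)))
    · rintro j rfl - h
      have h1 : ((D.inEdge (D.later c)).2 : ℕ) < D.len (D.inEdge (D.later c)).1 := by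
        simp [GaussData.inEdge]
      have h2 : ((D.lastEdge (D.inEdge (D.later c)).1).2 : ℕ) = D.len (D.inEdge (D.later c)).1 := rfl
      omega
    · intro p ih h1 h2 h3
      by_cases hl : p = D.later c
      · rw [hl]
      have hp : p.1 ≠ c := by
        rintro rfl
        rcases D.eq_later_or_earlier p with h4 | h4
        · exact hl h4
        · rw [← h4] at h2; exact h2.false
      rw [D.diff_in_eq_out hg hp]
      have h4 := hout p
      refine ih h1 (by omega) ?_
      have h5 : ((D.inEdge p).2 : ℕ) ≠ (D.inEdge (D.later c)).2 := by
        intro h5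
        apply hl
        apply D.inEdge_injective
        apply D.edgeOrder_injective
        exact congrArg toLex (Prod.ext h1 h5)
      omega
  apply key _ hs
  · rw [hout]; omega
  · rw [hout]; omega

end Unit

/-- If the crossing belongs to two strands, `diff g` vanishes on both outgoing edges, so `g` agrees
on `ahead`, `left` and `right`; equal weights then meet opposite signs. If it belongs to one strand,
`diff g` is constant between its two passages, so `g` agrees on `ahead` and `behind`, whose weights
are opposite or both zero. -/
theorem sum_weight_eq_zero (i : Fin k) {g : D.Region → ℚ} {c : Fin D.numCrossings}
    (hg : D.jumps g = Pi.single (.inl c) 1) :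
    ∑ q, quadSign q * D.weight i c q * g (D.corner c q) = 0 := by
  have h1 := D.diff_out_later hg
  have h2 := D.diff_out_earlier hg
  have h3 := D.diff_out_earlier' hg
  have h4 : D.jumps g (.inl c) = 1 := by rw [hg]; simp
  simp only [jumps, Sum.elim_inl] at h4
  have h5 := D.diff_kirchhoff g c
  rw [Quadrant.sum_univ]
  simp only [weight, quadSign]
  have hs : D.strand (D.earlier c) = D.strand (D.later c) ↔
      D.strand (c, true) = D.strand (c, false) := by
    unfold earlier later
    split_ifs
    · exact Iff.rfl
    · exact eq_comm
  rw [hs] at h3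
  rw [ne_eq, hs] at h2
  have key : (D.strand (c, true) = D.strand (c, false) → g (D.corner c .ahead) =
      g (D.corner c .behind)) ∧ (D.strand (c, true) ≠ D.strand (c, false) →
      g (D.corner c .ahead) = g (D.corner c .left) ∧
      g (D.corner c .ahead) = g (D.corner c .right)) := by
    rcases D.later_cases c with ⟨e1, e2⟩ | ⟨e1, e2⟩ <;> rw [e1] at h1 h3 <;> rw [e2] at h2 h3 <;>
      rw [diff_ri, diff_ro] at h4 <;> simp only [diff_ri, diff_ro, diff_fi, diff_fo] at h1 h2 h3 <;>
      constructor
    · intro h; have := h3 h; linarith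
    · intro h; have := h2 h; constructor <;> linarith
    · intro h; have := h3 h; linarith
    · intro h; have := h2 h; constructor <;> linarith
  by_cases ht : D.strand (c, true) = i <;> by_cases hf : D.strand (c, false) = i
  · have := key.1 (ht.trans hf.symm)
    simp only [ht, hf, if_true]
    cases D.positive c <;> simp [selfWeight] <;> linarith
  · have := key.2 (fun h => hf (h.symm.trans ht))
    simp only [ht, hf, if_true, if_false]
    cases D.positive c <;> simp [overWeight] <;> linarith
  · have := key.2 (fun h => ht (h.trans hf))
    simp only [ht, hf, if_true, if_false]
    cases D.positive c <;> simp [underWeight] <;> linarith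
  · simp [ht, hf]

/-- The derivative of the state sum at one vanishes. -/
theorem sum_filtration_eq_zero (i : Fin k) :
    ∑ x : D.State, (((D.grading x).negOnePow : ℤ) : ℚ) * D.filtration i x = 0 := by
  classical
  obtain ⟨ε, hε⟩ := D.exists_det_eq_stateSum i
  simp only [filtration, Finset.mul_sum]
  rw [Finset.sum_comm]
  refine Finset.sum_eq_zero fun c _ => ?_
  -- The product rule: only the weights at the one crossing `c` are differentiated. The function on
  -- the regions that jumps only at `c` lies in the kernel of the resulting matrix.
  let w : Fin D.numCrossings → Quadrant → ℚ := fun c' q => if c' = c then D.weight i c q else 1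
  have h1 : D.stateSum w =
      ∑ x : D.State, (((D.grading x).negOnePow : ℤ) : ℚ) * D.weight i c (x.1.quad c) := by
    refine Finset.sum_congr rfl fun x _ => ?_
    simp [w]
  rw [← h1]
  have hε0 : ((ε : ℤ) : ℚ) ≠ 0 := by exact_mod_cast ε.ne_zero
  have h2 := hε w
  have h3 : (D.squareMatrix i fun c q => quadSign q * w c q).det = 0 := by
    rw [← exists_mulVec_eq_zero_iff]
    obtain ⟨g, h0, hg⟩ := D.exists_of_jumps (R := ℚ) i (Pi.single (.inl c) 1)
    refine ⟨fun a => g ((D.regionEquiv i).symm a).1, ?_, ?_⟩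
    · intro h
      have h4 : g = 0 := by
        rw [← D.extendZero_eq h0]
        funext S
        unfold extendZero
        split_ifs with hS
        · rfl
        · have := congrFun h (D.regionEquiv i ⟨S, hS⟩)
          simpa using this
      have h5 := congrFun hg (.inl c)
      rw [h4] at h5
      simp [jumps, diff] at h5
    · rw [squareMatrix_mulVec]
      have h4 : ((fun a => g ((D.regionEquiv i).symm a).1) ∘ D.regionEquiv i) =
          fun S : D.InnerRegion => g S.1 := by
        funext S; simp
      rw [h4]
      ext a
      cases a with
      | inl c' =>
        rw [stateMatrix_mulVec_inl, D.extendZero_eq h0]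
        by_cases hc : c' = c
        · subst hc
          simpa [w] using D.sum_weight_eq_zero i hg
        · have h5 : D.jumps g (.inl c') = 0 := by
            rw [hg, Pi.single_eq_of_ne (by simpa using hc)]
          rw [← D.extendZero_eq h0, ← flat_mulVec, stateMatrix_mulVec_inl, D.extendZero_eq h0] at h5
          simpa [w, hc] using h5
      | inr j =>
        rw [stateMatrix_mulVec_inr, D.extendZero_eq h0]
        exact D.diff_lastEdge hg j
  rw [h3] at h2
  exact (mul_eq_zero.mp h2.symm).resolve_left hε0

end Diagram
end StringLink

/-! ### Laurent polynomials with rational exponents and their units -/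

namespace StringLink

section GroupRing

/-- If one of `u` and its inverse had more than one term, two different products of terms in `u * v`
could not cancel, but `1` has a single term. -/
theorem exists_eq_single_of_isUnit {G : Type*} [AddMonoid G] [TwoUniqueSums G]
    {u : AddMonoidAlgebra ℤ G} (hu : IsUnit u) : ∃ (g : G) (ε : ℤˣ), u = .single g (ε : ℤ) := by
  classical
  obtain ⟨v, huv⟩ := hu.exists_right_inv
  have hne : ∀ p : G × G, p ∈ u.coeff.support ×ˢ v.coeff.support →
      UniqueAdd u.coeff.support v.coeff.support p.1 p.2 → p.1 + p.2 = 0 := by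
    intro p hp h
    rw [Finset.mem_product, Finsupp.mem_support_iff, Finsupp.mem_support_iff] at hp
    by_contra h0
    have h1 := AddMonoidAlgebra.coeff_mul_add_of_uniqueAdd h
    rw [huv, AddMonoidAlgebra.one_def, AddMonoidAlgebra.coeff_single,
      Finsupp.single_eq_of_ne h0] at h1
    exact mul_ne_zero hp.1 hp.2 h1.symm
  have hcard : u.coeff.support.card * v.coeff.support.card ≤ 1 := by
    by_contra h
    obtain ⟨p, hp, q, hq, hpq, h1, h2⟩ := TwoUniqueSums.uniqueAdd_of_one_lt_card (not_le.mp h)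
    apply hpq
    have h3 := hne p hp h1
    have h4 := hne q hq h2
    rw [Finset.mem_product] at hq
    have h5 := h1 hq.1 hq.2 (h4.trans h3.symm)
    exact Prod.ext h5.1.symm h5.2.symm
  have h01 : (1 : AddMonoidAlgebra ℤ G) ≠ 0 := one_ne_zero
  have hu0 : u.coeff.support.Nonempty := by
    rw [Finsupp.support_nonempty_iff, ne_eq, AddMonoidAlgebra.coeff_eq_zero]
    rintro rfl
    exact h01 (by rw [← huv, zero_mul])
  have hv0 : v.coeff.support.Nonempty := by
    rw [Finsupp.support_nonempty_iff, ne_eq, AddMonoidAlgebra.coeff_eq_zero]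
    rintro rfl
    exact h01 (by rw [← huv, mul_zero])
  have hu1 : u.coeff.support.card = 1 := by
    have := hu0.card_pos
    have := hv0.card_pos
    nlinarith
  have hv1 : v.coeff.support.card = 1 := by
    have := hu0.card_pos
    have := hv0.card_pos
    nlinarith
  rw [Finsupp.card_support_eq_one'] at hu1 hv1
  obtain ⟨g, n, hn, hgn⟩ := hu1
  obtain ⟨g', n', hn', hgn'⟩ := hv1
  have e1 : u = .single g n := AddMonoidAlgebra.coeff_injective hgn
  have e2 : v = .single g' n' := AddMonoidAlgebra.coeff_injective hgn'
  rw [e1, e2, AddMonoidAlgebra.single_mul_single, AddMonoidAlgebra.one_def] at huv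
  have h6 := congrArg AddMonoidAlgebra.coeff huv
  rw [AddMonoidAlgebra.coeff_single, AddMonoidAlgebra.coeff_single, Finsupp.single_eq_single_iff]
    at h6
  have h7 : n * n' = 1 := by
    rcases h6 with h6 | h6
    · exact h6.2
    · exact absurd h6.2 one_ne_zero
  exact ⟨g, Units.mkOfMulEqOne n n' h7, e1⟩

/-- Powers of the variable with rational exponents. -/
noncomputable def tpow (q : ℚ) : (AddMonoidAlgebra ℤ ℚ)ˣ where
  val := .single q 1
  inv := .single (-q) 1
  val_inv := by rw [AddMonoidAlgebra.single_mul_single, AddMonoidAlgebra.one_def]; simp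
  inv_val := by rw [AddMonoidAlgebra.single_mul_single, AddMonoidAlgebra.one_def]; simp

theorem tpow_val (q : ℚ) : (tpow q : AddMonoidAlgebra ℤ ℚ) = .single q 1 := rfl

theorem tpow_add (p q : ℚ) : tpow (p + q) = tpow p * tpow q := by
  ext1
  rw [Units.val_mul, tpow_val, tpow_val, tpow_val, AddMonoidAlgebra.single_mul_single, one_mul]

theorem tpow_zero : tpow 0 = 1 := Units.ext AddMonoidAlgebra.one_def.symm

theorem single_eq_mul_tpow (q : ℚ) (n : ℤ) :
    AddMonoidAlgebra.single q n = (n : AddMonoidAlgebra ℤ ℚ) * tpow q := by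
  have : (n : AddMonoidAlgebra ℤ ℚ) = .single 0 n := by
    rw [← zsmul_one, AddMonoidAlgebra.one_def, AddMonoidAlgebra.smul_single]; simp
  rw [this, tpow_val, AddMonoidAlgebra.single_mul_single, zero_add, mul_one]

theorem isUnit_iff_tpow {u : AddMonoidAlgebra ℤ ℚ} (hu : IsUnit u) :
    ∃ (q : ℚ) (ε : ℤˣ), u = ((ε : ℤ) : AddMonoidAlgebra ℤ ℚ) * tpow q := by
  obtain ⟨q, ε, rfl⟩ := exists_eq_single_of_isUnit hu
  exact ⟨q, ε, single_eq_mul_tpow q _⟩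

/-- The first order Taylor polynomial at one. -/
noncomputable def taylor : AddMonoidAlgebra ℤ ℚ →ₐ[ℤ] DualNumber ℚ :=
  AddMonoidAlgebra.lift ℤ (DualNumber ℚ) ℚ
    { toFun := fun q => 1 + TrivSqZeroExt.inr q.toAdd
      map_one' := by simp
      map_mul' := fun p q => by
        ext <;> simp [add_comm] }

theorem taylor_tpow (q : ℚ) : taylor (tpow q) = 1 + TrivSqZeroExt.inr q := by
  rw [tpow_val, taylor, AddMonoidAlgebra.lift_single, one_smul]
  rfl

/-- The unit is `±t^q`, with first order Taylor polynomial `±(1 + q ε)`. The value at one fixes the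
sign and the derivative fixes `q = 0`. -/
theorem eq_of_associated {f g : AddMonoidAlgebra ℤ ℚ} (h : Associated f g) (hf : taylor f = 1)
    (hg : taylor g = 1) : f = g := by
  obtain ⟨u, rfl⟩ := h
  obtain ⟨q, ε, hu⟩ := isUnit_iff_tpow u.isUnit
  rw [map_mul, hf, one_mul, hu, map_mul, taylor_tpow, map_intCast] at hg
  have h1 := congrArg TrivSqZeroExt.fst hg
  have h2 := congrArg TrivSqZeroExt.snd hg
  simp at h1 h2
  have hε : (ε : ℤ) = 1 := by
    have : ε = 1 := by exact_mod_cast h1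
    rw [this]; rfl
  have hq : q = 0 := h2
  rw [hu, hε, hq, tpow_zero]
  simp

/-- Inversion of the variable. -/
noncomputable def invertRat : AddMonoidAlgebra ℤ ℚ →+* AddMonoidAlgebra ℤ ℚ :=
  AddMonoidAlgebra.mapDomainRingHom ℤ (negAddMonoidHom : ℚ →+ ℚ)

theorem invertRat_tpow (q : ℚ) : invertRat (tpow q) = tpow (-q) := by
  simp [invertRat, tpow_val]

theorem taylor_snd_invertRat (f : AddMonoidAlgebra ℤ ℚ) :
    (taylor (invertRat f)).snd = -(taylor f).snd ∧ (taylor (invertRat f)).fst = (taylor f).fst := by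
  induction f using AddMonoidAlgebra.induction_linear with
  | zero => simp
  | add f g hf hg =>
    simp only [map_add, TrivSqZeroExt.snd_add, TrivSqZeroExt.fst_add, hf, hg]
    constructor
    · ring
    · trivial
  | single q n =>
    rw [single_eq_mul_tpow, map_mul, map_mul, map_mul, invertRat_tpow, taylor_tpow, taylor_tpow,
      map_intCast, map_intCast]
    simp

namespace Diagram

theorem ofLaurent_T (n : ℤ) : ofLaurent (LaurentPolynomial.T n) = tpow n := by
  exact AddMonoidAlgebra.mapDomain_single

theorem ofLaurent_injective : Function.Injective ofLaurent := by
  have : Function.Injective (Int.castAddHom ℚ) := Int.cast_injective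
  exact AddMonoidAlgebra.mapDomain_injective this

theorem ofLaurent_invert (f : ℤ[T;T⁻¹]) :
    ofLaurent (LaurentPolynomial.invert f) = invertRat (ofLaurent f) := by
  induction f using LaurentPolynomial.induction_on' with
  | add f g hf hg => simp only [map_add, hf, hg]
  | C_mul_T n a =>
    rw [map_mul, map_mul, map_mul, map_mul, LaurentPolynomial.invert_T, LaurentPolynomial.invert_C,
      ofLaurent_T, ofLaurent_T, invertRat_tpow]
    congr 1
    simp

theorem taylor_fst_ofLaurent (f : ℤ[T;T⁻¹]) : (taylor (ofLaurent f)).fst =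
    ((LaurentPolynomial.eval₂ (RingHom.id ℤ) 1 f : ℤ) : ℚ) := by
  induction f using LaurentPolynomial.induction_on' with
  | add f g hf hg => simp only [map_add, TrivSqZeroExt.fst_add, hf, hg, Int.cast_add]
  | C_mul_T n a =>
    rw [map_mul, map_mul, map_mul, ofLaurent_T, taylor_tpow, LaurentPolynomial.eval₂_T,
      LaurentPolynomial.eval₂_C]
    simp

/-- Inverting the variable changes the sign of the derivative at one, so symmetry makes it zero. -/
theorem taylor_ofLaurent_eq_one {f : ℤ[T;T⁻¹]} (h1 : LaurentPolynomial.invert f = f)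
    (h2 : LaurentPolynomial.eval₂ (RingHom.id ℤ) 1 f = 1) : taylor (ofLaurent f) = 1 := by
  have h3 := (taylor_snd_invertRat (ofLaurent f)).1
  rw [← ofLaurent_invert, h1] at h3
  ext
  · rw [taylor_fst_ofLaurent, h2]; simp
  · rw [TrivSqZeroExt.snd_one]; linarith

end Diagram

end GroupRing
end StringLink

/-! ### The state sum of one strand, change of weights and integrality -/

namespace StringLink
namespace Diagram

variable {k : ℕ} (D : Diagram k) (i : Fin k)

open Matrix

/-- The state sum for strand `i` as a Laurent polynomial. -/
noncomputable def strandSum : AddMonoidAlgebra ℤ ℚ :=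
  D.stateSum fun c q => (tpow (D.weight i c q)).val

theorem prod_tpow {ι : Type*} (s : Finset ι) (f : ι → ℚ) :
    ∏ a ∈ s, ((tpow (f a) : (AddMonoidAlgebra ℤ ℚ)ˣ) : AddMonoidAlgebra ℤ ℚ) =
      tpow (∑ a ∈ s, f a) := by
  classical
  induction s using Finset.induction_on with
  | empty => simp [tpow_zero]
  | insert a s ha ih => rw [Finset.prod_insert ha, Finset.sum_insert ha, tpow_add, ih]; simp

theorem strandSum_eq : D.strandSum i = ∑ x : D.State,
    (((D.grading x).negOnePow : ℤ) : AddMonoidAlgebra ℤ ℚ) * tpow (D.filtration i x) := by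
  refine Finset.sum_congr rfl fun x _ => ?_
  rw [prod_tpow]
  rfl

theorem specialize_nabla : specialize i D.nabla = D.strandSum i := by
  rw [nabla, map_sum, strandSum_eq]
  refine Finset.sum_congr rfl fun x _ => ?_
  rw [← single_eq_mul_tpow]
  exact AddMonoidAlgebra.mapDomain_single

theorem invertRat_strandSum :
    invertRat (D.strandSum i) = D.stateSum fun c q => (tpow (-D.weight i c q)).val := by
  rw [strandSum, map_stateSum]
  simp only [invertRat_tpow]

/-- The value at one is the signed number of states, and the derivative is the signed sum of the
filtration indices. -/
theorem taylor_strandSum : taylor (D.strandSum i) = 1 := by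
  have h1 := D.stateSum_one i
  have h2 := D.sum_filtration_eq_zero i
  simp only [stateSum, Finset.prod_const_one, mul_one] at h1
  rw [strandSum_eq, map_sum]
  simp only [map_mul, map_intCast, taylor_tpow, mul_add, mul_one, Finset.sum_add_distrib]
  have h3 : ∑ x : D.State, (((D.grading x).negOnePow : ℤ) : DualNumber ℚ) = 1 := by
    exact_mod_cast congrArg (Int.cast : ℤ → DualNumber ℚ) h1
  rw [h3]
  have h4 : ∑ x : D.State, (((D.grading x).negOnePow : ℤ) : DualNumber ℚ) *
      TrivSqZeroExt.inr (D.filtration i x) = TrivSqZeroExt.inr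
      (∑ x : D.State, (((D.grading x).negOnePow : ℤ) : ℚ) * D.filtration i x) := by
    rw [← TrivSqZeroExt.inrHom_apply (R := ℚ), map_sum]
    refine Finset.sum_congr rfl fun x _ => ?_
    ext
    · simp
    · simp [mul_comm]
  rw [h4, h2]
  simp

/-- A numbering of the regions that decreases by one from left to right across strand `i`. -/
theorem exists_numbering (R : Type*) [CommRing R] : ∃ b : D.Region → R, D.VanishesLeft b ∧
    ∀ e, D.diff b e = if e.1 = i then -1 else 0 := by
  obtain ⟨b, h0, hb⟩ := D.exists_of_jumps (R := R) i
    (Sum.elim (fun _ => 0) fun j => if j = i then -1 else 0)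
  refine ⟨b, h0, fun e => ?_⟩
  rw [D.diff_const (fun c => by rw [hb]; rfl)]
  exact congrFun hb (.inr e.1)

/-- The sign of a crossing. -/
def crossingSign (c : Fin D.numCrossings) : ℤ := if D.positive c then 1 else -1

/-- The exponent of the factor at crossings that strand `i` crosses at level `l`. -/
noncomputable def passExponent (l : Bool) (c : Fin D.numCrossings) : ℤ :=
  if D.strand (c, l) = i then -D.crossingSign c else 0

/-- The quadrants next to the outgoing edge of the under strand. -/
def outUnder (positive : Bool) : Quadrant → Bool
  | .ahead => true
  | .behind => false
  | .left => positive
  | .right => !positive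

/-- The quadrants next to the incoming edge of the over strand. -/
def inOver (positive : Bool) : Quadrant → Bool
  | .ahead => false
  | .behind => true
  | .left => positive
  | .right => !positive

theorem numbering_corner {R : Type*} [CommRing R] {b : D.Region → R}
    (hb : ∀ e, D.diff b e = if e.1 = i then -1 else 0) (c) :
    b (D.corner c .ahead) = b (D.corner c .right) +
      (if D.strand (c, D.positive c) = i then 1 else 0) ∧
    b (D.corner c .behind) = b (D.corner c .right) +
      (if D.strand (c, !D.positive c) = i then 1 else 0) ∧
    b (D.corner c .left) = b (D.corner c .right) +
      (if D.strand (c, D.positive c) = i then 1 else 0) +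
      (if D.strand (c, !D.positive c) = i then 1 else 0) := by
  have h1 := hb (D.inEdge (D.rising c))
  have h2 := hb (D.outEdge (D.rising c))
  have h3 := hb (D.inEdge (D.falling c))
  rw [diff_ri] at h1
  rw [diff_ro] at h2
  rw [diff_fi] at h3
  change _ = if D.strand (c, D.positive c) = i then _ else _ at h1
  change _ = if D.strand (c, D.positive c) = i then _ else _ at h2
  change _ = if D.strand (c, !D.positive c) = i then _ else _ at h3
  split_ifs at h1 h2 h3 ⊢ <;> refine ⟨?_, ?_, ?_⟩ <;>
    first
    | linear_combination -h2
    | linear_combination -h3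
    | linear_combination -h3 - h1

/-- Up to half a numbering of the regions and a constant for each crossing, the weights are
concentrated on the two quadrants beside the outgoing under edge, and nonzero only if strand `i`
passes over. The constant is chosen to vanish on `behind`, which is not one of these quadrants. -/
theorem weight_lower {b : D.Region → ℚ} (hb : ∀ e, D.diff b e = if e.1 = i then -1 else 0) (c q) :
    -(D.weight i c .behind - b (D.corner c .behind) / 2) + -(b (D.corner c q) / 2) +
      D.weight i c q = if outUnder (D.positive c) q then (D.passExponent i true c : ℚ) else 0 := by
  obtain ⟨h1, h2, h3⟩ := D.numbering_corner i hb c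
  simp only [weight, passExponent, crossingSign]
  cases q <;> simp only [h1, h2, h3] <;>
  by_cases ht : D.strand (c, true) = i <;> by_cases hf : D.strand (c, false) = i <;>
  cases hp : D.positive c <;>
  simp [outUnder, selfWeight, overWeight, underWeight, ht, hf] <;> ring

/-- The counterpart for the inverted variable: the negated weights move to the quadrants beside the
incoming over edge, and matter only if strand `i` passes under. -/
theorem weight_upper {b : D.Region → ℚ} (hb : ∀ e, D.diff b e = if e.1 = i then -1 else 0) (c q) :
    (D.weight i c .ahead + b (D.corner c .ahead) / 2) + -(b (D.corner c q) / 2) +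
      -D.weight i c q = if inOver (D.positive c) q then (D.passExponent i false c : ℚ) else 0 := by
  obtain ⟨h1, h2, h3⟩ := D.numbering_corner i hb c
  simp only [weight, passExponent, crossingSign]
  cases q <;> simp only [h1, h2, h3] <;>
  by_cases ht : D.strand (c, true) = i <;> by_cases hf : D.strand (c, false) = i <;>
  cases hp : D.positive c <;>
  simp [inOver, selfWeight, overWeight, underWeight, ht, hf] <;> ring

theorem associated_det (i : Fin k) (w : Fin D.numCrossings → Quadrant → AddMonoidAlgebra ℤ ℚ)
    (ρ : Fin D.numCrossings → AddMonoidAlgebra ℤ ℚ) (z : Fin D.numCrossings → D.Edge)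
    (h : ∀ (g : D.Region → AddMonoidAlgebra ℤ ℚ) (c),
      ∑ q, quadSign q * w c q * g (D.corner c q) = D.jumps g (.inl c) + ρ c * D.diff g (z c)) :
    Associated (D.stateSum w) (D.edgeMatrix ρ z).det := by
  obtain ⟨ε, hε⟩ := D.exists_det_eq_stateSum i
  have h1 := D.det_squareMatrix_eq i _ ρ z h
  rw [hε w] at h1
  have h2 : IsUnit (((ε : ℤ) : AddMonoidAlgebra ℤ ℚ)) := ε.isUnit.map (Int.castRingHom _)
  have h3 := D.flat_det_isUnit (R := AddMonoidAlgebra ℤ ℚ) i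
  exact (associated_unit_mul_left (D.stateSum w) _ h2).symm.trans
    (h1 ▸ associated_mul_unit_left _ _ h3)

/-- After the change of weights, the two quadrants beside the outgoing under edge carry a common
factor `τ`. Compared with unit weights this alters the row by a multiple of the difference across
that edge, with coefficient `1 - τ` up to the sign of the passage. -/
theorem associated_lower : Associated (D.strandSum i)
    (D.edgeMatrix (fun c => D.jumpSign (c, false) * (1 - (tpow (D.passExponent i true c)).val))
      fun c => D.outEdge (c, false)).det := by
  obtain ⟨b, -, hb⟩ := D.exists_numbering i ℚ
  refine (D.stateSum_gauge _ (fun c q => if outUnder (D.positive c) q then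
      ((tpow (D.passExponent i true c) : (AddMonoidAlgebra ℤ ℚ)ˣ) : AddMonoidAlgebra ℤ ℚ) else 1)
    (fun c => tpow (-(D.weight i c .behind - b (D.corner c .behind) / 2)))
    (fun S => tpow (-(b S / 2))) ?_).trans (D.associated_det i _ _ _ ?_)
  · intro c q
    rw [← Units.val_mul, ← Units.val_mul, ← tpow_add, ← tpow_add, D.weight_lower i hb]
    split_ifs
    · rfl
    · rw [tpow_zero]; rfl
  · intro g c
    rw [Quadrant.sum_univ]
    cases hp : D.positive c
    · have h1 : (c, false) = D.rising c := by rw [GaussData.rising, hp]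
      rw [h1, jumpSign_rising, diff_ro]
      simp [outUnder, quadSign, jumps, diff_ri, diff_ro]; ring
    · have h1 : (c, false) = D.falling c := by rw [GaussData.falling, hp]; rfl
      rw [h1, jumpSign_falling, diff_fo]
      simp [outUnder, quadSign, jumps, diff_ri, diff_ro]; ring

theorem associated_upper : Associated (invertRat (D.strandSum i))
    (D.edgeMatrix (fun c => D.jumpSign (c, false) * (1 - (tpow (D.passExponent i false c)).val))
      fun c => D.inEdge (c, true)).det := by
  obtain ⟨b, -, hb⟩ := D.exists_numbering i ℚ
  rw [invertRat_strandSum]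
  refine (D.stateSum_gauge _ (fun c q => if inOver (D.positive c) q then
      ((tpow (D.passExponent i false c) : (AddMonoidAlgebra ℤ ℚ)ˣ) : AddMonoidAlgebra ℤ ℚ) else 1)
    (fun c => tpow (D.weight i c .ahead + b (D.corner c .ahead) / 2))
    (fun S => tpow (-(b S / 2))) ?_).trans (D.associated_det i _ _ _ ?_)
  · intro c q
    rw [← Units.val_mul, ← Units.val_mul, ← tpow_add, ← tpow_add, D.weight_upper i hb]
    split_ifs
    · rfl
    · rw [tpow_zero]; rfl
  · intro g c
    rw [Quadrant.sum_univ]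
    cases hp : D.positive c
    · have h1 : (c, false) = D.rising c := by rw [GaussData.rising, hp]
      have h2 : (c, true) = D.falling c := by rw [GaussData.falling, hp]; rfl
      rw [h1, h2, jumpSign_rising, diff_fi]
      simp [inOver, quadSign, jumps, diff_ri, diff_ro]; ring
    · have h1 : (c, false) = D.falling c := by rw [GaussData.falling, hp]; rfl
      have h2 : (c, true) = D.rising c := by rw [GaussData.rising, hp]
      rw [h1, h2, jumpSign_falling, diff_ri]
      simp [inOver, quadSign, jumps, diff_ri, diff_ro]; ring

/-- The filtration indices of all states are congruent modulo one, and half-integers. -/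
theorem exists_filtration_eq : ∃ N : ℤ, ∀ x : D.State, ∃ m : ℤ, 2 * D.filtration i x = N + 2 * m := by
  obtain ⟨b, -, hb⟩ := D.exists_numbering i ℤ
  have hb' : ∀ e, D.diff (fun S => (b S : ℚ)) e = if e.1 = i then -1 else 0 := by
    intro e
    have := congrArg (Int.cast : ℤ → ℚ) (hb e)
    simpa [diff, apply_ite (Int.cast : ℤ → ℚ)] using this
  have hw : ∀ c, ∃ n : ℤ, 2 * D.weight i c .behind = n := by
    intro c
    simp only [weight]
    split_ifs <;> cases D.positive c <;>
      first
      | (refine ⟨0, ?_⟩; norm_num [selfWeight, overWeight, underWeight]; done)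
      | (refine ⟨1, ?_⟩; norm_num [selfWeight]; done)
      | (refine ⟨-1, ?_⟩; norm_num [selfWeight])
  choose n hn using hw
  refine ⟨∑ c, (n c - b (D.corner c .behind)) + (∑ S : D.InnerRegion, b S -
    ∑ j, b (D.region (D.lastEdge j, .left))), fun x => ⟨∑ c,
    if outUnder (D.positive c) (x.1.quad c) then D.passExponent i true c else 0, ?_⟩⟩
  rw [← D.sum_marked x, ← Finset.sum_add_distrib, filtration, Finset.mul_sum]
  push_cast
  rw [Finset.mul_sum, ← Finset.sum_add_distrib]
  refine Finset.sum_congr rfl fun c _ => ?_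
  have := D.weight_lower i hb' c (x.1.quad c)
  have h2 := hn c
  rw [← this]
  linarith

/-- Twice the indices are integers of one parity `N`. As the signed number of states is one and the
signed sum of the indices is zero, `N` itself is an even integer. -/
theorem filtration_integer (x : D.State) : ∃ m : ℤ, D.filtration i x = m := by
  obtain ⟨N, hN⟩ := D.exists_filtration_eq i
  choose m hm using hN
  have h1 := D.stateSum_one i
  have h2 := D.sum_filtration_eq_zero i
  simp only [stateSum, Finset.prod_const_one, mul_one] at h1
  have h3 : ∑ x : D.State, ((D.grading x).negOnePow : ℤ) * (N + 2 * m x) = 0 := by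
    have : (((∑ x : D.State, ((D.grading x).negOnePow : ℤ) * (N + 2 * m x) : ℤ)) : ℚ) = 0 := by
      push_cast
      rw [show (0 : ℚ) = 2 * 0 by norm_num, ← h2, Finset.mul_sum]
      refine Finset.sum_congr rfl fun x _ => ?_
      rw [← hm]; ring
    exact_mod_cast this
  simp only [mul_add, Finset.sum_add_distrib, ← Finset.sum_mul] at h3
  simp only [Int.cast_id] at h1
  rw [h1, one_mul] at h3
  have h4 : N = 2 * -∑ x : D.State, ((D.grading x).negOnePow : ℤ) * m x := by
    rw [mul_neg, Finset.mul_sum, eq_neg_iff_add_eq_zero, ← h3]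
    congr 1
    exact Finset.sum_congr rfl fun x _ => by ring
  refine ⟨-(∑ x : D.State, ((D.grading x).negOnePow : ℤ) * m x) + m x, ?_⟩
  have h5 := hm x
  rw [h4] at h5
  push_cast at h5 ⊢
  linarith

end Diagram
end StringLink

/-! ### Relations along a strand and between arcs -/

namespace StringLink

section Relation

open Matrix

theorem det_eq_zero_of_row_sums {n R : Type*} [Fintype n] [DecidableEq n] [Nonempty n] [CommRing R]
    (M : Matrix n n R) (h : M *ᵥ (fun _ => 1) = 0) : M.det = 0 := by
  have h1 : (M.adjugate * M) *ᵥ (fun _ => (1 : R)) = 0 := by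
    rw [← mulVec_mulVec, h, mulVec_zero]
  rw [adjugate_mul, smul_mulVec, one_mulVec] at h1
  have h2 := congrFun h1 (Classical.arbitrary n)
  simpa using h2

variable {R : Type*} [CommRing R] {n : ℕ} (θ : Fin n → R) (o : Fin n → Fin (n + 1))

/-- The relation `a (m + 1) = (1 - θ m) a m + θ m a (o m)`. -/
def relRow (m : Fin n) : Fin (n + 1) → R :=
  Pi.single m.succ 1 - Pi.single m.castSucc 1 +
    θ m • (Pi.single m.castSucc 1 - Pi.single (o m) 1)

/-- The matrix of the relations, together with one more row. -/
def relMatrix (v : Fin (n + 1) → R) : Matrix (Fin (n + 1)) (Fin (n + 1)) R :=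
  Matrix.of (Fin.snoc (α := fun _ => Fin (n + 1) → R) (relRow θ o) v)

theorem relMatrix_castSucc (v : Fin (n + 1) → R) (m) :
    relMatrix θ o v m.castSucc = relRow θ o m :=
  Fin.snoc_castSucc (α := fun _ => Fin (n + 1) → R) _ _ _

theorem relMatrix_last (v : Fin (n + 1) → R) : relMatrix θ o v (Fin.last n) = v :=
  Fin.snoc_last (α := fun _ => Fin (n + 1) → R) _ _

theorem relMatrix_eq_updateRow (v v' : Fin (n + 1) → R) :
    relMatrix θ o v = (relMatrix θ o v').updateRow (Fin.last n) v := by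
  ext e e'
  induction e using Fin.lastCases with
  | last => rw [updateRow_self, relMatrix_last]
  | cast m =>
    rw [updateRow_ne (Fin.castSucc_lt_last m).ne, relMatrix_castSucc, relMatrix_castSucc]

/-- The determinant only depends on the sum of the entries of the additional row. -/
theorem det_relMatrix_congr (v v' : Fin (n + 1) → R) (h : ∑ e, v e = ∑ e, v' e) :
    (relMatrix θ o v).det = (relMatrix θ o v').det := by
  have h1 : v = v' + (v - v') := by abel
  -- By linearity in the last row it remains to treat an additional row with sum zero. Then all rows
  -- have sum zero, as the relations do, and the constant vector is in the kernel.
  rw [h1, relMatrix_eq_updateRow θ o _ v', det_updateRow_add, ← relMatrix_eq_updateRow,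
    ← relMatrix_eq_updateRow, det_eq_zero_of_row_sums (relMatrix θ o (v - v')), add_zero]
  ext e
  rw [mulVec, dotProduct]
  simp only [mul_one, Pi.zero_apply]
  induction e using Fin.lastCases with
  | last => rw [relMatrix_last]; simp [h]
  | cast m =>
    rw [relMatrix_castSucc]
    simp [relRow, Finset.sum_add_distrib, ← Finset.mul_sum]

theorem det_relMatrix_zero : (relMatrix (0 : Fin n → R) o (Pi.single (Fin.last n) 1)).det =
    (-1) ^ n := by
  rw [det_of_triangular id Function.injective_id, Fin.prod_univ_castSucc, relMatrix_last]
  · have : ∀ m : Fin n, relMatrix (0 : Fin n → R) o (Pi.single (Fin.last n) 1) m.castSucc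
        m.castSucc = -1 := by
      intro m
      rw [relMatrix_castSucc]
      simp [relRow, Fin.castSucc_lt_succ.ne]
    simp [this]
  · intro e e' h
    induction e using Fin.lastCases with
    | last => rw [relMatrix_last]; exact Pi.single_eq_of_ne (M := fun _ => R) (ne_of_lt h) 1
    | cast m =>
      rw [relMatrix_castSucc]
      have h1 : e' ≠ m.castSucc := h.ne
      have h2 : e' ≠ m.succ := (lt_trans h Fin.castSucc_lt_succ).ne
      simp [relRow, Pi.single_eq_of_ne h1, Pi.single_eq_of_ne h2]

variable {u : ℕ} (m : Fin u → Fin n)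

/-- The number of the arc that contains an edge; the arcs end at the positions `m r`. -/
def arcIndex (e : Fin (n + 1)) : ℕ := (Finset.univ.filter fun r => (m r).castSucc < e).card

variable {m} (hm : StrictMono m)

include hm in
theorem arcIndex_le_iff (e : Fin (n + 1)) (r : Fin u) : arcIndex m e ≤ r ↔ e ≤ (m r).castSucc := by
  constructor
  · intro h
    by_contra he
    rw [not_le] at he
    have h1 : Finset.Iic r ⊆ Finset.univ.filter fun r => (m r).castSucc < e := by
      intro s hs
      rw [Finset.mem_Iic] at hs
      rw [Finset.mem_filter]
      exact ⟨Finset.mem_univ _, lt_of_le_of_lt (Fin.castSucc_le_castSucc_iff.mpr (hm.monotone hs)) he⟩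
    have h2 := Finset.card_le_card h1
    rw [Fin.card_Iic] at h2
    unfold arcIndex at h
    omega
  · intro h
    have h1 : (Finset.univ.filter fun r => (m r).castSucc < e) ⊆ Finset.Iio r := by
      intro s hs
      rw [Finset.mem_filter] at hs
      rw [Finset.mem_Iio]
      have := lt_of_lt_of_le hs.2 h
      exact hm.lt_iff_lt.mp (Fin.castSucc_lt_castSucc_iff.mp this)
    have h2 := Finset.card_le_card h1
    rwa [Fin.card_Iio] at h2

theorem arcIndex_le (e : Fin (n + 1)) : arcIndex m e ≤ u :=
  (Finset.card_filter_le _ _).trans (by simp)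

theorem arcIndex_zero : arcIndex m 0 = 0 := by simp [arcIndex]

theorem arcIndex_last : arcIndex m (Fin.last n) = u := by
  simp [arcIndex, Fin.castSucc_lt_last]

include hm in
theorem arcIndex_castSucc (r : Fin u) : arcIndex m (m r).castSucc = r := by
  have : (Finset.univ.filter fun s => (m s).castSucc < (m r).castSucc) = Finset.Iio r := by
    ext s; simp [hm.lt_iff_lt]
  rw [arcIndex, this, Fin.card_Iio]

include hm in
theorem arcIndex_succ (r : Fin u) : arcIndex m (m r).succ = r + 1 := by
  have : (Finset.univ.filter fun s => (m s).castSucc < (m r).succ) = Finset.Iic r := by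
    ext s; simp [hm.le_iff_le]
  rw [arcIndex, this, Fin.card_Iic]

theorem arcIndex_succ_of_notMem {a : Fin n} (ha : a ∉ Set.range m) :
    arcIndex m a.succ = arcIndex m a.castSucc := by
  unfold arcIndex
  congr 1
  ext s
  have h1 : m s ≠ a := fun h => ha ⟨s, h⟩
  have h2 : (m s : ℕ) ≠ a := fun h => h1 (Fin.ext h)
  simp only [Finset.mem_filter, Finset.mem_univ, true_and, Fin.lt_def, Fin.val_castSucc,
    Fin.val_succ]
  omega

variable (m) in
/-- The relations between the arcs, with the last arc set to zero. -/
def arcMatrix : Matrix (Fin u) (Fin u) R :=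
  Matrix.of (fun r => relRow θ o (m r)) *
    Matrix.of fun e (s : Fin u) => if arcIndex m e = s then (1 : R) else 0

theorem relRow_dotProduct (a : Fin n) (v : Fin (n + 1) → R) : relRow θ o a ⬝ᵥ v =
    v a.succ - v a.castSucc + θ a * (v a.castSucc - v (o a)) := by
  simp [relRow, add_dotProduct, sub_dotProduct, smul_dotProduct]

theorem arcMatrix_apply (r s : Fin u) : arcMatrix θ o m r s =
    relRow θ o (m r) ⬝ᵥ fun e => if arcIndex m e = s then 1 else 0 := rfl

variable (hθ : ∀ a, a ∉ Set.range m → θ a = 0)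

include hm hθ in
-- Only the relations at the ends of arcs contain `θ`; the others identify consecutive edges. So the
-- matrix is a triangular one `A` plus a correction `U * V` with one term per arc end. The matrix
-- determinant lemma leaves a determinant of the size of the number of arc ends, which is that of
-- the arc matrix up to the triangular factor `T`.
theorem associated_arcMatrix :
    Associated (relMatrix θ o (Pi.single (Fin.last n) 1)).det (arcMatrix θ o m).det := by
  let A : Matrix (Fin (n + 1)) (Fin (n + 1)) R := relMatrix 0 o (Pi.single (Fin.last n) 1)
  let U : Matrix (Fin (n + 1)) (Fin u) R := Matrix.of fun e r => if e = (m r).castSucc then 1 else 0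
  let V : Matrix (Fin u) (Fin (n + 1)) R := Matrix.of fun r =>
    θ (m r) • (Pi.single (m r).castSucc 1 - Pi.single (o (m r)) 1)
  let X : Matrix (Fin (n + 1)) (Fin u) R := Matrix.of fun e r =>
    if e ≤ (m r).castSucc then -1 else 0
  let T : Matrix (Fin u) (Fin u) R := Matrix.of fun s r => if s ≤ r then -1 else 0
  have hA : IsUnit A.det := by
    rw [det_relMatrix_zero]; exact isUnit_one.neg.pow n
  have h1 : relMatrix θ o (Pi.single (Fin.last n) 1) = A + U * V := by
    ext e e'
    rw [Matrix.add_apply, mul_apply]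
    induction e using Fin.lastCases with
    | last =>
      simp only [A]
      rw [relMatrix_last, relMatrix_last, Finset.sum_eq_zero, add_zero]
      intro r _
      simp [U, (Fin.castSucc_lt_last _).ne']
    | cast a =>
      simp only [A]
      rw [relMatrix_castSucc, relMatrix_castSucc]
      by_cases ha : a ∈ Set.range m
      · obtain ⟨r, rfl⟩ := ha
        rw [Finset.sum_eq_single r]
        · simp [U, V, relRow]
        · intro s _ hs
          simp [U, hm.injective.ne hs.symm]
        · simp
      · rw [Finset.sum_eq_zero, add_zero]
        · simp [relRow, hθ a ha]
        · intro s _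
          have : a ≠ m s := fun h => ha ⟨s, h.symm⟩
          simp [U, this]
  have h2 : A * X = U := by
    ext e r
    rw [mul_apply]
    change A e ⬝ᵥ (fun e => X e r) = _
    simp only [A]
    induction e using Fin.lastCases with
    | last =>
      rw [relMatrix_last, single_dotProduct, one_mul]
      simp [X, U, (Fin.castSucc_lt_last _).ne', (Fin.castSucc_lt_last _).not_ge]
    | cast a =>
      rw [relMatrix_castSucc, relRow_dotProduct]
      simp only [X, U, of_apply, Pi.zero_apply, zero_mul, add_zero, Fin.castSucc_le_castSucc_iff,
        Fin.succ_le_castSucc_iff, Fin.castSucc_inj]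
      rcases lt_trichotomy a (m r) with h | h | h
      · simp [h, h.le, h.ne]
      · simp [h]
      · simp [h.not_gt, h.not_ge, h.ne']
  have h3 : A⁻¹ * U = X := by
    rw [← h2, nonsing_inv_mul_cancel_left _ _ hA]
  have h4 : 1 + V * X = arcMatrix θ o m * T := by
    have h5 : (Matrix.of fun e (s : Fin u) => if arcIndex m e = s then (1 : R) else 0) * T = X := by
      ext e r
      rw [mul_apply]
      simp only [of_apply, ite_mul, one_mul, zero_mul, T, X, ← arcIndex_le_iff hm]
      by_cases he : arcIndex m e < u
      · rw [Finset.sum_eq_single ⟨_, he⟩]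
        · simp [Fin.le_def]
        · intro s _ hs
          rw [if_neg]
          rintro h
          exact hs (Fin.ext h.symm)
        · simp
      · rw [Finset.sum_eq_zero, if_neg]
        · have := r.isLt; omega
        · intro s _
          rw [if_neg]
          have := s.isLt; omega
    rw [arcMatrix, Matrix.mul_assoc, h5]
    ext r s
    rw [Matrix.add_apply, mul_apply, mul_apply]
    change _ + V r ⬝ᵥ (fun e => X e s) = relRow θ o (m r) ⬝ᵥ (fun e => X e s)
    have h6 : (V r ⬝ᵥ fun e => X e s) = θ (m r) * (X (m r).castSucc s - X (o (m r)) s) := by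
      change (θ (m r) • ((Pi.single (m r).castSucc 1 : Fin (n + 1) → R) - Pi.single (o (m r)) 1) ⬝ᵥ _) = _
      rw [smul_dotProduct, sub_dotProduct, single_dotProduct, single_dotProduct, one_mul, one_mul,
        smul_eq_mul]
    rw [relRow_dotProduct, h6]
    congr 1
    simp only [X, of_apply, Fin.castSucc_le_castSucc_iff, Fin.succ_le_castSucc_iff, hm.lt_iff_lt,
      hm.le_iff_le, one_apply]
    rcases lt_trichotomy r s with h | h | h
    · simp [h, h.le, h.ne]
    · simp [h]
    · simp [h.not_gt, h.not_ge, h.ne']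
  have h6 : IsUnit T.det := by
    rw [det_of_triangular id Function.injective_id]
    · simp only [T, of_apply, le_refl, if_true, Finset.prod_const]
      exact isUnit_one.neg.pow _
    · intro r s h
      simp only [T, of_apply, id] at h ⊢
      rw [if_neg (not_le.mpr h)]
  rw [h1, det_add_mul _ _ hA, Matrix.mul_assoc, h3, h4, det_mul]
  exact (associated_unit_mul_left _ _ hA).trans (associated_mul_unit_left _ _ h6)

end Relation

section Minor

open Matrix

variable {R : Type*} [CommRing R] {n : ℕ} (θ : Fin n → R) (o : Fin n → Fin (n + 1))
  {u : ℕ} {m : Fin (u + 1) → Fin n} (hθ : ∀ a, a ∉ Set.range m → θ a = 0)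

include hθ in
/-- A linear relation between the rows allows one to discard the first row and column. -/
theorem associated_arcMatrix_minor (hm : StrictMono m) (Λ : Fin n → Rˣ) (c : Rˣ) (c' : R)
    (hΛ : ∑ a, (Λ a : R) • relRow θ o a = c' • Pi.single (Fin.last n) 1 - (c : R) • Pi.single 0 1) :
    Associated (arcMatrix θ o m).det ((arcMatrix θ o m).submatrix Fin.succ Fin.succ).det := by
  let J : Fin (u + 1) → Fin (n + 1) → R := fun s e => if arcIndex m e = s then 1 else 0
  -- Relations inside an arc vanish in terms of arcs, and so does the term of the last edge, as the
  -- last arc is set to zero. Replacing row `0` by this combination, which has an invertible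
  -- coefficient there, leaves a row with a single unit entry.
  have h1 : ∑ r, (Λ (m r) : R) • arcMatrix θ o m r = Pi.single 0 (-(c : R)) := by
    ext s
    rw [Finset.sum_apply]
    have h2 : ∑ a, (Λ a : R) * (relRow θ o a ⬝ᵥ J s) = ∑ r, (Λ (m r) : R) * (relRow θ o (m r) ⬝ᵥ J s) := by
      rw [← Finset.sum_image (s := Finset.univ) (g := m)
        (f := fun a => (Λ a : R) * (relRow θ o a ⬝ᵥ J s)) (fun _ _ _ _ h => hm.injective h)]
      symm
      apply Finset.sum_subset (Finset.subset_univ _)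
      intro a _ ha
      have ha' : a ∉ Set.range m := by
        rintro ⟨r, rfl⟩
        exact ha (Finset.mem_image_of_mem _ (Finset.mem_univ _))
      rw [relRow_dotProduct, hθ a ha']
      simp [J, arcIndex_succ_of_notMem ha']
    have h3 : ∑ r, ((Λ (m r) : R) • arcMatrix θ o m r) s =
        ∑ r, (Λ (m r) : R) * (relRow θ o (m r) ⬝ᵥ J s) := rfl
    rw [h3, ← h2]
    have h4 : ∑ a, (Λ a : R) * (relRow θ o a ⬝ᵥ J s) = (∑ a, (Λ a : R) • relRow θ o a) ⬝ᵥ J s := by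
      rw [sum_dotProduct]
      simp only [smul_dotProduct, smul_eq_mul]
    rw [h4, hΛ, sub_dotProduct, smul_dotProduct, smul_dotProduct, single_dotProduct,
      single_dotProduct]
    simp only [J, arcIndex_last, arcIndex_zero]
    have h5 : (u + 1 : ℕ) ≠ s := s.isLt.ne'
    rw [if_neg h5]
    induction s using Fin.cases with
    | zero => simp
    | succ s => simp
  have h2 := det_updateRow_sum (arcMatrix θ o m) 0 fun r => (Λ (m r) : R)
  rw [h1, smul_eq_mul] at h2
  refine (associated_unit_mul_right _ _ (Λ (m 0)).isUnit).trans ?_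
  rw [← h2, det_succ_row_zero, Finset.sum_eq_single 0]
  · simp only [updateRow_self, Pi.single_eq_same]
    have h6 : ((arcMatrix θ o m).updateRow 0 (Pi.single 0 (-(c : R)))).submatrix Fin.succ
        (Fin.succAbove 0) = (arcMatrix θ o m).submatrix Fin.succ Fin.succ := by
      ext r s
      simp
    rw [h6]
    exact associated_unit_mul_left _ _ (by simp)
  · intro s _ hs
    rw [updateRow_self, Pi.single_eq_of_ne hs]
    simp
  · simp

end Minor
end StringLink

/-! ### Separation of strand `i` and symmetry of the state sum -/

namespace StringLink
namespace Diagram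

variable {k : ℕ} (D : Diagram k) (i : Fin k)

open Matrix

section Block

variable {R : Type*} [CommRing R]

theorem jumpSign_mul_self (p) : D.jumpSign (R := R) p * D.jumpSign p = 1 := by
  unfold jumpSign; split_ifs <;> simp

theorem jumpSign_over_mul_under (c) :
    D.jumpSign (R := R) (c, true) * D.jumpSign (c, false) = -1 := by
  unfold jumpSign GaussData.rising
  cases D.positive c <;> simp

/-- The block of strand `i` of a matrix on the edges. -/
def strandBlock (M : Matrix D.Edge D.Edge R) : Matrix (Fin (D.len i + 1)) (Fin (D.len i + 1)) R :=
  M.submatrix (fun m => (⟨i, m⟩ : D.Edge)) fun m => (⟨i, m⟩ : D.Edge)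

/-- At a passage of another strand the correction is zero or refers to an edge next to this passage.
So the equations of the other strands do not involve strand `i`, and they form a triangular block
whose diagonal entries are units. -/
theorem associated_strandBlock (ρ : Fin D.numCrossings → R) (z : Fin D.numCrossings → D.Edge)
    (h : ∀ p, D.strand p ≠ i → ρ p.1 = 0 ∨ z p.1 = D.outEdge p ∨
      (z p.1 = D.inEdge p ∧ IsUnit (1 + D.jumpSign p * ρ p.1))) :
    Associated (D.edgeMatrix ρ z).det (D.strandBlock i (D.edgeMatrix ρ z)).det := by
  classical
  have hstr : ∀ p, (D.inEdge p).1 = D.strand p := fun _ => rfl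
  have hstr' : ∀ p, (D.outEdge p).1 = D.strand p := fun _ => rfl
  rw [twoBlockTriangular_det (D.edgeMatrix ρ z) fun e => e.1 = i]
  · have h1 : (toSquareBlockProp (D.edgeMatrix ρ z) fun e => e.1 = i).det =
        (D.strandBlock i (D.edgeMatrix ρ z)).det := by
      let f : Fin (D.len i + 1) ≃ {e : D.Edge // e.1 = i} :=
        { toFun := fun m => ⟨⟨i, m⟩, rfl⟩
          invFun := fun e => e.2 ▸ e.1.2
          left_inv := fun m => rfl
          right_inv := by rintro ⟨⟨j, m⟩, rfl⟩; rfl }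
      rw [← det_submatrix_equiv_self f]
      rfl
    rw [h1]
    refine associated_mul_unit_left _ _ ?_
    rw [det_of_triangular (fun e : {e : D.Edge // ¬ e.1 = i} => D.edgeOrder e)
      (fun e e' he => Subtype.ext (D.edgeOrder_injective he))]
    · refine IsUnit.prod_univ_iff.mpr ?_
      rintro ⟨e, he⟩
      change IsUnit (D.edgeMatrix ρ z e e)
      rcases D.edge_cases e with ⟨p, rfl⟩ | ⟨j, rfl⟩
      · rw [edgeMatrix_inEdge]
        have h2 : D.inEdge p ≠ D.outEdge p := fun h' => (D.edgeOrder_in_lt_out p).ne (congrArg _ h')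
        simp only [Pi.add_apply, Pi.sub_apply, Pi.single_eq_same, Pi.single_eq_of_ne h2,
          Pi.smul_apply]
        rcases h p he with h | h | ⟨h, h'⟩
        · simp [h]
        · simp [h, Pi.single_eq_of_ne h2]
        · rw [h]; simpa using h'
      · simp [edgeMatrix_lastEdge]
    · rintro ⟨e, he⟩ ⟨e', he'⟩ hlt
      change D.edgeMatrix ρ z e e' = 0
      change D.edgeOrder e' < D.edgeOrder e at hlt
      have h0 : e' ≠ e := fun h' => hlt.ne (congrArg _ h')
      rcases D.edge_cases e with ⟨p, rfl⟩ | ⟨j, rfl⟩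
      · have h2 : e' ≠ D.outEdge p := fun h' =>
          (hlt.trans (D.edgeOrder_in_lt_out p)).ne (congrArg _ h')
        rw [edgeMatrix_inEdge]
        simp only [Pi.add_apply, Pi.sub_apply, Pi.single_eq_of_ne h0, Pi.single_eq_of_ne h2,
          Pi.smul_apply]
        rcases h p he with h | h | ⟨h, h'⟩
        · simp [h]
        · simp [h, Pi.single_eq_of_ne h2]
        · simp [h, Pi.single_eq_of_ne h0]
      · rw [edgeMatrix_lastEdge, Pi.single_eq_of_ne h0]
  · intro e he e' he'
    have hne : ∀ e'' : D.Edge, e''.1 ≠ i → e' ≠ e'' := fun e'' h' h'' => h' (h'' ▸ he')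
    rcases D.edge_cases e with ⟨p, rfl⟩ | ⟨j, rfl⟩
    · rw [edgeMatrix_inEdge]
      simp only [Pi.add_apply, Pi.sub_apply, Pi.single_eq_of_ne (hne _ he),
        Pi.single_eq_of_ne (hne (D.outEdge p) he), Pi.smul_apply]
      rcases h p he with h | h | ⟨h, h'⟩
      · simp [h]
      · simp [h, Pi.single_eq_of_ne (hne (D.outEdge p) he)]
      · simp [h, Pi.single_eq_of_ne (hne _ he)]
    · rw [edgeMatrix_lastEdge, Pi.single_eq_of_ne (hne _ he)]

end Block

theorem inEdge_eq_iff (p) (m : Fin (D.len i)) :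
    D.inEdge p = ⟨i, m.castSucc⟩ ↔ p = D.passage ⟨i, m⟩ := by
  rw [← D.inEdge_passage, D.inEdge_injective.eq_iff]

theorem outEdge_eq_iff (p) (m : Fin (D.len i)) :
    D.outEdge p = ⟨i, m.succ⟩ ↔ p = D.passage ⟨i, m⟩ := by
  rw [← D.outEdge_passage, D.outEdge_injective.eq_iff]

theorem strand_passage (m : Fin (D.len i)) : D.strand (D.passage ⟨i, m⟩) = i := by
  simp [GaussData.strand]

/-- The coefficients of the relations along strand `i`. -/
noncomputable def coeff (m : Fin (D.len i)) : AddMonoidAlgebra ℤ ℚ :=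
  if (D.passage ⟨i, m⟩).2 = false then
    1 - (tpow (D.passExponent i true (D.passage ⟨i, m⟩).1)).val else 0

open Classical in
/-- The position on strand `i` of the passage over a crossing. -/
noncomputable def overPos (m : Fin (D.len i)) : Fin (D.len i + 1) :=
  if h : ∃ m', D.inEdge ((D.passage ⟨i, m⟩).1, true) = ⟨i, m'⟩ then h.choose else 0

theorem inEdge_overPos (m : Fin (D.len i)) (h : D.strand ((D.passage ⟨i, m⟩).1, true) = i) :
    D.inEdge ((D.passage ⟨i, m⟩).1, true) = ⟨i, D.overPos i m⟩ := by
  have h1 : ∃ m', D.inEdge ((D.passage ⟨i, m⟩).1, true) = ⟨i, m'⟩ := by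
    generalize he : D.inEdge ((D.passage ⟨i, m⟩).1, true) = e
    have h2 : e.1 = i := by rw [← he]; exact h
    obtain ⟨j, m'⟩ := e
    subst h2
    exact ⟨m', rfl⟩
  rw [overPos, dif_pos h1]
  exact h1.choose_spec

theorem coeff_of_over {m : Fin (D.len i)} (h : (D.passage ⟨i, m⟩).2 = true) : D.coeff i m = 0 :=
  if_neg (by simp [h])

theorem passExponent_of_ne {l c} (h : D.strand (c, l) ≠ i) : D.passExponent i l c = 0 := if_neg h

theorem coeff_of_ne {m : Fin (D.len i)} (h : D.strand ((D.passage ⟨i, m⟩).1, true) ≠ i) :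
    D.coeff i m = 0 := by
  rw [coeff, D.passExponent_of_ne i h]
  simp [tpow_zero]

theorem single_mk {R : Type*} [Zero R] [One R] (e : D.Edge) (m : Fin (D.len i + 1)) [Decidable (e = ⟨i, m⟩)] :
    (Pi.single e (1 : R) : D.Edge → R) ⟨i, m⟩ = if e = ⟨i, m⟩ then 1 else 0 := by
  classical
  rw [Pi.single_apply]
  simp only [eq_comm]

theorem mk_inj {m m' : Fin (D.len i + 1)} : (⟨i, m⟩ : D.Edge) = ⟨i, m'⟩ ↔ m = m' :=
  ⟨fun h => eq_of_heq (Sigma.mk.inj h).2, fun h => by rw [h]⟩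

/-- The block of strand `i` of the lower matrix. -/
theorem lower_eq : (D.strandBlock i (D.edgeMatrix
    (fun c => D.jumpSign (c, false) * (1 - (tpow (D.passExponent i true c)).val))
    fun c => D.outEdge (c, false)))ᵀ.submatrix (finRotate _) id =
      relMatrix (D.coeff i) (D.overPos i) (Pi.single 0 1) := by
  classical
  refine Matrix.ext fun e e' => ?_
  -- The column of the edge after passage `m` is the relation at `m`, so after transposition the
  -- rows are shifted by one. The column of the first edge comes last and gives the additional row.
  rw [submatrix_apply, transpose_apply, id, strandBlock, submatrix_apply]
  induction e using Fin.lastCases with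
  | last =>
    rw [relMatrix_last, finRotate_last]
    induction e' using Fin.lastCases with
    | last =>
      change D.edgeMatrix _ _ (D.lastEdge i) _ = _
      have h3 : (Pi.single 0 1 : Fin (D.len i + 1) → AddMonoidAlgebra ℤ ℚ) (Fin.last _) =
          if Fin.last _ = 0 then 1 else 0 := Pi.single_apply ..
      refine Eq.trans ?_ h3.symm
      rw [edgeMatrix_lastEdge, Pi.single_apply]
      simp only [GaussData.lastEdge, D.mk_inj i, eq_comm]
    | cast m =>
      have h0 : ∀ p, D.outEdge p ≠ (⟨i, 0⟩ : D.Edge) := fun p => D.outEdge_ne_firstEdge p i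
      rw [← D.inEdge_passage, edgeMatrix_inEdge]
      simp only [Pi.add_apply, Pi.sub_apply, Pi.smul_apply, single_mk, h0, if_false, smul_zero,
        sub_zero, add_zero]
      rw [D.inEdge_passage, Pi.single_apply]
      simp only [D.mk_inj i]
  | cast m =>
    have hm : finRotate _ m.castSucc = m.succ := finRotate_of_lt m.isLt
    rw [relMatrix_castSucc, hm]
    change D.edgeMatrix _ _ _ ⟨i, m.succ⟩ = _
    simp only [relRow, Pi.add_apply, Pi.sub_apply, Pi.smul_apply, smul_eq_mul, Pi.single_apply]
    induction e' using Fin.lastCases with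
    | last =>
      change D.edgeMatrix _ _ (D.lastEdge i) _ = _
      have h1 : Fin.last (D.len i) ≠ m.castSucc := (Fin.castSucc_lt_last m).ne'
      have h2 : D.coeff i m * (if Fin.last (D.len i) = D.overPos i m then 1 else 0) = 0 := by
        split_ifs with h2
        · by_cases h3 : D.strand ((D.passage ⟨i, m⟩).1, true) = i
          · have h4 := D.inEdge_overPos i m h3
            rw [← h2] at h4
            exact absurd h4 (D.inEdge_ne_lastEdge _ i)
          · rw [D.coeff_of_ne i h3, zero_mul]
        · rw [mul_zero]
      rw [edgeMatrix_lastEdge, if_neg h1, zero_sub, mul_neg, h2, sub_zero, neg_zero, add_zero,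
        Pi.single_apply]
      simp only [GaussData.lastEdge, D.mk_inj i, eq_comm]
    | cast a =>
      rw [← D.inEdge_passage, edgeMatrix_inEdge]
      simp only [Pi.add_apply, Pi.sub_apply, Pi.smul_apply, single_mk]
      rw [D.inEdge_passage, D.outEdge_passage]
      simp only [D.mk_inj i, outEdge_eq_iff, smul_eq_mul]
      have hkey : D.jumpSign (D.passage ⟨i, a⟩) *
          (D.jumpSign ((D.passage ⟨i, a⟩).1, false) *
            (1 - (tpow (D.passExponent i true (D.passage ⟨i, a⟩).1)).val)) *
          (if ((D.passage ⟨i, a⟩).1, false) = D.passage ⟨i, m⟩ then 1 else 0) =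
          D.coeff i m * ((if a.castSucc = m.castSucc then 1 else 0) -
            if a.castSucc = D.overPos i m then 1 else 0) := by
        have hov : D.strand ((D.passage ⟨i, m⟩).1, true) = i →
            (a.castSucc = D.overPos i m ↔ ((D.passage ⟨i, m⟩).1, true) = D.passage ⟨i, a⟩) := by
          intro h
          rw [← D.inEdge_eq_iff i, D.inEdge_overPos i m h, D.mk_inj i, eq_comm]
        by_cases h1 : ((D.passage ⟨i, a⟩).1, false) = D.passage ⟨i, m⟩
        · rw [if_pos h1, mul_one]
          have hc : (D.passage ⟨i, a⟩).1 = (D.passage ⟨i, m⟩).1 := by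
            have := congrArg Prod.fst h1
            exact this
          have hu : (D.passage ⟨i, m⟩).2 = false := (congrArg Prod.snd h1).symm
          have hcoeff : D.coeff i m =
              1 - (tpow (D.passExponent i true (D.passage ⟨i, m⟩).1)).val := if_pos hu
          cases hb : (D.passage ⟨i, a⟩).2
          · have ham : D.passage ⟨i, a⟩ = D.passage ⟨i, m⟩ := Prod.ext hc (hb.trans hu.symm)
            have ham' : a = m := by
              have := D.passage.injective ham
              exact eq_of_heq (Sigma.mk.inj this).2
            subst ham'
            have hp : ((D.passage ⟨i, a⟩).1, false) = D.passage ⟨i, a⟩ := h1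
            rw [hp, ← mul_assoc, jumpSign_mul_self, one_mul, hcoeff, if_pos rfl]
            by_cases hs : D.strand ((D.passage ⟨i, a⟩).1, true) = i
            · have : ¬ a.castSucc = D.overPos i a := by
                rw [hov hs]
                intro h
                have := congrArg Prod.snd h
                rw [hb] at this
                exact absurd this (by simp)
              rw [if_neg this]; ring
            · rw [D.passExponent_of_ne i hs]; simp [tpow_zero]
          · have hp : D.passage ⟨i, a⟩ = ((D.passage ⟨i, m⟩).1, true) := Prod.ext hc hb
            have hs : D.strand ((D.passage ⟨i, m⟩).1, true) = i := by
              rw [← hp, strand_passage]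
            have ham : ¬ a.castSucc = m.castSucc := by
              rw [Fin.castSucc_inj]
              rintro rfl
              rw [hb] at hu; exact absurd hu (by simp)
            rw [if_neg ham, if_pos ((hov hs).mpr hp.symm), hcoeff, hp, ← mul_assoc,
              jumpSign_over_mul_under]
            ring
        · rw [if_neg h1, mul_zero]
          cases hb : (D.passage ⟨i, m⟩).2
          · have ham : ¬ a.castSucc = m.castSucc := by
              rw [Fin.castSucc_inj]
              rintro rfl
              exact h1 (Prod.ext rfl hb.symm)
            rw [if_neg ham]
            by_cases hs : D.strand ((D.passage ⟨i, m⟩).1, true) = i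
            · rw [if_neg, sub_zero, mul_zero]
              rw [hov hs]
              intro h
              apply h1
              rw [← h]
              exact Prod.ext rfl hb.symm
            · rw [D.coeff_of_ne i hs, zero_mul]
          · rw [D.coeff_of_over i hb, zero_mul]
      rw [hkey]
      simp only [Fin.succ_inj, Fin.castSucc_inj]

/-- The transposed lower block has the additional row for the first edge. It may be moved to the
last edge, since only the sum of its entries matters. -/
theorem associated_relMatrix : Associated (D.strandSum i)
    (relMatrix (D.coeff i) (D.overPos i) (Pi.single (Fin.last _) 1)).det := by
  refine (D.associated_lower i).trans ((D.associated_strandBlock i _ _ fun p hp => ?_).trans ?_)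
  · obtain ⟨c, b⟩ := p
    cases b
    · exact Or.inr (Or.inl rfl)
    · left
      simp [D.passExponent_of_ne i hp, tpow_zero]
  · rw [det_relMatrix_congr _ _ _ (Pi.single 0 1) (by simp), ← lower_eq]
    rw [← det_transpose]
    have := det_permute (finRotate _) (D.strandBlock i (D.edgeMatrix
      (fun c => D.jumpSign (c, false) * (1 - (tpow (D.passExponent i true c)).val))
      fun c => D.outEdge (c, false)))ᵀ
    rw [this]
    exact associated_unit_mul_right _ _ ((Units.isUnit _).map (Int.castRingHom _))

open Matrix

theorem numbering_outEdge {R : Type*} [CommRing R] {b : D.Region → R}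
    (hb : ∀ e, D.diff b e = if e.1 = i then -1 else 0) (p) :
    b (D.region (D.outEdge p, .right)) = b (D.region (D.inEdge p, .right)) -
      D.jumpSign p * if D.strand (p.1, !p.2) = i then 1 else 0 := by
  obtain ⟨h1, h2, -⟩ := D.numbering_corner i hb p.1
  rcases D.eq_rising_or_falling p with h | h
  · have h3 : D.strand (p.1, !p.2) = D.strand (p.1, !D.positive p.1) :=
      congrArg (fun b => D.strand (p.1, !b)) (congrArg Prod.snd h)
    rw [h3, h, jumpSign_rising]
    change _ = _ - 1 * if D.strand (p.1, !D.positive p.1) = i then 1 else 0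
    rw [GaussData.region_ro_right, GaussData.region_ri_right, h2]
    ring
  · have h3 : D.strand (p.1, !p.2) = D.strand (p.1, D.positive p.1) := by
      have := congrArg (fun b => D.strand (p.1, !b)) (congrArg Prod.snd h)
      rw [this]
      change D.strand (p.1, !!D.positive p.1) = _
      rw [Bool.not_not]
    rw [h3, h, jumpSign_falling]
    change _ = _ - -1 * if D.strand (p.1, D.positive p.1) = i then 1 else 0
    rw [GaussData.region_fo_right, GaussData.region_fi_right, h1]
    ring

theorem jumpSign_under {R : Type*} [CommRing R] (c) :
    D.jumpSign (R := R) (c, false) = -(D.crossingSign c : R) := by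
  unfold jumpSign GaussData.rising crossingSign
  cases D.positive c <;> simp

theorem jumpSign_over {R : Type*} [CommRing R] (c) :
    D.jumpSign (R := R) (c, true) = (D.crossingSign c : R) := by
  unfold jumpSign GaussData.rising crossingSign
  cases D.positive c <;> simp

theorem numbering_over {b : D.Region → ℤ}
    (hb : ∀ e, D.diff b e = if e.1 = i then -1 else 0) {c} (ht : D.strand (c, true) = i)
    (hf : D.strand (c, false) = i) :
    b (D.region (D.inEdge (c, true), .right)) =
      b (D.region (D.inEdge (c, false), .right)) + D.crossingSign c := by
  obtain ⟨h1, h2, -⟩ := D.numbering_corner i hb c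
  cases hp : D.positive c
  · have e1 : (c, false) = D.rising c := by rw [GaussData.rising, hp]
    have e2 : (c, true) = D.falling c := by rw [GaussData.falling, hp]; rfl
    rw [e1, e2, GaussData.region_ri_right, GaussData.region_fi_right, h2, hp]
    simp [ht, crossingSign, hp]
  · have e1 : (c, false) = D.falling c := by rw [GaussData.falling, hp]; rfl
    have e2 : (c, true) = D.rising c := by rw [GaussData.rising, hp]
    rw [e1, e2, GaussData.region_ri_right, GaussData.region_fi_right, h2, hp]
    simp [hf, crossingSign, hp]

/-- The block of strand `i` of the upper matrix. -/
noncomputable def upperBlock : Matrix (Fin (D.len i + 1)) (Fin (D.len i + 1)) (AddMonoidAlgebra ℤ ℚ) :=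
  D.strandBlock i (D.edgeMatrix
    (fun c => D.jumpSign (c, false) * (1 - (tpow (D.passExponent i false c)).val))
    fun c => D.inEdge (c, true))

theorem upperBlock_last (m') : D.upperBlock i (Fin.last _) m' = if m' = Fin.last _ then 1 else 0 := by
  rw [upperBlock, strandBlock, submatrix_apply]
  change D.edgeMatrix _ _ (D.lastEdge i) _ = _
  rw [edgeMatrix_lastEdge, Pi.single_apply]
  simp only [GaussData.lastEdge, D.mk_inj i]

theorem upperBlock_castSucc (m : Fin (D.len i)) (m' : Fin (D.len i + 1)) :
    D.upperBlock i m.castSucc m' = (if m' = m.castSucc then 1 else 0) - (if m' = m.succ then 1 else 0) +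
      D.jumpSign (D.passage ⟨i, m⟩) * (D.jumpSign ((D.passage ⟨i, m⟩).1, false) *
        (1 - (tpow (D.passExponent i false (D.passage ⟨i, m⟩).1)).val)) *
      if D.inEdge ((D.passage ⟨i, m⟩).1, true) = ⟨i, m'⟩ then 1 else 0 := by
  rw [upperBlock, strandBlock, submatrix_apply]
  rw [← D.inEdge_passage, edgeMatrix_inEdge]
  simp only [Pi.add_apply, Pi.sub_apply, Pi.smul_apply, single_mk]
  rw [D.inEdge_passage, D.outEdge_passage]
  simp only [D.mk_inj i, smul_eq_mul, eq_comm]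

/-- The main terms telescope. Over and under passage of a crossing refer to the same over edge with
opposite coefficients, so their corrections cancel; those from passages of other strands are zero
anyway. -/
theorem sum_upperBlock (m') : ∑ m : Fin (D.len i), D.upperBlock i m.castSucc m' =
    (if m' = 0 then 1 else 0) - (if m' = Fin.last _ then 1 else 0) := by
  let F : Fin D.numCrossings × Bool → AddMonoidAlgebra ℤ ℚ := fun p =>
    D.jumpSign p * (D.jumpSign (p.1, false) * (1 - (tpow (D.passExponent i false p.1)).val)) *
      if D.inEdge (p.1, true) = ⟨i, m'⟩ then 1 else 0
  have hF : ∀ p, D.strand p ≠ i → F p = 0 := by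
    rintro ⟨c, l⟩ hp
    cases l
    · simp [F, D.passExponent_of_ne i hp, tpow_zero]
    · have : D.inEdge (c, true) ≠ ⟨i, m'⟩ := fun h => hp (congrArg Sigma.fst h)
      simp [F, this]
  have h1 : ∑ m : Fin (D.len i), F (D.passage ⟨i, m⟩) = 0 := by
    have h2 : ∑ p, F p = 0 := by
      rw [Fintype.sum_prod_type]
      refine Finset.sum_eq_zero fun c _ => ?_
      rw [Fintype.sum_bool]
      simp only [F]
      rw [← mul_assoc, ← mul_assoc, jumpSign_over_mul_under, jumpSign_mul_self]
      ring
    rw [← Equiv.sum_comp D.passage, Fintype.sum_sigma, Fintype.sum_eq_single i] at h2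
    · exact h2
    · intro j hj
      refine Finset.sum_eq_zero fun m _ => hF _ ?_
      rw [D.strand_passage]
      exact hj
  have h3 : ∑ m : Fin (D.len i), ((if m' = m.castSucc then (1 : AddMonoidAlgebra ℤ ℚ) else 0) -
      (if m' = m.succ then 1 else 0)) = (if m' = 0 then 1 else 0) -
      (if m' = Fin.last _ then 1 else 0) := by
    have e1 := Fin.sum_univ_castSucc fun e => if m' = e then (1 : AddMonoidAlgebra ℤ ℚ) else 0
    have e2 := Fin.sum_univ_succ fun e => if m' = e then (1 : AddMonoidAlgebra ℤ ℚ) else 0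
    rw [Finset.sum_sub_distrib]
    rw [e1] at e2
    linear_combination e2
  simp only [upperBlock_castSucc, Finset.sum_add_distrib, h3]
  rw [h1, add_zero]

/-- The upper equations are the relations of the lower block after rescaling each edge by the power
of the variable given by the number of the region on its right. This number changes along the strand
by signs of self-crossings, which are the exponents in the coefficients. -/
theorem upperBlock_eq {b : D.Region → ℤ} (hb : ∀ e, D.diff b e = if e.1 = i then -1 else 0) (m m') :
    D.upperBlock i m.castSucc m' =
      -(tpow (b (D.region (⟨i, m.succ⟩, .right)))).val * relRow (D.coeff i) (D.overPos i) m m' *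
        (tpow (-b (D.region (⟨i, m'⟩, .right)))).val := by
  classical
  have hβ := D.numbering_outEdge i hb (D.passage ⟨i, m⟩)
  rw [D.outEdge_passage, D.inEdge_passage] at hβ
  have hmul : ∀ x y : ℚ, (tpow x).val * (tpow y).val = (tpow (x + y)).val := fun x y => by
    rw [tpow_add]; rfl
  rw [upperBlock_castSucc, relRow]
  simp only [Pi.add_apply, Pi.sub_apply, Pi.smul_apply, smul_eq_mul,
    Pi.single_apply]
  have hind : ∀ a, (if m' = a then (1 : AddMonoidAlgebra ℤ ℚ) else 0) *
      (tpow (-b (D.region (⟨i, m'⟩, .right)))).val =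
      (if m' = a then 1 else 0) * (tpow (-b (D.region (⟨i, a⟩, .right)))).val := by
    intro a
    split_ifs with h
    · rw [h]
    · rw [zero_mul, zero_mul]
  have hA := hind m.castSucc
  have hS := hind m.succ
  have hO := hind (D.overPos i m)
  have e1 : (tpow (b (D.region (⟨i, m.succ⟩, .right)))).val *
      (tpow (-b (D.region (⟨i, m.succ⟩, .right)))).val = 1 := by
    rw [hmul, add_neg_cancel, tpow_zero]; rfl
  obtain ⟨⟨c, l⟩, hp⟩ : ∃ p, D.passage ⟨i, m⟩ = p := ⟨_, rfl⟩
  have hs : D.strand (c, l) = i := by rw [← hp, strand_passage]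
  have hin : D.inEdge (c, l) = ⟨i, m.castSucc⟩ := by rw [← hp, D.inEdge_passage]
  simp only [hp] at hβ ⊢
  cases l
  · have hcoeff : D.coeff i m = 1 - (tpow (D.passExponent i true c)).val := by
      rw [coeff, hp, if_pos rfl]
    have hpass : D.passExponent i false c = -D.crossingSign c := if_pos hs
    rw [hcoeff, hpass, ← mul_assoc, jumpSign_mul_self, one_mul]
    by_cases ht : D.strand (c, true) = i
    · have ho := D.inEdge_overPos i m (by rw [hp]; exact ht)
      rw [hp] at ho
      have hover := D.numbering_over i hb ht hs
      change D.inEdge (c, true) = _ at ho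
      rw [ho, hin] at hover
      simp only [Bool.not_false, if_pos ht, jumpSign_under] at hβ
      have hpass' : D.passExponent i true c = -D.crossingSign c := if_pos ht
      rw [ho, hpass']
      simp only [D.mk_inj i, eq_comm (a := D.overPos i m)]
      have e2 : (tpow (b (D.region (⟨i, m.succ⟩, .right)))).val *
          (tpow (-b (D.region (⟨i, m.castSucc⟩, .right)))).val *
          (tpow ((-D.crossingSign c : ℤ) : ℚ)).val = 1 := by
        rw [hmul, hmul, hβ]
        push_cast
        rw [show ∀ x y : ℚ, x - -y * 1 + -x + -y = 0 by intros; ring, tpow_zero]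
        rfl
      have e3 : (tpow (b (D.region (⟨i, m.succ⟩, .right)))).val *
          (tpow (-b (D.region (⟨i, D.overPos i m⟩, .right)))).val = 1 := by
        rw [hmul, hβ, hover]
        push_cast
        rw [show ∀ x y : ℚ, x - -y * 1 + -(x + y) = 0 by intros; ring, tpow_zero]
        rfl
      generalize (tpow ((-D.crossingSign c : ℤ) : ℚ)).val = τ at *
      generalize (tpow (b (D.region (⟨i, m.succ⟩, .right)))).val = X at *
      linear_combination X * hS - X * τ * hA - X * (1 - τ) * hO +
        (if m' = m.succ then 1 else 0) * e1 - (if m' = m.castSucc then 1 else 0) * e2 -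
        (1 - τ) * (if m' = D.overPos i m then 1 else 0) * e3
    · have ho : D.inEdge (c, true) ≠ ⟨i, m'⟩ := fun h => ht (congrArg Sigma.fst h)
      simp only [Bool.not_false, if_neg ht, mul_zero, sub_zero] at hβ
      rw [if_neg ho, D.passExponent_of_ne i ht, Int.cast_zero, tpow_zero]
      rw [hβ] at e1 hS ⊢
      generalize (tpow (b (D.region (⟨i, m.castSucc⟩, .right)))).val = X at *
      simp only [Units.val_one]
      linear_combination X * hS - X * hA +
        ((if m' = m.succ then 1 else 0) - (if m' = m.castSucc then 1 else 0)) * e1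
  · rw [D.coeff_of_over i (by rw [hp]), hin, ← mul_assoc, jumpSign_over_mul_under]
    simp only [D.mk_inj i, eq_comm (a := m.castSucc)]
    have e2 : (tpow (b (D.region (⟨i, m.succ⟩, .right)))).val *
        (tpow (-b (D.region (⟨i, m.castSucc⟩, .right)))).val =
          (tpow (D.passExponent i false c)).val := by
      rw [hmul, hβ, jumpSign_over, passExponent]
      congr 2
      by_cases hf : D.strand (c, false) = i
      · simp [hf]; ring
      · simp [hf]
    generalize (tpow (D.passExponent i false c)).val = τ at *
    generalize (tpow (b (D.region (⟨i, m.succ⟩, .right)))).val = X at *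
    linear_combination X * hS - X * hA + (if m' = m.succ then 1 else 0) * e1 -
      (if m' = m.castSucc then 1 else 0) * e2

theorem associated_upperBlock : Associated (D.upperBlock i).det
    (relMatrix (D.coeff i) (D.overPos i) (Pi.single (Fin.last _) 1)).det := by
  obtain ⟨b, -, hb⟩ := D.exists_numbering i ℤ
  let B : Fin (D.len i + 1) → ℚ := fun m => b (D.region (⟨i, m⟩, .right))
  let d : Fin (D.len i + 1) → (AddMonoidAlgebra ℤ ℚ)ˣ :=
    Fin.snoc (α := fun _ => (AddMonoidAlgebra ℤ ℚ)ˣ) (fun m => -tpow (B m.succ)) (tpow (B (Fin.last _)))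
  have h : D.upperBlock i = diagonal (fun e => (d e).val) *
      relMatrix (D.coeff i) (D.overPos i) (Pi.single (Fin.last _) 1) *
      diagonal fun e => (tpow (-B e)).val := by
    refine Matrix.ext fun e e' => ?_
    rw [mul_diagonal, diagonal_mul]
    induction e using Fin.lastCases with
    | last =>
      have h1 : d (Fin.last _) = tpow (B (Fin.last _)) := Fin.snoc_last (α := fun _ => _) _ _
      have h2 : (Pi.single (Fin.last _) 1 : Fin (D.len i + 1) → AddMonoidAlgebra ℤ ℚ) e' =
          if e' = Fin.last _ then 1 else 0 := Pi.single_apply ..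
      rw [upperBlock_last, relMatrix_last, h1, h2]
      split_ifs with h
      · rw [h, mul_one, ← Units.val_mul, ← tpow_add, add_neg_cancel, tpow_zero]; rfl
      · rw [mul_zero, zero_mul]
    | cast m =>
      have h1 : d m.castSucc = -tpow (B m.succ) := Fin.snoc_castSucc (α := fun _ => _) _ _ _
      rw [upperBlock_eq D i hb, relMatrix_castSucc, h1, Units.val_neg]
  have hu : ∀ f : Fin (D.len i + 1) → (AddMonoidAlgebra ℤ ℚ)ˣ,
      IsUnit (diagonal fun e => (f e).val).det := by
    intro f
    rw [det_diagonal, ← Units.coe_prod]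
    exact Units.isUnit _
  rw [h, det_mul, det_mul]
  exact (associated_mul_unit_left _ _ (hu fun e => tpow (-B e))).trans
    (associated_unit_mul_left _ _ (hu d))

/-- Upper and lower form reduce to the same relations up to units, so the state sum and its image
under inversion are associated. Both have Taylor polynomial one, so they are equal. -/
theorem invertRat_strandSum_eq : invertRat (D.strandSum i) = D.strandSum i := by
  have h1 := D.taylor_strandSum i
  refine eq_of_associated ?_ ?_ h1
  · refine (D.associated_upper i).trans ((D.associated_strandBlock i _ _ fun p hp => ?_).trans
      ((D.associated_upperBlock i).trans (D.associated_relMatrix i).symm))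
    obtain ⟨c, l⟩ := p
    cases l
    · left
      simp [D.passExponent_of_ne i hp, tpow_zero]
    · refine Or.inr (Or.inr ⟨rfl, ?_⟩)
      rw [← mul_assoc, jumpSign_over_mul_under]
      have : (1 + -1 * (1 - (tpow (D.passExponent i false c)).val)) =
        (tpow (D.passExponent i false c)).val := by ring
      rw [this]
      exact Units.isUnit _
  · obtain ⟨h2, h3⟩ := taylor_snd_invertRat (D.strandSum i)
    rw [h1] at h2 h3
    ext
    · exact h3
    · rw [h2]; simp

/-- The relation between the relations along strand `i`. -/
theorem exists_sum_relRow : ∃ (Λ : Fin (D.len i) → (AddMonoidAlgebra ℤ ℚ)ˣ)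
    (c : (AddMonoidAlgebra ℤ ℚ)ˣ) (c' : AddMonoidAlgebra ℤ ℚ),
    ∑ a, (Λ a).val • relRow (D.coeff i) (D.overPos i) a =
      c' • Pi.single (Fin.last _) 1 - c.val • Pi.single 0 1 := by
  obtain ⟨b, -, hb⟩ := D.exists_numbering i ℤ
  let B : Fin (D.len i + 1) → ℚ := fun m => b (D.region (⟨i, m⟩, .right))
  refine ⟨fun m => -tpow (B m.succ), -tpow (B 0), -(tpow (B (Fin.last _))).val, ?_⟩
  refine funext fun m' => ?_
  have h := D.sum_upperBlock i m'
  simp only [upperBlock_eq D i hb, ← Finset.sum_mul] at h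
  have h1 : (tpow (-B m')).val * (tpow (B m')).val = 1 := by
    rw [← Units.val_mul, ← tpow_add, neg_add_cancel, tpow_zero]; rfl
  have h2 := congrArg (· * (tpow (B m')).val) h
  simp only [mul_assoc] at h2
  rw [h1, mul_one] at h2
  rw [Finset.sum_apply]
  simp only [Pi.smul_apply, smul_eq_mul, Pi.sub_apply, Pi.single_apply, Units.val_neg]
  rw [h2]
  rcases eq_or_ne m' 0 with h3 | h3 <;> rcases eq_or_ne m' (Fin.last _) with h4 | h4
  · simp only [if_pos h3, if_pos h4]; rw [← h4, ← h3]; ring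
  · simp only [if_pos h3, if_neg h4]; rw [← h3]; ring
  · simp only [if_neg h3, if_pos h4]; rw [← h4]; ring
  · simp only [if_neg h3, if_neg h4]; ring

end Diagram
end StringLink

/-! ### Comparison with the Alexander matrix of the closure -/

namespace StringLink

theorem takeWhile_ne_eq_filter {α : Type*} [LinearOrder α] {L : List α} (hL : L.Pairwise (· < ·))
    {a : α} (ha : a ∈ L) : L.takeWhile (fun b => decide (b ≠ a)) = L.filter (fun b => decide (b < a)) := by
  induction L with
  | nil => simp at ha
  | cons b L ih =>
    rw [List.pairwise_cons] at hL
    rcases eq_or_ne b a with h | h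
    · subst h
      rw [List.takeWhile_cons_of_neg (by simp), List.filter_cons_of_neg (by simp), eq_comm,
        List.filter_eq_nil_iff]
      intro c hc
      simpa using (hL.1 c hc).le
    · have h1 : a ∈ L := by simpa [h.symm] using ha
      rw [List.takeWhile_cons_of_pos (by simpa using h),
        List.filter_cons_of_pos (by simpa using hL.1 a h1), ih hL.2 h1]

namespace Diagram

variable {k : ℕ} (D : Diagram k) (i : Fin k)

open Matrix

/-- The positions of the passages of strand `i` over and under itself. -/
def selfPositions : List (Fin (D.len i)) :=
  (List.finRange (D.len i)).filter fun m =>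
    D.strand ((D.passage ⟨i, m⟩).1, !(D.passage ⟨i, m⟩).2) = i

theorem closureCode_eq : D.closureCode i = (D.selfPositions i).map fun m => D.passage ⟨i, m⟩ := by
  rw [closureCode, List.ofFn_eq_map, List.filter_map]
  rfl

def underPositions : List (Fin (D.len i)) :=
  (D.selfPositions i).filter fun m => !(D.passage ⟨i, m⟩).2

theorem unders_closureCode :
    unders (D.closureCode i) = (D.underPositions i).map fun m => D.passage ⟨i, m⟩ := by
  rw [closureCode_eq, unders, List.filter_map]
  rfl

theorem selfPositions_pairwise : (D.selfPositions i).Pairwise (· < ·) :=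
  (List.pairwise_lt_finRange _).filter _

theorem underPositions_pairwise : (D.underPositions i).Pairwise (· < ·) :=
  (D.selfPositions_pairwise i).filter _

theorem mem_selfPositions {m} : m ∈ D.selfPositions i ↔
    D.strand ((D.passage ⟨i, m⟩).1, !(D.passage ⟨i, m⟩).2) = i := by
  simp [selfPositions]

theorem mem_underPositions {m} : m ∈ D.underPositions i ↔ (D.passage ⟨i, m⟩).2 = false ∧
    D.strand ((D.passage ⟨i, m⟩).1, true) = i := by
  rw [underPositions, List.mem_filter, mem_selfPositions]
  constructor
  · rintro ⟨h1, h2⟩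
    have h3 : (D.passage ⟨i, m⟩).2 = false := by simpa using h2
    rw [h3] at h1
    exact ⟨h3, h1⟩
  · rintro ⟨h1, h2⟩
    rw [h1]
    exact ⟨h2, rfl⟩

/-- The position on strand `i` of the passage that ends the `r`-th arc. -/
def underPosition (r : Fin (unders (D.closureCode i)).length) : Fin (D.len i) :=
  (D.underPositions i).get (r.cast (by rw [unders_closureCode, List.length_map]))

theorem underPosition_strictMono : StrictMono (D.underPosition i) := by
  intro r s h
  exact List.pairwise_iff_get.mp (D.underPositions_pairwise i) _ _ (by simpa using h)

theorem mem_range_underPosition {a} : a ∈ Set.range (D.underPosition i) ↔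
    a ∈ D.underPositions i := by
  constructor
  · rintro ⟨r, rfl⟩
    exact List.get_mem _ _
  · intro h
    obtain ⟨r, hr⟩ := List.get_of_mem h
    exact ⟨r.cast (by rw [unders_closureCode, List.length_map]), hr⟩

theorem passage_underPosition (r) : D.passage ⟨i, D.underPosition i r⟩ =
    (unders (D.closureCode i)).get r := by
  simp only [List.get_eq_getElem, unders_closureCode, List.getElem_map]
  rfl

theorem coeff_eq_zero {a} (ha : a ∉ Set.range (D.underPosition i)) : D.coeff i a = 0 := by
  rw [mem_range_underPosition, mem_underPositions, not_and_or] at ha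
  rcases ha with h | h
  · exact D.coeff_of_over i (by simpa using h)
  · exact D.coeff_of_ne i h

theorem arcIndex_underPosition (a : Fin (D.len i)) : arcIndex (D.underPosition i) a.castSucc =
    ((D.underPositions i).filter fun b => decide (b < a)).length := by
  classical
  rw [arcIndex, ← Finset.card_image_of_injective _ (D.underPosition_strictMono i).injective,
    ← List.toFinset_card_of_nodup
      (((D.underPositions_pairwise i).imp (fun h => h.ne)).filter _)]
  congr 1
  ext b
  simp only [Finset.mem_image, Finset.mem_filter, Finset.mem_univ, true_and, List.mem_toFinset,
    List.mem_filter, decide_eq_true_eq, Fin.castSucc_lt_castSucc_iff,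
    ← mem_range_underPosition, Set.mem_range]
  constructor
  · rintro ⟨r, h, rfl⟩
    exact ⟨⟨r, rfl⟩, h⟩
  · rintro ⟨⟨r, rfl⟩, h⟩
    exact ⟨r, h, rfl⟩

/-- Both sides count the under self-passages before the passage over the crossing. The modulus
accounts for the closing arc, which joins the last arc of the strand to the first. -/
theorem overArc_eq (r) : overArc (D.closureCode i) ((unders (D.closureCode i)).get r).1 =
    arcIndex (D.underPosition i) (D.overPos i (D.underPosition i r)) %
      (unders (D.closureCode i)).length := by
  rw [← passage_underPosition, overArc]
  congr 1
  have h1 := (D.mem_underPositions i).mp ((D.mem_range_underPosition i).mp ⟨r, rfl⟩)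
  obtain ⟨c, hc⟩ : ∃ c, (D.passage ⟨i, D.underPosition i r⟩).1 = c := ⟨_, rfl⟩
  have ho := D.inEdge_overPos i _ h1.2
  rw [hc] at ho h1 ⊢
  obtain ⟨a, ha⟩ : ∃ a, D.overPos i (D.underPosition i r) = Fin.castSucc a := by
    refine ⟨(D.overPos i (D.underPosition i r)).castPred ?_, (Fin.castSucc_castPred _ _).symm⟩
    intro h
    rw [h] at ho
    exact D.inEdge_ne_lastEdge _ i ho
  rw [ha] at ho ⊢
  have hp : (c, true) = D.passage ⟨i, a⟩ := (D.inEdge_eq_iff i _ a).mp ho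
  have hm : a ∈ D.selfPositions i := by
    rw [mem_selfPositions, ← hp]
    have h2 := D.strand_passage i (D.underPosition i r)
    have h3 : D.passage ⟨i, D.underPosition i r⟩ = (c, false) := Prod.ext hc h1.1
    rw [h3] at h2
    exact h2
  have h4 : (fun m => decide (D.passage ⟨i, m⟩ ≠ (c, true))) = fun m => decide (m ≠ a) := by
    funext m
    rw [hp]
    simp
  rw [arcIndex_underPosition, closureCode_eq, List.takeWhile_map, unders, List.filter_map,
    List.length_map]
  change (List.filter _ (List.takeWhile (fun m => decide (D.passage ⟨i, m⟩ ≠ (c, true))) _)).length = _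
  rw [h4, takeWhile_ne_eq_filter (D.selfPositions_pairwise i) hm, underPositions, List.filter_filter,
    List.filter_filter]
  congr 2
  funext m
  exact Bool.and_comm _ _

/-- Up to a unit, the rows of the Alexander matrix are those of the matrix of arcs. -/
theorem ofLaurent_alexanderMatrix (r s : Fin (unders (D.closureCode i)).length) (hs : (s : ℕ) ≠ 0) :
    ofLaurent (alexanderMatrix D.positive (D.closureCode i) r s) =
      (if D.positive ((unders (D.closureCode i)).get r).1 then tpow 1 else -1 :
        (AddMonoidAlgebra ℤ ℚ)ˣ).val *
      arcMatrix (D.coeff i) (D.overPos i) (D.underPosition i) r s := by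
  -- Reduction modulo the number of arcs only changes the index of the last arc, to `0`. Away from
  -- column `0`, identifying it with the first arc is the same as setting it to zero.
  have hmod : ∀ x, x ≤ (unders (D.closureCode i)).length →
      ((s : ℕ) = x % (unders (D.closureCode i)).length ↔ x = s) := by
    intro x hx
    rcases hx.lt_or_eq with h | h
    · rw [Nat.mod_eq_of_lt h, eq_comm]
    · rw [h, Nat.mod_self]
      have := s.isLt
      constructor <;> intro h <;> omega
  have h1 := (D.mem_underPositions i).mp ((D.mem_range_underPosition i).mp ⟨r, rfl⟩)
  have hm := D.underPosition_strictMono i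
  rw [arcMatrix_apply, relRow_dotProduct, arcIndex_castSucc hm, arcIndex_succ hm, coeff,
    if_pos h1.1, alexanderMatrix, of_apply, passExponent, if_pos h1.2, passage_underPosition]
  simp only [overArc_eq, hmod _ (arcIndex_le _), hmod _ (show (r : ℕ) + 1 ≤ _ from r.isLt)]
  rw [crossingSign]
  have e1 : ∀ n : ℤ, (tpow (n : ℚ)).val = ofLaurent (LaurentPolynomial.T n) := fun n =>
    (ofLaurent_T n).symm
  have e2 : (s = r) ↔ ((r : ℕ) = s) := by rw [Fin.ext_iff, eq_comm]
  have e3 : ofLaurent (LaurentPolynomial.T 1) * ofLaurent (LaurentPolynomial.T (-1)) = 1 := by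
    rw [← map_mul, ← LaurentPolynomial.T_add]; simp
  have e4 : (tpow 1).val = ofLaurent (LaurentPolynomial.T 1) := by exact_mod_cast e1 1
  rw [e1]
  simp only [e2, map_add]
  by_cases hp : D.positive ((unders (D.closureCode i)).get r).1 = true
  · simp only [hp, if_true, e4, apply_ite ofLaurent, map_sub, map_neg, map_one, map_zero]
    generalize ofLaurent (LaurentPolynomial.T 1) = t at *
    generalize ofLaurent (LaurentPolynomial.T (-1)) = t' at *
    split_ifs <;> first | linear_combination e3 | linear_combination -e3 | ring
  · simp only [hp, apply_ite ofLaurent, map_sub, map_neg, map_one, map_zero]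
    simp only [Bool.false_eq_true, if_false, neg_neg, Units.val_neg, Units.val_one]
    split_ifs <;> ring

/-- The discarded column is the only one in which the two matrices may differ by more than a unit
factor of each row. With no self-crossing both determinants are empty, hence one. -/
theorem associated_minor {u : ℕ} {m : Fin u → Fin (D.len i)} (hm : StrictMono m)
    (hθ : ∀ a, a ∉ Set.range m → D.coeff i a = 0) (v : Fin u → (AddMonoidAlgebra ℤ ℚ)ˣ)
    (M : Matrix (Fin u) (Fin u) ℤ[T;T⁻¹])
    (hM : ∀ r s : Fin u, (s : ℕ) ≠ 0 →
      ofLaurent (M r s) = (v r).val * arcMatrix (D.coeff i) (D.overPos i) m r s)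
    (f : Fin (u - 1) → Fin u) (hf : ∀ r, (f r : ℕ) = r + 1) :
    Associated (arcMatrix (D.coeff i) (D.overPos i) m).det
      (ofLaurent.mapMatrix (M.submatrix f f)).det := by
  cases u with
  | zero =>
    have : IsEmpty (Fin (0 - 1)) := inferInstanceAs (IsEmpty (Fin 0))
    rw [det_isEmpty, det_isEmpty]
  | succ u =>
    obtain ⟨Λ, c, c', hΛ⟩ := D.exists_sum_relRow i
    refine (associated_arcMatrix_minor _ _ hθ hm Λ c c' hΛ).trans ?_
    have hf' : f = Fin.succ := funext fun r => Fin.ext (hf r)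
    have h1 : ofLaurent.mapMatrix (M.submatrix f f) =
        Matrix.of fun r s => (v (Fin.succ r)).val *
          (arcMatrix (D.coeff i) (D.overPos i) m).submatrix Fin.succ Fin.succ r s := by
      refine Matrix.ext fun r s => ?_
      rw [hf']
      exact hM (Fin.succ r) (Fin.succ s) (Nat.succ_ne_zero _)
    refine Associated.trans ?_ (Associated.of_eq (congrArg det h1).symm)
    have h2 := det_mul_column (fun r : Fin u => (v (Fin.succ r)).val)
      ((arcMatrix (D.coeff i) (D.overPos i) m).submatrix Fin.succ Fin.succ)
    rw [← Units.coe_prod] at h2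
    refine Associated.trans ?_ (Associated.of_eq h2.symm)
    exact (associated_unit_mul_left _ _ (Units.isUnit _)).symm

/-- The minor of the Alexander matrix, up to a unit. -/
theorem associated_alexanderMinor :
    Associated (D.strandSum i) (ofLaurent (alexanderMinor D.positive (D.closureCode i))) := by
  have hm := D.underPosition_strictMono i
  have hθ : ∀ a, a ∉ Set.range (D.underPosition i) → D.coeff i a = 0 := fun a ha =>
    D.coeff_eq_zero i ha
  rw [alexanderMinor, RingHom.map_det]
  exact ((D.associated_relMatrix i).trans (associated_arcMatrix (D.coeff i) (D.overPos i) hm hθ)).trans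
    (D.associated_minor i hm hθ _ _ (D.ofLaurent_alexanderMatrix i) _ fun _ => rfl)

theorem exists_ofLaurent_eq : ∃ Δ : ℤ[T;T⁻¹], ofLaurent Δ = D.strandSum i := by
  choose m hm using D.filtration_integer i
  refine ⟨∑ x : D.State, (((D.grading x).negOnePow : ℤ) : ℤ[T;T⁻¹]) * LaurentPolynomial.T (m x), ?_⟩
  rw [strandSum_eq, map_sum]
  refine Finset.sum_congr rfl fun x _ => ?_
  rw [map_mul, map_intCast, ofLaurent_T, hm]

theorem taylor_snd_ofLaurent (f : ℤ[T;T⁻¹]) : ∃ n : ℤ, (taylor (ofLaurent f)).snd = n := by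
  induction f using LaurentPolynomial.induction_on' with
  | add f g hf hg =>
    obtain ⟨a, ha⟩ := hf
    obtain ⟨b, hb⟩ := hg
    exact ⟨a + b, by simp [ha, hb]⟩
  | C_mul_T n a =>
    refine ⟨a * n, ?_⟩
    rw [map_mul, map_mul, ofLaurent_T, taylor_tpow]
    simp

/-- The connecting unit is `±t^q`. Since the derivative of `f` at one is an integer and its value is
`±1`, the condition on `g` makes `q` an integer, so the unit is a Laurent monomial. -/
theorem associated_of_ofLaurent {f g : ℤ[T;T⁻¹]} (h : Associated (ofLaurent f) (ofLaurent g))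
    (hg : taylor (ofLaurent g) = 1) : Associated f g := by
  obtain ⟨u, hu⟩ := h
  obtain ⟨q, ε, hq⟩ := isUnit_iff_tpow u.isUnit
  obtain ⟨n, hn⟩ := taylor_snd_ofLaurent f
  have h1 := hg
  rw [← hu, hq, map_mul, map_mul, map_intCast, taylor_tpow] at h1
  have h2 := congrArg TrivSqZeroExt.fst h1
  have h3 := congrArg TrivSqZeroExt.snd h1
  simp [hn] at h2 h3
  have hε : ((ε : ℤ) : ℚ) * ((ε : ℤ) : ℚ) = 1 := by exact_mod_cast Int.units_coe_mul_self ε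
  have h4 : q = (-(ε * n) : ℤ) := by
    push_cast
    linear_combination h3 - q * h2
  let w : ℤ[T;T⁻¹]ˣ := ⟨LaurentPolynomial.T (-(ε * n)), LaurentPolynomial.T (ε * n),
    by rw [← LaurentPolynomial.T_add, neg_add_cancel, LaurentPolynomial.T_zero],
    by rw [← LaurentPolynomial.T_add, add_neg_cancel, LaurentPolynomial.T_zero]⟩
  refine ⟨Units.map (Int.castRingHom ℤ[T;T⁻¹]).toMonoidHom ε * w, ofLaurent_injective ?_⟩
  rw [← hu, hq, h4, map_mul, Units.val_mul, map_mul, ← ofLaurent_T]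
  congr 2
  exact map_intCast _ _

/-- The state sum is associated to the minor, symmetric and has value one at one. Conversely, these
conditions determine a polynomial, because its Taylor polynomial is one. -/
theorem isAlexanderConway_iff (Δ : ℤ[T;T⁻¹]) :
    IsAlexanderConway D.positive (D.closureCode i) Δ ↔ ofLaurent Δ = D.strandSum i := by
  have h0 := D.taylor_strandSum i
  constructor
  · rintro ⟨h1, h2, h3⟩
    refine eq_of_associated ?_ (taylor_ofLaurent_eq_one h2 h3) h0
    exact ((D.associated_alexanderMinor i).trans (h1.map ofLaurent)).symm
  · intro h
    refine ⟨associated_of_ofLaurent ?_ ?_, ?_, ?_⟩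
    · rw [h]
      exact (D.associated_alexanderMinor i).symm
    · rw [h, h0]
    · apply ofLaurent_injective
      rw [ofLaurent_invert, h, invertRat_strandSum_eq]
    · have h1 := taylor_fst_ofLaurent Δ
      rw [h, h0, TrivSqZeroExt.fst_one] at h1
      exact_mod_cast h1.symm

theorem existsUnique_isAlexanderConway :
    ∃! Δ : ℤ[T;T⁻¹], IsAlexanderConway D.positive (D.closureCode i) Δ := by
  simp only [isAlexanderConway_iff]
  obtain ⟨Δ, hΔ⟩ := D.exists_ofLaurent_eq i
  exact ⟨Δ, hΔ, fun Δ' h => ofLaurent_injective (h.trans hΔ.symm)⟩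

end Diagram
end StringLink

/-! ### Chains on the Heegaard surface as functions on gaps -/

namespace StringLink
namespace Diagram

variable {k : ℕ} (D : Diagram k) (i : Fin k)

/-- On one edge side the ranks separate the kinds of points: a tube has `2`, the finger `1` and `3`,
a change of sheet `0` or `4` according to the end of the edge, and a corner `5`. -/
theorem place_injective : Function.Injective (D.place i) := by
  have hu : ∀ {u u' : D.UnderPos i}, (⟨i, u.1.castSucc⟩ : D.Edge) = ⟨i, u'.1.castSucc⟩ → u = u' := by
    intro u u' h
    exact Subtype.ext (Fin.castSucc_injective _ ((D.mk_inj i).mp h))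
  have hu' : ∀ {u u' : D.UnderPos i}, (⟨i, u.1.succ⟩ : D.Edge) = ⟨i, u'.1.succ⟩ → u = u' := by
    intro u u' h
    exact Subtype.ext (Fin.succ_injective _ ((D.mk_inj i).mp h))
  rintro (⟨c, q⟩ | ⟨e, s⟩ | u | u | _ | _) (⟨c', q'⟩ | ⟨e', s'⟩ | u' | u' | _ | _) h <;>
    simp only [place, Prod.mk.injEq] at h
  all_goals first
  | rfl
  | (obtain ⟨h1, h2⟩ := D.arrival_injective h.1; rw [h1, h2])
  | (rw [h.1.1, h.1.2]; done)
  | (rw [hu h.1.1])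
  | (rw [hu' h.1.1])
  | (exfalso; have h2 := h.2; split_ifs at h2 <;> omega)
  | (exfalso; obtain ⟨⟨_, h1⟩, h2⟩ := h; rw [h1] at h2; split_ifs at h2)
  | exact absurd h.2 (by norm_num)

theorem place_le (p : D.BetaPoint i) : (D.place i p).2 ≤ 5 := by
  rcases p with ⟨c, q⟩ | ⟨e, s⟩ | u | u | _ | _ <;> simp only [place] <;> (try split_ifs) <;> simp

variable {X : Type*}

/-- A function on the gaps between the intersection points on the `β`-curves on both sheets: gap `n`
of an edge side comes before the point of rank `n`. -/
abbrev GapFunction (X : Type*) : Type _ := D.EdgeSide → ℕ → Bool → X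

variable {D} in
/-- The value on the gap after a point. -/
def GapFunction.after (G : D.GapFunction X) (a : D.EdgeSide × ℕ) (u : Bool) : X :=
  if a.2 = 5 then G (D.next a.1) 0 u else G a.1 (a.2 + 1) u

variable {D} in
/-- The values at the four corners at a point of a `β`-curve. -/
def GapFunction.atPoint (G : D.GapFunction X) (a : D.EdgeSide × ℕ) : Fin 4 → X :=
  ![G.after a false, G a.1 a.2 false, G a.1 a.2 true, G.after a true]

variable {D} in
/-- The values at the four corners at an intersection point with `λ` on a tube. -/
def GapFunction.atMid (G : D.GapFunction X) (m : Fin (D.len i + 1)) : Fin 4 → X :=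
  if m = Fin.last _ then ![G (⟨i, m⟩, .right) 2 false, G (⟨i, m⟩, .right) 3 false,
    G (⟨i, m⟩, .left) 2 false, G (⟨i, m⟩, .left) 3 false]
  else ![G (⟨i, m⟩, .left) 3 true, G (⟨i, m⟩, .left) 2 true, G (⟨i, m⟩, .right) 3 true,
    G (⟨i, m⟩, .right) 2 true]

variable {D} in
/-- The value at a corner. -/
noncomputable def GapFunction.value (G : D.GapFunction X) : D.Dart i → X
  | (.pt p, a) => G.atPoint (D.place i p) a
  | (.mid m, a) => G.atMid i m a

variable {D} in
/-- The function is constant on gaps that are not separated by a point. -/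
structure GapFunction.Consistent (G : D.GapFunction X) : Prop where
  skip : ∀ a n u, n < 5 → (∀ p, D.place i p ≠ (a, n)) → G a n u = G a (n + 1) u
  last : ∀ a u, (∀ p, D.place i p ≠ (a, 5)) → G a 5 u = G (D.next a) 0 u

/-- Corners on the two sides of a `β`-arc on one sheet are read off from the same gap. Corners at
points inside a tube are carried to gaps along the curves `κ_e`. -/
theorem exists_gapFunction (P : D.Face i → X) :
    ∃ G : D.GapFunction X, G.Consistent i ∧ ∀ d, P (Quot.mk _ d) = G.value i d := by
  classical
  let S : D.EdgeSide → ℕ → Prop := fun a n => ∃ p, D.place i p = (a, n)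
  have htube : ∀ a : D.EdgeSide, D.place i (.tube a.1 a.2) = (a, 2) := fun a => rfl
  have hnext : ∀ p q, D.BetaNext i p q → ∀ u : Bool,
      P (Quot.mk _ (.pt p, if u then 3 else 0)) = P (Quot.mk _ (.pt q, if u then 2 else 1)) := by
    intro p q h u
    cases u
    · exact congrArg P (Quot.sound (SameFace.leftSide _ _ 0 2 (.beta p q h)))
    · exact congrArg P (Quot.sound (SameFace.rightSide _ _ 0 2 (.beta p q h)))
  -- the last point of an edge side
  have hlast : ∀ a, ∃ p, (D.place i p).1 = a ∧
      ∀ r, (D.place i r).1 = a → (D.place i r).2 ≤ (D.place i p).2 := by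
    intro a
    have h1 : ∃ n, S a (5 - n) := ⟨3, .tube a.1 a.2, rfl⟩
    obtain ⟨p, hp⟩ := Nat.find_spec h1
    refine ⟨p, by rw [hp], fun r hr => ?_⟩
    have h2 := Nat.find_min' h1 (m := 5 - (D.place i r).2)
      ⟨r, by have := D.place_le i r; rw [Nat.sub_sub_self this, ← hr]⟩
    have := D.place_le i r
    rw [hp]
    simp only
    omega
  choose l hl1 hl2 using hlast
  let back : D.BetaPoint i → Bool → X := fun p u => P (Quot.mk _ (.pt p, if u then 2 else 1))
  let fwd : D.BetaPoint i → Bool → X := fun p u => P (Quot.mk _ (.pt p, if u then 3 else 0))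
  -- The value behind the first point of rank at least `n`, or, if there is none on this edge side,
  -- the value ahead of its last point.
  let G : D.GapFunction X := fun a n u =>
    if h : ∃ m, n ≤ m ∧ S a m then back (Nat.find_spec h).2.choose u else fwd (l a) u
  have hG1 : ∀ p n u, n ≤ (D.place i p).2 →
      (∀ r, (D.place i r).1 = (D.place i p).1 → n ≤ (D.place i r).2 →
        (D.place i p).2 ≤ (D.place i r).2) → G (D.place i p).1 n u = back p u := by
    intro p n u hn hmin
    have h : ∃ m, n ≤ m ∧ S (D.place i p).1 m := ⟨_, hn, p, rfl⟩
    have h1 : G (D.place i p).1 n u = back (Nat.find_spec h).2.choose u := dif_pos h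
    have h2 := (Nat.find_spec h).2.choose_spec
    have h3 : Nat.find h = (D.place i p).2 := by
      apply le_antisymm
      · exact Nat.find_min' h ⟨hn, p, rfl⟩
      · have := hmin (Nat.find_spec h).2.choose (by rw [h2]) (by rw [h2]; exact (Nat.find_spec h).1)
        rwa [h2] at this
    have h4 : (Nat.find_spec h).2.choose = p := by
      apply D.place_injective i
      rw [h2, h3]
    rw [h1, h4]
  have hG2 : ∀ a n u, (∀ r, (D.place i r).1 = a → (D.place i r).2 < n) → G a n u = fwd (l a) u := by
    intro a n u h
    refine dif_neg ?_
    rintro ⟨m, hm, p, hp⟩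
    have := h p (by rw [hp])
    rw [hp] at this
    exact absurd hm (not_le.mpr this)
  have hfirst : ∀ a u, fwd (l a) u = G (D.next a) 0 u := by
    intro a u
    have h : ∃ m, 0 ≤ m ∧ S (D.next a) m := ⟨2, by omega, .tube (D.next a).1 (D.next a).2, rfl⟩
    obtain ⟨q, hq⟩ := (Nat.find_spec h).2
    have hmin : ∀ r, (D.place i r).1 = D.next a → (D.place i q).2 ≤ (D.place i r).2 := by
      intro r hr
      rw [hq]
      exact Nat.find_min' h ⟨Nat.zero_le _, r, by rw [← hr]⟩
    have h1 := hG1 q 0 u (Nat.zero_le _) fun r hr _ => hmin r (by rw [hr, hq])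
    rw [hq] at h1
    simp only at h1
    rw [h1]
    refine hnext _ _ (Or.inr ⟨?_, ?_, ?_⟩) u
    · rw [hq, hl1]
    · intro r hr; exact hl2 a r (by rw [hr, hl1])
    · intro r hr; exact hmin r (by rw [hr, hq])
  have hcons : G.Consistent i := by
    constructor
    · intro a n u hn hp
      have key : (∃ m, n ≤ m ∧ S a m) ↔ ∃ m, n + 1 ≤ m ∧ S a m := by
        constructor
        · rintro ⟨m, hm, p, hpm⟩
          refine ⟨m, ?_, p, hpm⟩
          rcases hm.lt_or_eq with h | h
          · exact h
          · subst h; exact absurd hpm (hp p)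
        · rintro ⟨m, hm, h⟩
          exact ⟨m, by omega, h⟩
      by_cases h : ∃ m, n ≤ m ∧ S a m
      · obtain ⟨q, hq⟩ := (Nat.find_spec h).2
        have h1 : (D.place i q).1 = a := by rw [hq]
        have h2 : n < (D.place i q).2 := by
          have h3 : n ≤ (D.place i q).2 := by rw [hq]; exact (Nat.find_spec h).1
          rcases h3.lt_or_eq with h4 | h4
          · exact h4
          · exact absurd (by rw [h4]; rw [← h1]) (hp q)
        have h3 : ∀ r, (D.place i r).1 = (D.place i q).1 → n ≤ (D.place i r).2 →
            (D.place i q).2 ≤ (D.place i r).2 := by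
          intro r hr hn'
          rw [hq]
          exact Nat.find_min' h ⟨hn', r, by rw [← h1, ← hr]⟩
        rw [← h1, hG1 q n u h2.le h3, hG1 q (n + 1) u h2 fun r hr hn' => h3 r hr (by omega)]
      · have h' := h
        rw [key] at h'
        have e1 : G a n u = fwd (l a) u := dif_neg h
        have e2 : G a (n + 1) u = fwd (l a) u := dif_neg h'
        rw [e1, e2]
    · intro a u hp
      rw [← hfirst]
      apply hG2
      intro r hr
      have := D.place_le i r
      rcases this.lt_or_eq with h | h
      · exact h
      · exact absurd (by rw [← hr, ← h]) (hp r)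
  have hback : ∀ p u, back p u = G (D.place i p).1 (D.place i p).2 u := fun p u =>
    (hG1 p _ u le_rfl fun r _ h => h).symm
  have hfwd : ∀ p u, fwd p u = G.after (D.place i p) u := by
    intro p u
    by_cases h : ∃ m, (D.place i p).2 + 1 ≤ m ∧ S (D.place i p).1 m
    · obtain ⟨q, hq⟩ := (Nat.find_spec h).2
      have h1 : (D.place i q).1 = (D.place i p).1 := by rw [hq]
      have h2 : (D.place i p).2 + 1 ≤ (D.place i q).2 := by rw [hq]; exact (Nat.find_spec h).1
      have h3 : ∀ r, (D.place i r).1 = (D.place i q).1 → (D.place i p).2 + 1 ≤ (D.place i r).2 →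
          (D.place i q).2 ≤ (D.place i r).2 := by
        intro r hr hn'
        rw [hq]
        exact Nat.find_min' h ⟨hn', r, by rw [← h1, ← hr]⟩
      have h4 : (D.place i p).2 ≠ 5 := by have := D.place_le i q; omega
      rw [GapFunction.after, if_neg h4, ← h1, hG1 q _ u h2 h3]
      refine hnext _ _ (Or.inl ⟨h1, h2, fun r hr hr' => ?_⟩) u
      have := h3 r (by rw [hr, h1]) hr'.1
      omega
    · have h1 : ∀ r, (D.place i r).1 = (D.place i p).1 → (D.place i r).2 ≤ (D.place i p).2 := by
        intro r hr
        by_contra h'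
        exact h ⟨(D.place i r).2, by omega, r, by rw [← hr]⟩
      have h2 : l (D.place i p).1 = p := by
        apply D.place_injective i
        have h3 := hl1 (D.place i p).1
        refine Prod.ext h3 (le_antisymm (h1 _ h3) (hl2 _ p rfl))
      rw [GapFunction.after]
      split_ifs with h5
      · rw [← hfirst, h2]
      · rw [hG2 _ _ _ fun r hr => Nat.lt_succ_of_le (h1 r hr), h2]
  have hpt : ∀ p a, P (Quot.mk _ (.pt p, a)) = G.value i (.pt p, a) := by
    intro p a
    fin_cases a
    · exact hfwd p false
    · exact hback p false
    · exact hback p true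
    · exact hfwd p true
  refine ⟨G, hcons, ?_⟩
  rintro ⟨p | m, a⟩
  · exact hpt p a
  · have hl : ∀ v w a b, D.Glued i (v, a) (w, b) → P (Quot.mk _ (v, a)) = P (Quot.mk _ (w, b - 1)) :=
      fun v w a b h => congrArg P (Quot.sound (SameFace.leftSide v w a b h))
    have hr : ∀ v w a b, D.Glued i (v, a) (w, b) → P (Quot.mk _ (v, a - 1)) = P (Quot.mk _ (w, b)) :=
      fun v w a b h => congrArg P (Quot.sound (SameFace.rightSide v w a b h))
    by_cases hm : m = Fin.last _
    · subst hm
      have e1 := Glued.last_lower_left (D := D) (i := i)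
      have e2 := Glued.last_lower_right (D := D) (i := i)
      change P _ = G.atMid i (Fin.last _) a
      rw [GapFunction.atMid, if_pos rfl]
      fin_cases a
      · exact (hr _ _ _ _ e2).trans (hpt _ _)
      · exact (hl _ _ _ _ e2).trans (hpt _ _)
      · exact (hl _ _ _ _ e1).symm.trans (hpt _ _)
      · exact (hr _ _ _ _ e1).symm.trans (hpt _ _)
    · have e1 := Glued.tube_upper_left (D := D) (i := i) m hm
      have e2 := Glued.tube_upper_right (D := D) (i := i) m hm
      change P _ = G.atMid i m a
      rw [GapFunction.atMid, if_neg hm]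
      fin_cases a
      · exact (hl _ _ _ _ e1).symm.trans (hpt _ _)
      · exact (hr _ _ _ _ e1).symm.trans (hpt _ _)
      · exact (hr _ _ _ _ e2).trans (hpt _ _)
      · exact (hl _ _ _ _ e2).trans (hpt _ _)

end Diagram
end StringLink

/-! ### Gluing conditions along the strips of the sheets -/

namespace StringLink
namespace Diagram

variable {k : ℕ} (D : Diagram k) (i : Fin k)

/-- The edge of a passage that comes before (`h = true`, it arrives with its head) or after it. -/
def endEdge (p : Fin D.numCrossings × Bool) (h : Bool) : D.Edge :=
  if h then D.inEdge p else D.outEdge p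

theorem endEdge_true (p) : D.endEdge p true = D.inEdge p := rfl
theorem endEdge_false (p) : D.endEdge p false = D.outEdge p := rfl

theorem endEdge_fst (p h) : (D.endEdge p h).1 = D.strand p := by cases h <;> rfl

/-- The side of the tube on which `λ` changes the sheet before (`h = true`) and after the under
passage of `c`. -/
def dipSide (c : Fin D.numCrossings) (h : Bool) : Side :=
  if D.strand (c, true) = i ∧ D.positive c = h then .left else .right

/-- The number of the gap on the half of an edge side towards the head (`h = true`) or the tail of
the edge; the gaps on this half are numbered from `0` to `2`, starting at the tube. -/
def gapNum : Bool → Side → ℕ → ℕ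
  | true, .left, t => 3 + t
  | true, .right, t => 2 - t
  | false, .left, t => 2 - t
  | false, .right, t => 3 + t

/-- The gaps on the two sides of the place where `λ` goes to the lower sheet, the one on the left
side of `λ` before the one on the right side. -/
def dipGap : Side → Side → ℕ
  | .left, .left => 1
  | .left, .right => 2
  | .right, .left => 2
  | .right, .right => 1

variable {D} {X : Type*}

def GapFunction.half (G : D.GapFunction X) (e : D.Edge) (h : Bool) (s : Side) (t : ℕ) (u : Bool) : X :=
  G (e, s) (gapNum h s t) u

/-- The value on the upper sheet on the side `s` of `λ`, where `λ` enters (`h = false`) or leaves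
(`h = true`) the edge `e`. -/
def GapFunction.beside (G : D.GapFunction X) (e : D.Edge) (h : Bool) (s : Side) : X :=
  if e = D.lastEdge i then G.half e h .left (if s = .left then 1 else 0) true else G.half e h s 0 true

/-- The function is constant on gaps that are connected by strips of the sheets. -/
structure GapFunction.Compatible (G : D.GapFunction X) : Prop where
  tube : ∀ e : D.Edge, e.1 ≠ i → ∀ h u, G.half e h .left 0 u = G.half e h .right 0 u
  tube_lower : ∀ m : Fin (D.len i + 1), m ≠ Fin.last _ → ∀ h,
    G.half ⟨i, m⟩ h .left 0 false = G.half ⟨i, m⟩ h .right 0 false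
  tube_last : ∀ h, G.half (D.lastEdge i) h .left 0 true = G.half (D.lastEdge i) h .right 0 true
  finger : ∀ h, G.half (D.lastEdge i) h .left 1 false = G.half (D.lastEdge i) h .right 0 false
  straight : ∀ c u s,
    G.half (D.inEdge (c, u)) true s 2 u = G.half (D.outEdge (c, u)) false s 2 u
  cap : ∀ c u h,
    G.half (D.endEdge (c, !u) h) h .left 2 u = G.half (D.endEdge (c, !u) h) h .right 2 u
  close : ∀ s, G.beside i (D.lastEdge i) true s = G.beside i (D.firstEdge i) false s
  passOver : ∀ c, D.strand (c, true) = i → ∀ s,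
    G.beside i (D.inEdge (c, true)) true s = G.beside i (D.outEdge (c, true)) false s
  dip : ∀ c, D.strand (c, false) = i → ∀ h s, G.beside i (D.endEdge (c, false) h) h s =
    G.half (D.endEdge (c, false) h) h (D.dipSide i c h) (dipGap (D.dipSide i c h) s) true
  under : ∀ c, D.strand (c, false) = i → ∀ s,
    G.half (D.inEdge (c, false)) true (D.dipSide i c true) (dipGap (D.dipSide i c true) s) false =
      G.half (D.outEdge (c, false)) false (D.dipSide i c false) (dipGap (D.dipSide i c false) s) false

section Dips

variable (D)

theorem exists_underPos {c} (hc : D.strand (c, false) = i) : ∃ u : D.UnderPos i,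
    D.passage ⟨i, u.1⟩ = (c, false) := by
  obtain ⟨⟨j, m⟩, hm⟩ := D.passage.surjective (c, false)
  have : j = i := by rw [← hc, GaussData.strand, ← hm]; simp
  subst this
  exact ⟨⟨m, by rw [hm]⟩, hm⟩

theorem passage_underPos (u : D.UnderPos i) : ∃ c, D.passage ⟨i, u.1⟩ = (c, false) :=
  ⟨(D.passage ⟨i, u.1⟩).1, Prod.ext rfl u.2⟩

theorem dipInSide_eq {u : D.UnderPos i} {c} (h : D.passage ⟨i, u.1⟩ = (c, false)) :
    D.dipInSide i u = D.dipSide i c true := by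
  unfold dipInSide dipSide IsSelf
  rw [h]
  congr

theorem dipOutSide_eq {u : D.UnderPos i} {c} (h : D.passage ⟨i, u.1⟩ = (c, false)) :
    D.dipOutSide i u = D.dipSide i c false := by
  unfold dipOutSide dipSide IsSelf
  rw [h]
  congr

theorem underPos_in {u : D.UnderPos i} {c} (h : D.passage ⟨i, u.1⟩ = (c, false)) :
    (⟨i, u.1.castSucc⟩ : D.Edge) = D.inEdge (c, false) := by
  rw [← D.inEdge_passage, h]

theorem underPos_out {u : D.UnderPos i} {c} (h : D.passage ⟨i, u.1⟩ = (c, false)) :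
    (⟨i, u.1.succ⟩ : D.Edge) = D.outEdge (c, false) := by
  rw [← D.outEdge_passage, h]

theorem place_dipIn {u : D.UnderPos i} {c} (h : D.passage ⟨i, u.1⟩ = (c, false)) :
    D.place i (.dipIn u) = ((D.inEdge (c, false), D.dipSide i c true),
      if D.dipSide i c true = .left then 4 else 0) := by
  rw [place, D.dipInSide_eq i h, D.underPos_in i h]

theorem place_dipOut {u : D.UnderPos i} {c} (h : D.passage ⟨i, u.1⟩ = (c, false)) :
    D.place i (.dipOut u) = ((D.outEdge (c, false), D.dipSide i c false),
      if D.dipSide i c false = .left then 0 else 4) := by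
  rw [place, D.dipOutSide_eq i h, D.underPos_out i h]

end Dips

theorem GapFunction.value_dipIn (G : D.GapFunction X) {u : D.UnderPos i} {c}
    (h : D.passage ⟨i, u.1⟩ = (c, false)) (a : Fin 4) : G.value i (.pt (.dipIn u), a) =
      G.half (D.inEdge (c, false)) true (D.dipSide i c true)
        (dipGap (D.dipSide i c true) (![Side.right, .left, .left, .right] a))
          (![false, false, true, true] a) := by
  rw [value, D.place_dipIn i h]
  cases D.dipSide i c true <;> fin_cases a <;> rfl

theorem GapFunction.value_dipOut (G : D.GapFunction X) {u : D.UnderPos i} {c}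
    (h : D.passage ⟨i, u.1⟩ = (c, false)) (a : Fin 4) : G.value i (.pt (.dipOut u), a) =
      G.half (D.outEdge (c, false)) false (D.dipSide i c false)
        (dipGap (D.dipSide i c false) (![Side.left, .right, .right, .left] a))
          (![false, false, true, true] a) := by
  rw [value, D.place_dipOut i h]
  cases D.dipSide i c false <;> fin_cases a <;> rfl

theorem GapFunction.value_exit (G : D.GapFunction X) (m : Fin (D.len i + 1)) :
    G.value i (D.exit i m) = G.beside i ⟨i, m⟩ true .left ∧
      G.value i ((D.exit i m).1, (D.exit i m).2 - 1) = G.beside i ⟨i, m⟩ true .right := by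
  unfold exit beside
  by_cases hm : m = Fin.last _
  · subst hm
    rw [if_pos rfl, if_pos (show (⟨i, Fin.last _⟩ : D.Edge) = D.lastEdge i from rfl),
      if_pos (show (⟨i, Fin.last _⟩ : D.Edge) = D.lastEdge i from rfl)]
    exact ⟨rfl, rfl⟩
  · have h : (⟨i, m⟩ : D.Edge) ≠ D.lastEdge i := fun h => hm ((D.mk_inj i).mp h)
    rw [if_neg hm, if_neg h, if_neg h]
    simp only [value, atMid, if_neg hm]
    exact ⟨rfl, rfl⟩

theorem GapFunction.value_entry (G : D.GapFunction X) (m : Fin (D.len i + 1)) :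
    G.value i (D.entry i m) = G.beside i ⟨i, m⟩ false .right ∧
      G.value i ((D.entry i m).1, (D.entry i m).2 - 1) = G.beside i ⟨i, m⟩ false .left := by
  unfold entry beside
  by_cases hm : m = Fin.last _
  · subst hm
    rw [if_pos rfl, if_pos (show (⟨i, Fin.last _⟩ : D.Edge) = D.lastEdge i from rfl),
      if_pos (show (⟨i, Fin.last _⟩ : D.Edge) = D.lastEdge i from rfl)]
    exact ⟨rfl, rfl⟩
  · have h : (⟨i, m⟩ : D.Edge) ≠ D.lastEdge i := fun h => hm ((D.mk_inj i).mp h)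
    rw [if_neg hm, if_neg h, if_neg h]
    simp only [value, atMid, if_neg hm]
    exact ⟨rfl, rfl⟩

/-- The values at the corner `q` of a crossing. -/
theorem GapFunction.value_corner (G : D.GapFunction X) (c q) (a : Fin 4) :
    G.value i (.pt (.corner c q), a) =
      ![G (D.departure c q) 0 false, G (D.arrival c q) 5 false, G (D.arrival c q) 5 true,
        G (D.departure c q) 0 true] a := by
  rw [← D.next_arrival]
  fin_cases a <;> rfl

theorem GapFunction.value_eq {G : D.GapFunction X}
    (hG : ∀ d d', D.SameFace i d d' → G.value i d = G.value i d') {d d' : D.Dart i}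
    (h : D.Glued i d d') :
    G.value i d = G.value i (d'.1, d'.2 - 1) ∧ G.value i (d.1, d.2 - 1) = G.value i d' :=
  ⟨hG _ _ (.leftSide _ _ _ _ h), hG _ _ (.rightSide _ _ _ _ h)⟩

theorem GapFunction.compatible {G : D.GapFunction X}
    (hG : ∀ d d', D.SameFace i d d' → G.value i d = G.value i d') : G.Compatible i := by
  have hv := fun {d d'} h => GapFunction.value_eq (i := i) hG (d := d) (d' := d') h
  constructor
  · intro e he h u
    have h1 := hv (.tube_other e u he)
    cases h <;> cases u
    · exact h1.1
    · exact h1.2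
    · exact h1.2
    · exact h1.1
  · intro m hm h
    have h1 := hv (.tube_lower m hm)
    cases h
    · exact h1.1
    · exact h1.2
  · intro h
    have h1 := hv .last_upper
    cases h
    · exact h1.2
    · exact h1.1
  · intro h
    have hm : ∀ a, G.value i (.mid (Fin.last _), a) = ![G (D.lastEdge i, .right) 2 false,
      G (D.lastEdge i, .right) 3 false, G (D.lastEdge i, .left) 2 false,
      G (D.lastEdge i, .left) 3 false] a := by
      intro a
      simp only [value, atMid, if_true]; rfl
    have h1 := hv .lambda_before
    have h2 := hv .lambda_after
    rw [hm, hm] at h1 h2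
    cases h
    · exact h1.1
    · exact h2.1.symm
  · intro c u s
    have h1 := hv (.alpha_ahead_left c)
    have h2 := hv (.alpha_left_behind c)
    have h3 := hv (.alpha_behind_right c)
    have h4 := hv (.alpha_right_ahead c)
    simp only [value_corner] at h1 h2 h3 h4
    have e1 : (c, u) = if u = D.positive c then D.rising c else D.falling c := by
      unfold GaussData.rising GaussData.falling
      cases u <;> cases D.positive c <;> rfl
    rw [e1]
    cases hp : D.positive c <;> rw [hp] at h1 h2 h3 h4 <;> cases u <;> cases s <;>
    first
      | exact h1.1 | exact h1.1.symm | exact h1.2 | exact h1.2.symm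
      | exact h2.1 | exact h2.1.symm | exact h2.2 | exact h2.2.symm
      | exact h3.1 | exact h3.1.symm | exact h3.2 | exact h3.2.symm
      | exact h4.1 | exact h4.1.symm | exact h4.2
  · intro c u h
    have h1 := hv (.alpha_ahead_left c)
    have h2 := hv (.alpha_left_behind c)
    have h3 := hv (.alpha_behind_right c)
    have h4 := hv (.alpha_right_ahead c)
    simp only [value_corner] at h1 h2 h3 h4
    have e1 : (c, !u) = if u = D.positive c then D.falling c else D.rising c := by
      unfold GaussData.rising GaussData.falling
      cases u <;> cases D.positive c <;> rfl
    rw [e1]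
    cases hp : D.positive c <;> rw [hp] at h1 h2 h3 h4 <;> cases u <;> cases h <;>
    first
      | exact h1.1 | exact h1.1.symm | exact h1.2 | exact h1.2.symm
      | exact h2.1 | exact h2.1.symm | exact h2.2 | exact h2.2.symm
      | exact h3.1 | exact h3.1.symm | exact h3.2 | exact h3.2.symm
      | exact h4.1 | exact h4.1.symm | exact h4.2 | exact h4.2.symm
  · intro s
    have h1 := hv .lambda_close
    rw [(G.value_exit i _).1, (G.value_exit i _).2, (G.value_entry i _).1,
      (G.value_entry i _).2] at h1
    cases s
    · exact h1.1
    · exact h1.2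
  · intro c hc s
    obtain ⟨⟨j, m⟩, hm⟩ := D.passage.surjective (c, true)
    have : j = i := by rw [← hc, GaussData.strand, ← hm]; simp
    subst this
    have h1 := hv (.lambda_over m (by rw [hm]))
    rw [(G.value_exit j _).1, (G.value_exit j _).2, (G.value_entry j _).1,
      (G.value_entry j _).2] at h1
    rw [← hm, D.inEdge_passage, D.outEdge_passage]
    cases s
    · exact h1.1
    · exact h1.2
  · intro c hc h s
    obtain ⟨u, hu⟩ := D.exists_underPos i hc
    cases h
    · have h1 := hv (.lambda_out u)
      rw [(G.value_entry i _).1, (G.value_entry i _).2, G.value_dipOut i hu, G.value_dipOut i hu,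
        D.underPos_out i hu] at h1
      cases s
      · exact h1.1.symm
      · exact h1.2.symm
    · have h1 := hv (.lambda_in u)
      rw [(G.value_exit i _).1, (G.value_exit i _).2, G.value_dipIn i hu, G.value_dipIn i hu,
        D.underPos_in i hu] at h1
      cases s
      · exact h1.1
      · exact h1.2
  · intro c hc s
    obtain ⟨u, hu⟩ := D.exists_underPos i hc
    have h1 := hv (.lambda_under u)
    rw [G.value_dipOut i hu, G.value_dipOut i hu, G.value_dipIn i hu, G.value_dipIn i hu] at h1
    cases s
    · exact h1.1
    · exact h1.2

theorem GapFunction.Consistent.after_eq {G : D.GapFunction X} (hG : G.Consistent i)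
    {p q : D.BetaPoint i} (h : D.BetaNext i p q) (u : Bool) :
    G.after (D.place i p) u = G (D.place i q).1 (D.place i q).2 u := by
  have hskip : ∀ a (n n' : ℕ), n ≤ n' → n' ≤ 5 →
      (∀ r, (D.place i r).1 = a → ¬ (n ≤ (D.place i r).2 ∧ (D.place i r).2 < n')) →
      G a n u = G a n' u := by
    intro a n n' hn
    induction n', hn using Nat.le_induction with
    | base => intros; rfl
    | succ m hm ih =>
      intro h5 hr
      rw [ih (by omega) fun r hr' h => hr r hr' ⟨h.1, by omega⟩]
      refine hG.skip a m u (by omega) fun p hp => ?_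
      refine hr p (by rw [hp]) ⟨by rw [hp]; exact hm, by rw [hp]; exact Nat.lt_succ_self _⟩
  have hq := D.place_le i q
  have hp := D.place_le i p
  rcases h with ⟨h1, h2, h3⟩ | ⟨h1, h2, h3⟩
  · rw [GapFunction.after, if_neg (by omega), h1]
    refine hskip _ _ _ h2 hq fun r hr h => h3 r hr ⟨by omega, h.2⟩
  · have h4 : G.after (D.place i p) u = G (D.next (D.place i p).1) 0 u := by
      rw [GapFunction.after]
      split_ifs with h5
      · rfl
      · rw [hskip _ _ 5 (by omega) le_rfl fun r hr h => absurd (h2 r hr) (by omega)]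
        refine hG.last _ u fun r hr => ?_
        have := h2 r (by rw [hr])
        rw [hr] at this
        simp only at this
        omega
    rw [h4, ← h1]
    exact hskip _ _ _ (Nat.zero_le _) hq fun r hr h => absurd (h3 r hr) (by omega)

/-- Consistency is invariance across the ends of `β`-arcs, and compatibility is invariance along
both sides of every other arc. Together these generate the relation that defines the faces. -/
theorem GapFunction.exists_face {G : D.GapFunction X} (hG : G.Consistent i) (h : G.Compatible i) :
    ∃ P : D.Face i → X, ∀ d, P (Quot.mk _ d) = G.value i d := by
  have key : ∀ d d', D.Glued i d d' →
      G.value i d = G.value i (d'.1, d'.2 - 1) ∧ G.value i (d.1, d.2 - 1) = G.value i d' := by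
    have hmid : ∀ (m : Fin (D.len i + 1)) (hm : m ≠ Fin.last _) (a : Fin 4), G.value i (.mid m, a) =
      ![G (⟨i, m⟩, .left) 3 true, G (⟨i, m⟩, .left) 2 true, G (⟨i, m⟩, .right) 3 true,
        G (⟨i, m⟩, .right) 2 true] a := by
      intro m hm a
      simp only [value, atMid, if_neg hm]
    have hlast : ∀ a, G.value i (.mid (Fin.last _), a) = ![G (D.lastEdge i, .right) 2 false,
      G (D.lastEdge i, .right) 3 false, G (D.lastEdge i, .left) 2 false,
      G (D.lastEdge i, .left) 3 false] a := by
      intro a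
      simp only [value, atMid, if_true]; rfl
    have hs := h.straight
    have hc := h.cap
    have e1 : ∀ c, (c, true) = if D.positive c then D.rising c else D.falling c := by
      intro c
      unfold GaussData.rising GaussData.falling
      cases D.positive c <;> rfl
    have e2 : ∀ c, (c, false) = if D.positive c then D.falling c else D.rising c := by
      intro c
      unfold GaussData.rising GaussData.falling
      cases D.positive c <;> rfl
    have halpha : ∀ c, ∀ E : Quadrant → Quadrant → Bool → Prop,
        (∀ q q' u, E q q' u ↔
          G.value i (.pt (.corner c q), sheet u) = G.value i (.pt (.corner c q'), sheet u - 1) ∧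
          G.value i (.pt (.corner c q), sheet u - 1) = G.value i (.pt (.corner c q'), sheet u)) →
        E .ahead .left (D.positive c) ∧ E .left .behind (!D.positive c) ∧
          E .behind .right (D.positive c) ∧ E .right .ahead (!D.positive c) := by
      intro c E hE
      simp only [hE, value_corner]
      have s1 := hs c true
      have s2 := hs c false
      have c1 := hc c true
      have c2 := hc c false
      simp only [Bool.not_true, Bool.not_false, e1, e2] at s1 s2 c1 c2
      cases hp : D.positive c <;> rw [hp] at s1 s2 c1 c2 <;>
        refine ⟨⟨?_, ?_⟩, ⟨?_, ?_⟩, ⟨?_, ?_⟩, ?_, ?_⟩ <;>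
        first
        | exact s1 .left | exact (s1 .left).symm | exact s1 .right | exact (s1 .right).symm
        | exact s2 .left | exact (s2 .left).symm | exact s2 .right | exact (s2 .right).symm
        | exact c1 true | exact (c1 true).symm | exact c1 false | exact (c1 false).symm
        | exact c2 true | exact (c2 true).symm | exact c2 false | exact (c2 false).symm
    have halpha := fun c => halpha c _ fun _ _ _ => Iff.rfl
    intro d d' hdd
    cases hdd with
    | beta p q hpq =>
      have h1 := hG.after_eq i hpq
      exact ⟨h1 false, h1 true⟩
    | alpha_ahead_left c => exact (halpha c).1
    | alpha_left_behind c => exact (halpha c).2.1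
    | alpha_behind_right c => exact (halpha c).2.2.1
    | alpha_right_ahead c => exact (halpha c).2.2.2
    | tube_other e u he =>
      have h1 := h.tube e he
      cases u
      · exact ⟨h1 false false, h1 true false⟩
      · exact ⟨h1 true true, h1 false true⟩
    | tube_upper_left m hm => rw [hmid m hm, hmid m hm]; exact ⟨rfl, rfl⟩
    | tube_upper_right m hm => rw [hmid m hm, hmid m hm]; exact ⟨rfl, rfl⟩
    | tube_lower m hm =>
      have h1 := h.tube_lower m hm
      exact ⟨h1 false, h1 true⟩
    | last_upper => exact ⟨h.tube_last true, h.tube_last false⟩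
    | last_lower_left => rw [hlast, hlast]; exact ⟨rfl, rfl⟩
    | last_lower_right => rw [hlast, hlast]; exact ⟨rfl, rfl⟩
    | lambda_before => rw [hlast, hlast]; exact ⟨h.finger false, rfl⟩
    | lambda_after => rw [hlast, hlast]; exact ⟨(h.finger true).symm, rfl⟩
    | lambda_over m hm =>
      rw [(G.value_exit i _).1, (G.value_exit i _).2, (G.value_entry i _).1, (G.value_entry i _).2]
      obtain ⟨⟨c, l⟩, hp⟩ : ∃ p, D.passage ⟨i, m⟩ = p := ⟨_, rfl⟩
      have hl : l = true := by rw [hp] at hm; exact hm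
      subst hl
      have h1 := h.passOver c (by rw [← hp, strand_passage])
      rw [← hp, D.inEdge_passage, D.outEdge_passage] at h1
      exact ⟨h1 .left, h1 .right⟩
    | lambda_in u =>
      obtain ⟨c, hp⟩ := D.passage_underPos i u
      rw [(G.value_exit i _).1, (G.value_exit i _).2, G.value_dipIn i hp, G.value_dipIn i hp,
        D.underPos_in i hp]
      have h1 := h.dip c (by rw [← hp, strand_passage]) true
      exact ⟨h1 .left, h1 .right⟩
    | lambda_under u =>
      obtain ⟨c, hp⟩ := D.passage_underPos i u
      rw [G.value_dipOut i hp, G.value_dipOut i hp, G.value_dipIn i hp, G.value_dipIn i hp]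
      have h1 := h.under c (by rw [← hp, strand_passage])
      exact ⟨h1 .left, h1 .right⟩
    | lambda_out u =>
      obtain ⟨c, hp⟩ := D.passage_underPos i u
      rw [(G.value_entry i _).1, (G.value_entry i _).2, G.value_dipOut i hp, G.value_dipOut i hp,
        D.underPos_out i hp]
      have h1 := h.dip c (by rw [← hp, strand_passage]) false
      exact ⟨(h1 .left).symm, (h1 .right).symm⟩
    | lambda_close =>
      rw [(G.value_exit i _).1, (G.value_exit i _).2, (G.value_entry i _).1, (G.value_entry i _).2]
      exact ⟨h.close .left, h.close .right⟩
  refine ⟨Quot.lift (G.value i) ?_, fun _ => rfl⟩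
  rintro _ _ (⟨v, w, a, b, h1⟩ | ⟨v, w, a, b, h1⟩)
  · exact (key _ _ h1).1
  · exact (key _ _ h1).2

end Diagram
end StringLink

/-! ### The conditions on gaps in terms of half edges -/

namespace StringLink
namespace Diagram

variable {k : ℕ} (D : Diagram k) (i : Fin k)

/-- The passage at the head (`h = true`) or tail of an edge, if it does not lie on the boundary of
the square. -/
def farEnd (e : D.Edge) : Bool → Option (Fin D.numCrossings × Bool)
  | true => if h : (e.2 : ℕ) < D.len e.1 then some (D.passage ⟨e.1, ⟨e.2, h⟩⟩) else none
  | false => if h : 0 < (e.2 : ℕ) then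
      some (D.passage ⟨e.1, ⟨(e.2 : ℕ) - 1, by have := e.2.isLt; omega⟩⟩) else none

theorem farEnd_endEdge (p h) : D.farEnd (D.endEdge p h) h = some p := by
  cases h
  · simp [farEnd, endEdge, GaussData.outEdge]
  · simp [farEnd, endEdge, GaussData.inEdge]

theorem farEnd_lastEdge (j) : D.farEnd (D.lastEdge j) true = none := by
  simp [farEnd, GaussData.lastEdge]

theorem farEnd_firstEdge (j) : D.farEnd (D.firstEdge j) false = none := by
  simp [farEnd, GaussData.firstEdge]

/-- The edge at the top or bottom end of a strand. -/
def borderEdge (j : Fin k) (h : Bool) : D.Edge := if h then D.lastEdge j else D.firstEdge j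

theorem farEnd_borderEdge (j h) : D.farEnd (D.borderEdge j h) h = none := by
  cases h
  · exact D.farEnd_firstEdge j
  · exact D.farEnd_lastEdge j

theorem end_cases (e : D.Edge) (h : Bool) :
    (∃ p, e = D.endEdge p h) ∨ ∃ j, e = D.borderEdge j h := by
  obtain ⟨j, m⟩ := e
  cases h
  · induction m using Fin.cases with
    | zero => exact Or.inr ⟨j, rfl⟩
    | succ m => exact Or.inl ⟨_, (D.outEdge_passage j m).symm⟩
  · induction m using Fin.lastCases with
    | last => exact Or.inr ⟨j, rfl⟩
    | cast m => exact Or.inl ⟨_, (D.inEdge_passage j m).symm⟩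

theorem endEdge_injective (h : Bool) : Function.Injective fun p => D.endEdge p h := by
  cases h
  · exact D.outEdge_injective
  · exact D.inEdge_injective

theorem endEdge_ne_borderEdge (p j h) : D.endEdge p h ≠ D.borderEdge j h := by
  cases h
  · exact D.outEdge_ne_firstEdge p j
  · exact D.inEdge_ne_lastEdge p j

variable {D} {X : Type*}

/-- The function is constant on gaps of the same half edge side that are not separated by a point
and on gaps that are connected along the boundary of the square. -/
structure GapFunction.Steady (G : D.GapFunction X) : Prop where
  near : ∀ e h s u, ¬ (e = D.lastEdge i ∧ s = .left) → G.half e h s 0 u = G.half e h s 1 u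
  far : ∀ e h s u, (∀ c, D.strand (c, false) = i → e = D.endEdge (c, false) h →
    s ≠ D.dipSide i c h) → G.half e h s 1 u = G.half e h s 2 u
  bottom : ∀ j j' u, (D.bot.symm j' : ℕ) = D.bot.symm j + 1 →
    G.half (D.lastEdge j) true .left 2 u = G.half (D.lastEdge j') true .right 2 u
  top : ∀ j j' u, (D.top.symm j' : ℕ) = D.top.symm j + 1 →
    G.half (D.firstEdge j') false .right 2 u = G.half (D.firstEdge j) false .left 2 u
  east : ∀ j j' u, D.top.symm j' = D.bot.symm j → (D.bot.symm j : ℕ) + 1 = k →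
    G.half (D.lastEdge j) true .left 2 u = G.half (D.firstEdge j') false .left 2 u
  west : ∀ j j' u, D.top.symm j = D.bot.symm j' → (D.top.symm j : ℕ) = 0 →
    G.half (D.firstEdge j) false .right 2 u = G.half (D.lastEdge j') true .right 2 u

variable (D)

theorem place_rank (p : D.BetaPoint i) :
    (∃ c q, p = .corner c q) ∨ (∃ e s, p = .tube e s) ∨ p = .before ∨ p = .after ∨
      ∃ c h, D.strand (c, false) = i ∧ D.place i p = ((D.endEdge (c, false) h, D.dipSide i c h),
        if h = (D.dipSide i c h = .left) then 4 else 0) := by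
  rcases p with ⟨c, q⟩ | ⟨e, s⟩ | u | u | _ | _
  · exact Or.inl ⟨c, q, rfl⟩
  · exact Or.inr (Or.inl ⟨e, s, rfl⟩)
  · obtain ⟨c, hc⟩ := D.passage_underPos i u
    refine Or.inr (Or.inr (Or.inr (Or.inr ⟨c, true, by rw [← hc, strand_passage], ?_⟩)))
    rw [D.place_dipIn i hc]
    simp [endEdge]
  · obtain ⟨c, hc⟩ := D.passage_underPos i u
    refine Or.inr (Or.inr (Or.inr (Or.inr ⟨c, false, by rw [← hc, strand_passage], ?_⟩)))
    rw [D.place_dipOut i hc]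
    cases D.dipSide i c false <;> simp [endEdge]
  · exact Or.inr (Or.inr (Or.inl rfl))
  · exact Or.inr (Or.inr (Or.inr (Or.inl rfl)))

theorem exists_dip {c} (hc : D.strand (c, false) = i) (h : Bool) :
    ∃ p, D.place i p = ((D.endEdge (c, false) h, D.dipSide i c h),
      if h = (D.dipSide i c h = .left) then 4 else 0) := by
  obtain ⟨u, hu⟩ := D.exists_underPos i hc
  cases h
  · refine ⟨.dipOut u, ?_⟩
    rw [D.place_dipOut i hu]
    cases D.dipSide i c false <;> simp [endEdge]
  · refine ⟨.dipIn u, ?_⟩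
    rw [D.place_dipIn i hu]
    simp [endEdge]

theorem not_corner {a : D.EdgeSide} (ha : D.target a = none) (p : D.BetaPoint i) :
    D.place i p ≠ (a, 5) := by
  intro h
  have h2 := congrArg Prod.snd h
  rcases D.place_rank i p with ⟨c, q, rfl⟩ | ⟨e, s, rfl⟩ | rfl | rfl | ⟨c, h', -, hp⟩
  · have h1 : D.arrival c q = a := congrArg Prod.fst h
    rw [← h1, D.target_arrival] at ha
    cases ha
  · exact absurd h2 (by simp [place])
  · exact absurd h2 (by simp [place])
  · exact absurd h2 (by simp [place])
  · rw [hp] at h2; simp only at h2; split_ifs at h2; omega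

theorem near_free {e : D.Edge} {s n} (hn : n = 1 ∨ n = 3)
    (h : ¬ (e = D.lastEdge i ∧ s = .left)) (p : D.BetaPoint i) : D.place i p ≠ ((e, s), n) := by
  intro hp
  rcases D.place_rank i p with ⟨c, q, rfl⟩ | ⟨e, s, rfl⟩ | rfl | rfl | ⟨c, h', -, hp'⟩
  · have := congrArg Prod.snd hp; simp only [place] at this; omega
  · have := congrArg Prod.snd hp; simp only [place] at this; omega
  · simp only [place, Prod.mk.injEq] at hp; exact h ⟨hp.1.1.symm, hp.1.2.symm⟩
  · simp only [place, Prod.mk.injEq] at hp; exact h ⟨hp.1.1.symm, hp.1.2.symm⟩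
  · rw [hp'] at hp
    have := congrArg Prod.snd hp; simp only at this; split_ifs at this <;> omega

theorem far_free {e : D.Edge} {h : Bool} {s n} (hn : n = if h = (s = .left) then 4 else 0)
    (hf : ∀ c, D.strand (c, false) = i → e = D.endEdge (c, false) h → s ≠ D.dipSide i c h)
    (p : D.BetaPoint i) : D.place i p ≠ ((e, s), n) := by
  intro hp
  rcases D.place_rank i p with ⟨c, q, rfl⟩ | ⟨e, s, rfl⟩ | rfl | rfl | ⟨c, h', hc, hp'⟩
  · have := congrArg Prod.snd hp; simp only [place] at this; split_ifs at hn <;> omega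
  · have := congrArg Prod.snd hp; simp only [place] at this; split_ifs at hn <;> omega
  · have := congrArg Prod.snd hp; simp only [place] at this; split_ifs at hn <;> omega
  · have := congrArg Prod.snd hp; simp only [place] at this; split_ifs at hn <;> omega
  · rw [hp'] at hp
    simp only [Prod.mk.injEq] at hp
    obtain ⟨⟨h1, h2⟩, h3⟩ := hp
    have h4 : h = h' := by
      rw [← h3, h2] at hn
      cases h <;> cases h' <;> cases s <;> simp at hn <;> rfl
    subst h4
    exact hf c hc h1.symm h2.symm

variable {D}

/-- On a half edge side, the gap next to the tube is separated from the middle one only by the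
finger of `λ`, and the middle one from the far one only by a change of sheet. The ends of the
strands have no corner, so gaps continue along the boundary of the square. -/
theorem GapFunction.Consistent.steady {G : D.GapFunction X} (hG : G.Consistent i) :
    G.Steady i := by
  have hlast : ∀ j u, G (D.lastEdge j, .left) 5 u = G (D.next (D.lastEdge j, .left)) 0 u :=
    fun j u => hG.last _ _ (D.not_corner i (D.target_lastEdge_left j))
  have hfirst : ∀ j u, G (D.firstEdge j, .right) 5 u = G (D.next (D.firstEdge j, .right)) 0 u :=
    fun j u => hG.last _ _ (D.not_corner i (D.target_firstEdge_right j))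
  constructor
  · intro e h s u hes
    cases h <;> cases s <;> simp only [half, gapNum]
    · exact (hG.skip _ 1 u (by norm_num) (D.near_free i (.inl rfl) hes)).symm
    · exact hG.skip _ 3 u (by norm_num) (D.near_free i (.inr rfl) hes)
    · exact hG.skip _ 3 u (by norm_num) (D.near_free i (.inr rfl) hes)
    · exact (hG.skip _ 1 u (by norm_num) (D.near_free i (.inl rfl) hes)).symm
  · intro e h s u hf
    cases h <;> cases s <;> simp only [half, gapNum]
    · exact (hG.skip _ 0 u (by norm_num) (D.far_free i (by simp) hf)).symm
    · exact hG.skip _ 4 u (by norm_num) (D.far_free i (by simp) hf)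
    · exact hG.skip _ 4 u (by norm_num) (D.far_free i (by simp) hf)
    · exact (hG.skip _ 0 u (by norm_num) (D.far_free i (by simp) hf)).symm
  · intro j j' u h
    have hk : (D.bot.symm j : ℕ) + 1 < k := by have := (D.bot.symm j').isLt; omega
    have h1 : D.bot ⟨(D.bot.symm j : ℕ) + 1, hk⟩ = j' := by
      apply D.bot.symm.injective; ext; simp [h]
    have h2 := hlast j u
    rw [D.next_lastEdge_left, dif_pos hk, h1] at h2
    exact h2
  · intro j j' u h
    have h1 : D.top ⟨(D.top.symm j' : ℕ) - 1, by have := (D.top.symm j').isLt; omega⟩ = j := by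
      apply D.top.symm.injective; ext; simp [h]
    have h2 := hfirst j' u
    rw [D.next_firstEdge_right, if_pos (by omega), h1] at h2
    exact h2
  · intro j j' u h hk
    have h2 := hlast j u
    rw [D.next_lastEdge_left, dif_neg (by omega), ← h, Equiv.apply_symm_apply] at h2
    exact h2
  · intro j j' u h hk
    have h2 := hfirst j u
    rw [D.next_firstEdge_right, if_neg (by omega), h, Equiv.apply_symm_apply] at h2
    exact h2

theorem GapFunction.Steady.consistent {G : D.GapFunction X} (hG : G.Steady i) :
    G.Consistent i := by
  constructor
  · rintro ⟨e, s⟩ n u hn hp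
    have hnear : n = 1 ∨ n = 3 → ¬ (e = D.lastEdge i ∧ s = .left) := by
      rintro (rfl | rfl) ⟨rfl, rfl⟩
      · exact hp .before rfl
      · exact hp .after rfl
    have hfar : ∀ h : Bool, (n = if h = (s = .left) then 4 else 0) → ∀ c, D.strand (c, false) = i →
        e = D.endEdge (c, false) h → s ≠ D.dipSide i c h := by
      rintro h h' c hc rfl rfl
      obtain ⟨p, hp'⟩ := D.exists_dip i hc h
      exact hp p (by rw [hp', h'])
    have h1 := fun h hes => hG.near e h s u hes
    have h2 := fun h hf => hG.far e h s u hf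
    obtain rfl | rfl | rfl | rfl | rfl : n = 0 ∨ n = 1 ∨ n = 2 ∨ n = 3 ∨ n = 4 := by omega
    · cases s
      · exact (h2 false (hfar false (by simp))).symm
      · exact (h2 true (hfar true (by simp))).symm
    · cases s
      · exact (h1 false (hnear (.inl rfl))).symm
      · exact (h1 true (hnear (.inl rfl))).symm
    · exact absurd rfl (hp (.tube e s))
    · cases s
      · exact h1 true (hnear (.inr rfl))
      · exact h1 false (hnear (.inr rfl))
    · cases s
      · exact h2 true (hfar true (by simp))
      · exact h2 false (hfar false (by simp))
  · intro a u hp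
    rcases D.target_cases a with ⟨c, q, rfl⟩ | ⟨j, rfl⟩ | ⟨j, rfl⟩
    · exact absurd rfl (hp (.corner c q))
    · rw [D.next_lastEdge_left]
      split_ifs with h
      · exact hG.bottom j _ u (by simp)
      · have := (D.bot.symm j).isLt
        exact hG.east j _ u (by simp) (by omega)
    · rw [D.next_firstEdge_right]
      split_ifs with h
      · exact hG.top _ j u (by simp; omega)
      · exact hG.west j _ u (by simp) (by omega)

/-- A function on the gaps with given values in terms of half edges. -/
def GapFunction.ofHalf (F : D.Edge → Bool → Side → ℕ → Bool → X) : D.GapFunction X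
  | (e, .left), n, u => if n < 3 then F e false .left (2 - n) u else F e true .left (n - 3) u
  | (e, .right), n, u => if n < 3 then F e true .right (2 - n) u else F e false .right (n - 3) u

theorem GapFunction.half_ofHalf (F : D.Edge → Bool → Side → ℕ → Bool → X) (e h s u) {t : ℕ}
    (ht : t ≤ 2) : (GapFunction.ofHalf F).half e h s t u = F e h s t u := by
  obtain rfl | rfl | rfl : t = 0 ∨ t = 1 ∨ t = 2 := by omega
  all_goals cases h <;> cases s <;> rfl

/-- Each value on a gap is the value at a corner. -/
theorem GapFunction.Consistent.exists_value {G : D.GapFunction X} (hG : G.Consistent i) (e h s u)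
    {t : ℕ} (ht : t ≤ 2) : ∃ d, G.value i d = G.half e h s t u := by
  have hback : ∀ p, ∃ d, G.value i d = G (D.place i p).1 (D.place i p).2 u := fun p =>
    ⟨(.pt p, if u then 2 else 1), by cases u <;> rfl⟩
  have hfwd : ∀ p, ∃ d, G.value i d = G.after (D.place i p) u := fun p =>
    ⟨(.pt p, if u then 3 else 0), by cases u <;> rfl⟩
  have key : ∀ n, n ≤ 5 → ∃ d, G.value i d = G (e, s) n u := by
    have h2 := hback (.tube e s)
    have h3 := hfwd (.tube e s)
    have lower : ∀ n, n < 2 → (∃ d, G.value i d = G (e, s) (n + 1) u) →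
        ∃ d, G.value i d = G (e, s) n u := by
      intro n hn h
      by_cases hp : ∃ p, D.place i p = ((e, s), n)
      · obtain ⟨p, hp⟩ := hp
        have := hback p
        rwa [hp] at this
      · rwa [hG.skip _ n u (by omega) fun p h' => hp ⟨p, h'⟩]
    have upper : ∀ n, n < 5 → (∃ d, G.value i d = G (e, s) n u) →
        ∃ d, G.value i d = G (e, s) (n + 1) u := by
      intro n hn h
      by_cases hp : ∃ p, D.place i p = ((e, s), n)
      · obtain ⟨p, hp⟩ := hp
        have := hfwd p
        rw [hp, after] at this
        simp only at this
        rwa [if_neg (by omega)] at this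
      · rwa [← hG.skip _ n u (by omega) fun p h' => hp ⟨p, h'⟩]
    have h1 := lower 1 (by norm_num) h2
    have h4 := upper 3 (by norm_num) h3
    intro n hn
    obtain rfl | rfl | rfl | rfl | rfl | rfl : n = 0 ∨ n = 1 ∨ n = 2 ∨ n = 3 ∨ n = 4 ∨ n = 5 := by
      omega
    · exact lower 0 (by norm_num) h1
    · exact h1
    · exact h2
    · exact h3
    · exact h4
    · exact upper 4 (by norm_num) h4
  exact key _ (by cases h <;> cases s <;> simp only [gapNum] <;> omega)

/-- Each value at a corner is the value on a gap. -/
theorem GapFunction.exists_half (G : D.GapFunction X) (d) :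
    ∃ e h s t u, t ≤ 2 ∧ G.value i d = G.half e h s t u := by
  have key : ∀ a n u, n ≤ 5 → ∃ e h s t u', t ≤ 2 ∧ G a n u = G.half e h s t u' := by
    rintro ⟨e, s⟩ n u hn
    by_cases h : n < 3
    · refine ⟨e, if s = .left then false else true, s, 2 - n, u, by omega, ?_⟩
      cases s <;> simp only [half, gapNum, if_true, if_false, reduceCtorEq] <;> congr 1 <;> omega
    · refine ⟨e, if s = .left then true else false, s, n - 3, u, by omega, ?_⟩
      cases s <;> simp only [half, gapNum, if_true, if_false, reduceCtorEq] <;> congr 1 <;> omega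
  obtain ⟨p | m, a⟩ := d
  · have hafter : ∀ u, ∃ e h s t u', t ≤ 2 ∧ G.after (D.place i p) u = G.half e h s t u' := by
      intro u
      have := D.place_le i p
      unfold after
      split_ifs
      · exact key _ _ _ (by omega)
      · exact key _ _ _ (by omega)
    fin_cases a
    · exact hafter false
    · exact key _ _ _ (D.place_le i p)
    · exact key _ _ _ (D.place_le i p)
    · exact hafter true
  · change ∃ e h s t u, t ≤ 2 ∧ G.atMid i m a = G.half e h s t u
    unfold atMid
    split_ifs <;> fin_cases a <;> exact key _ _ _ (by norm_num)

end Diagram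
end StringLink

/-! ### Names of the components of the complement -/

namespace StringLink
namespace Diagram

variable {k : ℕ} (D : Diagram k) (i : Fin k)

/-- Names of the components of the complement of all curves. At each crossing there are one on the
upper sheet of the over strand (`rOver` is cut off from it by `λ`) and one on the lower sheet of the
under strand (with `rUnder`), and at each end of the two tubes one on the other side of the strand
(with `rEnd`). The rest lies on the outer ball. -/
inductive FaceName
  | up (c : Fin D.numCrossings)
  | lo (c : Fin D.numCrossings)
  | rOver (c : Fin D.numCrossings)
  | rUnder (c : Fin D.numCrossings)
  | upEnd (c : Fin D.numCrossings) (h : Bool)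
  | loEnd (c : Fin D.numCrossings) (h : Bool)
  | rEnd (c : Fin D.numCrossings) (h : Bool)
  | outUp
  | outLo
  | close
  | fin (h : Bool)
  deriving DecidableEq

/-- The position of an end of a strand on the edge of the square. -/
def position (j : Fin k) (h : Bool) : Fin k := if h then D.bot.symm j else D.top.symm j

/-- The component of a gap, without the finger move of `λ`. -/
def plainName (e : D.Edge) (h : Bool) (s : Side) (t : ℕ) (u : Bool) : D.FaceName :=
  match D.farEnd e h, u with
  | some (c, true), true => if e.1 = i ∧ s = .right then .rOver c else .up c
  | some (c, true), false => .loEnd c h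
  | some (c, false), true =>
      if e.1 = i ∧ ((s = .right) ≠ (t = 2 ∧ s = D.dipSide i c h)) then .rEnd c h else .upEnd c h
  | some (c, false), false =>
      if e.1 = i ∧ ((D.dipSide i c h = .left) ≠ (t = 2 ∧ s = D.dipSide i c h)) then .rUnder c
      else .lo c
  | none, true =>
      if (e.1 = i ∧ s = .right) ∨ D.position e.1 h < D.position i h then .close else .outUp
  | none, false => .outLo

/-- The component of a gap. -/
def halfName (e : D.Edge) (h : Bool) (s : Side) (t : ℕ) (u : Bool) : D.FaceName :=
  if e = D.lastEdge i ∧ s = .left ∧ t = 0 then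
    if u then D.plainName i e h .right t u else .fin h
  else D.plainName i e h s t u

def gapName : D.GapFunction D.FaceName := GapFunction.ofHalf (D.halfName i)

theorem gapName_half (e h s u) {t : ℕ} (ht : t ≤ 2) :
    (D.gapName i).half e h s t u = D.halfName i e h s t u :=
  GapFunction.half_ofHalf _ e h s u ht

theorem gapName_half_zero (e h s u) (he : ¬ (e = D.lastEdge i ∧ s = .left)) :
    (D.gapName i).half e h s 0 u = D.plainName i e h s 0 u := by
  rw [gapName_half _ _ _ _ _ _ (by norm_num), halfName, if_neg fun h => he ⟨h.1, h.2.1⟩]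

theorem gapName_half_pos (e h s u) {t : ℕ} (ht : t ≤ 2) (h0 : t ≠ 0) :
    (D.gapName i).half e h s t u = D.plainName i e h s t u := by
  rw [gapName_half _ _ _ _ _ _ ht, halfName, if_neg fun h => h0 h.2.2]

theorem plainName_over (c h s t u) : D.plainName i (D.endEdge (c, true) h) h s t u =
    if u then (if D.strand (c, true) = i ∧ s = .right then .rOver c else .up c)
    else .loEnd c h := by
  cases u <;> simp [plainName, farEnd_endEdge, endEdge_fst]

theorem plainName_under (c h s t u) : D.plainName i (D.endEdge (c, false) h) h s t u =
    if u then (if D.strand (c, false) = i ∧ ((s = .right) ≠ (t = 2 ∧ s = D.dipSide i c h)) then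
      .rEnd c h else .upEnd c h)
    else if D.strand (c, false) = i ∧ ((D.dipSide i c h = .left) ≠ (t = 2 ∧ s = D.dipSide i c h))
      then .rUnder c else .lo c := by
  cases u <;> simp [plainName, farEnd_endEdge, endEdge_fst]

theorem borderEdge_fst (j h) : (D.borderEdge j h).1 = j := by cases h <;> rfl

theorem plainName_border (j h s t u) : D.plainName i (D.borderEdge j h) h s t u =
    if u then (if (j = i ∧ s = .right) ∨ D.position j h < D.position i h then .close else .outUp)
    else .outLo := by
  cases u <;> simp [plainName, farEnd_borderEdge, borderEdge_fst]

theorem plainName_one (e h s u) : D.plainName i e h s 1 u = D.plainName i e h s 0 u := by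
  unfold plainName
  simp

theorem plainName_side (e h s s' u) (hu : u = true → e.1 ≠ i) :
    D.plainName i e h s 0 u = D.plainName i e h s' 0 u := by
  rcases D.end_cases e h with ⟨⟨c, l⟩, rfl⟩ | ⟨j, rfl⟩
  · rw [endEdge_fst] at hu
    cases u <;> cases l <;> simp [plainName_under, plainName_over] <;> simp [hu rfl]
  · rw [borderEdge_fst] at hu
    cases u <;> simp [plainName_border]
    simp [hu rfl]

theorem position_eq (j j' h) : D.position j h = D.position j' h ↔ j = j' := by
  cases h <;> simp [position]

theorem plainName_border_left (j j' h h' s t u)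
    (hj : (D.position j' h' : ℕ) = D.position j h + 1)
    (hi : (h = h') ) : D.plainName i (D.borderEdge j h) h .left t u =
      D.plainName i (D.borderEdge j' h') h' .right s u := by
  subst hi
  rw [plainName_border, plainName_border]
  cases u
  · rfl
  · have h1 := D.position_eq j i h
    have h2 := D.position_eq j' i h
    have key : (D.position j h < D.position i h) ↔
      (j' = i ∨ D.position j' h < D.position i h) := by
      rw [← h2, Fin.lt_def, Fin.lt_def, Fin.ext_iff]
      omega
    simp [key]

/-- The only delicate point is the upper sheet of the outer ball. There `λ` separates the ends to
the west of strand `i`, at the top and at the bottom alike, from those to the east; the two parts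
are `close` and `outUp`. -/
theorem gapName_steady : (D.gapName i).Steady i := by
  constructor
  · intro e h s u he
    rw [gapName_half_zero _ _ _ _ _ _ he, gapName_half_pos _ _ _ _ _ _ (by norm_num) (by norm_num),
      plainName_one]
  · intro e h s u hf
    rw [gapName_half_pos _ _ _ _ _ _ (by norm_num) (by norm_num),
      gapName_half_pos _ _ _ _ _ _ (by norm_num) (by norm_num)]
    rcases D.end_cases e h with ⟨⟨c, l⟩, rfl⟩ | ⟨j, rfl⟩
    · cases l
      · rw [plainName_under, plainName_under]
        by_cases hc : D.strand (c, false) = i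
        · simp [hf c hc rfl]
        · simp [hc]
      · rw [plainName_over, plainName_over]
    · rw [plainName_border, plainName_border]
  · intro j j' u h
    rw [gapName_half_pos _ _ _ _ _ _ (by norm_num) (by norm_num),
      gapName_half_pos _ _ _ _ _ _ (by norm_num) (by norm_num)]
    exact D.plainName_border_left i j j' true true _ _ u h rfl
  · intro j j' u h
    rw [gapName_half_pos _ _ _ _ _ _ (by norm_num) (by norm_num),
      gapName_half_pos _ _ _ _ _ _ (by norm_num) (by norm_num)]
    exact (D.plainName_border_left i j j' false false _ _ u h rfl).symm
  · intro j j' u h hk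
    rw [gapName_half_pos _ _ _ _ _ _ (by norm_num) (by norm_num),
      gapName_half_pos _ _ _ _ _ _ (by norm_num) (by norm_num)]
    refine (D.plainName_border i j true .left 2 u).trans
      (Eq.trans ?_ (D.plainName_border i j' false .left 2 u).symm)
    have h1 : ¬ D.position j true < D.position i true := by
      have := (D.position i true).isLt
      rw [Fin.lt_def]
      have h2 : D.position j true = D.bot.symm j := rfl
      rw [h2]; omega
    have h2 : ¬ D.position j' false < D.position i false := by
      have := (D.position i false).isLt
      rw [Fin.lt_def]
      have h2 : D.position j' false = D.bot.symm j := h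
      rw [h2]; omega
    simp [h1, h2]
  · intro j j' u h hk
    rw [gapName_half_pos _ _ _ _ _ _ (by norm_num) (by norm_num),
      gapName_half_pos _ _ _ _ _ _ (by norm_num) (by norm_num)]
    refine (D.plainName_border i j false .right 2 u).trans
      (Eq.trans ?_ (D.plainName_border i j' true .right 2 u).symm)
    have h1 : j = i ∨ D.position j false < D.position i false := by
      rw [← D.position_eq j i false, Fin.lt_def, Fin.ext_iff]
      have h2 : D.position j false = D.top.symm j := rfl
      rw [h2]; omega
    have h2 : j' = i ∨ D.position j' true < D.position i true := by
      rw [← D.position_eq j' i true, Fin.lt_def, Fin.ext_iff]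
      have h2 : D.position j' true = D.top.symm j := h.symm
      rw [h2]; omega
    simp [h1, h2]

theorem beside_gapName (e h s) :
    (D.gapName i).beside i e h s = D.plainName i e h s 0 true := by
  unfold GapFunction.beside
  split_ifs with h1 h2
  · subst h2
    rw [gapName_half_pos _ _ _ _ _ _ (by norm_num) (by norm_num), plainName_one]
  · rw [gapName_half _ _ _ _ _ _ (by norm_num), halfName, if_pos ⟨h1, rfl, rfl⟩, if_pos rfl]
    cases s
    · exact absurd rfl h2
    · rfl
  · rw [gapName_half_zero _ _ _ _ _ _ fun h => h1 h.1]

theorem dipGap_le (s s') : dipGap s s' ≤ 2 := by cases s <;> cases s' <;> decide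
theorem dipGap_ne (s s') : dipGap s s' ≠ 0 := by cases s <;> cases s' <;> decide

theorem gapName_compatible : (D.gapName i).Compatible i := by
  have hni : ∀ m : Fin (D.len i + 1), m ≠ Fin.last _ → (⟨i, m⟩ : D.Edge) ≠ D.lastEdge i :=
    fun m hm h => hm ((D.mk_inj i).mp h)
  constructor
  · intro e he h u
    have h1 : e ≠ D.lastEdge i := by rintro rfl; exact he rfl
    rw [gapName_half_zero _ _ _ _ _ _ fun h => h1 h.1, gapName_half_zero _ _ _ _ _ _ fun h => h1 h.1]
    exact D.plainName_side i _ _ _ _ _ fun _ => he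
  · intro m hm h
    rw [gapName_half_zero _ _ _ _ _ _ fun h => hni m hm h.1,
      gapName_half_zero _ _ _ _ _ _ fun h => hni m hm h.1]
    exact D.plainName_side i _ _ _ _ _ (by simp)
  · intro h
    rw [gapName_half_zero _ _ _ _ .right _ (by simp), gapName_half _ _ _ _ _ _ (by norm_num),
      halfName, if_pos ⟨rfl, rfl, rfl⟩, if_pos rfl]
  · intro h
    rw [gapName_half_zero _ _ _ _ .right _ (by simp),
      gapName_half_pos _ _ _ _ _ _ (by norm_num) (by norm_num), plainName_one]
    exact D.plainName_side i _ _ _ _ _ (by simp)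
  · intro c u s
    rw [gapName_half_pos _ _ _ _ _ _ (by norm_num) (by norm_num),
      gapName_half_pos _ _ _ _ _ _ (by norm_num) (by norm_num)]
    cases u
    · refine (D.plainName_under i c true s 2 false).trans
        (Eq.trans ?_ (D.plainName_under i c false s 2 false).symm)
      by_cases hc : D.strand (c, false) = i
      · cases s <;> cases D.dipSide i c true <;> cases D.dipSide i c false <;> simp
      · simp [hc]
    · exact (D.plainName_over i c true s 2 true).trans (D.plainName_over i c false s 2 true).symm
  · intro c u h
    rw [gapName_half_pos _ _ _ _ _ _ (by norm_num) (by norm_num),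
      gapName_half_pos _ _ _ _ _ _ (by norm_num) (by norm_num)]
    cases u
    · refine (D.plainName_over i c h .left 2 false).trans (D.plainName_over i c h .right 2 false).symm
    · refine (D.plainName_under i c h .left 2 true).trans
        (Eq.trans ?_ (D.plainName_under i c h .right 2 true).symm)
      cases D.dipSide i c h <;> simp
  · intro s
    rw [beside_gapName, beside_gapName]
    refine (D.plainName_border i i true s 0 true).trans
      (Eq.trans ?_ (D.plainName_border i i false s 0 true).symm)
    simp
  · intro c hc s
    rw [beside_gapName, beside_gapName]
    exact (D.plainName_over i c true s 0 true).trans (D.plainName_over i c false s 0 true).symm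
  · intro c hc h s
    rw [beside_gapName,
      gapName_half_pos _ _ _ _ _ _ (dipGap_le _ _) (dipGap_ne _ _), plainName_under, plainName_under]
    cases s <;> cases D.dipSide i c h <;> simp [hc, dipGap]
  · intro c hc s
    rw [gapName_half_pos _ _ _ _ _ _ (dipGap_le _ _) (dipGap_ne _ _),
      gapName_half_pos _ _ _ _ _ _ (dipGap_le _ _) (dipGap_ne _ _)]
    refine (D.plainName_under i c true _ _ false).trans
        (Eq.trans ?_ (D.plainName_under i c false _ _ false).symm)
    cases s <;> cases D.dipSide i c true <;> cases D.dipSide i c false <;> simp [dipGap]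

theorem exists_faceName : ∃ f : D.Face i → D.FaceName, ∀ d, f (Quot.mk _ d) = (D.gapName i).value i d :=
  GapFunction.exists_face i ((D.gapName_steady i).consistent i) (D.gapName_compatible i)

end Diagram
end StringLink

/-! ### The names determine all values -/

namespace StringLink
namespace Diagram

variable {k : ℕ} {D : Diagram k} (i : Fin k) {X : Type*}

/-- For a row of ends of strands with values `A p` and `B p` on the two sides of the `p`-th: if only
position `p₀` can separate values, one value holds to its left and one to its right. -/
theorem eq_of_row {A B : Fin k → X} {p₀ : Fin k} (step : ∀ p p' : Fin k, (p' : ℕ) = p + 1 → B p = A p')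
    (same : ∀ p, p ≠ p₀ → A p = B p) :
    (∀ p, p ≤ p₀ → A p = A p₀) ∧ ∀ p, p₀ ≤ p → B p = B p₀ := by
  constructor
  · have : ∀ n, ∀ p : Fin k, (p : ℕ) + n = p₀ → A p = A p₀ := by
      intro n
      induction n with
      | zero => intro p hp; rw [show p = p₀ from Fin.ext hp]
      | succ n ih =>
        intro p hp
        have hk : (p : ℕ) + 1 < k := by have := p₀.isLt; omega
        rw [same p (by rintro rfl; omega), step p ⟨_, hk⟩ rfl]
        exact ih _ (by simp only; omega)
    intro p hp
    have h : (p : ℕ) ≤ p₀ := hp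
    exact this (p₀ - p) p (by omega)
  · have : ∀ n, ∀ p : Fin k, (p₀ : ℕ) + n = p → B p = B p₀ := by
      intro n
      induction n with
      | zero => intro p hp; rw [show p = p₀ from (Fin.ext hp).symm]
      | succ n ih =>
        intro p hp
        have hk : (p₀ : ℕ) + n < k := by have := p.isLt; omega
        rw [← same p (by rintro rfl; omega), ← step ⟨_, hk⟩ p (by simp only; omega)]
        exact ih _ rfl
    intro p hp
    have h : (p₀ : ℕ) ≤ p := hp
    exact this (p - p₀) p (by omega)

theorem GapFunction.Steady.far_over {G : D.GapFunction X} (hG : G.Steady i) (c h s u) :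
    G.half (D.endEdge (c, true) h) h s 1 u = G.half (D.endEdge (c, true) h) h s 2 u :=
  hG.far _ _ _ _ fun c' _ h' => by
    have := congrArg Prod.snd (D.endEdge_injective h h'); cases this

theorem GapFunction.Steady.far_under {G : D.GapFunction X} (hG : G.Steady i) {c h s} (u)
    (hs : D.strand (c, false) = i → s ≠ D.dipSide i c h) :
    G.half (D.endEdge (c, false) h) h s 1 u = G.half (D.endEdge (c, false) h) h s 2 u :=
  hG.far _ _ _ _ fun c' hc h' => by
    obtain rfl : c = c' := congrArg Prod.fst (D.endEdge_injective h h')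
    exact hs hc

theorem GapFunction.Steady.far_border {G : D.GapFunction X} (hG : G.Steady i) (j h s u) :
    G.half (D.borderEdge j h) h s 1 u = G.half (D.borderEdge j h) h s 2 u :=
  hG.far _ _ _ _ fun _ _ h' => absurd h'.symm (D.endEdge_ne_borderEdge _ _ _)

theorem GapFunction.Steady.near_right {G : D.GapFunction X} (hG : G.Steady i) (e h u) :
    G.half e h .right 0 u = G.half e h .right 1 u :=
  hG.near _ _ _ _ (by simp)

/-- A tube can be crossed on the lower sheet always, and on the upper sheet if `λ` does not run
along its top. On the lower sheet of the last edge of strand `i`, this passes in front of the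
finger. -/
theorem GapFunction.Steady.cross {G : D.GapFunction X} (hG : G.Steady i) (hc : G.Compatible i)
    (e h) {u} (hu : u = true → e.1 ≠ i) : G.half e h .left 1 u = G.half e h .right 1 u := by
  rw [← hG.near_right]
  by_cases he : e.1 = i
  · cases u
    · by_cases hl : e = D.lastEdge i
      · subst hl
        exact hc.finger h
      · rw [← hG.near _ _ _ _ fun h => hl h.1]
        obtain ⟨j, m⟩ := e
        change j = i at he
        subst he
        exact hc.tube_lower m (by rintro rfl; exact hl rfl) h
    · exact absurd he (hu rfl)
  · rw [← hG.near _ _ _ _ fun h => he (by rw [h.1]; rfl)]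
    exact hc.tube e he h u

/-- Top and bottom are joined along the west edge of the square for the ends up to strand `i`, and
along the east edge for those from strand `i` on. -/
theorem GapFunction.Steady.border {G : D.GapFunction X} (hG : G.Steady i) (hc : G.Compatible i)
    (h u) :
    (∀ j, D.position j h ≤ D.position i h → G.half (D.borderEdge j h) h .right 2 u =
      G.half (D.lastEdge i) true .right 2 u) ∧
    (∀ j, D.position i h ≤ D.position j h → G.half (D.borderEdge j h) h .left 2 u =
      G.half (D.lastEdge i) true .left 2 u) := by
  have hk := i.isLt
  have hpos : ∃ σ : Bool → Equiv.Perm (Fin k), ∀ j h, D.position j h = (σ h).symm j :=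
    ⟨fun h => if h then D.bot else D.top, by intro j h; cases h <;> rfl⟩
  obtain ⟨σ, hσ⟩ := hpos
  have hrow : ∀ h, _ := fun h => eq_of_row (p₀ := D.position i h)
    (A := fun p => G.half (D.borderEdge (σ h p) h) h .right 2 u)
    (B := fun p => G.half (D.borderEdge (σ h p) h) h .left 2 u)
    (by
      intro p p' hp
      have h1 : (D.position (σ h p') h : ℕ) = D.position (σ h p) h + 1 := by simp [hσ, hp]
      cases h
      · exact (hG.top _ _ u h1).symm
      · exact hG.bottom _ _ u h1)
    (by
      intro p hp
      rw [← hG.far_border, ← hG.far_border]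
      refine (hG.cross i hc _ _ fun _ => ?_).symm
      rw [D.borderEdge_fst]
      rintro rfl
      simp [hσ] at hp)
  simp only [hσ, Equiv.apply_symm_apply] at hrow
  have hA := fun h j => (hrow h).1 ((σ h).symm j)
  have hB := fun h j => (hrow h).2 ((σ h).symm j)
  simp only [Equiv.apply_symm_apply] at hA hB
  simp only [hσ]
  cases h
  · have e1 : ∀ p : Fin k, (σ false p) = D.top p := by
      intro p; rw [← Equiv.eq_symm_apply, ← hσ]; simp [position]
    have e2 : ∀ p : Fin k, (σ true p) = D.bot p := by
      intro p; rw [← Equiv.eq_symm_apply, ← hσ]; simp [position]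
    constructor
    · intro j hj
      have h0 : (⟨0, by omega⟩ : Fin k) ≤ (σ false).symm i := Nat.zero_le _
      have h0' : (⟨0, by omega⟩ : Fin k) ≤ (σ true).symm i := Nat.zero_le _
      rw [hA false j hj, ← (hrow false).1 _ h0]
      refine (hG.west (σ false ⟨0, by omega⟩) (σ true ⟨0, by omega⟩) u (by simp [e1, e2])
        (by simp [e1])).trans ?_
      exact (hrow true).1 _ h0'
    · intro j hj
      have h0 : (σ false).symm i ≤ (⟨k - 1, by omega⟩ : Fin k) := by
        rw [Fin.le_def]; have := ((σ false).symm i).isLt; simp only; omega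
      have h0' : (σ true).symm i ≤ (⟨k - 1, by omega⟩ : Fin k) := by
        rw [Fin.le_def]; have := ((σ true).symm i).isLt; simp only; omega
      rw [hB false j hj, ← (hrow false).2 _ h0]
      refine (hG.east (σ true ⟨k - 1, by omega⟩) (σ false ⟨k - 1, by omega⟩) u (by simp [e1, e2])
        (by simp [e2]; omega)).symm.trans ?_
      exact (hrow true).2 _ h0'
  · exact ⟨fun j hj => hA true j hj, fun j hj => hB true j hj⟩

/-- The values of a function on the components. -/
def GapFunction.nameValue (G : D.GapFunction X) : D.FaceName → X
  | .up c => G.half (D.endEdge (c, true) true) true .left 1 true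
  | .lo c => G.half (D.endEdge (c, false) true) true .left 2 false
  | .rOver c => G.half (D.endEdge (c, true) true) true .right 0 true
  | .rUnder c => G.half (D.endEdge (c, false) true) true .right 2 false
  | .upEnd c h => G.half (D.endEdge (c, false) h) h .left 1 true
  | .loEnd c h => G.half (D.endEdge (c, true) h) h .right 0 false
  | .rEnd c h => G.half (D.endEdge (c, false) h) h .right 0 true
  | .outUp => G.half (D.lastEdge i) true .left 1 true
  | .outLo => G.half (D.lastEdge i) true .right 0 false
  | .close => G.half (D.lastEdge i) true .right 0 true
  | .fin h => G.half (D.lastEdge i) h .left 0 false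

theorem GapFunction.Steady.eq_over {G : D.GapFunction X} (hG : G.Steady i) (hc : G.Compatible i)
    (c h s u) : G.half (D.endEdge (c, true) h) h s 1 u =
      G.nameValue i (D.plainName i (D.endEdge (c, true) h) h s 1 u) := by
  have hst : ∀ s, G.half (D.endEdge (c, true) h) h s 1 true =
      G.half (D.endEdge (c, true) true) true s 1 true := by
    intro s
    cases h
    · rw [hG.far_over, hG.far_over]; exact (hc.straight c true s).symm
    · rfl
  rw [D.plainName_over]
  cases u
  · rw [if_neg (by simp)]
    simp only [nameValue]
    rw [hG.near_right]
    cases s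
    · rw [hG.far_over, hG.far_over]; exact hc.cap c false h
    · rfl
  · rw [if_pos rfl]
    cases s
    · rw [if_neg (by simp)]
      exact hst _
    · split_ifs with h1
      · simp only [nameValue]
        rw [hG.near_right]
        exact hst _
      · simp only [nameValue]
        rw [hst, hG.cross i hc _ _ fun _ h => h1 ⟨(D.endEdge_fst _ _).symm.trans h, rfl⟩]

theorem GapFunction.Steady.eq_under {G : D.GapFunction X} (hG : G.Steady i) (hc : G.Compatible i)
    (c h s u) {t} (ht : t = 1 ∨ t = 2) : G.half (D.endEdge (c, false) h) h s t u =
      G.nameValue i (D.plainName i (D.endEdge (c, false) h) h s t u) := by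
  have hst : ∀ s, G.half (D.endEdge (c, false) h) h s 2 false =
      G.half (D.endEdge (c, false) true) true s 2 false := by
    intro s
    cases h
    · exact (hc.straight c false s).symm
    · rfl
  have hcap := hc.cap c true h
  simp only [Bool.not_true] at hcap
  have hcross := hG.cross i hc (D.endEdge (c, false) h) h (u := false) (by simp)
  rw [D.plainName_under]
  by_cases hi : D.strand (c, false) = i
  · cases u
    · rw [if_neg (by simp)]
      have hf := fun s hs => hG.far_under (c := c) (h := h) (s := s) i false fun _ => hs
      rcases ht with rfl | rfl
      · cases hd : D.dipSide i c h <;> rw [hd] at hf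
        · have h1 := hf .right (by simp)
          have e : G.half (D.endEdge (c, false) h) h s 1 false =
              G.half (D.endEdge (c, false) h) h .right 1 false := by
            cases s
            · exact hcross
            · rfl
          rw [e, h1, hst]
          simp [hi, nameValue]
        · have h1 := hf .left (by simp)
          have e : G.half (D.endEdge (c, false) h) h s 1 false =
              G.half (D.endEdge (c, false) h) h .left 1 false := by
            cases s
            · rfl
            · exact hcross.symm
          rw [e, h1, hst]
          simp [hi, nameValue]
      · rw [hst]
        cases hd : D.dipSide i c h <;> cases s <;> simp [hi, nameValue]
    · rw [if_pos rfl]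
      have hf := fun s hs => hG.far_under (c := c) (h := h) (s := s) i true fun _ => hs
      rcases ht with rfl | rfl
      · cases s
        · simp [nameValue]
        · simp [hi, nameValue, hG.near_right]
      · cases hd : D.dipSide i c h <;> rw [hd] at hf
        · have h1 := hf .right (by simp)
          cases s
          · simp [hi, nameValue, hG.near_right, hcap, h1]
          · simp [hi, nameValue, hG.near_right, h1]
        · have h1 := hf .left (by simp)
          cases s
          · simp [nameValue, h1]
          · simp [nameValue, ← hcap, h1]
  · have hf := fun s u => hG.far_under (c := c) (h := h) (s := s) i u fun h => absurd h hi
    have e : G.half (D.endEdge (c, false) h) h s t u = G.half (D.endEdge (c, false) h) h s 2 u := by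
      rcases ht with rfl | rfl
      · exact hf s u
      · rfl
    rw [e]
    cases u
    · simp only [hi, false_and, if_false, Bool.false_eq_true, nameValue]
      rw [← hst]
      cases s
      · rfl
      · rw [← hf, ← hf, hcross]
    · simp only [hi, false_and, if_false, if_true, nameValue, hf]
      cases s
      · rfl
      · exact hcap.symm

theorem GapFunction.Steady.eq_border {G : D.GapFunction X} (hG : G.Steady i) (hc : G.Compatible i)
    (j h s u) : G.half (D.borderEdge j h) h s 1 u =
      G.nameValue i (D.plainName i (D.borderEdge j h) h s 1 u) := by
  obtain ⟨hr, hl⟩ := hG.border i hc h u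
  have hcross := fun u hu => hG.cross i hc (D.borderEdge j h) h (u := u) hu
  rw [D.borderEdge_fst] at hcross
  have hlast := fun s u => hG.far_border i i true s u
  change ∀ s u, G.half (D.lastEdge i) true s 1 u = G.half (D.lastEdge i) true s 2 u at hlast
  simp only [hG.far_border] at hcross ⊢
  rw [D.plainName_border]
  have hp := D.position_eq j i h
  have hc' := hG.cross i hc (D.lastEdge i) true (u := false) (by simp)
  rw [hlast, hlast] at hc'
  cases u
  · rw [if_neg (by simp)]
    simp only [nameValue, hG.near_right, hlast]
    rcases le_total (D.position j h) (D.position i h) with h1 | h1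
    · cases s
      · rw [hcross _ (by simp), hr j h1]
      · exact hr j h1
    · cases s
      · rw [hl j h1, hc']
      · rw [← hcross _ (by simp), hl j h1, hc']
  · rw [if_pos rfl]
    rcases lt_trichotomy (D.position j h) (D.position i h) with h1 | h1 | h1
    · have hne : j ≠ i := by rintro rfl; exact h1.ne rfl
      simp only [h1, or_true, if_true, nameValue, hG.near_right, hlast]
      cases s
      · rw [hcross _ fun _ => hne, hr j h1.le]
      · exact hr j h1.le
    · obtain rfl := hp.mp h1
      simp only [lt_irrefl, or_false, true_and]
      cases s
      · simp only [reduceCtorEq, if_false, nameValue, hlast]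
        exact hl _ le_rfl
      · simp only [if_true, nameValue, hG.near_right, hlast]
        exact hr _ le_rfl
    · have hne : j ≠ i := by rintro rfl; exact h1.ne rfl
      simp only [h1.not_gt, hne, false_and, or_false, if_false, nameValue, hlast]
      cases s
      · exact hl j h1.le
      · rw [← hcross _ fun _ => hne, hl j h1.le]

/-- A function on the components is determined by its values on the named gaps. -/
theorem GapFunction.Steady.eq_nameValue {G : D.GapFunction X} (hG : G.Steady i)
    (hc : G.Compatible i) (e h s u) {t : ℕ} (ht : t ≤ 2) :
    G.half e h s t u = G.nameValue i (D.halfName i e h s t u) := by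
  have key : ∀ s t, t ≤ 2 → ¬ (e = D.lastEdge i ∧ s = .left ∧ t = 0) →
      G.half e h s t u = G.nameValue i (D.plainName i e h s t u) := by
    have h1 : ∀ s t, t = 1 ∨ t = 2 →
        G.half e h s t u = G.nameValue i (D.plainName i e h s t u) := by
      intro s t ht
      rcases D.end_cases e h with ⟨⟨c, l⟩, rfl⟩ | ⟨j, rfl⟩
      · cases l
        · exact hG.eq_under i hc c h s u ht
        · rcases ht with rfl | rfl
          · exact hG.eq_over i hc c h s u
          · rw [← hG.far_over, hG.eq_over i hc, D.plainName_over, D.plainName_over]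
      · rcases ht with rfl | rfl
        · exact hG.eq_border i hc j h s u
        · rw [← hG.far_border, hG.eq_border i hc, D.plainName_border, D.plainName_border]
    intro s t ht hn
    by_cases h0 : t = 0
    · subst h0
      rw [hG.near _ _ _ _ fun h => hn ⟨h.1, h.2, rfl⟩, h1 s 1 (.inl rfl), D.plainName_one]
    · exact h1 s t (by omega)
  unfold halfName
  split_ifs with h1 h2
  · obtain ⟨rfl, rfl, rfl⟩ := h1
    subst h2
    rw [hc.tube_last h, key .right 0 (by norm_num) (by simp)]
  · obtain ⟨rfl, rfl, rfl⟩ := h1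
    simp only [Bool.not_eq_true] at h2
    subst h2
    rfl
  · exact key s t ht h1

theorem exists_gapNum (s) {n : ℕ} (hn : n ≤ 5) : ∃ h t, t ≤ 2 ∧ gapNum h s t = n := by
  by_cases hn' : n < 3
  · exact ⟨if s = .left then false else true, 2 - n, by omega, by
      cases s <;> simp only [gapNum, if_true, if_false, reduceCtorEq] <;> omega⟩
  · exact ⟨if s = .left then true else false, n - 3, by omega, by
      cases s <;> simp only [gapNum, if_true, if_false, reduceCtorEq] <;> omega⟩

theorem GapFunction.value_map {Y : Type*} (f : X → Y) (G : D.GapFunction X) (d) :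
    GapFunction.value i (fun a n u => f (G a n u)) d = f (G.value i d) := by
  have h : ∀ a u, GapFunction.after (fun a n u => f (G a n u)) a u = f (G.after a u) := by
    intro a u
    unfold after
    split_ifs <;> rfl
  obtain ⟨p | m, a⟩ := d
  · fin_cases a
    · exact h _ false
    · rfl
    · rfl
    · exact h _ true
  · change GapFunction.atMid i (fun a n u => f (G a n u)) m a = f (G.atMid i m a)
    unfold atMid
    split_ifs <;> fin_cases a <;> rfl

theorem GapFunction.value_congr {G G' : D.GapFunction X}
    (h : ∀ e h s t u, t ≤ 2 → G.half e h s t u = G'.half e h s t u) (d) :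
    G.value i d = G'.value i d := by
  have h1 : ∀ a n u, n ≤ 5 → G a n u = G' a n u := by
    rintro ⟨e, s⟩ n u hn
    obtain ⟨h', t, ht, rfl⟩ := exists_gapNum s hn
    exact h e h' s t u ht
  obtain ⟨p | m, a⟩ := d
  · have hp := D.place_le i p
    have h2 : ∀ u, G.after (D.place i p) u = G'.after (D.place i p) u := by
      intro u
      unfold GapFunction.after
      split_ifs
      · exact h1 _ _ _ (by omega)
      · exact h1 _ _ _ (by omega)
    fin_cases a
    · exact h2 false
    · exact h1 _ _ _ hp
    · exact h1 _ _ _ hp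
    · exact h2 true
  · change G.atMid i m a = G'.atMid i m a
    unfold GapFunction.atMid
    split_ifs <;> fin_cases a <;> exact h1 _ _ _ (by norm_num)

/-- Every gap can be joined to a chosen gap with the same name by moves that do not change the
value, so a function on the faces factors through the names. -/
theorem gapFunction_eq (P : D.Face i → X) : ∃ p : D.FaceName → X,
    (∀ d, P (Quot.mk _ d) = p ((D.gapName i).value i d)) := by
  obtain ⟨G, hG, hP⟩ := D.exists_gapFunction i P
  have hc : G.Compatible i := GapFunction.compatible i fun d d' h => by
    rw [← hP, ← hP, Quot.sound h]
  refine ⟨G.nameValue i, fun d => ?_⟩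
  rw [hP]
  refine Eq.trans ?_ (GapFunction.value_map i (G.nameValue i) (D.gapName i) d)
  refine GapFunction.value_congr i (fun e h s t u ht => ?_) d
  rw [(hG.steady i).eq_nameValue i hc e h s u ht, ← D.gapName_half _ _ _ _ _ ht]
  rfl

end Diagram
end StringLink

/-! ### The faces and the Euler measure -/

namespace StringLink
namespace Diagram

variable {k : ℕ} (D : Diagram k) (i : Fin k)

/-- The names of components that exist for strand `i`. -/
def FaceName.Valid : D.FaceName → Prop
  | .rOver c => D.strand (c, true) = i
  | .rUnder c => D.strand (c, false) = i
  | .rEnd c _ => D.strand (c, false) = i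
  | _ => True

theorem plainName_valid (e h s t u) : (D.plainName i e h s t u).Valid D i := by
  rcases D.end_cases e h with ⟨⟨c, l⟩, rfl⟩ | ⟨j, rfl⟩
  · cases l
    · rw [plainName_under]
      split_ifs with h1 h2 h3
      · exact h2.1
      · trivial
      · exact h3.1
      · trivial
    · rw [plainName_over]
      split_ifs with h1 h2
      · exact h2.1
      · trivial
      · trivial
  · rw [plainName_border]
    split_ifs <;> trivial

theorem halfName_valid (e h s t u) : (D.halfName i e h s t u).Valid D i := by
  unfold halfName
  split_ifs
  · exact D.plainName_valid i _ _ _ _ _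
  · trivial
  · exact D.plainName_valid i _ _ _ _ _

theorem exists_halfName {l : D.FaceName} (hl : l.Valid D i) :
    ∃ e h s t u, t ≤ 2 ∧ D.halfName i e h s t u = l := by
  have key : ∀ e h s t u, t ≤ 2 → t ≠ 0 → D.plainName i e h s t u = l →
      ∃ e h s t u, t ≤ 2 ∧ D.halfName i e h s t u = l := by
    intro e h s t u ht h0 hp
    exact ⟨e, h, s, t, u, ht, by rw [halfName, if_neg fun h => h0 h.2.2, hp]⟩
  cases l with
  | up c =>
      exact key _ _ .left 1 true (by norm_num) (by norm_num)
        ((D.plainName_over i c true _ _ _).trans (by simp))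
  | lo c =>
      exact key _ _ .left 2 false (by norm_num) (by norm_num)
        ((D.plainName_under i c true _ _ _).trans (by cases D.dipSide i c true <;> simp))
  | rOver c =>
      have hl : D.strand (c, true) = i := hl
      exact key _ _ .right 1 true (by norm_num) (by norm_num)
        ((D.plainName_over i c true _ _ _).trans (by simp [hl]))
  | rUnder c =>
      have hl : D.strand (c, false) = i := hl
      exact key _ _ .right 2 false (by norm_num) (by norm_num)
        ((D.plainName_under i c true _ _ _).trans (by cases D.dipSide i c true <;> simp [hl]))
  | upEnd c h =>
      exact key _ _ .left 1 true (by norm_num) (by norm_num)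
        ((D.plainName_under i c h _ _ _).trans (by simp))
  | loEnd c h =>
      exact key _ _ .left 1 false (by norm_num) (by norm_num)
        ((D.plainName_over i c h _ _ _).trans (by simp))
  | rEnd c h =>
      have hl : D.strand (c, false) = i := hl
      exact key _ _ .right 1 true (by norm_num) (by norm_num)
        ((D.plainName_under i c h _ _ _).trans (by simp [hl]))
  | outUp =>
      exact key _ _ .left 1 true (by norm_num) (by norm_num)
        ((D.plainName_border i i true _ _ _).trans (by simp))
  | outLo =>
      exact key _ _ .left 1 false (by norm_num) (by norm_num)
        ((D.plainName_border i i true _ _ _).trans (by simp))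
  | close =>
      exact key _ _ .right 1 true (by norm_num) (by norm_num)
        ((D.plainName_border i i true _ _ _).trans (by simp))
  | fin h => exact ⟨D.lastEdge i, h, .left, 0, false, by norm_num, by simp [halfName]⟩

/-- The components of the complement of all curves and their names. -/
theorem exists_faceEquiv : ∃ φ : D.Face i ≃ {l : D.FaceName // l.Valid D i},
    ∀ d, (φ (Quot.mk _ d) : D.FaceName) = (D.gapName i).value i d := by
  obtain ⟨f, hf⟩ := D.exists_faceName i
  -- Applied to the identity of the faces, the factorization through names yields a left inverse of
  -- the naming map.
  obtain ⟨p, hp⟩ := gapFunction_eq i (fun x : D.Face i => x)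
  have hv : ∀ x, (f x).Valid D i := by
    rintro ⟨d⟩
    obtain ⟨e, h, s, t, u, ht, hd⟩ := (D.gapName i).exists_half i d
    rw [hf, hd, D.gapName_half _ _ _ _ _ ht]
    exact D.halfName_valid i _ _ _ _ _
  refine ⟨Equiv.ofBijective (fun x => ⟨f x, hv x⟩) ⟨?_, ?_⟩, hf⟩
  · have hpf : ∀ x, p (f x) = x := by
      rintro ⟨d⟩
      rw [hf]
      exact (hp d).symm
    intro x y hxy
    rw [← hpf x, ← hpf y]
    exact congrArg p (congrArg Subtype.val hxy)
  · rintro ⟨l, hl⟩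
    obtain ⟨e, h, s, t, u, ht, rfl⟩ := D.exists_halfName i hl
    obtain ⟨d, hd⟩ := ((D.gapName_steady i).consistent i).exists_value i e h s u ht
    refine ⟨Quot.mk _ d, Subtype.ext ?_⟩
    simp only
    rw [hf, hd, D.gapName_half _ _ _ _ _ ht]

/-- The names of components as a sum type. -/
def nameEquiv : D.FaceName ≃
    (Fin D.numCrossings × (Fin 4 ⊕ Bool × Fin 3)) ⊕ (Fin 3 ⊕ Bool) where
  toFun
    | .up c => .inl (c, .inl 0)
    | .lo c => .inl (c, .inl 1)
    | .rOver c => .inl (c, .inl 2)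
    | .rUnder c => .inl (c, .inl 3)
    | .upEnd c h => .inl (c, .inr (h, 0))
    | .loEnd c h => .inl (c, .inr (h, 1))
    | .rEnd c h => .inl (c, .inr (h, 2))
    | .outUp => .inr (.inl 0)
    | .outLo => .inr (.inl 1)
    | .close => .inr (.inl 2)
    | .fin h => .inr (.inr h)
  invFun
    | .inl (c, .inl 0) => .up c
    | .inl (c, .inl 1) => .lo c
    | .inl (c, .inl 2) => .rOver c
    | .inl (c, .inl 3) => .rUnder c
    | .inl (c, .inr (h, 0)) => .upEnd c h
    | .inl (c, .inr (h, 1)) => .loEnd c h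
    | .inl (c, .inr (h, 2)) => .rEnd c h
    | .inr (.inl 0) => .outUp
    | .inr (.inl 1) => .outLo
    | .inr (.inl 2) => .close
    | .inr (.inr h) => .fin h
  left_inv l := by cases l <;> rfl
  right_inv
    | .inl (c, .inl 0) => rfl
    | .inl (c, .inl 1) => rfl
    | .inl (c, .inl 2) => rfl
    | .inl (c, .inl 3) => rfl
    | .inl (c, .inr (h, 0)) => rfl
    | .inl (c, .inr (h, 1)) => rfl
    | .inl (c, .inr (h, 2)) => rfl
    | .inr (.inl 0) => rfl
    | .inr (.inl 1) => rfl
    | .inr (.inl 2) => rfl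
    | .inr (.inr h) => rfl

instance : Fintype D.FaceName := Fintype.ofEquiv _ D.nameEquiv.symm

theorem sum_faceName {M : Type*} [AddCommMonoid M] (g : D.FaceName → M) :
    ∑ l, g l = ∑ c, (g (.up c) + g (.lo c) + g (.rOver c) + g (.rUnder c) +
      ∑ h, (g (.upEnd c h) + g (.loEnd c h) + g (.rEnd c h))) +
      (g .outUp + g .outLo + g .close + ∑ h, g (.fin h)) := by
  rw [← D.nameEquiv.symm.sum_comp, Fintype.sum_sum_type, Fintype.sum_prod_type]
  simp only [Fintype.sum_sum_type, Fintype.sum_prod_type]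
  simp only [Fin.sum_univ_four, Fin.sum_univ_three]
  rfl

variable {i} in
/-- The intersection points as a sum type. -/
def vertexEquiv : D.Vertex i ≃ ((Fin D.numCrossings × Quadrant) ⊕ D.EdgeSide) ⊕
    ((D.UnderPos i ⊕ D.UnderPos i) ⊕ (Bool ⊕ Fin (D.len i + 1))) where
  toFun
    | .pt (.corner c q) => .inl (.inl (c, q))
    | .pt (.tube e s) => .inl (.inr (e, s))
    | .pt (.dipIn u) => .inr (.inl (.inl u))
    | .pt (.dipOut u) => .inr (.inl (.inr u))
    | .pt .before => .inr (.inr (.inl true))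
    | .pt .after => .inr (.inr (.inl false))
    | .mid m => .inr (.inr (.inr m))
  invFun
    | .inl (.inl (c, q)) => .pt (.corner c q)
    | .inl (.inr (e, s)) => .pt (.tube e s)
    | .inr (.inl (.inl u)) => .pt (.dipIn u)
    | .inr (.inl (.inr u)) => .pt (.dipOut u)
    | .inr (.inr (.inl true)) => .pt .before
    | .inr (.inr (.inl false)) => .pt .after
    | .inr (.inr (.inr m)) => .mid m
  left_inv v := by rcases v with (⟨c, q⟩ | ⟨e, s⟩ | u | u | _ | _) | m <;> rfl
  right_inv v := by rcases v with (⟨c, q⟩ | ⟨e, s⟩) | ((u | u) | ((_ | _) | m)) <;> rfl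

instance : Fintype (D.Vertex i) := Fintype.ofEquiv _ D.vertexEquiv.symm

theorem sum_vertex {M : Type*} [AddCommMonoid M] (g : D.Vertex i → M) :
    ∑ v, g v = (∑ c, ∑ q, g (.pt (.corner c q)) + ∑ e, ∑ s, g (.pt (.tube e s))) +
      ((∑ u, g (.pt (.dipIn u)) + ∑ u, g (.pt (.dipOut u))) +
        ((g (.pt .before) + g (.pt .after)) + ∑ m, g (.mid m))) := by
  rw [← D.vertexEquiv.symm.sum_comp]
  simp only [Fintype.sum_sum_type, Fintype.sum_prod_type, Fintype.sum_bool]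
  rfl

-- Each corner takes a quarter from the face it belongs to. Summed by vertices instead of by faces,
-- the quarters at a vertex make up its point measure.
open Classical in
theorem eulerMeasure_eq {P : D.Face i → ℤ} {p : D.FaceName → ℤ}
    (hP : ∀ d, P (Quot.mk _ d) = p ((D.gapName i).value i d)) :
    D.eulerMeasure i P = (∑ l, if l.Valid D i then (p l : ℚ) else 0) -
      ∑ v, D.pointMeasure i P v := by
  obtain ⟨φ, hφ⟩ := D.exists_faceEquiv i
  have hpφ : ∀ f, P f = p (φ f) := by
    rintro ⟨d⟩
    rw [hφ]
    exact hP d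
  let : Fintype (D.Face i) := Fintype.ofEquiv _ φ.symm
  unfold eulerMeasure
  rw [finsum_eq_sum_of_fintype]
  simp only [mul_sub, mul_one, Finset.sum_sub_distrib]
  congr 1
  · rw [← Finset.sum_filter, ← Finset.sum_subtype_eq_sum_filter, Finset.subtype_univ,
      ← φ.sum_comp]
    exact Finset.sum_congr rfl fun f _ => by rw [hpφ]
  · have h1 : ∀ f : D.Face i, (P f : ℚ) * ((Nat.card {d : D.Dart i // Quot.mk _ d = f} : ℚ) / 4) =
        ∑ d : D.Dart i with Quot.mk _ d = f, (P (Quot.mk _ d) : ℚ) / 4 := by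
      intro f
      rw [Finset.sum_congr rfl fun d hd => by rw [(Finset.mem_filter.mp hd).2], Finset.sum_const,
        nsmul_eq_mul, Nat.card_eq_fintype_card, Fintype.card_subtype]
      ring
    simp only [h1]
    let π : D.Dart i → D.Face i := Quot.mk _
    refine (Finset.sum_fiberwise Finset.univ π
      fun d => (P (Quot.mk _ d) : ℚ) / 4).trans ?_
    rw [Fintype.sum_prod_type]
    refine Finset.sum_congr rfl fun v _ => ?_
    rw [pointMeasure, Finset.sum_div]
    rfl

end Diagram
end StringLink

/-! ### Periodic domains as numberings -/

namespace StringLink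
namespace Diagram

variable {k : ℕ} (D : Diagram k) (i : Fin k)

/-- Multiplicities of the components that come from a Seifert surface: they differ between the upper
and the lower sheet by a numbering of the regions, and agree on both sides of the auxiliary curves. -/
structure SeifertNumbers (p : D.FaceName → ℤ) (b : D.Region → ℤ) : Prop where
  vanishes : D.VanishesLeft b
  numbering : ∀ e, D.diff b e = if e.1 = i then -1 else 0
  lower : ∀ e h s t, t ≤ 2 →
    p (D.halfName i e h s t false) = p (D.halfName i e h s t true) + b (D.region (e, s))
  tube : ∀ e s, (e.1 = i ∨ e ≠ D.lastEdge e.1) →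
    p (D.halfName i e true s 0 true) = p (D.halfName i e false s 0 true)

theorem halfName_pos (e h s u) {t : ℕ} (h0 : t ≠ 0) :
    D.halfName i e h s t u = D.plainName i e h s t u := by
  rw [halfName, if_neg fun h => h0 h.2.2]

theorem halfName_right (e h u) {t : ℕ} :
    D.halfName i e h .right t u = D.plainName i e h .right t u := by
  rw [halfName, if_neg fun h => by cases h.2.1]

theorem plainName_under_lower (c h s) : D.plainName i (D.endEdge (c, false) h) h s 2 false =
    if D.strand (c, false) = i ∧ s = .right then .rUnder c else .lo c := by
  rw [plainName_under]
  by_cases hc : D.strand (c, false) = i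
  · cases s <;> cases D.dipSide i c h <;> simp [hc]
  · simp [hc]

theorem plainName_under_upper (c h s) : D.plainName i (D.endEdge (c, false) h) h s 2 true =
    if D.strand (c, false) = i ∧ D.dipSide i c h = .left then .rEnd c h else .upEnd c h := by
  rw [plainName_under]
  by_cases hc : D.strand (c, false) = i
  · cases s <;> cases D.dipSide i c h <;> simp [hc]
  · simp [hc]

theorem gapNum_le (h s) {t : ℕ} (ht : t ≤ 2) : gapNum h s t ≤ 5 := by
  cases h <;> cases s <;> simp only [gapNum] <;> omega

/-- The jump of the numbers along a strand. -/
theorem numbering_of_lower {p : D.FaceName → ℤ} {b : D.Region → ℤ}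
    (hl : ∀ e h s t, t ≤ 2 →
      p (D.halfName i e h s t false) = p (D.halfName i e h s t true) + b (D.region (e, s)))
    (h1 : p (.fin true) - p .outLo = 1) (e : D.Edge) : D.diff b e = if e.1 = i then -1 else 0 := by
  have hother : ∀ e : D.Edge, e.1 ≠ i → D.diff b e = 0 := by
    intro e he
    have h2 := fun u => (D.gapName_compatible i).tube e he true u
    simp only [D.gapName_half _ _ _ _ _ (by norm_num : 0 ≤ 2)] at h2
    have h3 := hl e true .left 0 (by norm_num)
    have h4 := hl e true .right 0 (by norm_num)
    rw [h2, h2] at h3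
    rw [diff]; linarith
  have hlast : D.diff b (D.lastEdge i) = -1 := by
    have h3 := hl (D.lastEdge i) true .left 0 (by norm_num)
    have h4 := hl (D.lastEdge i) true .right 0 (by norm_num)
    have e1 : D.halfName i (D.lastEdge i) true .left 0 false = .fin true := by simp [halfName]
    have e2 : D.halfName i (D.lastEdge i) true .left 0 true =
        D.halfName i (D.lastEdge i) true .right 0 true := by simp [halfName]
    have e3 : D.halfName i (D.lastEdge i) true .right 0 false = .outLo := by
      rw [halfName_right]
      exact D.plainName_border i i true _ _ _
    rw [e1, e2] at h3
    rw [e3] at h4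
    rw [diff]; linarith
  -- At a passage, the difference across both adjacent edges is expressed by the same faces at the
  -- crossing: those on the lower sheet for an under passage, those on the upper sheet for an over
  -- passage.
  have hstep : ∀ p', D.diff b (D.inEdge p') = D.diff b (D.outEdge p') := by
    suffices ∀ p', ∃ z, ∀ h, D.diff b (D.endEdge p' h) = z by
      intro p'
      obtain ⟨z, hz⟩ := this p'
      exact (hz true).trans (hz false).symm
    rintro ⟨c, _ | _⟩
    · refine ⟨p (if D.strand (c, false) = i then .rUnder c else .lo c) - p (.lo c), fun h => ?_⟩
      have h3 := hl (D.endEdge (c, false) h) h .left 2 (by norm_num)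
      have h4 := hl (D.endEdge (c, false) h) h .right 2 (by norm_num)
      simp only [D.halfName_pos i _ _ _ _ (show 2 ≠ 0 by norm_num), plainName_under_lower,
        plainName_under_upper, reduceCtorEq, and_false, if_false, and_true] at h3 h4
      rw [diff]; linarith
    · refine ⟨p (.up c) - p (if D.strand (c, true) = i then .rOver c else .up c), fun h => ?_⟩
      have h3 := hl (D.endEdge (c, true) h) h .left 2 (by norm_num)
      have h4 := hl (D.endEdge (c, true) h) h .right 2 (by norm_num)
      simp only [D.halfName_pos i _ _ _ _ (show 2 ≠ 0 by norm_num), plainName_over,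
        reduceCtorEq, and_false, if_false, and_true, if_true, Bool.false_eq_true] at h3 h4
      rw [diff]; linarith
  rw [D.diff_const fun c => sub_eq_zero.mpr (hstep _)]
  split_ifs with h
  · rw [h, hlast]
  · exact hother _ h

/-- At a point of a `β`-curve, the curve condition says that the step from the upper to the lower
sheet is the same on both sides of the point. So this step is a function `b` on the regions; the
coefficient of `λ` becomes the jump of `b` across strand `i`. -/
theorem isSeifertDomain_iff {P : D.Face i → ℤ} {p : D.FaceName → ℤ}
    (hP : ∀ d, P (Quot.mk _ d) = p ((D.gapName i).value i d)) :
    D.IsSeifertDomain i P ↔ ∃ b, D.SeifertNumbers i p b := by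
  let G : D.GapFunction ℤ := fun a n u => p (D.gapName i a n u)
  have hG : G.Consistent i := by
    have h := (D.gapName_steady i).consistent i
    exact ⟨fun a n u hn hp => congrArg p (h.skip a n u hn hp), fun a u hp => congrArg p (h.last a u hp)⟩
  have hGP : ∀ v a, D.mult i P v a = G.value i (v, a) := fun v a =>
    (hP (v, a)).trans (GapFunction.value_map i p (D.gapName i) _).symm
  have hhalf : ∀ e h s u t, t ≤ 2 → G.half e h s t u = p (D.halfName i e h s t u) :=
    fun e h s u t ht => congrArg p (D.gapName_half i e h s u ht)
  have hmid : ∀ (m : Fin (D.len i + 1)), m ≠ Fin.last _ → ∀ a, D.mult i P (.mid m) a =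
      ![G (⟨i, m⟩, .left) 3 true, G (⟨i, m⟩, .left) 2 true, G (⟨i, m⟩, .right) 3 true,
        G (⟨i, m⟩, .right) 2 true] a := by
    intro m hm a
    rw [hGP]
    simp only [GapFunction.value, GapFunction.atMid, if_neg hm]
  have hlast : ∀ a, D.mult i P (.mid (Fin.last _)) a = ![G (D.lastEdge i, .right) 2 false,
      G (D.lastEdge i, .right) 3 false, G (D.lastEdge i, .left) 2 false,
      G (D.lastEdge i, .left) 3 false] a := by
    intro a
    rw [hGP]
    simp only [GapFunction.value, GapFunction.atMid, if_true]
    rfl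
  have e1 : G (D.lastEdge i, .left) 3 false = p (.fin true) := by
    refine (hhalf (D.lastEdge i) true .left false 0 (by norm_num)).trans ?_
    simp [halfName]
  have e2 : G (D.lastEdge i, .right) 2 false = p .outLo := by
    refine (hhalf (D.lastEdge i) true .right false 0 (by norm_num)).trans ?_
    rw [halfName_right]
    exact congrArg p (D.plainName_border i i true _ _ _)
  constructor
  · rintro ⟨⟨hcurves, htubes, hleft⟩, hone⟩
    have hpt : ∀ q, G.after (D.place i q) false - G.after (D.place i q) true =
        G (D.place i q).1 (D.place i q).2 false - G (D.place i q).1 (D.place i q).2 true := by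
      intro q
      have h := hcurves (.pt q)
      rw [hGP, hGP, hGP, hGP] at h
      change G.after _ false + G _ _ true = G _ _ false + G.after _ true at h
      linarith
    have hstep : ∀ a n, n < 5 → G a n false - G a n true = G a (n + 1) false - G a (n + 1) true := by
      intro a n hn
      by_cases h : ∃ q, D.place i q = (a, n)
      · obtain ⟨q, hq⟩ := h
        have := hpt q
        simp only [hq, GapFunction.after, if_neg hn.ne] at this
        exact this.symm
      · rw [hG.skip _ _ _ hn fun q hq => h ⟨q, hq⟩, hG.skip _ _ _ hn fun q hq => h ⟨q, hq⟩]
    have hnext : ∀ a, G a 5 false - G a 5 true = G (D.next a) 0 false - G (D.next a) 0 true := by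
      intro a
      by_cases h : ∃ q, D.place i q = (a, 5)
      · obtain ⟨q, hq⟩ := h
        have := hpt q
        simp only [hq, GapFunction.after, if_true] at this
        exact this.symm
      · rw [hG.last _ _ fun q hq => h ⟨q, hq⟩, hG.last _ _ fun q hq => h ⟨q, hq⟩]
    have hconst : ∀ a n, n ≤ 5 → G a n false - G a n true = G a 0 false - G a 0 true := by
      intro a n hn
      induction n with
      | zero => rfl
      | succ n ih => rw [← hstep a n (by omega), ih (by omega)]
    -- The multiplicity of the `β`-curve of the region in the boundary, constant along the whole
    -- walk around it.
    let b : D.Region → ℤ := Quot.lift (fun a => G a 0 false - G a 0 true) (by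
      rintro a _ rfl
      rw [← hnext, hconst a 5 le_rfl])
    have hb : ∀ a n, n ≤ 5 → G a n false = G a n true + b (D.region a) := by
      intro a n hn
      change _ = _ + (G a 0 false - G a 0 true)
      rw [← hconst a n hn]; ring
    have hl : ∀ e h s t, t ≤ 2 →
        p (D.halfName i e h s t false) = p (D.halfName i e h s t true) + b (D.region (e, s)) := by
      intro e h s t ht
      rw [← hhalf _ _ _ _ _ ht, ← hhalf _ _ _ _ _ ht]
      exact hb _ _ (gapNum_le h s ht)
    refine ⟨b, ?_, D.numbering_of_lower i hl ?_, hl, ?_⟩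
    · rintro R ⟨j, hj, rfl⟩
      have h := hleft (.tube (D.lastEdge j) .right) ⟨j, hj, rfl⟩
      rw [hGP, hGP] at h
      have h' := hb (D.lastEdge j, .right) 3 (by norm_num)
      change G (D.lastEdge j, .right) 3 false = G (D.lastEdge j, .right) 3 true at h
      linarith
    · rw [hlast, hlast] at hone
      rw [← e1, ← e2]
      exact hone
    · intro e s he
      have h := htubes e s he
      rw [hGP, hGP] at h
      change G (e, s) 2 true = G (e, s) 3 true at h
      rw [← hhalf _ _ _ _ _ (by norm_num), ← hhalf _ _ _ _ _ (by norm_num)]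
      cases s
      · exact h.symm
      · exact h
  · rintro ⟨b, h0, hn, hl, ht⟩
    have hb : ∀ a n, n ≤ 5 → G a n false = G a n true + b (D.region a) := by
      rintro ⟨e, s⟩ n hn
      obtain ⟨h, t, ht, rfl⟩ := exists_gapNum s hn
      have := hl e h s t ht
      rwa [← hhalf _ _ _ _ _ ht, ← hhalf _ _ _ _ _ ht] at this
    have hafter : ∀ q, G.after (D.place i q) false = G.after (D.place i q) true +
        b (D.region (D.place i q).1) := by
      intro q
      have := D.place_le i q
      unfold GapFunction.after
      split_ifs
      · rw [hb _ _ (by norm_num), D.region_next]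
      · exact hb _ _ (by omega)
    have htube : ∀ (e : D.Edge) s, (e.1 = i ∨ e ≠ D.lastEdge e.1) →
        G (e, s) 2 true = G (e, s) 3 true := by
      intro e s he
      have := ht e s he
      rw [← hhalf _ _ _ _ _ (by norm_num), ← hhalf _ _ _ _ _ (by norm_num)] at this
      cases s
      · exact this.symm
      · exact this
    refine ⟨⟨?_, ?_, ?_⟩, ?_⟩
    · rintro (q | m)
      · rw [hGP, hGP, hGP, hGP]
        change G.after _ false + G _ _ true = G _ _ false + G.after _ true
        rw [hafter, hb _ _ (D.place_le i q)]
        ring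
      · by_cases hm : m = Fin.last _
        · subst hm
          rw [hlast, hlast, hlast, hlast]
          change G (D.lastEdge i, .right) 2 false + G (D.lastEdge i, .left) 2 false =
            G (D.lastEdge i, .right) 3 false + G (D.lastEdge i, .left) 3 false
          rw [hb _ 2 (by norm_num), hb _ 2 (by norm_num), hb _ 3 (by norm_num),
            hb _ 3 (by norm_num), htube _ _ (.inl rfl), htube _ _ (.inl rfl)]
        · rw [hmid m hm, hmid m hm, hmid m hm, hmid m hm]
          change G (⟨i, m⟩, .left) 3 true + G (⟨i, m⟩, .right) 3 true =
            G (⟨i, m⟩, .left) 2 true + G (⟨i, m⟩, .right) 2 true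
          rw [htube _ _ (.inl rfl), htube _ _ (.inl rfl)]
    · intro e s he
      rw [hGP, hGP]
      exact htube e s he
    · intro q hq
      rw [hGP, hGP]
      change G.after _ false = G.after _ true
      rw [hafter, h0 _ hq, add_zero]
    · rw [hlast, hlast]
      change G (D.lastEdge i, .left) 3 false - G (D.lastEdge i, .right) 2 false = 1
      have h1 := hn (D.lastEdge i)
      rw [if_pos (show (D.lastEdge i).1 = i from rfl), diff] at h1
      have h2 := (D.gapName_compatible i).tube_last true
      have h3 : G (D.lastEdge i, .left) 3 true = G (D.lastEdge i, .right) 2 true := congrArg p h2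
      rw [hb _ 3 (by norm_num), hb _ 2 (by norm_num), h3]
      linarith

end Diagram
end StringLink

/-! ### Multiplicities and point measures of a Seifert domain -/

namespace StringLink
namespace Diagram

variable {k : ℕ} {D : Diagram k} {i : Fin k} {p : D.FaceName → ℤ} {b : D.Region → ℤ}

/-- A numbering of the regions on the border of the square. -/
theorem numbering_border (h0 : D.VanishesLeft b) (hb : ∀ e, D.diff b e = if e.1 = i then -1 else 0)
    (h) : (∀ j, D.position j h ≤ D.position i h → b (D.region (D.borderEdge j h, .right)) = 0) ∧
      ∀ j, D.position i h ≤ D.position j h → b (D.region (D.borderEdge j h, .left)) = 1 := by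
  obtain ⟨σ, hσ⟩ : ∃ σ : Equiv.Perm (Fin k), ∀ j, D.position j h = σ.symm j :=
    ⟨if h then D.bot else D.top, by intro j; cases h <;> rfl⟩
  have hd : ∀ j, b (D.region (D.borderEdge j h, .left)) =
      b (D.region (D.borderEdge j h, .right)) + if j = i then 1 else 0 := by
    intro j
    have h1 := hb (D.borderEdge j h)
    rw [diff, borderEdge_fst] at h1
    split_ifs at h1 ⊢ <;> linarith
  have hrow := eq_of_row (p₀ := σ.symm i)
    (A := fun q => b (D.region (D.borderEdge (σ q) h, .right)))
    (B := fun q => b (D.region (D.borderEdge (σ q) h, .left)))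
    (fun q q' hq => by
      have hq' : (D.position (σ q') h : ℕ) = D.position (σ q) h + 1 := by simp [hσ, hq]
      cases h
      · exact congrArg b (D.region_top_left _ _ hq').symm
      · exact congrArg b (D.region_bot_left _ _ hq').symm)
    (fun q hq => by
      rw [hd, if_neg (by rintro rfl; simp at hq), add_zero])
  simp only [Equiv.apply_symm_apply] at hrow
  have hz : b (D.region (D.borderEdge i h, .right)) = 0 := by
    have hk := i.pos
    rw [← hrow.1 ⟨0, hk⟩ (Nat.zero_le _)]
    have hpos : (D.position (σ ⟨0, hk⟩) h : ℕ) = 0 := by simp [hσ]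
    cases h
    · have h1 := D.region_next (D.borderEdge (σ ⟨0, hk⟩) false, .right)
      have h2 := D.next_firstEdge_right (σ ⟨0, hk⟩)
      rw [if_neg (by change ¬ 0 < (D.position (σ ⟨0, hk⟩) false : ℕ); omega)] at h2
      rw [← h1]
      exact h0 _ ⟨_, by rw [Equiv.symm_apply_apply]; exact hpos, congrArg D.region h2⟩
    · exact h0 _ ⟨_, hpos, rfl⟩
  refine ⟨fun j hj => ?_, fun j hj => ?_⟩
  · rw [hσ, hσ] at hj
    rw [← hz, ← hrow.1 _ hj, Equiv.apply_symm_apply]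
  · rw [hσ, hσ] at hj
    have h1 := hrow.2 _ hj
    rw [Equiv.apply_symm_apply] at h1
    rw [h1, hd, if_pos rfl, hz, zero_add]

namespace SeifertNumbers

theorem left_eq (h : D.SeifertNumbers i p b) (e : D.Edge) : b (D.region (e, .left)) =
    b (D.region (e, .right)) + if e.1 = i then 1 else 0 := by
  have := h.numbering e
  rw [diff] at this
  split_ifs at this ⊢ <;> linarith

/-- Below the tube, left and right belong to one face, while `b` is larger by one on the left. So
the upper multiplicity is smaller by one on the left of `λ`. -/
theorem lower_left_sub_right (h : D.SeifertNumbers i p b) (e : D.Edge) (he : e.1 = i) (h' : Bool) :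
    p (D.plainName i e h' .right 0 true) = p (D.plainName i e h' .left 0 true) + 1 := by
  have h1 := h.lower e h' .left 1 (by norm_num)
  have h2 := h.lower e h' .right 1 (by norm_num)
  have h3 := h.left_eq e
  rw [if_pos he] at h3
  simp only [D.halfName_pos i _ _ _ _ (show 1 ≠ 0 by norm_num), plainName_one] at h1 h2
  rw [D.plainName_side i e h' .left .right false (by simp)] at h1
  linarith

theorem rOver (h : D.SeifertNumbers i p b) {c} (hc : D.strand (c, true) = i) :
    p (.rOver c) = p (.up c) + 1 := by
  have := h.lower_left_sub_right (D.endEdge (c, true) true) hc true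
  simpa [plainName_over, hc] using this

theorem rEnd (h : D.SeifertNumbers i p b) {c} (hc : D.strand (c, false) = i) (h') :
    p (.rEnd c h') = p (.upEnd c h') + 1 := by
  have := h.lower_left_sub_right (D.endEdge (c, false) h') ((D.endEdge_fst _ _).trans hc) h'
  simpa [plainName_under, hc] using this

theorem close (h : D.SeifertNumbers i p b) : p .close = p .outUp + 1 := by
  have := h.lower_left_sub_right (D.borderEdge i true) rfl true
  simpa [plainName_border] using this

theorem loEnd (h : D.SeifertNumbers i p b) (c h') : p (.loEnd c h') = p (.up c) +
    b (D.region (D.endEdge (c, true) h', .left)) := by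
  have := h.lower (D.endEdge (c, true) h') h' .left 1 (by norm_num)
  simpa [D.halfName_pos i _ _ _ _ (show 1 ≠ 0 by norm_num), plainName_over] using this

/-- The number on the upper sheet at the end of a tube of an under strand. -/
theorem under_upper (h : D.SeifertNumbers i p b) (c h' s) :
    p (D.plainName i (D.endEdge (c, false) h') h' s 2 true) =
      p (.lo c) - b (D.region (D.endEdge (c, false) h', .left)) := by
  have := h.lower (D.endEdge (c, false) h') h' .left 2 (by norm_num)
  simp only [D.halfName_pos i _ _ _ _ (show 2 ≠ 0 by norm_num), plainName_under_lower,
    reduceCtorEq, and_false, if_false] at this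
  rw [this, plainName_under_upper, plainName_under_upper]
  ring

theorem upEnd (h : D.SeifertNumbers i p b) (c h') : p (.upEnd c h') = p (.lo c) -
    b (D.region (D.endEdge (c, false) h', .left)) -
      if D.strand (c, false) = i ∧ D.dipSide i c h' = .left then 1 else 0 := by
  rw [← h.under_upper c h' .left, plainName_under_upper]
  split_ifs with h1
  · rw [h.rEnd h1.1]; ring
  · ring

theorem rUnder (h : D.SeifertNumbers i p b) {c} (hc : D.strand (c, false) = i) :
    p (.rUnder c) = p (.lo c) - 1 := by
  have h1 := h.lower (D.endEdge (c, false) true) true .left 2 (by norm_num)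
  have h2 := h.lower (D.endEdge (c, false) true) true .right 2 (by norm_num)
  have h3 := h.left_eq (D.endEdge (c, false) true)
  rw [if_pos ((D.endEdge_fst _ _).trans hc)] at h3
  simp only [D.halfName_pos i _ _ _ _ (show 2 ≠ 0 by norm_num), plainName_under_lower,
    plainName_under_upper, reduceCtorEq, and_false, if_false, and_true, if_pos hc] at h1 h2
  linarith

theorem bottom (h : D.SeifertNumbers i p b) : b (D.region (D.lastEdge i, .right)) = 0 :=
  (numbering_border h.vanishes h.numbering true).1 i le_rfl

/-- At the meridian of strand `i` the finger keeps `λ` off the upper sheet, so all four gaps around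
it have one value. It may be read off at the border, since the meridian is no longer an attaching
curve. -/
theorem last_upper (h : D.SeifertNumbers i p b) (h' s) :
    p (D.halfName i (D.lastEdge i) h' s 0 true) = p .close := by
  have e1 : D.halfName i (D.lastEdge i) h' s 0 true =
      D.plainName i (D.lastEdge i) h' .right 0 true := by
    cases s
    · simp [halfName]
    · rw [halfName_right]
  have e2 := h.tube (D.lastEdge i) .right (.inl rfl)
  rw [halfName_right, halfName_right] at e2
  have e3 : D.plainName i (D.lastEdge i) true .right 0 true = .close :=
    (D.plainName_border i i true _ _ _).trans (by simp)
  rw [e3] at e2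
  rw [e1]
  cases h'
  · exact e2.symm
  · rw [e3]

theorem last_upper_one (h : D.SeifertNumbers i p b) (h') :
    p (D.halfName i (D.lastEdge i) h' .left 1 true) = p .close - 1 := by
  have h1 := h.lower_left_sub_right (D.lastEdge i) rfl h'
  have h2 := h.last_upper h' .right
  rw [halfName_right] at h2
  rw [halfName_pos _ _ _ _ _ _ (by norm_num), plainName_one]
  linarith

theorem last_lower_right (h : D.SeifertNumbers i p b) (h') :
    p (D.halfName i (D.lastEdge i) h' .right 0 false) = p .close := by
  rw [h.lower _ _ _ _ (by norm_num), h.last_upper, h.bottom, add_zero]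

theorem last_lower_left (h : D.SeifertNumbers i p b) (h') :
    p (D.halfName i (D.lastEdge i) h' .left 0 false) = p .close + 1 := by
  rw [h.lower _ _ _ _ (by norm_num), h.last_upper, h.left_eq, h.bottom, zero_add,
    if_pos (show (D.lastEdge i).1 = i from rfl)]

theorem fin (h : D.SeifertNumbers i p b) (h') : p (.fin h') = p .close + 1 := by
  rw [← h.last_lower_left h', halfName, if_pos ⟨rfl, rfl, rfl⟩, if_neg (by simp)]

theorem outLo (h : D.SeifertNumbers i p b) : p .outLo = p .close := by
  rw [← h.last_lower_right true, halfName_right]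
  exact congrArg p (D.plainName_border i i true .right 0 false).symm

section Measure

variable {P : D.Face i → ℤ} (hP : ∀ d, P (Quot.mk _ d) = p ((D.gapName i).value i d))

include hP in
theorem _root_.StringLink.Diagram.mult_eq (v : D.Vertex i) (a : Fin 4) : D.mult i P v a =
    GapFunction.value i (fun a n u => p (D.gapName i a n u)) (v, a) :=
  (hP (v, a)).trans (GapFunction.value_map i p (D.gapName i) _).symm

include hP in
-- The two corners on the lower sheet exceed those on the upper sheet by `b`. Rank `5` is excluded
-- because there the walk proceeds to another edge side.
theorem pointMeasure_of_place (h : D.SeifertNumbers i p b) (q : D.BetaPoint i) {e : D.Edge}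
    {s n} (hq : D.place i q = ((e, s), n)) (hn : n ≠ 5) :
    D.pointMeasure i P (.pt q) = (p (D.gapName i (e, s) n true) +
      p (D.gapName i (e, s) (n + 1) true) + b (D.region (e, s)) : ℚ) / 2 := by
  have h1 := D.place_le i q
  rw [hq] at h1
  simp only at h1
  have hl : ∀ n, n ≤ 5 → (p (D.gapName i (e, s) n false) : ℚ) =
      p (D.gapName i (e, s) n true) + b (D.region (e, s)) := by
    intro n hn
    obtain ⟨h', t, ht, rfl⟩ := exists_gapNum s hn
    have h2 := h.lower e h' s t ht
    rw [← D.gapName_half _ _ _ _ _ ht, ← D.gapName_half _ _ _ _ _ ht] at h2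
    exact_mod_cast h2
  rw [pointMeasure, Fin.sum_univ_four, mult_eq hP, mult_eq hP, mult_eq hP, mult_eq hP]
  simp only [GapFunction.value, GapFunction.atPoint, hq]
  simp only [GapFunction.after, if_neg hn]
  change ((p (D.gapName i (e, s) (n + 1) false) : ℚ) + p (D.gapName i (e, s) n false) +
    p (D.gapName i (e, s) n true) + p (D.gapName i (e, s) (n + 1) true)) / 4 = _
  rw [hl n h1, hl (n + 1) (by omega)]
  ring

include hP in
theorem pointMeasure_tube (h : D.SeifertNumbers i p b) (e : D.Edge) (s) :
    D.pointMeasure i P (.pt (.tube e s)) = (p (D.halfName i e true s 0 true) +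
      p (D.halfName i e false s 0 true) + b (D.region (e, s)) : ℚ) / 2 := by
  rw [h.pointMeasure_of_place hP (.tube e s) rfl (by norm_num)]
  have h1 := D.gapName_half i e true s true (t := 0) (by norm_num)
  have h2 := D.gapName_half i e false s true (t := 0) (by norm_num)
  rw [← h1, ← h2]
  cases s
  · rw [add_comm (p ((D.gapName i).half e true .left 0 true) : ℚ)]; rfl
  · rfl

include hP in
theorem pointMeasure_dip (h : D.SeifertNumbers i p b) {c} (hc : D.strand (c, false) = i) (h' : Bool)
    {q : D.BetaPoint i} (hq : D.place i q = ((D.endEdge (c, false) h', D.dipSide i c h'),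
      if h' = (D.dipSide i c h' = .left) then 4 else 0)) :
    D.pointMeasure i P (.pt q) =
      p (.lo c) - (b (D.region (D.endEdge (c, false) h', .left)) +
        (if D.dipSide i c h' = .left then 1 else 0) : ℚ) / 2 := by
  rw [h.pointMeasure_of_place hP q hq (by split_ifs <;> norm_num)]
  have h1 := fun s => D.gapName_half i (D.endEdge (c, false) h') h' s true (t := 1) (by norm_num)
  have h2 := fun s => D.gapName_half i (D.endEdge (c, false) h') h' s true (t := 2) (by norm_num)
  have h3 := h.left_eq (D.endEdge (c, false) h')
  rw [if_pos ((D.endEdge_fst _ _).trans hc)] at h3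
  simp only [D.halfName_pos i _ _ _ _ (show 1 ≠ 0 by norm_num),
    D.halfName_pos i _ _ _ _ (show 2 ≠ 0 by norm_num)] at h1 h2
  have h4 : (p (D.plainName i (D.endEdge (c, false) h') h' (D.dipSide i c h') 1 true) : ℚ) =
      p (.lo c) - b (D.region (D.endEdge (c, false) h', .left)) +
        (if D.dipSide i c h' = .left then -1 else 1) := by
    rw [plainName_under]
    cases hd : D.dipSide i c h'
    · simp [h.upEnd, hc, hd]; ring
    · simp [h.rEnd hc, h.upEnd, hc, hd]
  have h5 : (p (D.plainName i (D.endEdge (c, false) h') h' (D.dipSide i c h') 2 true) : ℚ) =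
      p (.lo c) - b (D.region (D.endEdge (c, false) h', .left)) := by
    rw [h.under_upper]; push_cast; ring
  rw [← h1] at h4
  rw [← h2] at h5
  have h6 : (p (D.gapName i (D.endEdge (c, false) h', D.dipSide i c h')
      (if h' = (D.dipSide i c h' = .left) then 4 else 0) true) : ℚ) +
      p (D.gapName i (D.endEdge (c, false) h', D.dipSide i c h')
      ((if h' = (D.dipSide i c h' = .left) then 4 else 0) + 1) true) =
      p ((D.gapName i).half (D.endEdge (c, false) h') h' (D.dipSide i c h') 1 true) +
      p ((D.gapName i).half (D.endEdge (c, false) h') h' (D.dipSide i c h') 2 true) := by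
    unfold GapFunction.half
    cases h' <;> cases D.dipSide i c _ <;> simp [gapNum] <;> ring
  rw [h6, h4, h5]
  cases D.dipSide i c h'
  · simp only [if_true]; ring
  · rw [h3]; push_cast; ring

include hP in
-- The finger is symmetric about the meridian. Hence twice the point of `x'` on `λ` cancels the two
-- vertices `before` and `after` in the Euler measure.
theorem pointMeasure_before (h : D.SeifertNumbers i p b) :
    D.pointMeasure i P (.pt .before) = D.pointMeasure i P (.pt .after) := by
  rw [h.pointMeasure_of_place hP .before rfl (by norm_num),
    h.pointMeasure_of_place hP .after rfl (by norm_num)]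
  have h0 := fun h' => congrArg p (D.gapName_half i (D.lastEdge i) h' .left true (t := 0) (by norm_num))
  have h1 := fun h' => congrArg p (D.gapName_half i (D.lastEdge i) h' .left true (t := 1) (by norm_num))
  have h2 := fun h' => (h0 h').trans (h.last_upper h' .left)
  have h3 := fun h' => (h1 h').trans (h.last_upper_one h')
  have e1 : p (D.gapName i (D.lastEdge i, .left) 1 true) = _ := h3 false
  have e2 : p (D.gapName i (D.lastEdge i, .left) (1 + 1) true) = _ := h2 false
  have e3 : p (D.gapName i (D.lastEdge i, .left) 3 true) = _ := h2 true
  have e4 : p (D.gapName i (D.lastEdge i, .left) (3 + 1) true) = _ := h3 true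
  rw [e1, e2, e3, e4]
  ring

include hP in
theorem pointMeasure_mid (h : D.SeifertNumbers i p b) {m : Fin (D.len i + 1)} (hm : m ≠ Fin.last _) :
    D.pointMeasure i P (.mid m) = (p (D.halfName i ⟨i, m⟩ true .left 0 true) +
      p (D.halfName i ⟨i, m⟩ true .right 0 true) : ℚ) / 2 := by
  rw [pointMeasure, Fin.sum_univ_four, mult_eq hP, mult_eq hP, mult_eq hP, mult_eq hP]
  simp only [GapFunction.value, GapFunction.atMid, if_neg hm]
  have h0 := fun h' s => congrArg p
    (D.gapName_half i ⟨i, m⟩ h' s true (t := 0) (by norm_num))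
  have ht := fun s => h.tube ⟨i, m⟩ s (.inl rfl)
  have e1 : p (D.gapName i (⟨i, m⟩, .left) 3 true) = _ := h0 true .left
  have e2 : p (D.gapName i (⟨i, m⟩, .left) 2 true) = _ := h0 false .left
  have e3 : p (D.gapName i (⟨i, m⟩, .right) 3 true) = _ := h0 false .right
  have e4 : p (D.gapName i (⟨i, m⟩, .right) 2 true) = _ := h0 true .right
  change ((p (D.gapName i (⟨i, m⟩, .left) 3 true) : ℚ) + p (D.gapName i (⟨i, m⟩, .left) 2 true) +
    p (D.gapName i (⟨i, m⟩, .right) 3 true) + p (D.gapName i (⟨i, m⟩, .right) 2 true)) / 4 = _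
  rw [e1, e2, e3, e4, ht, ht]
  ring

include hP in
theorem pointMeasure_mid_last (h : D.SeifertNumbers i p b) :
    D.pointMeasure i P (.mid (Fin.last _)) = p .close + 1 / 2 := by
  rw [pointMeasure, Fin.sum_univ_four, mult_eq hP, mult_eq hP, mult_eq hP, mult_eq hP]
  simp only [GapFunction.value, GapFunction.atMid, if_true]
  have h0 := fun h' s => congrArg p
    (D.gapName_half i (D.lastEdge i) h' s false (t := 0) (by norm_num))
  have e1 : p (D.gapName i (D.lastEdge i, .left) 3 false) = _ := h0 true .left
  have e2 : p (D.gapName i (D.lastEdge i, .left) 2 false) = _ := h0 false .left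
  have e3 : p (D.gapName i (D.lastEdge i, .right) 3 false) = _ := h0 false .right
  have e4 : p (D.gapName i (D.lastEdge i, .right) 2 false) = _ := h0 true .right
  change ((p (D.gapName i (D.lastEdge i, .right) 2 false) : ℚ) +
    p (D.gapName i (D.lastEdge i, .right) 3 false) + p (D.gapName i (D.lastEdge i, .left) 2 false) +
    p (D.gapName i (D.lastEdge i, .left) 3 false)) / 4 = _
  rw [e1, e2, e3, e4]
  simp only [h.last_lower_left, h.last_lower_right]
  push_cast
  ring

include hP in
theorem baseMult_eq (h : D.SeifertNumbers i p b) : D.baseMult i P = p .close := by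
  have h0 := congrArg p
    (D.gapName_half i (D.lastEdge i) true .right false (t := 0) (by norm_num))
  rw [h.last_lower_right] at h0
  rw [baseMult, mult_eq hP]
  exact h0

end Measure

end SeifertNumbers

end Diagram
end StringLink

/-! ### The local contribution of a crossing -/

namespace StringLink
namespace Diagram

variable {k : ℕ} {D : Diagram k} {i : Fin k} {p : D.FaceName → ℤ} {b : D.Region → ℤ}

/-- The quadrant to the left of the incoming (`h = true`) or outgoing edge of the rising or falling
passage. -/
def leftQuadrant : Bool → Bool → Quadrant
  | true, true => .left
  | true, false => .ahead
  | false, true => .behind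
  | false, false => .left

theorem region_endEdge_left (c l h) :
    D.region (D.endEdge (c, l) h, .left) = D.corner c (leftQuadrant (l == D.positive c) h) := by
  by_cases hl : l = D.positive c
  · subst hl
    rw [beq_self_eq_true]
    cases h
    · exact D.region_ro_left c
    · exact D.region_ri_left c
  · have e : (c, l) = D.falling c := by
      rw [GaussData.falling]
      cases l <;> cases hp : D.positive c <;> simp_all
    rw [beq_false_of_ne hl, e]
    cases h
    · exact D.region_fo_left c
    · exact D.region_fi_left c

/-- The quadrants to the right of the over strand. -/
def overRight (positive : Bool) : Quadrant → Bool
  | .ahead => !positive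
  | .behind => positive
  | .left => false
  | .right => true

theorem sum_strand (f : Fin D.numCrossings × Bool → ℚ) (i : Fin k) :
    ∑ m : Fin (D.len i), f (D.passage ⟨i, m⟩) = ∑ q, if D.strand q = i then f q else 0 := by
  rw [← D.passage.sum_comp, Fintype.sum_sigma]
  simp only [strand_passage]
  rw [Finset.sum_eq_single i]
  · simp
  · intro j _ hj
    simp [hj]
  · simp

theorem sum_underPos (f : Fin D.numCrossings → ℚ) (i : Fin k) :
    ∑ u : D.UnderPos i, f (D.passage ⟨i, u.1⟩).1 = ∑ c, if D.strand (c, false) = i then f c else 0 := by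
  rw [← Finset.sum_subtype (Finset.univ.filter fun m => (D.passage ⟨i, m⟩).2 = false) (by simp)
    fun m => f (D.passage ⟨i, m⟩).1, Finset.sum_filter,
    sum_strand (fun q => if q.2 = false then f q.1 else 0), Fintype.sum_prod_type]
  simp

namespace SeifertNumbers

theorem over_upper (h : D.SeifertNumbers i p b) (c h' s t) :
    (p (D.plainName i (D.endEdge (c, true) h') h' s t true) : ℚ) =
      p (.up c) + if D.strand (c, true) = i ∧ s = .right then 1 else 0 := by
  rw [plainName_over, if_pos rfl]
  split_ifs with h1
  · rw [h.rOver h1.1]; push_cast; rfl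
  · simp

theorem under_upper' (h : D.SeifertNumbers i p b) (c h' s) :
    (p (D.plainName i (D.endEdge (c, false) h') h' s 2 true) : ℚ) =
      p (.lo c) - b (D.region (D.endEdge (c, false) h', .left)) := by
  rw [h.under_upper]; push_cast; rfl

theorem under_near (h : D.SeifertNumbers i p b) (c h' s) :
    (p (D.plainName i (D.endEdge (c, false) h') h' s 0 true) : ℚ) =
      p (.upEnd c h') + if D.strand (c, false) = i ∧ s = .right then 1 else 0 := by
  rw [plainName_under, if_pos rfl]
  by_cases hc : D.strand (c, false) = i
  · cases s <;> simp [hc, h.rEnd hc]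
  · simp [hc]

section Measure

variable {P : D.Face i → ℤ} (hP : ∀ d, P (Quot.mk _ d) = p ((D.gapName i).value i d))

include hP in
-- One of the two upper corners lies on the over strand, beyond `λ` if it is on the right of it, and
-- the other at the end of the tube of the adjacent under edge. The lower corners add `b` of the
-- quadrant.
theorem pointMeasure_corner (h : D.SeifertNumbers i p b) (c q) :
    D.pointMeasure i P (.pt (.corner c q)) =
      (p (.up c) + (if D.strand (c, true) = i ∧ overRight (D.positive c) q then 1 else 0) +
        (p (.lo c) - b (D.region (D.endEdge (c, false) (!outUnder (D.positive c) q), .left))) +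
          b (D.corner c q)) / 2 := by
  have hl : ∀ a n, n ≤ 5 → (p (D.gapName i a n false) : ℚ) =
      p (D.gapName i a n true) + b (D.region a) := by
    rintro ⟨e, s⟩ n hn
    obtain ⟨h', t, ht, rfl⟩ := exists_gapNum s hn
    have h2 := h.lower e h' s t ht
    rw [← D.gapName_half _ _ _ _ _ ht, ← D.gapName_half _ _ _ _ _ ht] at h2
    exact_mod_cast h2
  have h1 : D.pointMeasure i P (.pt (.corner c q)) = (p (D.gapName i (D.departure c q) 0 true) +
      p (D.gapName i (D.arrival c q) 5 true) + b (D.corner c q)) / 2 := by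
    rw [pointMeasure, Fin.sum_univ_four, mult_eq hP, mult_eq hP, mult_eq hP, mult_eq hP]
    simp only [GapFunction.value_corner]
    change ((p (D.gapName i (D.departure c q) 0 false) : ℚ) + p (D.gapName i (D.arrival c q) 5 false) +
      p (D.gapName i (D.arrival c q) 5 true) + p (D.gapName i (D.departure c q) 0 true)) / 4 = _
    rw [hl _ _ (by norm_num), hl _ _ (by norm_num), D.region_departure, D.region_arrival]
    ring
  rw [h1]
  have ho := fun h' s => (congrArg (fun l => (p l : ℚ))
    ((D.gapName_half_pos i (D.endEdge (c, true) h') h' s true (le_refl 2) (by norm_num)))).trans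
      (h.over_upper c h' s 2)
  have hu := fun h' s => (congrArg (fun l => (p l : ℚ))
    ((D.gapName_half_pos i (D.endEdge (c, false) h') h' s true (le_refl 2) (by norm_num)))).trans
      (h.under_upper' c h' s)
  simp only [GapFunction.half, endEdge] at ho hu
  have o1 := ho true .left
  have o2 := ho true .right
  have o3 := ho false .left
  have o4 := ho false .right
  have u1 := hu true .left
  have u2 := hu true .right
  have u3 := hu false .left
  have u4 := hu false .right
  simp only [gapNum, if_true, reduceCtorEq, and_false, if_false, and_true, Nat.reduceAdd,
    Nat.reduceSub, Bool.false_eq_true] at o1 o2 o3 o4 u1 u2 u3 u4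
  cases hp : D.positive c <;> cases q <;>
    simp only [GaussData.departure, GaussData.arrival, GaussData.rising, GaussData.falling, hp,
      Bool.not_true, Bool.not_false, overRight, outUnder, endEdge, if_true, Bool.false_eq_true,
      and_false, and_true, if_false, o1, o2, o3, o4, u1, u2, u3, u4] <;> ring

include hP in
theorem sum_tube (h : D.SeifertNumbers i p b) (q) :
    ∑ s, D.pointMeasure i P (.pt (.tube (D.inEdge q) s)) =
      (p (D.plainName i (D.inEdge q) true .left 0 true) : ℚ) +
      p (D.plainName i (D.inEdge q) true .right 0 true) +
      (b (D.region (D.inEdge q, .left)) + b (D.region (D.inEdge q, .right)) : ℚ) / 2 := by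
  have h1 : ∀ s, D.halfName i (D.inEdge q) true s 0 true =
      D.plainName i (D.inEdge q) true s 0 true := by
    intro s
    rw [halfName, if_neg fun h => D.inEdge_ne_lastEdge q i h.1]
  have h2 := fun s => h.tube (D.inEdge q) s (.inr (D.inEdge_ne_lastEdge q _))
  rw [Side.sum_univ, h.pointMeasure_tube hP, h.pointMeasure_tube hP, ← h2, ← h2, h1, h1]
  ring

include hP in
/-- The contribution of a crossing to the Euler measure, and that of a quadrant to the measure of a
state. -/
theorem crossing_measure (h : D.SeifertNumbers i p b) (c q) :
    ((p (.up c) : ℚ) + p (.lo c) + (if D.strand (c, true) = i then (p (.rOver c) : ℚ) else 0) +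
      (if D.strand (c, false) = i then (p (.rUnder c) : ℚ) else 0) +
      ∑ h', ((p (.upEnd c h') : ℚ) + p (.loEnd c h') +
        if D.strand (c, false) = i then (p (.rEnd c h') : ℚ) else 0)) -
    ∑ q, D.pointMeasure i P (.pt (.corner c q)) -
    ∑ l, (∑ s, D.pointMeasure i P (.pt (.tube (D.inEdge (c, l)) s)) +
      if D.strand (c, l) = i then ((p (D.plainName i (D.inEdge (c, l)) true .left 0 true) : ℚ) +
        p (D.plainName i (D.inEdge (c, l)) true .right 0 true)) / 2 else 0) -
    (if D.strand (c, false) = i then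
      ∑ h', (p (.lo c) - (b (D.region (D.endEdge (c, false) h', .left)) +
        (if D.dipSide i c h' = .left then 1 else 0) : ℚ) / 2) else 0) +
    2 * D.pointMeasure i P (.pt (.corner c q)) = 2 * D.weight i c q := by
  have hr : ∀ l, (b (D.region (D.inEdge (c, l), .right)) : ℚ) =
      b (D.region (D.endEdge (c, l) true, .left)) - if D.strand (c, l) = i then 1 else 0 := by
    intro l
    have h1 := h.left_eq (D.endEdge (c, l) true)
    rw [endEdge_fst] at h1
    rw [h1, endEdge_true]
    push_cast
    ring
  have e1 : (if D.strand (c, true) = i then (p (.rOver c) : ℚ) else 0) =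
      if D.strand (c, true) = i then (p (.up c) : ℚ) + 1 else 0 := by
    split_ifs with hc
    · rw [h.rOver hc]; push_cast; rfl
    · rfl
  have e2 : (if D.strand (c, false) = i then (p (.rUnder c) : ℚ) else 0) =
      if D.strand (c, false) = i then (p (.lo c) : ℚ) - 1 else 0 := by
    split_ifs with hc
    · rw [h.rUnder hc]; push_cast; rfl
    · rfl
  have e3 : ∀ h', (if D.strand (c, false) = i then (p (.rEnd c h') : ℚ) else 0) =
      if D.strand (c, false) = i then (p (.upEnd c h') : ℚ) + 1 else 0 := by
    intro h'
    split_ifs with hc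
    · rw [h.rEnd hc]; push_cast; rfl
    · rfl
  have o := fun s => h.over_upper c true s 0
  have u := fun s => h.under_near c true s
  simp only [endEdge_true] at o u
  have b1 := fun l h' => congrArg (fun R => (b R : ℚ)) (D.region_endEdge_left c l h')
  have b2 := fun l => (congrArg (fun R => (b R : ℚ)) (D.region_endEdge_left c l true))
  simp only [endEdge_true] at b2
  obtain ⟨n1, n2, n3⟩ := D.numbering_corner i h.numbering c
  rw [e1, e2]
  simp only [e3, Fintype.sum_bool, Quadrant.sum_univ, h.pointMeasure_corner hP, h.sum_tube hP, o, u,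
    hr, h.upEnd, h.loEnd, b1, b2, Int.cast_add, Int.cast_sub, n1, n2, n3, weight, dipSide]
  -- All terms are now expressed by the multiplicities of `up` and `lo` and the number of the right
  -- quadrant. In each case of strands, sign and quadrant these three unknowns cancel.
  by_cases ht : D.strand (c, true) = i <;> by_cases hf : D.strand (c, false) = i <;>
  rcases Bool.eq_false_or_eq_true (D.positive c) with hp | hp <;> cases q <;>
  simp [leftQuadrant, outUnder, overRight, selfWeight, overWeight, underWeight, ht, hf, n1, n2, n3,
    hp] <;> ring

end Measure

end SeifertNumbers

end Diagram
end StringLink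

/-! ### Evaluation of the Chern class -/

namespace StringLink
namespace Diagram

variable {k : ℕ} {D : Diagram k} {i : Fin k}

namespace SeifertNumbers

variable {p : D.FaceName → ℤ} {b : D.Region → ℤ} {P : D.Face i → ℤ}
  (hP : ∀ d, P (Quot.mk _ d) = p ((D.gapName i).value i d))

include hP in
theorem sum_mid (h : D.SeifertNumbers i p b) : ∑ m, D.pointMeasure i P (.mid m) =
    ∑ q, (if D.strand q = i then ((p (D.plainName i (D.inEdge q) true .left 0 true) : ℚ) +
        p (D.plainName i (D.inEdge q) true .right 0 true)) / 2 else 0) + (p .close + 1 / 2) := by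
  rw [Fin.sum_univ_castSucc, h.pointMeasure_mid_last hP, ← sum_strand]
  congr 1
  refine Finset.sum_congr rfl fun m _ => ?_
  have h1 : ∀ s, D.halfName i ⟨i, m.castSucc⟩ true s 0 true =
      D.plainName i ⟨i, m.castSucc⟩ true s 0 true := by
    intro s
    rw [halfName, if_neg fun h => ?_]
    exact (Fin.castSucc_lt_last m).ne ((D.mk_inj i).mp h.1)
  rw [h.pointMeasure_mid hP (Fin.castSucc_lt_last m).ne, h1, h1, D.inEdge_passage]

include hP in
theorem sum_dip (h : D.SeifertNumbers i p b) :
    ∑ u, D.pointMeasure i P (.pt (.dipIn u)) + ∑ u, D.pointMeasure i P (.pt (.dipOut u)) =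
    ∑ c, if D.strand (c, false) = i then
      ∑ h', (p (.lo c) - (b (D.region (D.endEdge (c, false) h', .left)) +
        (if D.dipSide i c h' = .left then 1 else 0) : ℚ) / 2) else 0 := by
  rw [← sum_underPos, ← Finset.sum_add_distrib]
  refine Finset.sum_congr rfl fun u _ => ?_
  obtain ⟨c, hc⟩ := D.passage_underPos i u
  have hi : D.strand (c, false) = i := by rw [← hc, strand_passage]
  rw [hc, Fintype.sum_bool, h.pointMeasure_dip hP hi true (q := .dipIn u)
    (by rw [D.place_dipIn i hc]; simp [endEdge]), h.pointMeasure_dip hP hi false (q := .dipOut u)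
    (by rw [D.place_dipOut i hc]; cases D.dipSide i c false <;> simp [endEdge])]

include hP in
theorem tube_last_other (h : D.SeifertNumbers i p b) {j} (hj : j ≠ i) :
    D.pointMeasure i P (.pt (.tube (D.lastEdge j) .right)) =
      D.pointMeasure i P (.pt (.tube (D.lastEdge j) .left)) := by
  have h1 := fun h' => (D.gapName_compatible i).tube (D.lastEdge j) hj h' true
  simp only [D.gapName_half _ _ _ _ _ (by norm_num : 0 ≤ 2)] at h1
  have h2 := h.left_eq (D.lastEdge j)
  rw [if_neg (show (D.lastEdge j).1 ≠ i from hj), add_zero] at h2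
  rw [h.pointMeasure_tube hP, h.pointMeasure_tube hP, h1, h1, h2]

include hP in
open Classical in
/-- The evaluation of the first Chern class on a Seifert surface. -/
theorem chern_eq (h : D.SeifertNumbers i p b) (x : D.State) :
    D.chern i P x = 2 * D.filtration i x := by
  -- On the outer ball, `outUp` is one less than `close`, `outLo` equals it, and the two faces of
  -- the finger are one more: in total `5 * p .close + 1`.
  have hvalid : ∑ l, (if l.Valid D i then (p l : ℚ) else 0) =
      ∑ c, ((p (.up c) : ℚ) + p (.lo c) +
        (if D.strand (c, true) = i then (p (.rOver c) : ℚ) else 0) +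
      (if D.strand (c, false) = i then (p (.rUnder c) : ℚ) else 0) +
      ∑ h', ((p (.upEnd c h') : ℚ) + p (.loEnd c h') +
        if D.strand (c, false) = i then (p (.rEnd c h') : ℚ) else 0)) + (5 * p .close + 1) := by
    rw [sum_faceName]
    simp only [FaceName.Valid, if_true, Fintype.sum_bool, h.fin, h.outLo]
    refine congrArg₂ (· + ·) (Finset.sum_congr rfl fun c _ => by congr <;> exact if_pos trivial) ?_
    rw [h.close]
    push_cast
    ring
  -- At the meridians of the other strands both sides have the same measure, so these vertices
  -- cancel against the points of the state. The meridian of strand `i` has `b = 1` on the left and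
  -- `0` on the right.
  have htube : ∑ e, ∑ s, D.pointMeasure i P (.pt (.tube e s)) =
      ∑ q, ∑ s, D.pointMeasure i P (.pt (.tube (D.inEdge q) s)) +
      2 * ∑ j ∈ Finset.univ.erase i, D.pointMeasure i P (.pt (.tube (D.lastEdge j) (x.1.side j))) +
        (2 * p .close + 1 / 2) := by
    rw [D.sum_edge, add_assoc, ← Finset.sum_erase_add _ _ (Finset.mem_univ i), Finset.mul_sum]
    congr 2
    · refine Finset.sum_congr rfl fun j hj => ?_
      rw [Side.sum_univ, D.state_side, h.tube_last_other hP (Finset.ne_of_mem_erase hj)]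
      ring
    · rw [Side.sum_univ, h.pointMeasure_tube hP, h.pointMeasure_tube hP]
      simp only [h.last_upper, h.left_eq, h.bottom]
      rw [if_pos (show (D.lastEdge i).1 = i from rfl)]
      push_cast
      ring
  have hcross : ∀ c, _ := fun c => h.crossing_measure hP c (x.1.quad c)
  have hsum := Finset.sum_congr (rfl : (Finset.univ : Finset (Fin D.numCrossings)) = _)
    fun c _ => hcross c
  rw [Finset.sum_add_distrib, Finset.sum_sub_distrib, Finset.sum_sub_distrib,
    Finset.sum_sub_distrib, ← Finset.mul_sum, ← Finset.mul_sum] at hsum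
  have hprod : ∑ c, ∑ l, (∑ s, D.pointMeasure i P (.pt (.tube (D.inEdge (c, l)) s)) +
      if D.strand (c, l) = i then ((p (D.plainName i (D.inEdge (c, l)) true .left 0 true) : ℚ) +
        p (D.plainName i (D.inEdge (c, l)) true .right 0 true)) / 2 else 0) =
      ∑ q, ∑ s, D.pointMeasure i P (.pt (.tube (D.inEdge q) s)) +
      ∑ q, if D.strand q = i then ((p (D.plainName i (D.inEdge q) true .left 0 true) : ℚ) +
        p (D.plainName i (D.inEdge q) true .right 0 true)) / 2 else 0 := by
    rw [← Finset.sum_add_distrib, Fintype.sum_prod_type]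
  rw [hprod] at hsum
  -- With `q = p .close`, the rest is `(5 q + 1) - (2 q + 1/2) - (q + 1/2) - 2 q = 0`, from faces,
  -- meridian, intersection of `λ` with the meridian, and base point.
  rw [chern, D.eulerMeasure_eq i hP, D.sum_vertex, h.sum_dip hP, h.sum_mid hP, hvalid, htube,
    stateMeasure, h.baseMult_eq hP, ← h.pointMeasure_before hP, filtration, ← hsum]
  ring

end SeifertNumbers

theorem chern_eq_filtration {P : D.Face i → ℤ} (hP : D.IsSeifertDomain i P) (x : D.State) :
    D.chern i P x = 2 * D.filtration i x := by
  obtain ⟨p, hp⟩ := gapFunction_eq i P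
  obtain ⟨b, h⟩ := (D.isSeifertDomain_iff i hp).mp hP
  exact h.chern_eq hp x

end Diagram
end StringLink

/-! ### Existence of Seifert domains -/

namespace StringLink
namespace Diagram

variable {k : ℕ} (D : Diagram k) (i : Fin k)

/-- Multiplicities on the upper sheet at the left side of the edges, constant along the strands but
for the jumps where they pass below strand `i`. -/
theorem exists_upperNumbers : ∃ U : D.Edge → ℤ,
    (∀ j, U (D.firstEdge j) = if D.position j false < D.position i false then 1 else 0) ∧
    (∀ e : D.Edge, e.1 = i → U e = 0) ∧
    (∀ c, U (D.outEdge (c, true)) = U (D.inEdge (c, true))) ∧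
    ∀ c, D.strand (c, false) ≠ i → U (D.outEdge (c, false)) = U (D.inEdge (c, false)) -
      if D.strand (c, true) = i then D.crossingSign c else 0 := by
  -- The jumps occur only where another strand passes under strand `i`. A constant on each strand is
  -- then added to obtain the prescribed value at the top.
  obtain ⟨V, -, hV⟩ := D.exists_of_passage_jumps (fun _ => (0 : ℤ))
    fun q => if q.2 = false ∧ D.strand (q.1, false) ≠ i ∧ D.strand (q.1, true) = i then
      D.crossingSign q.1 else 0
  let U : D.Edge → ℤ := fun e => V e - V (D.firstEdge e.1) +
    if D.position e.1 false < D.position i false then 1 else 0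
  have hU : ∀ q, U (D.inEdge q) - U (D.outEdge q) = V (D.inEdge q) - V (D.outEdge q) := by
    intro q
    obtain ⟨z, hz⟩ : ∃ z, z = -V (D.firstEdge (D.strand q)) +
        if D.position (D.strand q) false < D.position i false then 1 else 0 := ⟨_, rfl⟩
    have h1 : ∀ e : D.Edge, e.1 = D.strand q → U e = V e + z := by
      intro e he
      simp only [U, he, hz]
      ring
    rw [h1 _ rfl, h1 _ rfl]
    ring
  have hfirst : ∀ j, U (D.firstEdge j) =
      if D.position j false < D.position i false then 1 else 0 := by
    intro j
    change V (D.firstEdge j) - V (D.firstEdge j) + _ = _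
    rw [sub_self, zero_add]; rfl
  refine ⟨U, hfirst, ?_, ?_, ?_⟩
  · intro e
    apply D.edge_induction_down (motive := fun e => e.1 = i → U e = 0)
    · rintro j rfl
      rw [hfirst]
      exact if_neg (lt_irrefl _)
    · rintro ⟨c, l⟩ ih hi
      have h1 := hU (c, l)
      rw [hV, ih hi, if_neg] at h1
      · linarith
      · rintro ⟨h2, h3, -⟩
        simp only at h2
        subst h2
        exact h3 hi
  · intro c
    have h1 := hU (c, true)
    rw [hV, if_neg (by simp)] at h1
    linarith
  · intro c hc
    have h1 := hU (c, false)
    rw [hV] at h1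
    simp only [hc, ne_eq, not_false_eq_true, true_and] at h1
    linarith

variable {D i} in
/-- Multiplicities of the components of a periodic domain, built from numbers on the upper sheet. -/
def seifertNumber (U : D.Edge → ℤ) (b : D.Region → ℤ) : D.FaceName → ℤ
  | .up c => U (D.endEdge (c, true) true)
  | .rOver c => U (D.endEdge (c, true) true) + 1
  | .loEnd c h => U (D.endEdge (c, true) h) + b (D.region (D.endEdge (c, true) h, .left))
  | .upEnd c h => U (D.endEdge (c, false) h)
  | .rEnd c h => U (D.endEdge (c, false) h) + 1
  | .lo c => U (D.endEdge (c, false) true) + b (D.region (D.endEdge (c, false) true, .left)) +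
      if D.strand (c, false) = i ∧ D.dipSide i c true = .left then 1 else 0
  | .rUnder c => U (D.endEdge (c, false) true) + b (D.region (D.endEdge (c, false) true, .left)) +
      (if D.strand (c, false) = i ∧ D.dipSide i c true = .left then 1 else 0) - 1
  | .outUp => 0
  | .outLo => 1
  | .close => 1
  | .fin _ => 2

/-- The values at the top are those of `close` to the west of strand `i` and of `outUp` elsewhere,
and they are propagated down the strands. On a strand `j ≠ i`, the result need not match the border
at the bottom, because its meridian is an attaching curve and may occur in the boundary. -/
theorem exists_seifertNumbers : ∃ p b, D.SeifertNumbers i p b := by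
  obtain ⟨b, h0, hb⟩ := D.exists_numbering i ℤ
  obtain ⟨U, hfirst, hUi, hover, hunder⟩ := D.exists_upperNumbers i
  have hright : ∀ e, b (D.region (e, .right)) = b (D.region (e, .left)) -
      if e.1 = i then 1 else 0 := by
    intro e
    have := hb e
    rw [diff] at this
    split_ifs at this ⊢ <;> linarith
  -- The lower face of a crossing reaches both ends of the under passage, and its multiplicity must
  -- come out the same from either end. For a strand other than `i` the jump of `U` balances the
  -- change of `b`; at a self-crossing of strand `i` the turn of `λ` around the tube does, which is
  -- where framing zero enters.
  have hlo : ∀ c h, seifertNumber (i := i) U b (.lo c) = U (D.endEdge (c, false) h) +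
      b (D.region (D.endEdge (c, false) h, .left)) +
      if D.strand (c, false) = i ∧ D.dipSide i c h = .left then 1 else 0 := by
    rintro c (_ | _)
    · obtain ⟨n1, n2, n3⟩ := D.numbering_corner i hb c
      have hu := hunder c
      have hi := fun h => hUi (D.endEdge (c, false) h)
      simp only [endEdge_fst] at hi
      simp only [seifertNumber, region_endEdge_left]
      simp only [endEdge_true, endEdge_false] at hi ⊢
      have hi1 := hi true
      have hi2 := hi false
      simp only [endEdge_true, endEdge_false] at hi1 hi2
      by_cases ht : D.strand (c, true) = i <;> by_cases hf : D.strand (c, false) = i <;>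
      rcases Bool.eq_false_or_eq_true (D.positive c) with hp | hp <;>
      simp [leftQuadrant, dipSide, crossingSign, ht, hf, hp] at hu hi1 hi2 n1 n2 n3 ⊢ <;> linarith
    · rfl
  -- The excluded case is the part below the meridian of another strand, where the multiplicity is
  -- dictated by the border and not by `U`.
  have hnear : ∀ e h s, (h = false ∨ e ≠ D.lastEdge e.1 ∨ e.1 = i) →
      seifertNumber (i := i) U b (D.plainName i e h s 0 true) =
        U e + if e.1 = i ∧ s = .right then 1 else 0 := by
    intro e h s he
    rcases D.end_cases e h with ⟨⟨c, l⟩, rfl⟩ | ⟨j, rfl⟩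
    · rw [endEdge_fst]
      cases l
      · rw [plainName_under]
        by_cases hc : D.strand (c, false) = i <;> cases s <;> simp [hc, seifertNumber]
      · have h1 : U (D.endEdge (c, true) h) = U (D.endEdge (c, true) true) := by
          cases h
          · exact hover c
          · rfl
        rw [plainName_over, h1]
        by_cases hc : D.strand (c, true) = i <;> cases s <;> simp [hc, seifertNumber]
    · rw [borderEdge_fst] at he ⊢
      rw [plainName_border, if_pos rfl]
      by_cases hj : j = i
      · subst hj
        rw [hUi _ (D.borderEdge_fst _ _)]
        cases s <;> simp [seifertNumber]
      · have hh : h = false := by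
          rcases he with he | he | he
          · exact he
          · cases h
            · rfl
            · exact absurd rfl he
          · exact absurd he hj
        subst hh
        have h1 := hfirst j
        change U (D.borderEdge j false) = _ at h1
        rw [h1]
        by_cases hlt : D.position j false < D.position i false <;> simp [hj, hlt, seifertNumber]
  have hplain : ∀ e h s t, seifertNumber (i := i) U b (D.plainName i e h s t false) =
      seifertNumber (i := i) U b (D.plainName i e h s t true) + b (D.region (e, s)) := by
    intro e h s t
    rcases D.end_cases e h with ⟨⟨c, l⟩, rfl⟩ | ⟨j, rfl⟩
    · have hr := hright (D.endEdge (c, l) h)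
      rw [endEdge_fst] at hr
      cases l
      · have h1 := hlo c h
        have h2 : seifertNumber (i := i) U b (.rUnder c) = seifertNumber (i := i) U b (.lo c) - 1 :=
          rfl
        rw [plainName_under, plainName_under]
        by_cases hc : D.strand (c, false) = i
        · by_cases ht : t = 2 <;> cases hd : D.dipSide i c h <;> cases s <;>
            simp [hc, ht, hd, h2, hr] at h1 ⊢ <;> simp only [seifertNumber] at h1 ⊢ <;> linarith
        · simp only [hc, false_and, if_false, if_true, Bool.false_eq_true, add_zero, sub_zero] at h1 hr ⊢
          rw [h1]
          cases s
          · rfl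
          · rw [hr]; rfl
      · have h1 : U (D.endEdge (c, true) h) = U (D.endEdge (c, true) true) := by
          cases h
          · exact hover c
          · rfl
        rw [plainName_over, plainName_over]
        by_cases hc : D.strand (c, true) = i <;> cases s <;>
          simp [hc, seifertNumber, hr, h1]
    · obtain ⟨n1, n2⟩ := numbering_border h0 hb h
      have hr := hright (D.borderEdge j h)
      rw [borderEdge_fst] at hr
      rw [plainName_border, plainName_border]
      rcases lt_trichotomy (D.position j h) (D.position i h) with hlt | heq | hlt
      · have hj : j ≠ i := by rintro rfl; exact hlt.ne rfl
        have n3 := n1 j hlt.le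
        rw [hr, if_neg hj] at n3
        cases s <;> simp [hj, hlt, seifertNumber, hr] <;> linarith
      · obtain rfl := (D.position_eq j i h).mp heq
        have n3 := n2 j le_rfl
        cases s <;> simp [seifertNumber, hr, n3]
      · have hj : j ≠ i := by rintro rfl; exact hlt.ne rfl
        have n3 := n2 j hlt.le
        cases s <;> simp [hj, hlt.not_gt, seifertNumber, hr, n3]
  refine ⟨seifertNumber (i := i) U b, b, h0, hb, ?_, ?_⟩
  · intro e h s t _
    by_cases h1 : e = D.lastEdge i ∧ s = .left ∧ t = 0
    · rw [halfName, halfName, if_pos h1, if_pos h1, if_neg (by simp), if_pos rfl]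
      obtain ⟨rfl, rfl, rfl⟩ := h1
      rw [hnear _ _ _ (.inr (.inr rfl)), hUi _ rfl]
      have n1 := (numbering_border h0 hb true).2 i le_rfl
      change b (D.region (D.lastEdge i, .left)) = 1 at n1
      rw [n1, if_pos ⟨rfl, rfl⟩]
      rfl
    · rw [halfName, halfName, if_neg h1, if_neg h1]
      exact hplain e h s t
  · intro e s he
    have hn : ∀ h s, seifertNumber (i := i) U b (D.plainName i e h s 0 true) =
        U e + if e.1 = i ∧ s = .right then 1 else 0 := fun h s => hnear e h s (.inr he.symm)
    rw [halfName, halfName]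
    by_cases h1 : e = D.lastEdge i ∧ s = .left ∧ 0 = 0
    · rw [if_pos h1, if_pos h1, if_pos rfl, if_pos rfl, hn, hn]
    · rw [if_neg h1, if_neg h1, hn, hn]

theorem exists_isSeifertDomain : ∃ P : D.Face i → ℤ, D.IsSeifertDomain i P := by
  obtain ⟨p, b, h⟩ := D.exists_seifertNumbers i
  obtain ⟨f, hf⟩ := D.exists_faceName i
  exact ⟨fun x => p (f x), (D.isSeifertDomain_iff i fun d => congrArg p (hf d)).mpr ⟨b, h⟩⟩

end Diagram
end StringLink

theorem mainTheorem7 {k : ℕ} (D : StringLink.Diagram k) :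
    (∀ (i : Fin k) (x : D.State), ∃ m : ℤ, D.filtration i x = m) ∧
    (∀ i : Fin k,
      ∃! Δ : LaurentPolynomial ℤ,
        StringLink.IsAlexanderConway D.positive (D.closureCode i) Δ) ∧
    (∀ (i : Fin k) (Δ : LaurentPolynomial ℤ),
      StringLink.IsAlexanderConway D.positive (D.closureCode i) Δ →
        StringLink.Diagram.specialize i D.nabla = StringLink.Diagram.ofLaurent Δ) ∧
    (∀ i : Fin k, ∃ P : D.Face i → ℤ, D.IsSeifertDomain i P) ∧
    (∀ (i : Fin k) (P : D.Face i → ℤ), D.IsSeifertDomain i P →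
      ∀ x : D.State, D.chern i P x = 2 * D.filtration i x) := by
  refine ⟨D.filtration_integer, D.existsUnique_isAlexanderConway, fun i Δ hΔ => ?_,
    D.exists_isSeifertDomain, fun i P hP x => StringLink.Diagram.chern_eq_filtration hP x⟩
  · rw [D.specialize_nabla, (D.isAlexanderConway_iff i Δ).mp hΔ]
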